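/- **General energy flux formula.** Let $3\le p\le 5$. There is a constant $C=C(p)>0$, depending on $p$ only, such that the following holds. Let $u:\mathbb R^3\times\mathbb R\to\mathbb R$ be a solution of $$\partial_t^2u-\Delta u=-|u|^{p-1}u\quad\text{in }\mathbb R^3\times\mathbb R$$ with finite energy $E=\int_{\mathbb R^3}\big(\tfrac12|\nabla u|^2+\tfrac12|u_t|^2+\tfrac1{p+1}|u|^{p+1}\big)(x,0)\,dx<\infty$; that is, $(u,u_t)\in C(\mathbb R;\dot H^1\times L^2(\mathbb R^3))$, $u\in L^{2p/(p-3)}L^{2p}([a,b]\times\mathbb R^3)$ for all $a<b$ (this is $L^\infty L^6$ if $p=3$), and the equation holds in the sense of distributions. Write $r=|x|$, $\partial_ru=\nabla u\cdot\frac{x}{|x|}$, $|\nabla u|^2=|\partial_ru|^2+|\nabla\!\!\!\!/\,u|^2$, $\mathbf L_\pm u=\partial_ru+\frac{u}{|x|}\pm u_t$, $\vec x=(x,0)$, $\vec e=(0,0,0,1)$, and $$\mathbf V_-=\Big[-\tfrac14|\mathbf L_+u|^2+\tfrac14|\nabla\!\!\!\!/\,u|^2+\tfrac{|u|^{p+1}}{2(p+1)}\Big]\tfrac{\vec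 x}{|x|}+\Big[\tfrac14|\mathbf L_+u|^2+\tfrac14|\nabla\!\!\!\!/\,u|^2+\tfrac{|u|^{p+1}}{2(p+1)}\Big]\vec e,$$ $$\mathbf V_+=\Big[\tfrac14|\mathbf L_-u|^2-\tfrac14|\nabla\!\!\!\!/\,u|^2-\tfrac{|u|^{p+1}}{2(p+1)}\Big]\tfrac{\vec x}{|x|}+\Big[\tfrac14|\mathbf L_-u|^2+\tfrac14|\nabla\!\!\!\!/\,u|^2+\tfrac{|u|^{p+1}}{2(p+1)}\Big]\vec e .$$ Let $\Omega=\{(x,t):(|x|,t)\in\Phi\}$, where $\Phi\subset\{(r,t):r\ge0\}$ is a bounded closed region whose boundary is a simple closed curve made of finitely many line segments, each parallel to a coordinate axis or to one of the lines $t\pm r=0$. Put $$\mathcal M(\Omega)=\iint_\Omega\Big(\frac{p-1}{2(p+1)}\frac{|u|^{p+1}}{|x|}+\frac12\frac{|\nabla\!\!\!\!/\,u|^2}{|x|}\Big)\,dx\,dt .$$ The integral $\int_{\partial\Omega}\mathbf V_\pm\cdot d\mathbf S$ (outward orientation) is the sum of the integrals over the annuli, cylinders and pieces of light cones that the sides of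 $\partial\Phi$ off the $t$-axis sweep out. Since $u$ need not be smooth, the integral over a cylinder $|x|=r_0$, $t\in[a,b]$, or over a piece $t=\tau\pm|x|$, $r_1\le|x|\le r_2$, of a light cone is understood as the limit, as $h\to0^+$, of the mean over $s\in(-h,h)$ of the integrals over the parallel surfaces with $r_0$, respectively $\tau$, replaced by $r_0+s$, respectively $\tau+s$. On annuli the integral is the ordinary one. 1. If $\Phi$ does not meet the $t$-axis $\{r=0\}$, then all these surface integrals exist, $\mathcal M(\Omega)<\infty$, and $$\int_{\partial\Omega}\mathbf V_\pm\cdot d\mathbf S=\pm\,\mathcal M(\Omega).$$ 2. There is a nonnegative finite measure $\mu$ on $\mathbb R$, determined by $u$ alone and independent of $\Omega$, such that $t\mapsto\mu((-\infty,t])$ is continuous, $\mu(\mathbb R)\le C E$, and, for every $\Omega$ as above (with $\Phi$ allowed to touch the $t$-axis), all these surface integrals exist, $\mathcal M(\Omega)<\infty$, and $$\int_{\partial\Omega}\mathbf V_\pm\cdot d\mathbf S\;\mp\;\pi\,\mu\big(\{t:(0,t)\in\partial\Phi\}\big)=\pm\,\mathcal M(\Omega).$$ In particular, if the part of $\partial\Phi$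 on the $t$-axis is a segment $[t_1,t_2]$, the extra term is $\mp\pi\mu([t_1,t_2])$. The measure $\mu$ is the only one with these properties. -/

import Mathlib

open MeasureTheory Filter Topology
open scoped ContDiff

noncomputable section

namespace InOutEnergy

/-- The space `ℝ³` with its Euclidean norm. -/
abbrev E3 := EuclideanSpace ℝ (Fin 3)

/-- Space-time `ℝ³ × ℝ`; a point is `(x, t)`. -/
abbrev Spacetime := E3 × ℝ

/-! ## Finite-energy solutions of `∂ₜ²u - Δu = -|u|^(p-1) u` -/

/-- `g` is the weak gradient of `f` on `ℝ³`. -/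
def IsWeakGradient (f : E3 → ℝ) (g : E3 → E3) : Prop :=
  ∀ φ : E3 → ℝ, ContDiff ℝ ∞ φ → HasCompactSupport φ → ∀ v : E3,
    ∫ x, f x * fderiv ℝ φ x v = -∫ x, inner ℝ (g x) v * φ x

/-- The energy density `½|∇u|² + ½|uₜ|² + |u|^(p+1)/(p+1)`. -/
def energyDensity (p : ℝ) (u : Spacetime → ℝ) (Du : Spacetime → E3) (ut : Spacetime → ℝ)
    (z : Spacetime) : ℝ :=
  1 / 2 * ‖Du z‖ ^ 2 + 1 / 2 * (ut z) ^ 2 + |u z| ^ (p + 1) / (p + 1)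

/-- The energy of the initial data, `E`. -/
def energy (p : ℝ) (u : Spacetime → ℝ) (Du : Spacetime → E3) (ut : Spacetime → ℝ) : ℝ :=
  ∫ x : E3, energyDensity p u Du ut (x, 0)

/-- `u`, with spatial gradient `Du` and time derivative `ut`, is a (global, real-valued) solution of
`∂ₜ²u - Δu = -|u|^(p-1) u` on `ℝ³ × ℝ` with finite energy. Namely
`(u, uₜ) ∈ C(ℝ; Ḣ¹ × L²)` (where `Ḣ¹(ℝ³)` is the space of functions in `L⁶` with weak gradient in
`L²`), `u ∈ L^(2p/(p-3)) L^(2p)` on bounded time intervals (this is `L^∞ L⁶` when `p = 3`), the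
equation holds in the sense of distributions, and the initial energy is finite. -/
structure IsFiniteEnergySolution (p : ℝ) (u : Spacetime → ℝ) (Du : Spacetime → E3)
    (ut : Spacetime → ℝ) : Prop where
  aesm_u : AEStronglyMeasurable u volume
  aesm_Du : AEStronglyMeasurable Du volume
  aesm_ut : AEStronglyMeasurable ut volume
  memLp_u : ∀ t : ℝ, MemLp (fun x : E3 => u (x, t)) 6 volume
  memLp_Du : ∀ t : ℝ, MemLp (fun x : E3 => Du (x, t)) 2 volume
  memLp_ut : ∀ t : ℝ, MemLp (fun x : E3 => ut (x, t)) 2 volume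
  weakGradient : ∀ t : ℝ, IsWeakGradient (fun x => u (x, t)) (fun x => Du (x, t))
  continuous_Du : ∀ t₀ : ℝ, Tendsto
    (fun t : ℝ => eLpNorm (fun x : E3 => Du (x, t) - Du (x, t₀)) 2 volume) (𝓝 t₀) (𝓝 0)
  continuous_ut : ∀ t₀ : ℝ, Tendsto
    (fun t : ℝ => eLpNorm (fun x : E3 => ut (x, t) - ut (x, t₀)) 2 volume) (𝓝 t₀) (𝓝 0)
  strichartz : ∀ a b : ℝ,
    eLpNorm (fun t : ℝ => eLpNorm (fun x : E3 => u (x, t)) (ENNReal.ofReal (2 * p)) volume)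
      (ENNReal.ofReal (2 * p) / ENNReal.ofReal (p - 3)) (volume.restrict (Set.Icc a b)) < ⊤
  timeDerivative : ∀ φ : Spacetime → ℝ, ContDiff ℝ ∞ φ → HasCompactSupport φ →
    ∫ z, u z * fderiv ℝ φ z (0, 1) = -∫ z, ut z * φ z
  equation : ∀ φ : Spacetime → ℝ, ContDiff ℝ ∞ φ → HasCompactSupport φ →
    -(∫ z, ut z * fderiv ℝ φ z (0, 1)) + (∫ z, fderiv ℝ φ z (Du z, 0))
      = -∫ z, |u z| ^ (p - 1) * u z * φ z
  finite_energy : Integrable (fun x : E3 => energyDensity p u Du ut (x, 0)) volume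

/-! ## The vector fields `V₋`, `V₊` and the Morawetz integral -/

/-- The unit radial vector `x / |x|`. -/
def radialDir (x : E3) : E3 := ‖x‖⁻¹ • x

/-- The radial derivative `∂ᵣu = ∇u · x/|x|`. -/
def radialDeriv (Du : Spacetime → E3) (z : Spacetime) : ℝ := inner ℝ (Du z) (radialDir z.1)

/-- The angular part `∇̸u = ∇u - (∂ᵣu) x/|x|` of the gradient. -/
def angularGrad (Du : Spacetime → E3) (z : Spacetime) : E3 :=
  Du z - radialDeriv Du z • radialDir z.1

/-- `L₊ u = ∂ᵣu + u/|x| + uₜ`. -/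
def Lplus (u : Spacetime → ℝ) (Du : Spacetime → E3) (ut : Spacetime → ℝ) (z : Spacetime) : ℝ :=
  radialDeriv Du z + u z / ‖z.1‖ + ut z

/-- `L₋ u = ∂ᵣu + u/|x| - uₜ`. -/
def Lminus (u : Spacetime → ℝ) (Du : Spacetime → E3) (ut : Spacetime → ℝ) (z : Spacetime) : ℝ :=
  radialDeriv Du z + u z / ‖z.1‖ - ut z

/-- The inward energy vector field `V₋`, with its spatial and its time component. -/
def Vminus (p : ℝ) (u : Spacetime → ℝ) (Du : Spacetime → E3) (ut : Spacetime → ℝ)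
    (z : Spacetime) : Spacetime :=
  ((-(1 / 4) * Lplus u Du ut z ^ 2 + 1 / 4 * ‖angularGrad Du z‖ ^ 2
      + |u z| ^ (p + 1) / (2 * (p + 1))) • radialDir z.1,
    1 / 4 * Lplus u Du ut z ^ 2 + 1 / 4 * ‖angularGrad Du z‖ ^ 2
      + |u z| ^ (p + 1) / (2 * (p + 1)))

/-- The outward energy vector field `V₊`, with its spatial and its time component. -/
def Vplus (p : ℝ) (u : Spacetime → ℝ) (Du : Spacetime → E3) (ut : Spacetime → ℝ)
    (z : Spacetime) : Spacetime :=
  ((1 / 4 * Lminus u Du ut z ^ 2 - 1 / 4 * ‖angularGrad Du z‖ ^ 2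
      - |u z| ^ (p + 1) / (2 * (p + 1))) • radialDir z.1,
    1 / 4 * Lminus u Du ut z ^ 2 + 1 / 4 * ‖angularGrad Du z‖ ^ 2
      + |u z| ^ (p + 1) / (2 * (p + 1)))

/-- The integrand of the Morawetz integral. -/
def morawetzDensity (p : ℝ) (u : Spacetime → ℝ) (Du : Spacetime → E3) (z : Spacetime) : ℝ :=
  (p - 1) / (2 * (p + 1)) * (|u z| ^ (p + 1) / ‖z.1‖)
    + 1 / 2 * (‖angularGrad Du z‖ ^ 2 / ‖z.1‖)

/-! ## Spatially radial regions -/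

/-- The spatially radial region `Ω = {(x, t) : (|x|, t) ∈ Φ}`. -/
def radialRegion (Φ : Set (ℝ × ℝ)) : Set Spacetime := {z | (‖z.1‖, z.2) ∈ Φ}

/-- The half-open segment `[P, Q)`. -/
def halfOpenSegment (P Q : ℝ × ℝ) : Set (ℝ × ℝ) :=
  {z | ∃ s : ℝ, 0 ≤ s ∧ s < 1 ∧ z = P + s • (Q - P)}

/-- `Φ` is a closed bounded region in the half plane `{(r, t) : r ≥ 0}` whose boundary is the simple
closed polygon with successive vertices `P 0, …, P m, P 0`, listed counterclockwise in the
`(r, t)` plane (the region lies to the left of each side), each side being parallel to a coordinate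
axis or to one of the lines `t ± r = 0`. (The index `i + 1` is taken modulo `m + 1`.) -/
structure IsAdmissibleRegion {m : ℕ} (Φ : Set (ℝ × ℝ)) (P : Fin (m + 1) → ℝ × ℝ) : Prop where
  isCompact : IsCompact Φ
  radius_nonneg : ∀ z ∈ Φ, 0 ≤ z.1
  side_ne : ∀ i, P i ≠ P (i + 1)
  direction : ∀ i,
    (P (i + 1)).1 = (P i).1 ∨ (P (i + 1)).2 = (P i).2 ∨
    (P (i + 1)).2 - (P i).2 = (P (i + 1)).1 - (P i).1 ∨
    (P (i + 1)).2 - (P i).2 = -((P (i + 1)).1 - (P i).1)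
  simple : ∀ i j, i ≠ j →
    Disjoint (halfOpenSegment (P i) (P (i + 1))) (halfOpenSegment (P j) (P (j + 1)))
  frontier_eq : frontier Φ = ⋃ i, segment ℝ (P i) (P (i + 1))
  left_inside : ∀ i, ∀ z ∈ openSegment ℝ (P i) (P (i + 1)), ∀ᶠ ε : ℝ in 𝓝[>] 0,
    z + ε • (-((P (i + 1)).2 - (P i).2), (P (i + 1)).1 - (P i).1) ∈ interior Φ ∧
    z - ε • (-((P (i + 1)).2 - (P i).2), (P (i + 1)).1 - (P i).1) ∉ Φ

/-! ## Surface integrals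

A side `[P, Q]` of the polygon, traversed counterclockwise, sweeps out an annulus, a circular
cylinder or a piece of a light cone; the outward normal is in the direction `(Δt, -Δr)` of the
`(r, t)` plane, where `(Δr, Δt) = Q - P`. On the surfaces `t = τ + c|x|` (`c = 0, ±1`) we have
`dS = √(1 + c²) dx`, hence `V · dS = (V · N) dx` with `N = (Δt, -Δr)/|Δr|`. On a cylinder `N` is the
outward unit normal.

The functions `∇u(·,t)`, `uₜ(·,t)` exist for each `t`, hence the integral over an annulus is an
ordinary integral. Their restrictions to cylinders and cones are not defined for an individual
surface when `u` is only a finite-energy solution. The integral over a cylinder or a cone is the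
limit of the mean of the integrals over the parallel surfaces at offset `s ∈ (-h, h)` as `h → 0⁺`,
and by Fubini's theorem such a mean is a volume integral over a thin layer. This is the usual
surface integral for a continuous integrand and, for a locally integrable one, on almost all
parallel surfaces. -/

/-- `V · N` where `N = ν₁ x/|x| + ν₂ e` and `e` is the unit vector of the time axis. -/
def normalComponent (V : Spacetime → Spacetime) (ν : ℝ × ℝ) (z : Spacetime) : ℝ :=
  ν.1 * inner ℝ (V z).1 (radialDir z.1) + ν.2 * (V z).2

/-- `F = ∫ V · dS` over the annulus swept out by `[P, Q]`, where `P`, `Q` have the same `t`. -/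
def HasAnnulusFlux (V : Spacetime → Spacetime) (P Q : ℝ × ℝ) (F : ℝ) : Prop :=
  let N : ℝ × ℝ := (0, -(Q.1 - P.1) / |Q.1 - P.1|)
  let A : Set E3 := {x | ‖x‖ ∈ Set.uIcc P.1 Q.1}
  IntegrableOn (fun x => normalComponent V N (x, P.2)) A ∧
    F = ∫ x in A, normalComponent V N (x, P.2)

/-- `F = ∫ V · dS` over the cylinder swept out by `[P, Q]`, where `P`, `Q` have the same `r > 0`. -/
def HasCylinderFlux (V : Spacetime → Spacetime) (P Q : ℝ × ℝ) (F : ℝ) : Prop :=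
  let N : ℝ × ℝ := ((Q.2 - P.2) / |Q.2 - P.2|, 0)
  let layer : ℝ → Set Spacetime := fun h => {z | |‖z.1‖ - P.1| < h ∧ z.2 ∈ Set.uIcc P.2 Q.2}
  (∀ᶠ h in 𝓝[>] 0, IntegrableOn (normalComponent V N) (layer h)) ∧
    Tendsto (fun h : ℝ => 1 / (2 * h) * ∫ z in layer h, normalComponent V N z) (𝓝[>] 0) (𝓝 F)

/-- `F = ∫ V · dS` over the piece of a light cone `t = P.2 + c (|x| - P.1)` swept out by `[P, Q]`,
where `c = Δt/Δr = ±1`. -/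
def HasConeFlux (V : Spacetime → Spacetime) (P Q : ℝ × ℝ) (F : ℝ) : Prop :=
  let N : ℝ × ℝ := ((Q.2 - P.2) / |Q.1 - P.1|, -(Q.1 - P.1) / |Q.1 - P.1|)
  let c : ℝ := (Q.2 - P.2) / (Q.1 - P.1)
  let layer : ℝ → Set Spacetime := fun h =>
    {z | ‖z.1‖ ∈ Set.uIcc P.1 Q.1 ∧ |z.2 - (P.2 + c * (‖z.1‖ - P.1))| < h}
  (∀ᶠ h in 𝓝[>] 0, IntegrableOn (normalComponent V N) (layer h)) ∧
    Tendsto (fun h : ℝ => 1 / (2 * h) * ∫ z in layer h, normalComponent V N z) (𝓝[>] 0) (𝓝 F)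

open Classical in
/-- `F = ∫ V · dS` over the surface swept out by the side `[P, Q]`. A side on the `t`-axis sweeps out
a degenerate surface, over which the integral is `0`. -/
def HasSideFlux (V : Spacetime → Spacetime) (P Q : ℝ × ℝ) (F : ℝ) : Prop :=
  if P.1 = Q.1 then
    if P.1 = 0 then F = 0 else HasCylinderFlux V P Q F
  else if P.2 = Q.2 then HasAnnulusFlux V P Q F
  else HasConeFlux V P Q F

/-- `F = ∫_{∂Ω} V · dS` with the outward orientation: the integral over each of the finitely many
pieces of `∂Ω` exists, and `F` is their sum. -/
def HasBoundaryFlux {m : ℕ} (V : Spacetime → Spacetime) (P : Fin (m + 1) → ℝ × ℝ) (F : ℝ) : Prop :=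
  ∃ f : Fin (m + 1) → ℝ, (∀ i, HasSideFlux V (P i) (P (i + 1)) (f i)) ∧ F = ∑ i, f i

end InOutEnergy

end

noncomputable section

namespace InOutEnergy

open scoped Convolution ENNReal NNReal
open ContinuousLinearMap (lsmul)
open Set Metric ENNReal

set_option linter.unusedSectionVars false

/-! Put `σ = 1` for `V₋` and `σ = -1` for `V₊`, and let `Q = ∂ᵣu + u/|x| + σ uₜ`. Up to the factor
`σ`, the field is the radial current with radial component `w = -Q²/4 + s` and time component `σ e`,
where `e = Q²/4 + s` and `s` collects the angular and the potential energy. Multiplication of the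
equation by `Q/2` shows that, away from the axis and against functions of `(|x|, t)` only, the
divergence of this current is `-m`, where `m` is the Morawetz density. A tangential term is needed
in the pointwise identity, but radial test functions do not see it. The sign `σ` then produces `∓`
in the two flux formulas.

For a finite-energy solution the identity is proved for mollifications and passed to the limit. The
quadratic terms converge locally in `L²`. The product of the nonlinearity with `Q` converges because
`|u|^(p-1) u` is locally in `L¹ₜL²ₓ` (this uses the space-time integrability and `p ≤ 5`), while `Q`
is in `L^∞ₜL²ₓ` by Hardy's inequality. A chain rule for the truncated power turns the nonlinear term
into derivatives of `|u|^(p+1)`. The result is `IsFiniteEnergySolution.integral_radial_identity`.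
Energy conservation and the identity `∫ (∂ᵣu + u/|x|)² = ∫ (∂ᵣu)²` show that the integrals of `e`
for the two signs add up to `E` at each time.

The rest uses only the properties collected in `RadialCurrent`, mainly `|w| ≤ e`, `w ≤ |x| m / 2`
and `|x| m ≤ 4 e`. The last one extends the identity to test functions that vanish linearly on the
axis. Testing with `r/(r+d)` in space then gives `m ∈ L¹` globally, the radial term being absorbed
by `w ≤ |x| m / 2`.

Define the potential `F(r, t) = σ ∫_{|x|>r} e(·, t) + ∫∫_{|x|>r, s<t} m`. Testing with piecewise
linear functions across thin layers shows that each side from `P` to `Q` off the axis has flux `σ`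
times `F(Q) - F(P)` plus or minus the integral of `m` below the side (`hasSideFlux`). Around the
closed polygon the increments telescope, and a discrete Green formula (`sum_belowSide`) adds the
remaining integrals up to `-∫_Ω m`. Only the increments of `F` along sides on the axis are left over
(`hasBoundaryFlux`).

On the axis `F(0, ·)` is continuous and nonincreasing, because the mean of `w` over the layer `0 < r
< 2k` is asymptotically nonpositive by `w ≤ |x| m / 2`. Thus `-F(0, ·)/π` is a Stieltjes function;
its measure is `μ`. The two potentials differ on the axis by the constant `E`, so the same `μ`
serves both fields. Rectangles with a side on the axis determine `μ` on all compact intervals, hence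
uniquely. -/

lemma eLpNorm_two_eq {α : Type*} [MeasurableSpace α] {V : Type*} [NormedAddCommGroup V]
    (μ : Measure α) (f : α → V) :
    eLpNorm f 2 μ = (∫⁻ x, ‖f x‖ₑ ^ 2 ∂μ) ^ (1 / 2 : ℝ) := by
  rw [eLpNorm_eq_lintegral_rpow_enorm_toReal (by norm_num) (by norm_num)]
  simp

lemma tendsto_zero_of_le {ι : Type*} {l : Filter ι} {f g : ι → ℝ≥0∞} (hg : Tendsto g l (𝓝 0))
    (h : ∀ i, f i ≤ g i) : Tendsto f l (𝓝 0) :=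
  tendsto_of_tendsto_of_tendsto_of_le_of_le tendsto_const_nhds hg (fun _ => bot_le) h

/-! ### Mollification in `L²` -/

section Mollify

variable {G : Type*} [NormedAddCommGroup G] [NormedSpace ℝ G] [FiniteDimensional ℝ G]
  [MeasureSpace G] [BorelSpace G] [(volume : Measure G).IsAddHaarMeasure]
  {V : Type*} [NormedAddCommGroup V] [NormedSpace ℝ V]

/-- A sequence of bump functions shrinking to the origin. -/
def shrinkingBump (G : Type*) [NormedAddCommGroup G] [NormedSpace ℝ G] (n : ℕ) :
    ContDiffBump (0 : G) where
  rIn := 1 / (2 * (n + 1))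
  rOut := 1 / (n + 1)
  rIn_pos := by positivity
  rIn_lt_rOut := by apply one_div_lt_one_div_of_lt <;> nlinarith [(Nat.cast_nonneg n : 0 ≤ n)]

/-- The mollifying kernel. -/
def mollifier (G : Type*) [NormedAddCommGroup G] [NormedSpace ℝ G] [FiniteDimensional ℝ G]
    [MeasureSpace G] (n : ℕ) : G → ℝ :=
  (shrinkingBump G n).normed volume

/-- The mollification of `f`. -/
def mollify (n : ℕ) (f : G → V) : G → V := mollifier G n ⋆[lsmul ℝ ℝ, volume] f

lemma mollifier_nonneg (n : ℕ) (x : G) : 0 ≤ mollifier G n x := (shrinkingBump G n).nonneg_normed x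

lemma contDiff_mollifier (n : ℕ) : ContDiff ℝ ∞ (mollifier G n) :=
  (shrinkingBump G n).contDiff_normed

lemma hasCompactSupport_mollifier (n : ℕ) : HasCompactSupport (mollifier G n) :=
  (shrinkingBump G n).hasCompactSupport_normed

lemma integral_mollifier (n : ℕ) : ∫ x, mollifier G n x = 1 := (shrinkingBump G n).integral_normed

lemma shrinkingBump_rOut_le (n : ℕ) : (shrinkingBump G n).rOut ≤ 1 := by
  simp only [shrinkingBump]
  rw [div_le_one (by positivity)]
  linarith

lemma tendsto_shrinkingBump_rOut : Tendsto (fun n => (shrinkingBump G n).rOut) atTop (𝓝 0) :=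
  tendsto_one_div_add_atTop_nhds_zero_nat

lemma mollifier_eq_zero {n : ℕ} {x : G} (hx : (shrinkingBump G n).rOut ≤ ‖x‖) :
    mollifier G n x = 0 := by
  have h : x ∉ Function.support (mollifier G n) := by
    unfold mollifier
    rw [(shrinkingBump G n).support_normed_eq]
    simpa using hx
  simpa using h

lemma continuous_mollifier (n : ℕ) : Continuous (mollifier G n) := (contDiff_mollifier n).continuous

lemma lintegral_mollifier (n : ℕ) : ∫⁻ x, ENNReal.ofReal (mollifier G n x) = 1 := by
  rw [← ofReal_integral_eq_lintegral_ofReal, integral_mollifier, ofReal_one]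
  · exact (continuous_mollifier n).integrable_of_hasCompactSupport (hasCompactSupport_mollifier n)
  · exact .of_forall fun x => mollifier_nonneg n x

lemma mollify_apply (n : ℕ) (f : G → V) (x : G) :
    mollify n f x = ∫ y, mollifier G n y • f (x - y) := rfl

lemma mollify_apply_swap (n : ℕ) (f : G → V) (x : G) :
    mollify n f x = ∫ y, mollifier G n (x - y) • f y := by
  unfold mollify
  rw [convolution_eq_swap]
  rfl

lemma enorm_mollify_le (n : ℕ) (f : G → V) (x : G) :
    ‖mollify n f x‖ₑ ≤ ∫⁻ y, ENNReal.ofReal (mollifier G n y) * ‖f (x - y)‖ₑ := by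
  rw [mollify_apply]
  refine (enorm_integral_le_lintegral_enorm _).trans (le_of_eq ?_)
  congr 1
  ext y
  rw [enorm_smul, Real.enorm_eq_ofReal (mollifier_nonneg n y)]

lemma aemeasurable_enorm_comp_sub {f : G → V} (hf : AEStronglyMeasurable f volume) (x : G) :
    AEMeasurable (fun y => ‖f (x - y)‖ₑ) volume :=
  (hf.comp_quasiMeasurePreserving (quasiMeasurePreserving_sub_left volume x)).enorm

lemma measurable_ofReal_mollifier (n : ℕ) : Measurable fun y => ENNReal.ofReal (mollifier G n y) :=
  (continuous_mollifier n).measurable.ennreal_ofReal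

/-- The kernel is a probability density, so this is Jensen's inequality for the square, obtained
from Cauchy–Schwarz against the constant `1`. No constant is lost, which makes mollification a
contraction on `L²` and keeps slice bounds uniform in `n`. -/
lemma enorm_mollify_sq_le {f : G → V} (hf : AEStronglyMeasurable f volume) (n : ℕ) (x : G) :
    ‖mollify n f x‖ₑ ^ 2 ≤ ∫⁻ y, ENNReal.ofReal (mollifier G n y) * ‖f (x - y)‖ₑ ^ 2 := by
  have h1 := enorm_mollify_le n f x
  set ν := volume.withDensity fun y => ENNReal.ofReal (mollifier G n y) with hν
  have hm := measurable_ofReal_mollifier (G := G) n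
  have hfx := aemeasurable_enorm_comp_sub hf x
  have hprob : ν univ = 1 := by
    rw [hν, withDensity_apply _ MeasurableSet.univ, Measure.restrict_univ, lintegral_mollifier]
  have hc : ∀ g : G → ℝ≥0∞, AEMeasurable g volume →
      ∫⁻ y, ENNReal.ofReal (mollifier G n y) * g y = ∫⁻ y, g y ∂ν := by
    intro g hg
    rw [hν, lintegral_withDensity_eq_lintegral_mul₀ hm.aemeasurable hg]
    rfl
  rw [hc _ hfx] at h1
  rw [hc _ (hfx.pow_const 2)]
  have hac : ν ≪ volume := withDensity_absolutelyContinuous _ _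
  have h2 := lintegral_mul_le_Lp_mul_Lq ν Real.HolderConjugate.two_two
    (hfx.mono_ac hac) (g := fun _ => 1) aemeasurable_const
  simp only [Pi.mul_apply, mul_one, one_rpow, lintegral_const, hprob] at h2
  calc ‖mollify n f x‖ₑ ^ 2 ≤ ((∫⁻ y, ‖f (x - y)‖ₑ ^ (2 : ℝ) ∂ν) ^ (1 / 2 : ℝ)) ^ 2 := by
        gcongr
        exact h1.trans h2
    _ = _ := by
        rw [← rpow_natCast, ← rpow_mul]
        norm_num

lemma contDiff_mollify {f : G → V} [CompleteSpace V] (hf : LocallyIntegrable f volume) (n : ℕ) :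
    ContDiff ℝ ∞ (mollify n f) :=
  (hasCompactSupport_mollifier n).contDiff_convolution_left _ (contDiff_mollifier n) hf

lemma mollify_add {f g : G → V} (hf : LocallyIntegrable f volume)
    (hg : LocallyIntegrable g volume) (n : ℕ) (x : G) :
    mollify n (fun y => f y + g y) x = mollify n f x + mollify n g x :=
  ConvolutionExistsAt.distrib_add
    ((hasCompactSupport_mollifier n).convolutionExists_left _ (continuous_mollifier n) hf x)
    ((hasCompactSupport_mollifier n).convolutionExists_left _ (continuous_mollifier n) hg x)

lemma mollify_sub {f g : G → V} (hf : LocallyIntegrable f volume)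
    (hg : LocallyIntegrable g volume) (n : ℕ) (x : G) :
    mollify n (fun y => f y - g y) x = mollify n f x - mollify n g x := by
  have h := mollify_add (hf.sub hg) hg n x
  simp only [Pi.sub_apply, sub_add_cancel] at h
  exact eq_sub_of_add_eq h.symm

lemma aestronglyMeasurable_mollify {f : G → V} (hf : AEStronglyMeasurable f volume)
    [CompleteSpace V] [SecondCountableTopology G] (n : ℕ) :
    AEStronglyMeasurable (mollify n f) volume := by
  have h := AEStronglyMeasurable.convolution_integrand (ν := (volume : Measure G)) (lsmul ℝ ℝ)
    ((continuous_mollifier n).aestronglyMeasurable) hf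
  exact h.integral_prod_right'

lemma lintegral_mollify_sq_le {f : G → V} (hf : AEStronglyMeasurable f volume) (n : ℕ) :
    ∫⁻ x, ‖mollify n f x‖ₑ ^ 2 ≤ ∫⁻ x, ‖f x‖ₑ ^ 2 := by
  have hmeas : AEMeasurable (fun z : G × G => ENNReal.ofReal (mollifier G n z.2) *
      ‖f (z.1 - z.2)‖ₑ ^ 2) (volume.prod volume) := by
    refine ((measurable_ofReal_mollifier n).comp measurable_snd).aemeasurable.mul ?_
    refine AEMeasurable.pow_const ?_ 2
    exact (hf.comp_quasiMeasurePreserving (quasiMeasurePreserving_sub volume volume)).enorm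
  calc ∫⁻ x, ‖mollify n f x‖ₑ ^ 2
      ≤ ∫⁻ x, ∫⁻ y, ENNReal.ofReal (mollifier G n y) * ‖f (x - y)‖ₑ ^ 2 :=
        lintegral_mono fun x => enorm_mollify_sq_le hf n x
    _ = ∫⁻ y, ∫⁻ x, ENNReal.ofReal (mollifier G n y) * ‖f (x - y)‖ₑ ^ 2 :=
        lintegral_lintegral_swap hmeas
    _ = ∫⁻ y, ENNReal.ofReal (mollifier G n y) * ∫⁻ x, ‖f x‖ₑ ^ 2 := by
        congr 1
        ext y
        rw [lintegral_const_mul' _ _ ofReal_ne_top]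
        rw [lintegral_sub_right_eq_self (fun x => ‖f x‖ₑ ^ 2) y]
    _ = ∫⁻ x, ‖f x‖ₑ ^ 2 := by
        rw [lintegral_mul_const _ (measurable_ofReal_mollifier n), lintegral_mollifier, one_mul]

lemma eLpNorm_mollify_le {f : G → V} (hf : AEStronglyMeasurable f volume) (n : ℕ) :
    eLpNorm (mollify n f) 2 volume ≤ eLpNorm f 2 volume := by
  rw [eLpNorm_two_eq, eLpNorm_two_eq]
  exact rpow_le_rpow (lintegral_mollify_sq_le hf n) (by norm_num)

lemma dist_mollify_le [CompleteSpace V] {f : G → V} {ε : ℝ} (hf : AEStronglyMeasurable f volume)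
    {n : ℕ} {x : G} (h : ∀ y, dist y x < (shrinkingBump G n).rOut → dist (f y) (f x) ≤ ε) :
    dist (mollify n f x) (f x) ≤ ε :=
  (shrinkingBump G n).dist_normed_convolution_le hf h

/-- All kernels live in the unit ball. Hence local statements reduce to global ones by cutting off
the function one unit farther out. -/
lemma mollify_congr_of_eqOn {f g : G → V} {n : ℕ} {x : G}
    (h : ∀ y, dist y x ≤ 1 → f y = g y) : mollify n f x = mollify n g x := by
  rw [mollify_apply, mollify_apply]
  congr 1
  ext y
  by_cases hy : (shrinkingBump G n).rOut ≤ ‖y‖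
  · rw [mollifier_eq_zero hy, zero_smul, zero_smul]
  · rw [h]
    have := shrinkingBump_rOut_le (G := G) n
    rw [dist_eq_norm, sub_sub_cancel_left, norm_neg]
    linarith

lemma tendsto_eLpNorm_mollify_sub_of_continuous [CompleteSpace V] {f : G → V}
    (hf : Continuous f) (hc : HasCompactSupport f) :
    Tendsto (fun n => eLpNorm (fun x => mollify n f x - f x) 2 volume) atTop (𝓝 0) := by
  set K := cthickening 1 (tsupport f) with hK
  have hKc : IsCompact K := hc.isCompact.cthickening
  have hKfin : volume K < ⊤ := hKc.measure_lt_top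
  have hunif := Metric.uniformContinuous_iff.1 (hc.uniformContinuous_of_continuous hf)
  rw [ENNReal.tendsto_nhds_zero]
  intro ε hε
  have hA : volume K ^ (1 / 2 : ℝ) ≠ ⊤ := (rpow_lt_top_of_nonneg (by norm_num) hKfin.ne).ne
  obtain ⟨δ, hδ, hδε⟩ : ∃ δ, 0 < δ ∧ ENNReal.ofReal δ * volume K ^ (1 / 2 : ℝ) ≤ ε := by
    rcases eq_or_ne ε ⊤ with rfl | hεt
    · exact ⟨1, one_pos, le_top⟩
    · set a := (volume K ^ (1 / 2 : ℝ)).toReal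
      refine ⟨ε.toReal / (a + 1), div_pos (toReal_pos hε.ne' hεt) (by positivity), ?_⟩
      rw [← ofReal_toReal hA, ← ofReal_mul (by positivity)]
      refine ofReal_le_of_le_toReal ?_
      rw [div_mul_eq_mul_div, div_le_iff₀ (by positivity)]
      have := (toReal_nonneg : 0 ≤ ε.toReal)
      nlinarith
  obtain ⟨r, hr, hrδ⟩ := hunif δ hδ
  have hsmall := (tendsto_shrinkingBump_rOut (G := G)).eventually (gt_mem_nhds hr)
  filter_upwards [hsmall] with n hn
  refine le_trans ?_ hδε
  have hpt : ∀ x, ‖mollify n f x - f x‖ ≤ K.indicator (fun _ => δ) x := by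
    intro x
    by_cases hx : x ∈ K
    · rw [indicator_of_mem hx, ← dist_eq_norm]
      exact dist_mollify_le hf.aestronglyMeasurable fun y hy => (hrδ (hy.trans hn)).le
    · rw [indicator_of_notMem hx]
      have hz : ∀ y, dist y x ≤ 1 → f y = 0 := by
        intro y hy
        by_contra hne
        apply hx
        exact mem_cthickening_of_dist_le x y 1 _ (subset_tsupport f hne) (by rwa [dist_comm])
      rw [mollify_congr_of_eqOn hz, hz x (by simp), mollify_apply]
      simp
  calc eLpNorm (fun x => mollify n f x - f x) 2 volume
      ≤ eLpNorm (K.indicator fun _ => δ) 2 volume := eLpNorm_mono_real hpt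
    _ = ENNReal.ofReal δ * volume K ^ (1 / 2 : ℝ) := by
        rw [eLpNorm_indicator_const hKc.isClosed.measurableSet (by norm_num) (by norm_num),
          Real.enorm_eq_ofReal hδ.le]
        simp

/-- Density of continuous functions with compact support, together with the contraction property; an
`ε/3` argument. -/
lemma tendsto_eLpNorm_mollify_sub [CompleteSpace V] {f : G → V} (hf : MemLp f 2 volume) :
    Tendsto (fun n => eLpNorm (fun x => mollify n f x - f x) 2 volume) atTop (𝓝 0) := by
  rw [ENNReal.tendsto_nhds_zero]
  intro ε hε
  have hε3 : ε / 3 ≠ 0 := by simp [hε.ne']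
  obtain ⟨g, hgc, hgε, hgcont, hgm⟩ := hf.exists_hasCompactSupport_eLpNorm_sub_le (by norm_num) hε3
  have h1 := tendsto_eLpNorm_mollify_sub_of_continuous hgcont hgc
  have hfl := hf.locallyIntegrable (by norm_num)
  have hgl : LocallyIntegrable g volume := hgcont.locallyIntegrable
  have h2 := ENNReal.tendsto_nhds_zero.1 h1 (ε / 3) (pos_iff_ne_zero.2 hε3)
  filter_upwards [h2] with n hn
  have hfg : AEStronglyMeasurable (fun x => f x - g x) volume :=
    hf.1.sub hgcont.aestronglyMeasurable
  have hsplit : (fun x => mollify n f x - f x) =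
      (fun x => mollify n (fun y => f y - g y) x) + (fun x => mollify n g x - g x)
        + (fun x => -(f x - g x)) := by
    ext x
    simp only [Pi.add_apply, mollify_sub hfl hgl]
    abel
  have hm1 := aestronglyMeasurable_mollify hfg n
  have hm2 := (aestronglyMeasurable_mollify hgcont.aestronglyMeasurable n).sub
    hgcont.aestronglyMeasurable
  rw [hsplit]
  calc _ ≤ eLpNorm (fun x => mollify n (fun y => f y - g y) x) 2 volume
        + eLpNorm (fun x => mollify n g x - g x) 2 volume
        + eLpNorm (fun x => -(f x - g x)) 2 volume :=
        (eLpNorm_add_le (hm1.add hm2) hfg.neg (by norm_num)).trans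
          (add_le_add_left (eLpNorm_add_le hm1 hm2 (by norm_num)) _)
    _ ≤ ε / 3 + ε / 3 + ε / 3 := by
        have e3 : eLpNorm (fun x => -(f x - g x)) 2 volume = eLpNorm (f - g) 2 volume :=
          eLpNorm_neg (f - g) 2 volume
        refine add_le_add (add_le_add ((eLpNorm_mollify_le hfg n).trans hgε) hn) ?_
        rw [e3]; exact hgε
    _ = ε := add_thirds ε

lemma tendsto_eLpNorm_mollify_sub_local [CompleteSpace V] {f : G → V}
    (hf : ∀ R, MemLp f 2 (volume.restrict (closedBall 0 R))) (R : ℝ) :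
    Tendsto (fun n => eLpNorm (fun x => mollify n f x - f x) 2
      (volume.restrict (closedBall 0 R))) atTop (𝓝 0) := by
  set g := (closedBall 0 (R + 1)).indicator f with hg
  have hgm : MemLp g 2 volume :=
    (memLp_indicator_iff_restrict measurableSet_closedBall).2 (hf (R + 1))
  refine tendsto_zero_of_le (tendsto_eLpNorm_mollify_sub hgm) fun n => ?_
  have : eLpNorm (fun x => mollify n f x - f x) 2 (volume.restrict (closedBall 0 R))
      = eLpNorm (fun x => mollify n g x - g x) 2 (volume.restrict (closedBall 0 R)) := by
    refine eLpNorm_congr_ae ?_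
    filter_upwards [ae_restrict_mem measurableSet_closedBall] with x hx
    have hx' : ‖x‖ ≤ R := by simpa using hx
    have hy : ∀ y, dist y x ≤ 1 → f y = g y := by
      intro y hy
      rw [hg, indicator_of_mem]
      rw [mem_closedBall_zero_iff]
      rw [dist_eq_norm] at hy
      calc ‖y‖ = ‖(y - x) + x‖ := by rw [sub_add_cancel]
        _ ≤ ‖y - x‖ + ‖x‖ := norm_add_le _ _
        _ ≤ R + 1 := by linarith
    rw [mollify_congr_of_eqOn hy, hy x (by simp)]
  rw [this]
  exact eLpNorm_mono_measure _ Measure.restrict_le_self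

end Mollify

section L2

variable {α : Type*} [MeasurableSpace α] {μ : Measure α}

lemma tendsto_integral_inner_of_L2 {V : Type*} [NormedAddCommGroup V] [InnerProductSpace ℝ V]
    {f g : α → V} {F H : ℕ → α → V}
    (hf : MemLp f 2 μ) (hg : MemLp g 2 μ) (hF : ∀ n, MemLp (F n) 2 μ) (hH : ∀ n, MemLp (H n) 2 μ)
    (hFf : Tendsto (fun n => eLpNorm (fun x => F n x - f x) 2 μ) atTop (𝓝 0))
    (hHg : Tendsto (fun n => eLpNorm (fun x => H n x - g x) 2 μ) atTop (𝓝 0)) :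
    Tendsto (fun n => ∫ x, (inner ℝ (F n x) (H n x) : ℝ) ∂μ) atTop
      (𝓝 (∫ x, (inner ℝ (f x) (g x) : ℝ) ∂μ)) := by
  have key : ∀ {a b : α → V} (ha : MemLp a 2 μ) (hb : MemLp b 2 μ),
      (inner ℝ (ha.toLp a) (hb.toLp b) : ℝ) = ∫ x, (inner ℝ (a x) (b x) : ℝ) ∂μ := by
    intro a b ha hb
    refine integral_congr_ae ?_
    filter_upwards [ha.coeFn_toLp, hb.coeFn_toLp] with x h1 h2
    rw [h1, h2]
  have t1 : Tendsto (fun n => (hF n).toLp (F n)) atTop (𝓝 (hf.toLp f)) :=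
    (Lp.tendsto_Lp_iff_tendsto_eLpNorm'' F hF f hf).2 hFf
  have t2 : Tendsto (fun n => (hH n).toLp (H n)) atTop (𝓝 (hg.toLp g)) :=
    (Lp.tendsto_Lp_iff_tendsto_eLpNorm'' H hH g hg).2 hHg
  have := t1.inner (𝕜 := ℝ) t2
  simp_rw [key] at this
  exact this

lemma tendsto_integral_mul_of_L2 {f g : α → ℝ} {F H : ℕ → α → ℝ}
    (hf : MemLp f 2 μ) (hg : MemLp g 2 μ) (hF : ∀ n, MemLp (F n) 2 μ) (hH : ∀ n, MemLp (H n) 2 μ)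
    (hFf : Tendsto (fun n => eLpNorm (fun x => F n x - f x) 2 μ) atTop (𝓝 0))
    (hHg : Tendsto (fun n => eLpNorm (fun x => H n x - g x) 2 μ) atTop (𝓝 0)) :
    Tendsto (fun n => ∫ x, F n x * H n x ∂μ) atTop (𝓝 (∫ x, f x * g x ∂μ)) := by
  have := tendsto_integral_inner_of_L2 hf hg hF hH hFf hHg
  simpa [mul_comm] using this

lemma integrable_mul_of_memLp_two {f g : α → ℝ} (hf : MemLp f 2 μ) (hg : MemLp g 2 μ) :
    Integrable (fun x => f x * g x) μ := by
  have := hf.integrable_mul hg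
  exact this

end L2

/-! ### Derivatives of mollifications and integration by parts -/

section MollifyDeriv

variable {G : Type*} [NormedAddCommGroup G] [NormedSpace ℝ G] [FiniteDimensional ℝ G]
  [MeasureSpace G] [BorelSpace G] [(volume : Measure G).IsAddHaarMeasure]

lemma contDiff_mollifier_sub (n : ℕ) (x : G) : ContDiff ℝ ∞ fun y => mollifier G n (x - y) :=
  (contDiff_mollifier n).comp (by fun_prop)

lemma hasCompactSupport_mollifier_sub (n : ℕ) (x : G) :
    HasCompactSupport fun y => mollifier G n (x - y) :=
  (hasCompactSupport_mollifier n).comp_homeomorph (Homeomorph.subLeft x)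

lemma fderiv_mollify_eq {f : G → ℝ} (hf : LocallyIntegrable f volume) (n : ℕ) (x v : G) :
    fderiv ℝ (mollify n f) x v = -∫ y, f y * fderiv ℝ (fun y => mollifier G n (x - y)) y v := by
  have hd := (hasCompactSupport_mollifier n).hasFDerivAt_convolution_left
    (lsmul ℝ ℝ) ((contDiff_mollifier n).of_le (by simp)) hf x
  have he : fderiv ℝ (mollify n f) x = _ := hd.fderiv
  have hcs : HasCompactSupport (fderiv ℝ (mollifier G n)) := (hasCompactSupport_mollifier n).fderiv ℝ
  have hex := (hcs.convolutionExists_left ((lsmul ℝ ℝ).precompL G)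
    ((contDiff_mollifier n).continuous_fderiv (by simp)) hf x).integrable_swap
  rw [he, convolution_eq_swap, ContinuousLinearMap.integral_apply hex, ← integral_neg]
  congr 1
  ext y
  have h2 : HasFDerivAt (fun y => mollifier G n (x - y))
      ((fderiv ℝ (mollifier G n) (x - y)).comp (-ContinuousLinearMap.id ℝ G)) y := by
    have h3 : HasFDerivAt (mollifier G n) (fderiv ℝ (mollifier G n) (x - y)) (x - y) :=
      ((contDiff_mollifier n).differentiable (by simp) _).hasFDerivAt
    exact h3.comp y ((hasFDerivAt_id y).const_sub x)
  rw [h2.fderiv]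
  simp [mul_comm]

/-- The reflected and translated kernel `y ↦ ρ (x - y)` is itself a test function, so a weak
derivative can be read off directly. -/
lemma fderiv_mollify {f g : G → ℝ} (hf : LocallyIntegrable f volume) {v : G}
    (h : ∀ φ : G → ℝ, ContDiff ℝ ∞ φ → HasCompactSupport φ →
      ∫ x, f x * fderiv ℝ φ x v = -∫ x, g x * φ x) (n : ℕ) (x : G) :
    fderiv ℝ (mollify n f) x v = mollify n g x := by
  rw [fderiv_mollify_eq hf, h _ (contDiff_mollifier_sub n x) (hasCompactSupport_mollifier_sub n x),
    neg_neg, mollify_apply_swap]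
  simp [mul_comm]

/-- Integration by parts against the constant `1`. The divergence identities below are obtained from
it one direction at a time, so that only line derivatives of the components are needed. -/
lemma integral_lineDeriv_eq_zero {f f' : G → ℝ} {v : G} (hf : Integrable f volume)
    (hf' : Integrable f' volume) (h : ∀ x, HasLineDerivAt ℝ f (f' x) x v) : ∫ x, f' x = 0 := by
  have := integral_bilinear_hasLineDerivAt_right_eq_neg_left_of_integrable
    (f := fun _ => 1) (f' := fun _ => 0)
    (g' := f')
    (B := ContinuousLinearMap.mul ℝ ℝ) (by simp) (by simpa using hf') (by simpa using hf)
    (fun x _ => by simpa using (hasFDerivAt_const 1 x).hasLineDerivAt v) (fun x _ => h x)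
  simpa using this

end MollifyDeriv

/-! ### Smooth cutoffs in time -/

section TestSequence

/-- The primitive of the mollifying kernel on the line. -/
def smoothStep (n : ℕ) (s : ℝ) : ℝ := ∫ t in (-1)..s, mollifier ℝ n t

lemma hasDerivAt_smoothStep (n : ℕ) (s : ℝ) : HasDerivAt (smoothStep n) (mollifier ℝ n s) s :=
  intervalIntegral.integral_hasDerivAt_right ((continuous_mollifier n).intervalIntegrable _ _)
    ((continuous_mollifier n).stronglyMeasurableAtFilter _ _) (continuous_mollifier n).continuousAt

lemma monotone_smoothStep (n : ℕ) : Monotone (smoothStep n) :=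
  monotone_of_deriv_nonneg (fun s => (hasDerivAt_smoothStep n s).differentiableAt) fun s => by
    rw [(hasDerivAt_smoothStep n s).deriv]; exact mollifier_nonneg n s

lemma smoothStep_eq_zero {n : ℕ} {s : ℝ} (hs : s ≤ -(shrinkingBump ℝ n).rOut) :
    smoothStep n s = 0 := by
  unfold smoothStep
  rw [intervalIntegral.integral_congr, intervalIntegral.integral_zero]
  intro t ht
  apply mollifier_eq_zero
  have h1 := shrinkingBump_rOut_le (G := ℝ) n
  have : t ≤ -(shrinkingBump ℝ n).rOut := by rcases mem_uIcc.1 ht with h | h <;> linarith [h.1, h.2]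
  rw [Real.norm_eq_abs, abs_of_nonpos (by linarith [(shrinkingBump ℝ n).rOut_pos])]
  linarith

lemma smoothStep_eq_one {n : ℕ} {s : ℝ} (hs : (shrinkingBump ℝ n).rOut ≤ s) :
    smoothStep n s = 1 := by
  unfold smoothStep
  rw [intervalIntegral.integral_eq_integral_of_support_subset, integral_mollifier]
  intro t ht
  have ht' : |t| < (shrinkingBump ℝ n).rOut := by
    by_contra h
    exact ht (mollifier_eq_zero (not_lt.1 h))
  have h1 := shrinkingBump_rOut_le (G := ℝ) n
  rw [abs_lt] at ht'
  constructor <;> linarith [ht'.1, ht'.2]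

lemma tendsto_integral_mollifier_sub_mul {f : ℝ → ℝ} (hf : Continuous f) {a : ℕ → ℝ} {a₀ : ℝ}
    {k : ℕ → ℕ} (hk : Tendsto k atTop atTop) (ha : Tendsto a atTop (𝓝 a₀)) :
    Tendsto (fun n => ∫ t, mollifier ℝ (k n) (t - a n) * f t) atTop (𝓝 (f a₀)) := by
  have h := ContDiffBump.convolution_tendsto_right (μ := (volume : Measure ℝ))
    (φ := fun n => shrinkingBump ℝ (k n))
    (tendsto_shrinkingBump_rOut.comp hk) (.of_forall fun _ => hf.aestronglyMeasurable)
    ((hf.tendsto a₀).comp tendsto_snd) ha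
  refine h.congr fun n => ?_
  rw [convolution_eq_swap]
  congr 1
  ext t
  have : mollifier ℝ (k n) (t - a n) = mollifier ℝ (k n) (a n - t) := by
    rw [← neg_sub]
    exact ContDiffBump.normed_neg _ _
  rw [this]
  rfl

/-- Smooth approximations from below of the indicator function of `(a, b)`, whose derivatives
converge to the difference of the point masses at `a` and `b`. -/
lemma exists_smooth_indicator {a b : ℝ} (hab : a < b) :
    ∃ γ γ' : ℕ → ℝ → ℝ, (∀ n, Continuous (γ' n)) ∧ (∀ n t, HasDerivAt (γ n) (γ' n t) t) ∧
      (∀ n t, 0 ≤ γ n t) ∧ (∀ n t, γ n t ≤ 1) ∧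
      (∀ n t, t ∉ Ioo a b → γ n t = 0 ∧ γ' n t = 0) ∧
      (∀ t ∈ Ioo a b, ∀ᶠ n in atTop, γ n t = 1) ∧
      ∀ f : ℝ → ℝ, Continuous f → Tendsto (fun n => ∫ t, γ' n t * f t) atTop (𝓝 (f a - f b)) := by
  obtain ⟨N, hN⟩ := (tendsto_shrinkingBump_rOut (G := ℝ)).eventually
    (gt_mem_nhds (show 0 < (b - a) / 6 by linarith)) |>.exists_forall_of_atTop
  set r := fun n => (shrinkingBump ℝ (n + N)).rOut with hr
  have hr0 : ∀ n, 0 < r n := fun n => (shrinkingBump ℝ (n + N)).rOut_pos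
  have hr6 := fun n => hN _ (Nat.le_add_left N n)
  have hk := tendsto_add_atTop_nat N
  have hrt : Tendsto r atTop (𝓝 0) := tendsto_shrinkingBump_rOut.comp hk
  -- The two steps have half-width `r n` and are centred at distance `2 r n` inside `(a, b)`: the
  -- support stays inside, the centres tend to the endpoints, and `r n < (b - a) / 6` keeps the
  -- steps apart.
  let γ : ℕ → ℝ → ℝ := fun n t => smoothStep (n + N) (t - (a + 2 * r n)) -
    smoothStep (n + N) (t - (b - 2 * r n))
  have hγ0 : ∀ n t, 0 ≤ γ n t := fun n t => sub_nonneg.2 (monotone_smoothStep _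
    (by linarith [hr6 n]))
  have hγd := fun n t => ((hasDerivAt_smoothStep (n + N) _).comp_sub_const t (a + 2 * r n)).sub
    ((hasDerivAt_smoothStep (n + N) _).comp_sub_const t (b - 2 * r n))
  have hz : ∀ n t, t ∉ Ioo a b → γ n t = 0 := by
    intro n t h
    have := hr0 n
    have := hr6 n
    rw [mem_Ioo, not_and_or, not_lt, not_lt] at h
    rcases h with h | h
    · simp only [γ]
      rw [smoothStep_eq_zero, smoothStep_eq_zero, sub_zero] <;> change _ ≤ -(r n) <;> linarith
    · simp only [γ]
      rw [smoothStep_eq_one, smoothStep_eq_one, sub_self] <;> change r n ≤ _ <;> linarith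
  -- Off `(a, b)` the nonnegative function `γ n` attains its minimum `0`, so its derivative vanishes
  -- there without computation.
  refine ⟨γ, _, fun n => ?_, hγd, hγ0, fun n t => ?_, fun n t ht => ⟨hz n t ht,
    IsLocalMin.hasDerivAt_eq_zero (.of_forall fun y => (hz n t ht).trans_le (hγ0 n y)) (hγd n t)⟩, ?_, ?_⟩
  · have := continuous_mollifier (G := ℝ) (n + N)
    fun_prop
  · have h1 : smoothStep (n + N) (t - (a + 2 * r n)) ≤ 1 := by
      rw [← smoothStep_eq_one (le_max_left (r n) (t - (a + 2 * r n)))]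
      exact monotone_smoothStep _ (le_max_right _ _)
    have h2 : 0 ≤ smoothStep (n + N) (t - (b - 2 * r n)) := by
      rw [← smoothStep_eq_zero (min_le_left (-(r n)) (t - (b - 2 * r n)))]
      exact monotone_smoothStep _ (min_le_right _ _)
    exact (sub_le_self _ h2).trans h1
  · intro t ht
    have h3 : ∀ᶠ n in atTop, r n < (t - a) / 3 := hrt.eventually (gt_mem_nhds (by linarith [ht.1]))
    have h4 : ∀ᶠ n in atTop, r n < (b - t) / 3 := hrt.eventually (gt_mem_nhds (by linarith [ht.2]))
    filter_upwards [h3, h4] with n h3 h4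
    simp only [γ]
    rw [smoothStep_eq_one, smoothStep_eq_zero, sub_zero]
    · change _ ≤ -(r n); linarith
    · change r n ≤ _; linarith
  · intro f hf
    have ha : Tendsto (fun n => a + 2 * r n) atTop (𝓝 a) := by
      simpa using (hrt.const_mul 2).const_add a
    have hb : Tendsto (fun n => b - 2 * r n) atTop (𝓝 b) := by
      simpa using (hrt.const_mul 2).const_sub b
    refine ((tendsto_integral_mollifier_sub_mul hf hk ha).sub
      (tendsto_integral_mollifier_sub_mul hf hk hb)).congr fun n => ?_
    have hi : ∀ c, Integrable fun t => mollifier ℝ (n + N) (t - c) * f t := fun c =>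
      (((continuous_mollifier _).comp (by fun_prop)).mul hf).integrable_of_hasCompactSupport
        (((hasCompactSupport_mollifier (n + N)).comp_homeomorph (Homeomorph.subRight c)).mul_right)
    rw [← integral_sub (hi _) (hi _)]
    simp only [sub_mul]

end TestSequence

/-! ### Dominated convergence in norm and cutoffs in space -/

section Dominated

lemma tendsto_eLpNorm_zero_of_dominated {α V W : Type*} [MeasurableSpace α] {μ : Measure α}
    [NormedAddCommGroup V] [NormedAddCommGroup W] {p : ℝ≥0∞} (hp0 : p ≠ 0) (hp : p ≠ ⊤)
    {F : ℕ → α → V} {f : α → W}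
    (hF : ∀ n, AEStronglyMeasurable (F n) μ) (hf : MemLp f p μ)
    (hle : ∀ n, ∀ᵐ x ∂μ, ‖F n x‖ ≤ ‖f x‖) (hlim : ∀ᵐ x ∂μ, Tendsto (fun n => F n x) atTop (𝓝 0)) :
    Tendsto (fun n => eLpNorm (F n) p μ) atTop (𝓝 0) := by
  simp_rw [eLpNorm_eq_lintegral_rpow_enorm_toReal hp0 hp]
  have hpr : 0 < p.toReal := toReal_pos hp0 hp
  have h1 : Tendsto (fun n => ∫⁻ x, ‖F n x‖ₑ ^ p.toReal ∂μ) atTop (𝓝 (∫⁻ _, 0 ∂μ)) := by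
    refine tendsto_lintegral_of_dominated_convergence' (fun x => ‖f x‖ₑ ^ p.toReal)
      (fun n => ((hF n).enorm.pow_const _)) (fun n => ?_) ?_ ?_
    · filter_upwards [hle n] with x hx
      gcongr
      exact enorm_le_iff_norm_le.2 hx
    · exact (lintegral_rpow_enorm_lt_top_of_eLpNorm_lt_top hp0 hp hf.2).ne
    · filter_upwards [hlim] with x hx
      have h2 : Tendsto (fun n => ‖F n x‖ₑ) atTop (𝓝 0) := by simpa using hx.enorm
      have h3 := (continuous_rpow_const (y := p.toReal)).tendsto 0 |>.comp h2
      rwa [zero_rpow_of_pos hpr] at h3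
  rw [lintegral_zero] at h1
  have h3 := (continuous_rpow_const (y := 1 / p.toReal)).tendsto 0 |>.comp h1
  rwa [zero_rpow_of_pos (by positivity)] at h3

end Dominated

section Cutoff

/-- A bump function equal to `1` on the unit ball and supported in the ball of radius `2`. -/
def unitBump : ContDiffBump (0 : E3) where
  rIn := 1
  rOut := 2
  rIn_pos := one_pos
  rIn_lt_rOut := one_lt_two

/-- A smooth cutoff at scale `R`. -/
def cutoff (R : ℝ) (x : E3) : ℝ := unitBump (R⁻¹ • x)

lemma cutoff_nonneg (R : ℝ) (x : E3) : 0 ≤ cutoff R x := unitBump.nonneg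

lemma cutoff_le_one (R : ℝ) (x : E3) : cutoff R x ≤ 1 := unitBump.le_one

lemma contDiff_cutoff (R : ℝ) : ContDiff ℝ ∞ (cutoff R) := unitBump.contDiff.comp (by fun_prop)

lemma cutoff_eq_one {R : ℝ} (hR : 0 < R) {x : E3} (hx : ‖x‖ ≤ R) : cutoff R x = 1 := by
  apply unitBump.one_of_mem_closedBall
  rw [mem_closedBall_zero_iff, norm_smul, norm_inv, Real.norm_of_nonneg hR.le]
  change _ ≤ 1
  rw [inv_mul_le_one₀ hR]
  exact hx

lemma cutoff_eq_zero {R : ℝ} (hR : 0 < R) {x : E3} (hx : 2 * R ≤ ‖x‖) : cutoff R x = 0 := by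
  apply unitBump.zero_of_le_dist
  rw [dist_zero_right, norm_smul, norm_inv, Real.norm_of_nonneg hR.le]
  change 2 ≤ _
  rw [le_inv_mul_iff₀ hR]
  linarith

lemma hasCompactSupport_cutoff {R : ℝ} (hR : 0 < R) : HasCompactSupport (cutoff R) := by
  refine .intro (isCompact_closedBall 0 (2 * R)) fun x hx => ?_
  apply cutoff_eq_zero hR
  rw [mem_closedBall_zero_iff, not_le] at hx
  exact hx.le

lemma exists_norm_fderiv_cutoff_le :
    ∃ C, 0 ≤ C ∧ ∀ R, 0 < R → ∀ x, ‖fderiv ℝ (cutoff R) x‖ ≤ C / R := by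
  have hc : Continuous (fderiv ℝ (unitBump : E3 → ℝ)) :=
    unitBump.contDiff.continuous_fderiv (n := ∞) (by simp)
  obtain ⟨C, hC⟩ := hc.bounded_above_of_compact_support (unitBump.hasCompactSupport.fderiv ℝ)
  refine ⟨C, (norm_nonneg _).trans (hC 0), fun R hR x => ?_⟩
  have : fderiv ℝ (cutoff R) x = R⁻¹ • fderiv ℝ (unitBump : E3 → ℝ) (R⁻¹ • x) := fderiv_comp_smul _
  rw [this, norm_smul, norm_inv, Real.norm_of_nonneg hR.le, div_eq_inv_mul]
  gcongr
  exact hC _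

lemma fderiv_cutoff_eq_zero {R : ℝ} (hR : 0 < R) {x : E3} (hx : ‖x‖ < R ∨ 2 * R < ‖x‖) :
    fderiv ℝ (cutoff R) x = 0 := by
  rcases hx with hx | hx
  · have : cutoff R =ᶠ[𝓝 x] fun _ => 1 := by
      filter_upwards [(isOpen_lt continuous_norm continuous_const).mem_nhds hx] with y hy
      exact cutoff_eq_one hR (le_of_lt hy)
    rw [this.fderiv_eq]; simp
  · have : cutoff R =ᶠ[𝓝 x] fun _ => 0 := by
      filter_upwards [(isOpen_lt continuous_const continuous_norm).mem_nhds hx] with y hy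
      exact cutoff_eq_zero hR (le_of_lt hy)
    rw [this.fderiv_eq]; simp

end Cutoff

/-! ### Weak gradients -/

section WeakGradient

open InnerProductSpace

lemma inner_gradient {f : E3 → ℝ} (x v : E3) : inner ℝ (gradient f x) v = fderiv ℝ f x v := by
  rw [← toDual_gradient]; rfl

lemma norm_gradient (f : E3 → ℝ) (x : E3) : ‖gradient f x‖ = ‖fderiv ℝ f x‖ := by
  rw [← toDual_gradient, LinearIsometryEquiv.norm_map]

lemma continuous_gradient {f : E3 → ℝ} (hf : ContDiff ℝ ∞ f) : Continuous (gradient f) :=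
  (toDual ℝ E3).symm.continuous.comp (hf.continuous_fderiv (by simp))

lemma hasCompactSupport_gradient {f : E3 → ℝ} (hf : HasCompactSupport f) :
    HasCompactSupport (gradient f) :=
  (hf.fderiv ℝ).comp_left (map_zero _)

lemma IsWeakGradient.smul_smooth {f : E3 → ℝ} {g : E3 → E3} (h : IsWeakGradient f g)
    (hf : LocallyIntegrable f volume) (hg : LocallyIntegrable g volume)
    {χ : E3 → ℝ} (hχ : ContDiff ℝ ∞ χ) :
    IsWeakGradient (fun x => χ x * f x) (fun x => χ x • g x + f x • gradient χ x) := by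
  intro φ hφ hc v
  have h1 := h (fun x => χ x * φ x) (hχ.mul hφ) hc.mul_left v
  have hφd := hφ.differentiable (by simp)
  have hχd := hχ.differentiable (by simp)
  have hcf : Continuous fun x => fderiv ℝ φ x v := (hφ.continuous_fderiv (by simp)).clm_apply
    continuous_const
  have hcχ : Continuous fun x => fderiv ℝ χ x v := (hχ.continuous_fderiv (by simp)).clm_apply
    continuous_const
  have e1 : ∀ x, fderiv ℝ (fun x => χ x * φ x) x v = χ x * fderiv ℝ φ x v + φ x * fderiv ℝ χ x v := by
    intro x
    rw [fderiv_fun_mul (hχd x) (hφd x)]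
    simp
  have i1 : Integrable fun x => f x * (χ x * fderiv ℝ φ x v) := by
    have := hf.integrable_smul_left_of_hasCompactSupport
      (hχ.continuous.mul hcf) ((hc.fderiv_apply ℝ v).mul_left)
    simpa [mul_comm] using this
  have i2 : Integrable fun x => f x * (φ x * fderiv ℝ χ x v) := by
    have := hf.integrable_smul_left_of_hasCompactSupport (hφ.continuous.mul hcχ) hc.mul_right
    simpa [mul_comm] using this
  have hgv : LocallyIntegrable (fun x => (inner ℝ (g x) v : ℝ)) volume := by
    intro x
    obtain ⟨s, hs, hi⟩ := hg x
    exact ⟨s, hs, hi.inner_const v⟩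
  have i3 : Integrable fun x => inner ℝ (g x) v * (χ x * φ x) := by
    have := hgv.integrable_smul_left_of_hasCompactSupport
      (hχ.continuous.mul hφ.continuous) hc.mul_left
    simpa [mul_comm] using this
  simp_rw [e1, mul_add] at h1
  rw [integral_add i1 i2] at h1
  have e2 : ∀ x, inner ℝ (χ x • g x + f x • gradient χ x) v * φ x =
      inner ℝ (g x) v * (χ x * φ x) + f x * (φ x * fderiv ℝ χ x v) := by
    intro x
    rw [inner_add_left, real_inner_smul_left, real_inner_smul_left, inner_gradient]
    ring
  simp_rw [e2]
  rw [integral_add i3 i2]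
  have e3 : ∫ x, χ x * f x * fderiv ℝ φ x v = ∫ x, f x * (χ x * fderiv ℝ φ x v) := by
    congr 1; ext x; ring
  linarith

lemma mollify_inner {G : Type*} [NormedAddCommGroup G] [NormedSpace ℝ G] [FiniteDimensional ℝ G]
    [MeasureSpace G] [BorelSpace G] [(volume : Measure G).IsAddHaarMeasure] {g : G → E3}
    (hg : LocallyIntegrable g volume) (n : ℕ) (x : G) (v : E3) :
    mollify n (fun y => (inner ℝ (g y) v : ℝ)) x = inner ℝ (mollify n g x) v := by
  have hex := (hasCompactSupport_mollifier n).convolutionExists_left (lsmul ℝ ℝ)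
    (continuous_mollifier n) hg x
  rw [mollify_apply, real_inner_comm]
  change _ = inner ℝ v (∫ y, (lsmul ℝ ℝ) (mollifier G n y) (g (x - y)))
  rw [← integral_inner hex]
  congr 1
  ext y
  rw [ContinuousLinearMap.lsmul_apply, real_inner_smul_right, real_inner_comm, smul_eq_mul]

lemma gradient_mollify {f : E3 → ℝ} {g : E3 → E3} (h : IsWeakGradient f g)
    (hf : LocallyIntegrable f volume) (hg : LocallyIntegrable g volume) (n : ℕ) (x : E3) :
    gradient (mollify n f) x = mollify n g x := by
  refine ext_inner_right ℝ fun v => ?_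
  rw [inner_gradient, fderiv_mollify hf (fun φ h1 h2 => h φ h1 h2 v), mollify_inner hg]

instance holderTriple_six_three_two : ENNReal.HolderTriple 6 3 2 where
  inv_add_inv_eq_inv := by
    rw [← ENNReal.toReal_eq_toReal_iff' (by simp) (by simp), ENNReal.toReal_add (by simp) (by simp)]
    simp only [ENNReal.toReal_inv, ENNReal.toReal_ofNat]
    norm_num

/-- The gradient of the cutoff at scale `R` has an `L³` norm bounded independently of `R`, and it
vanishes for `|x| < R`. By Hölder with `1/6 + 1/3 = 1/2` only the tail of `f` in `L⁶` remains. -/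
lemma tendsto_eLpNorm_smul_gradient_cutoff {f : E3 → ℝ} (hf : MemLp f 6 volume) :
    Tendsto (fun n : ℕ => eLpNorm (fun x => f x • gradient (cutoff (n + 1)) x) 2 volume)
      atTop (𝓝 0) := by
  obtain ⟨C, hC0, hC⟩ := exists_norm_fderiv_cutoff_le
  -- The `L³` norm of the constant `C / R` on a ball of radius `2 R` is `2 C |B₁|^(1/3)`, whatever
  -- `R` is.
  set A := ENNReal.ofReal (2 * C) * (volume (ball (0 : E3) 1)) ^ (1 / 3 : ℝ) with hA
  have hAt : A ≠ ⊤ := by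
    exact mul_ne_top ofReal_ne_top ((rpow_lt_top_of_nonneg (by norm_num) measure_ball_lt_top.ne).ne)
  set F : ℕ → E3 → ℝ := fun n => {x : E3 | n + 1 ≤ ‖x‖}.indicator f with hF
  have hms : ∀ n, MeasurableSet {x : E3 | n + 1 ≤ ‖x‖} := fun n =>
    measurableSet_le measurable_const measurable_norm
  have hF0 : Tendsto (fun n => eLpNorm (F n) 6 volume) atTop (𝓝 0) := by
    refine tendsto_eLpNorm_zero_of_dominated (by norm_num) (by norm_num)
      (fun n => hf.1.indicator (hms n)) hf (fun n => .of_forall fun x => ?_)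
      (.of_forall fun x => ?_)
    · exact norm_indicator_le_norm_self f x
    · obtain ⟨N, hN⟩ := exists_nat_gt ‖x‖
      refine tendsto_const_nhds.congr' ?_
      filter_upwards [eventually_ge_atTop N] with n hn
      rw [hF]
      simp only
      rw [indicator_of_notMem]
      have : (N : ℝ) ≤ n := by exact_mod_cast hn
      simp only [mem_ofPred_eq]
      linarith
  have hG : ∀ n : ℕ, eLpNorm (gradient (cutoff (n + 1))) 3 volume ≤ A := by
    intro n
    have hR : (0 : ℝ) < n + 1 := by positivity
    have hb : ∀ x, ‖gradient (cutoff (n + 1)) x‖ ≤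
        (closedBall 0 (2 * (n + 1))).indicator (fun _ => C / (n + 1)) x := by
      intro x
      rw [norm_gradient]
      by_cases hx : x ∈ closedBall 0 (2 * (n + 1))
      · simp_all
      · rw [indicator_of_notMem hx, fderiv_cutoff_eq_zero hR, norm_zero]
        right
        simpa using hx
    refine (eLpNorm_mono_real hb).trans ?_
    rw [eLpNorm_indicator_const measurableSet_closedBall (by norm_num)
      (by norm_num), Measure.addHaar_closedBall _ _ (by positivity), finrank_euclideanSpace_fin,
      Real.enorm_eq_ofReal (by positivity), mul_rpow_of_nonneg _ _ (by norm_num),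
      ← mul_assoc, hA, toReal_ofNat]
    refine mul_le_mul' ?_ (le_of_eq ?_)
    · rw [ofReal_rpow_of_nonneg (by positivity) (by norm_num), ← ofReal_mul (by positivity)]
      apply ofReal_le_ofReal
      rw [← Real.rpow_natCast, ← Real.rpow_mul (by positivity)]
      norm_num
      rw [div_mul_eq_mul_div, div_le_iff₀ hR]
      nlinarith
    · rw [EuclideanSpace.volume_ball]
  refine tendsto_zero_of_le (g := fun n => eLpNorm (F n) 6 volume * A) ?_ fun n => ?_
  · have := Tendsto.mul_const hF0 (Or.inr hAt)
    rwa [zero_mul] at this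
  · have e : (fun x => f x • gradient (cutoff (n + 1)) x) =
        F n • gradient (cutoff (n + 1)) := by
      ext1 x
      simp only [Pi.smul_apply', hF]
      by_cases hx : n + 1 ≤ ‖x‖
      · rw [indicator_of_mem (by exact hx)]
      · rw [indicator_of_notMem (by exact hx)]
        have h0 : gradient (cutoff (n + 1)) x = 0 := by
          rw [← norm_eq_zero, norm_gradient, fderiv_cutoff_eq_zero (by positivity)
            (by grind), norm_zero]
        rw [h0, smul_zero, smul_zero]
    rw [e]
    refine (eLpNorm_smul_le_mul_eLpNorm (p := 6) (q := 3)
      (continuous_gradient (contDiff_cutoff _)).aestronglyMeasurable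
      (hf.1.indicator (hms n))).trans ?_
    exact mul_le_mul_right (hG n) _

end WeakGradient

/-! ### Approximation by test functions and the Sobolev inequality -/

section Approximation

open InnerProductSpace

lemma hasCompactSupport_mollify {f : E3 → ℝ} (hf : HasCompactSupport f) (n : ℕ) :
    HasCompactSupport (mollify n f) :=
  (hasCompactSupport_mollifier n).convolution (lsmul ℝ ℝ) hf

-- Cut off at scale `n + 1`, then mollify with an index `k n` so large that the error is below `1 /
-- (n + 1)`. The functions are compared with the truncations of `f` and not with `f` itself, which
-- need not lie in `L²`.
set_option maxHeartbeats 800000 in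
lemma IsWeakGradient.exists_approx_L2 {f : E3 → ℝ} {g : E3 → E3} (hf : MemLp f 6 volume)
    (hg : MemLp g 2 volume) (h : IsWeakGradient f g) :
    ∃ F : ℕ → E3 → ℝ, (∀ n, ContDiff ℝ ∞ (F n)) ∧ (∀ n, HasCompactSupport (F n)) ∧
      Tendsto (fun n => eLpNorm (fun x => gradient (F n) x - g x) 2 volume) atTop (𝓝 0) ∧
      Tendsto (fun n => eLpNorm (fun x => F n x - cutoff (n + 1) x * f x) 2 volume)
        atTop (𝓝 0) := by
  have hfl := hf.locallyIntegrable (by norm_num)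
  have hgl := hg.locallyIntegrable (by norm_num)
  set H : ℕ → E3 → ℝ := fun n x => cutoff (n + 1) x * f x with hH
  set D : ℕ → E3 → E3 := fun n x => cutoff (n + 1) x • g x + f x • gradient (cutoff (n + 1)) x
    with hD
  have hR : ∀ n : ℕ, (0 : ℝ) < n + 1 := fun n => by positivity
  have hcut : ∀ n : ℕ, MemLp (cutoff (n + 1)) 3 volume := fun n =>
    (contDiff_cutoff _).continuous.memLp_of_hasCompactSupport (hasCompactSupport_cutoff (hR n))
  have hgcut : ∀ n : ℕ, MemLp (gradient (cutoff (n + 1))) 3 volume := fun n =>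
    (continuous_gradient (contDiff_cutoff _)).memLp_of_hasCompactSupport
      (hasCompactSupport_gradient (hasCompactSupport_cutoff (hR n)))
  have hHm : ∀ n, MemLp (H n) 2 volume := by
    intro n
    have : H n = f • cutoff (n + 1) := by ext x; simp [hH, mul_comm]
    rw [this]
    exact (hcut n).smul hf
  have hD1m : ∀ n, MemLp (fun x => cutoff (n + 1) x • g x) 2 volume := by
    intro n
    refine hg.mono ((contDiff_cutoff _).continuous.aestronglyMeasurable.smul hg.1)
      (.of_forall fun x => ?_)
    rw [norm_smul, Real.norm_of_nonneg (cutoff_nonneg _ _)]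
    exact mul_le_of_le_one_left (norm_nonneg _) (cutoff_le_one _ _)
  have hD2m : ∀ n : ℕ, MemLp (fun x => f x • gradient (cutoff (n + 1)) x) 2 volume := fun n =>
    (hgcut n).smul hf
  have hDm : ∀ n, MemLp (D n) 2 volume := fun n => (hD1m n).add (hD2m n)
  have hw : ∀ n, IsWeakGradient (H n) (D n) := fun n => h.smul_smooth hfl hgl (contDiff_cutoff _)
  have hDg : Tendsto (fun n => eLpNorm (fun x => D n x - g x) 2 volume) atTop (𝓝 0) := by
    have t1 : Tendsto (fun n : ℕ => eLpNorm (fun x => cutoff (n + 1) x • g x - g x) 2 volume)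
        atTop (𝓝 0) := by
      refine tendsto_eLpNorm_zero_of_dominated (by norm_num) (by norm_num)
        (fun n => (hD1m n).1.sub hg.1) hg (fun n => .of_forall fun x => ?_)
        (.of_forall fun x => ?_)
      · have : cutoff (n + 1) x • g x - g x = -((1 - cutoff (n + 1) x) • g x) := by
          rw [sub_smul, one_smul, neg_sub]
        rw [this, norm_neg, norm_smul, Real.norm_of_nonneg (by linarith [cutoff_le_one (n + 1) x])]
        exact mul_le_of_le_one_left (norm_nonneg _) (by linarith [cutoff_nonneg (n + 1) x])
      · obtain ⟨N, hN⟩ := exists_nat_gt ‖x‖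
        refine tendsto_const_nhds.congr' ?_
        filter_upwards [eventually_ge_atTop N] with n hn
        have : (N : ℝ) ≤ n := by exact_mod_cast hn
        rw [cutoff_eq_one (hR n) (by linarith), one_smul, sub_self]
    have t2 := t1.add (tendsto_eLpNorm_smul_gradient_cutoff hf)
    rw [add_zero] at t2
    refine tendsto_zero_of_le t2 fun n => ?_
    have e : (fun x => D n x - g x) = (fun x => cutoff (n + 1) x • g x - g x) +
        fun x => f x • gradient (cutoff (n + 1)) x := by
      ext1 x; simp only [hD, Pi.add_apply]; abel
    rw [e]
    exact eLpNorm_add_le ((hD1m n).1.sub hg.1) (hD2m n).1 (by norm_num)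
  have hex : ∀ n, ∃ k,
      eLpNorm (fun x => mollify k (H n) x - H n x) 2 volume < ENNReal.ofReal (1 / (n + 1)) ∧
      eLpNorm (fun x => mollify k (D n) x - D n x) 2 volume < ENNReal.ofReal (1 / (n + 1)) := by
    intro n
    have hpos : 0 < ENNReal.ofReal (1 / (n + 1)) := by rw [ofReal_pos]; positivity
    exact (((tendsto_eLpNorm_mollify_sub (hHm n)).eventually (gt_mem_nhds hpos)).and
      ((tendsto_eLpNorm_mollify_sub (hDm n)).eventually (gt_mem_nhds hpos))).exists
  choose k hk1 hk2 using hex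
  have hlim : Tendsto (fun n : ℕ => ENNReal.ofReal (1 / (n + 1))) atTop (𝓝 0) := by
    have := (continuous_ofReal.tendsto 0).comp tendsto_one_div_add_atTop_nhds_zero_nat
    simpa [Function.comp_def] using this
  have hHl := fun n => (hHm n).locallyIntegrable (by norm_num)
  have hDl := fun n => (hDm n).locallyIntegrable (by norm_num)
  refine ⟨fun n => mollify (k n) (H n), fun n => contDiff_mollify (hHl n) _, fun n => ?_, ?_, ?_⟩
  · exact hasCompactSupport_mollify ((hasCompactSupport_cutoff (hR n)).mul_right) _
  · have t := hlim.add hDg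
    rw [add_zero] at t
    refine tendsto_zero_of_le t fun n => ?_
    have e : (fun x => gradient (mollify (k n) (H n)) x - g x) =
        (fun x => mollify (k n) (D n) x - D n x) + fun x => D n x - g x := by
      ext1 x
      simp only [Pi.add_apply]
      rw [gradient_mollify (hw n) (hHl n) (hDl n)]
      abel
    rw [e]
    exact (eLpNorm_add_le ((aestronglyMeasurable_mollify (hDm n).1 _).sub (hDm n).1)
      ((hDm n).1.sub hg.1) (by norm_num)).trans (add_le_add_left (hk2 n).le _)
  · exact tendsto_zero_of_le hlim fun n => (hk1 n).le

/-- Approximation of a function in `Ḣ¹` by test functions. -/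
lemma IsWeakGradient.exists_approx {f : E3 → ℝ} {g : E3 → E3} (hf : MemLp f 6 volume)
    (hg : MemLp g 2 volume) (h : IsWeakGradient f g) :
    ∃ F : ℕ → E3 → ℝ, (∀ n, ContDiff ℝ ∞ (F n)) ∧ (∀ n, HasCompactSupport (F n)) ∧
      Tendsto (fun n => eLpNorm (fun x => gradient (F n) x - g x) 2 volume) atTop (𝓝 0) ∧
      ∀ᵐ x, Tendsto (fun n => F n x) atTop (𝓝 (f x)) := by
  obtain ⟨F, hF1, hF2, hF3, hF4⟩ := IsWeakGradient.exists_approx_L2 hf hg h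
  have hm : TendstoInMeasure volume (fun n x => F n x - cutoff (n + 1) x * f x) atTop
      (fun _ => 0) := by
    refine tendstoInMeasure_of_tendsto_eLpNorm (p := 2) (by norm_num) (fun n => ?_)
      aestronglyMeasurable_const ?_
    · exact (hF1 n).continuous.aestronglyMeasurable.sub
        ((contDiff_cutoff _).continuous.aestronglyMeasurable.mul hf.1)
    · refine hF4.congr fun n => ?_
      congr 1
      ext x
      simp
  obtain ⟨ns, hns, hae⟩ := hm.exists_seq_tendsto_ae
  refine ⟨fun n => F (ns n), fun n => hF1 _, fun n => hF2 _, hF3.comp hns.tendsto_atTop, ?_⟩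
  filter_upwards [hae] with x hx
  have h2 : Tendsto (fun n => cutoff ((ns n) + 1) x * f x) atTop (𝓝 (f x)) := by
    obtain ⟨N, hN⟩ := exists_nat_gt ‖x‖
    refine tendsto_const_nhds.congr' ?_
    filter_upwards [hns.tendsto_atTop.eventually (eventually_ge_atTop N)] with n hn
    have : (N : ℝ) ≤ ns n := by exact_mod_cast hn
    rw [cutoff_eq_one (by positivity) (by linarith), one_mul]
  have := hx.add h2
  simpa using this

lemma tendsto_eLpNorm_of_tendsto_sub {α V : Type*} [MeasurableSpace α] {μ : Measure α}
    [NormedAddCommGroup V] {p : ℝ≥0∞} (hp : 1 ≤ p) {ι : Type*} {l : Filter ι} {F : ι → α → V}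
    {f : α → V}
    (hF : ∀ n, AEStronglyMeasurable (F n) μ) (hf : MemLp f p μ)
    (h : Tendsto (fun n => eLpNorm (fun x => F n x - f x) p μ) l (𝓝 0)) :
    Tendsto (fun n => eLpNorm (F n) p μ) l (𝓝 (eLpNorm f p μ)) := by
  have hup : ∀ n, eLpNorm (F n) p μ ≤ eLpNorm f p μ + eLpNorm (fun x => F n x - f x) p μ := by
    intro n
    have e : F n = f + fun x => F n x - f x := by ext x; simp
    calc eLpNorm (F n) p μ = eLpNorm (f + fun x => F n x - f x) p μ := by rw [← e]
      _ ≤ _ := eLpNorm_add_le hf.1 ((hF n).sub hf.1) hp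
  have hlow : ∀ n, eLpNorm f p μ - eLpNorm (fun x => F n x - f x) p μ ≤ eLpNorm (F n) p μ := by
    intro n
    rw [tsub_le_iff_right]
    have e : f = F n + fun x => -(F n x - f x) := by ext x; simp
    have e2 : eLpNorm (fun x => -(F n x - f x)) p μ = eLpNorm (fun x => F n x - f x) p μ :=
      eLpNorm_neg (fun x => F n x - f x) p μ
    calc eLpNorm f p μ = eLpNorm (F n + fun x => -(F n x - f x)) p μ := by rw [← e]
      _ ≤ _ := (eLpNorm_add_le (hF n) ((hF n).sub hf.1).neg hp).trans (le_of_eq (congrArg _ e2))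
  refine tendsto_of_tendsto_of_tendsto_of_le_of_le ?_ ?_ hlow hup
  · have := Tendsto.sub tendsto_const_nhds h (Or.inl hf.2.ne)
    simpa using this
  · have := (tendsto_const_nhds (x := eLpNorm f p μ)).add h
    simpa using this

/-- The constant of the Sobolev inequality `‖f‖₆ ≤ C ‖∇f‖₂` on `ℝ³`. -/
def sobolevConst : ℝ≥0 := eLpNormLESNormFDerivOfEqInnerConst (volume : Measure E3) 2

/-- The inequality for test functions passes to the limit by Fatou on the left and by convergence of
gradients on the right. Applied to differences of time slices, it turns continuity of `Du` in `L²`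
into continuity of `u` in `L⁶`. -/
lemma IsWeakGradient.eLpNorm_six_le {f : E3 → ℝ} {g : E3 → E3} (hf : MemLp f 6 volume)
    (hg : MemLp g 2 volume) (h : IsWeakGradient f g) :
    eLpNorm f 6 volume ≤ sobolevConst * eLpNorm g 2 volume := by
  obtain ⟨F, hF1, hF2, hF3, hF4⟩ := IsWeakGradient.exists_approx hf hg h
  have h1 : ∀ n, eLpNorm (F n) 6 volume ≤ sobolevConst * eLpNorm (gradient (F n)) 2 volume := by
    intro n
    have := eLpNorm_le_eLpNorm_fderiv_of_eq_inner (volume : Measure E3)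
      ((hF1 n).of_le (by simp)) (hF2 n) (p := 2) (p' := 6) (by norm_num) (by simp)
      (by simp; norm_num)
    refine this.trans (le_of_eq ?_)
    congr 1
    exact eLpNorm_congr_norm_ae (.of_forall fun x => (norm_gradient _ _).symm)
  have h2 := tendsto_eLpNorm_of_tendsto_sub (by norm_num)
    (fun n => (continuous_gradient (hF1 n)).aestronglyMeasurable) hg hF3
  have h3 := Tendsto.const_mul h2 (a := (sobolevConst : ℝ≥0∞)) (Or.inr (by simp))
  calc eLpNorm f 6 volume ≤ liminf (fun n => eLpNorm (F n) 6 volume) atTop :=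
        Lp.eLpNorm_lim_le_liminf_eLpNorm (fun n => (hF1 n).continuous.aestronglyMeasurable) f hF4
    _ ≤ liminf (fun n => sobolevConst * eLpNorm (gradient (F n)) 2 volume) atTop :=
        liminf_le_liminf (.of_forall h1)
    _ = _ := h3.liminf_eq

lemma IsWeakGradient.sub {f f' : E3 → ℝ} {g g' : E3 → E3} (h : IsWeakGradient f g)
    (h' : IsWeakGradient f' g')
    (hf : LocallyIntegrable f volume) (hg : LocallyIntegrable g volume)
    (hf' : LocallyIntegrable f' volume) (hg' : LocallyIntegrable g' volume) :
    IsWeakGradient (fun x => f x - f' x) (fun x => g x - g' x) := by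
  intro φ hφ hc v
  have hcf : Continuous fun x => fderiv ℝ φ x v := (hφ.continuous_fderiv (by simp)).clm_apply
    continuous_const
  have key : ∀ {a : E3 → ℝ}, LocallyIntegrable a volume →
      Integrable fun x => a x * fderiv ℝ φ x v := fun ha => by
    have := ha.integrable_smul_left_of_hasCompactSupport hcf (hc.fderiv_apply ℝ v)
    simpa [mul_comm] using this
  have key2 : ∀ {a : E3 → E3}, LocallyIntegrable a volume →
      Integrable fun x => (inner ℝ (a x) v : ℝ) * φ x := fun ha => by
    have := (ha.integrable_smul_left_of_hasCompactSupport hφ.continuous hc).inner_const (𝕜 := ℝ) v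
    simpa [real_inner_smul_left, mul_comm] using this
  simp only [sub_mul, inner_sub_left]
  rw [integral_sub (key hf) (key hf'), integral_sub (key2 hg) (key2 hg'), h φ hφ hc v, h' φ hφ hc v]
  ring

end Approximation

/-! ### Hardy's inequality and identity -/

section Hardy

open InnerProductSpace

lemma eLpNorm_two_sq_eq {α V : Type*} [MeasurableSpace α] {μ : Measure α} [NormedAddCommGroup V]
    {f : α → V} (hf : MemLp f 2 μ) : eLpNorm f 2 μ = ENNReal.ofReal √(∫ x, ‖f x‖ ^ 2 ∂μ) := by
  rw [hf.eLpNorm_eq_integral_rpow_norm (by norm_num) (by norm_num), Real.sqrt_eq_rpow]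
  norm_num

lemma eLpNorm_two_le_of_integral_le {α V W : Type*} [MeasurableSpace α] {μ : Measure α}
    [NormedAddCommGroup V] [NormedAddCommGroup W] {f : α → V} {g : α → W} (hf : MemLp f 2 μ)
    (hg : MemLp g 2 μ) {c : ℝ} (hc : 0 ≤ c) (h : ∫ x, ‖f x‖ ^ 2 ∂μ ≤ c ^ 2 * ∫ x, ‖g x‖ ^ 2 ∂μ) :
    eLpNorm f 2 μ ≤ ENNReal.ofReal c * eLpNorm g 2 μ := by
  rw [eLpNorm_two_sq_eq hf, eLpNorm_two_sq_eq hg, ← ofReal_mul hc]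
  apply ofReal_le_ofReal
  calc √(∫ x, ‖f x‖ ^ 2 ∂μ) ≤ √(c ^ 2 * ∫ x, ‖g x‖ ^ 2 ∂μ) := Real.sqrt_le_sqrt h
    _ = c * √(∫ x, ‖g x‖ ^ 2 ∂μ) := by rw [Real.sqrt_mul (sq_nonneg c), Real.sqrt_sq hc]

lemma sum_gradient_mul (F : E3 → ℝ) (x : E3) :
    ∑ i, fderiv ℝ F x (EuclideanSpace.single i 1) * x i = inner ℝ (gradient F x) x := by
  rw [inner_gradient]
  calc _ = fderiv ℝ F x (∑ i, x i • EuclideanSpace.single i 1) := by simp [mul_comm]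
    _ = fderiv ℝ F x x := by
        congr 1
        simpa using (EuclideanSpace.basisFun (Fin 3) ℝ).sum_repr x

lemma sum_sq_eq_norm_sq (x : E3) : ∑ i, x i ^ 2 = ‖x‖ ^ 2 := by
  rw [EuclideanSpace.norm_sq_eq]
  simp

/-- The divergence theorem for the field `F² x / (|x|² + δ)`. -/
lemma integral_hardy_regularized {F : E3 → ℝ} (hF : ContDiff ℝ ∞ F) (hc : HasCompactSupport F)
    {δ : ℝ} (hδ : 0 < δ) :
    ∫ x, (2 * F x * inner ℝ (gradient F x) x / (‖x‖ ^ 2 + δ)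
      + F x ^ 2 * (3 / (‖x‖ ^ 2 + δ) - 2 * ‖x‖ ^ 2 / (‖x‖ ^ 2 + δ) ^ 2)) = 0 := by
  have hpos : ∀ x : E3, 0 < ‖x‖ ^ 2 + δ := fun x => by positivity
  have hFd := hF.differentiable (by simp)
  have hcont := hF.continuous
  set w : Fin 3 → E3 → ℝ := fun i x => F x ^ 2 * (x i / (‖x‖ ^ 2 + δ)) with hw
  set w' : Fin 3 → E3 → ℝ := fun i x =>
    2 * F x * fderiv ℝ F x (EuclideanSpace.single i 1) * (x i / (‖x‖ ^ 2 + δ)) +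
      F x ^ 2 * ((1 * (‖x‖ ^ 2 + δ) - x i * (2 * x i)) / (‖x‖ ^ 2 + δ) ^ 2) with hw'
  have hFi : ∀ i, Continuous fun x => fderiv ℝ F x (EuclideanSpace.single i 1) := fun i =>
    (hF.continuous_fderiv (by simp)).clm_apply continuous_const
  have hder : ∀ i x, HasLineDerivAt ℝ (w i) (w' i x) x (EuclideanSpace.single i 1) := by
    intro i x
    have h1 : HasDerivAt (fun s : ℝ => F (x + s • EuclideanSpace.single i 1))
        (fderiv ℝ F x (EuclideanSpace.single i 1)) 0 := (hFd x).hasFDerivAt.hasLineDerivAt _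
    have h2 : HasDerivAt (fun s : ℝ => (x + s • EuclideanSpace.single i 1 : E3) i) 1 0 := by
      simpa using (hasDerivAt_id 0).const_add (x i)
    have h3 : HasDerivAt (fun s : ℝ => ‖x + s • EuclideanSpace.single i 1‖ ^ 2 + δ)
        (2 * x i) 0 := by
      have e : ∀ s, ‖x + s • EuclideanSpace.single i 1‖ ^ 2 + δ =
          ‖x‖ ^ 2 + 2 * (s * x i) + s ^ 2 + δ := by
        intro s
        rw [norm_add_sq_real, real_inner_smul_right, norm_smul, mul_pow,
          EuclideanSpace.inner_single_right]
        simp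
      simp_rw [e]
      have := ((((hasDerivAt_id 0).mul_const (x i)).const_mul 2).const_add (‖x‖ ^ 2)).add
        ((hasDerivAt_id 0).pow 2) |>.add_const δ
      simpa using this
    have h4 := (h1.pow 2).mul (h2.div h3 (by grind))
    exact h4.congr_deriv (by simp [hw'])
  have hcw : ∀ i, Continuous (w i) := by
    intro i
    exact (hcont.pow 2).mul (Continuous.div (by fun_prop) (by fun_prop) fun x => (hpos x).ne')
  have hcw' : ∀ i, Continuous (w' i) := by
    intro i
    refine Continuous.add (Continuous.mul (by fun_prop)
      (Continuous.div (by fun_prop) (by fun_prop) fun x => (hpos x).ne')) ?_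
    exact (hcont.pow 2).mul (Continuous.div (by fun_prop) (by fun_prop)
      fun x => (pow_pos (hpos x) 2).ne')
  have hz : ∀ x, x ∉ tsupport F → F x = 0 := fun x hx => image_eq_zero_of_notMem_tsupport hx
  have hiw : ∀ i, Integrable (w i) := fun i => (hcw i).integrable_of_hasCompactSupport
    (.intro hc fun x hx => by simp [hw, hz x hx])
  have hiw' : ∀ i, Integrable (w' i) := fun i => (hcw' i).integrable_of_hasCompactSupport
    (.intro hc fun x hx => by simp [hw', hz x hx])
  have h0 := fun i => integral_lineDeriv_eq_zero (hiw i) (hiw' i) (hder i)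
  have hsum : ∑ i, ∫ x, w' i x = 0 := Finset.sum_eq_zero fun i _ => h0 i
  rw [← integral_finsetSum _ fun i _ => hiw' i] at hsum
  rw [← hsum]
  congr 1
  ext x
  have e1 := sum_gradient_mul F x
  have e2 := sum_sq_eq_norm_sq x
  rw [Fin.sum_univ_three] at e1 e2 ⊢
  simp only [hw']
  rw [← e1]
  field_simp
  rw [← e2]
  ring

/-- With `s = |x|²`, the middle expression is the divergence of `x / (|x|² + δ)`. The lower bound
yields Hardy's inequality; the upper one dominates the limit `δ → 0`. -/
lemma hardy_factor_bounds {s δ : ℝ} (hs : 0 ≤ s) (hδ : 0 < δ) :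
    1 / (s + δ) ≤ 3 / (s + δ) - 2 * s / (s + δ) ^ 2 ∧
      3 / (s + δ) - 2 * s / (s + δ) ^ 2 ≤ 3 / (s + δ) := by
  constructor
  · rw [← sub_nonneg]
    have : 3 / (s + δ) - 2 * s / (s + δ) ^ 2 - 1 / (s + δ) = 2 * δ / (s + δ) ^ 2 := by
      field_simp; ring
    rw [this]; positivity
  · have : 0 ≤ 2 * s / (s + δ) ^ 2 := by positivity
    linarith

lemma memLp_gradient {F : E3 → ℝ} (hF : ContDiff ℝ ∞ F) (hc : HasCompactSupport F) :
    MemLp (gradient F) 2 volume :=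
  (continuous_gradient hF).memLp_of_hasCompactSupport (hasCompactSupport_gradient hc)

lemma eLpNorm_hardy_regularized_le {F : E3 → ℝ} (hF : ContDiff ℝ ∞ F) (hc : HasCompactSupport F)
    {δ : ℝ} (hδ : 0 < δ) :
    eLpNorm (fun x => F x / √(‖x‖ ^ 2 + δ)) 2 volume ≤
      ENNReal.ofReal 2 * eLpNorm (gradient F) 2 volume := by
  have hpos : ∀ x : E3, 0 < ‖x‖ ^ 2 + δ := fun x => by positivity
  have hz : ∀ x, x ∉ tsupport F → F x = 0 := fun x hx => image_eq_zero_of_notMem_tsupport hx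
  have hcg := continuous_gradient hF
  have hc1 : Continuous fun x => F x / √(‖x‖ ^ 2 + δ) :=
    Continuous.div (by fun_prop) (by fun_prop) fun x => (Real.sqrt_pos.2 (hpos x)).ne'
  have hm1 : MemLp (fun x => F x / √(‖x‖ ^ 2 + δ)) 2 volume :=
    hc1.memLp_of_hasCompactSupport (.intro hc fun x hx => by simp [hz x hx])
  have hm2 := memLp_gradient hF hc
  refine eLpNorm_two_le_of_integral_le hm1 hm2 (by norm_num) ?_
  have hi1 := hm1.integrable_norm_pow (by norm_num)
  have hi2 := hm2.integrable_norm_pow (by norm_num)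
  have hid := integral_hardy_regularized hF hc hδ
  have hi3 : Integrable fun x => (2 * F x * inner ℝ (gradient F x) x / (‖x‖ ^ 2 + δ)
      + F x ^ 2 * (3 / (‖x‖ ^ 2 + δ) - 2 * ‖x‖ ^ 2 / (‖x‖ ^ 2 + δ) ^ 2)) := by
    refine Continuous.integrable_of_hasCompactSupport ?_ (.intro hc fun x hx => by simp [hz x hx])
    refine Continuous.add (Continuous.div (by fun_prop) (by fun_prop) fun x => (hpos x).ne') ?_
    refine Continuous.mul (by fun_prop) (Continuous.sub (Continuous.div (by fun_prop) (by fun_prop)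
      fun x => (hpos x).ne') (Continuous.div (by fun_prop) (by fun_prop)
      fun x => (pow_pos (hpos x) 2).ne'))
  -- With `a = |F| / √(|x|² + δ)`, the integrand of the divergence identity is at least `a² - 2 a
  -- |∇F|`, hence at least `a²/2 - 2 |∇F|²`, as `(a - 2 |∇F|)² ≥ 0`. Since its integral is zero, `∫
  -- a² ≤ 4 ∫ |∇F|²`: this is the constant `2`.
  have hle : ∀ x, ‖F x / √(‖x‖ ^ 2 + δ)‖ ^ 2 / 2 - 2 * ‖gradient F x‖ ^ 2 ≤
      2 * F x * inner ℝ (gradient F x) x / (‖x‖ ^ 2 + δ)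
      + F x ^ 2 * (3 / (‖x‖ ^ 2 + δ) - 2 * ‖x‖ ^ 2 / (‖x‖ ^ 2 + δ) ^ 2) := by
    intro x
    have hb := (hardy_factor_bounds (sq_nonneg ‖x‖) hδ).1
    have hb' := mul_le_mul_of_nonneg_left hb (sq_nonneg (F x))
    have hin := abs_real_inner_le_norm (gradient F x) x
    set q := √(‖x‖ ^ 2 + δ) with hq
    have hqp : 0 < q := by positivity
    have hq2 := Real.sq_sqrt (hpos x).le
    have hxq : ‖x‖ ≤ q := Real.le_sqrt_of_sq_le (by linarith)
    rw [← hq2] at hb' ⊢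
    have e1 : ‖F x / q‖ ^ 2 = F x ^ 2 * (1 / q ^ 2) := by rw [Real.norm_eq_abs, sq_abs]; ring
    set a := |F x| / q with ha
    have ha2 : F x ^ 2 * (1 / q ^ 2) = a ^ 2 := by rw [ha, div_pow, sq_abs]; ring
    have hcross : -(2 * a * ‖gradient F x‖) ≤ 2 * F x * inner ℝ (gradient F x) x / q ^ 2 := by
      have habs : |2 * F x * inner ℝ (gradient F x) x / q ^ 2| ≤ 2 * a * ‖gradient F x‖ := by
        rw [abs_div, abs_mul, abs_mul, abs_two, abs_of_pos (pow_pos hqp 2), ha,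
          div_le_iff₀ (pow_pos hqp 2)]
        calc 2 * |F x| * |inner ℝ (gradient F x) x| ≤ 2 * |F x| * (‖gradient F x‖ * q) := by
              refine mul_le_mul_of_nonneg_left (hin.trans ?_) (by positivity)
              exact mul_le_mul_of_nonneg_left hxq (norm_nonneg _)
          _ = 2 * (|F x| / q) * ‖gradient F x‖ * q ^ 2 := by field_simp
      exact (abs_le.1 habs).1
    nlinarith [sq_nonneg (a - 2 * ‖gradient F x‖)]
  have hmono := integral_mono ((hi1.div_const 2).sub (hi2.const_mul 2)) hi3 hle
  simp only [Pi.sub_apply] at hmono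
  rw [hid, integral_sub (hi1.div_const 2) (hi2.const_mul 2), integral_div,
    integral_const_mul] at hmono
  linarith

lemma measurable_radialDir : Measurable radialDir := by
  unfold radialDir
  fun_prop

lemma norm_radialDir_le (x : E3) : ‖radialDir x‖ ≤ 1 := by
  unfold radialDir
  rw [norm_smul, norm_inv, norm_norm]
  by_cases h : ‖x‖ = 0
  · simp [h]
  · rw [inv_mul_cancel₀ h]

lemma ae_ne_zero : ∀ᵐ x : E3, x ≠ 0 := by
  rw [ae_iff]
  simp

/-- Fatou's lemma along approximating test functions, the regularisation `δ = 1 / (n + 1)` being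
removed in the same limit. -/
lemma IsWeakGradient.eLpNorm_div_norm_le {f : E3 → ℝ} {g : E3 → E3} (hf : MemLp f 6 volume)
    (hg : MemLp g 2 volume) (h : IsWeakGradient f g) :
    eLpNorm (fun x => f x / ‖x‖) 2 volume ≤ 2 * eLpNorm g 2 volume := by
  obtain ⟨F, hF1, hF2, hF3, hF4⟩ := IsWeakGradient.exists_approx hf hg h
  have hδ : ∀ n : ℕ, (0 : ℝ) < 1 / (n + 1) := fun n => by positivity
  have h2 := tendsto_eLpNorm_of_tendsto_sub (by norm_num)
    (fun n => (continuous_gradient (hF1 n)).aestronglyMeasurable) hg hF3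
  have h3 := Tendsto.const_mul h2 (a := ENNReal.ofReal 2) (Or.inr (by simp))
  have hae : ∀ᵐ x, Tendsto (fun n => F n x / √(‖x‖ ^ 2 + 1 / (n + 1))) atTop (𝓝 (f x / ‖x‖)) := by
    filter_upwards [hF4, ae_ne_zero] with x hx hx0
    have hsq : Tendsto (fun n : ℕ => √(‖x‖ ^ 2 + 1 / (n + 1))) atTop (𝓝 ‖x‖) := by
      have := (Real.continuous_sqrt.tendsto _).comp
        (tendsto_one_div_add_atTop_nhds_zero_nat |>.const_add (‖x‖ ^ 2))
      simpa [Function.comp_def] using this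
    exact hx.div hsq (norm_ne_zero_iff.2 hx0)
  calc eLpNorm (fun x => f x / ‖x‖) 2 volume
      ≤ liminf (fun n => eLpNorm (fun x => F n x / √(‖x‖ ^ 2 + 1 / (n + 1))) 2 volume) atTop := by
        refine Lp.eLpNorm_lim_le_liminf_eLpNorm (fun n => ?_) _ hae
        exact (((hF1 n).continuous.measurable).div (by fun_prop)).aestronglyMeasurable
    _ ≤ liminf (fun n => ENNReal.ofReal 2 * eLpNorm (gradient (F n)) 2 volume) atTop :=
        liminf_le_liminf (.of_forall fun n => eLpNorm_hardy_regularized_le (hF1 n) (hF2 n) (hδ n))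
    _ = _ := by rw [h3.liminf_eq]; norm_num

lemma IsWeakGradient.memLp_div_norm {f : E3 → ℝ} {g : E3 → E3} (hf : MemLp f 6 volume)
    (hg : MemLp g 2 volume) (h : IsWeakGradient f g) :
    MemLp (fun x => f x / ‖x‖) 2 volume :=
  ⟨(hf.1.aemeasurable.div measurable_norm.aemeasurable).aestronglyMeasurable,
    (h.eLpNorm_div_norm_le hf hg).trans_lt (mul_lt_top (by simp) hg.2)⟩

lemma memLp_inner_radialDir {g : E3 → E3} (hg : MemLp g 2 volume) :
    MemLp (fun x => (inner ℝ (g x) (radialDir x) : ℝ)) 2 volume := by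
  refine hg.mono (hg.1.inner measurable_radialDir.aestronglyMeasurable) (.of_forall fun x => ?_)
  exact (norm_inner_le_norm _ _).trans (mul_le_of_le_one_right (norm_nonneg _) (norm_radialDir_le x))

lemma isWeakGradient_gradient {F : E3 → ℝ} (hF : ContDiff ℝ ∞ F) (hc : HasCompactSupport F) :
    IsWeakGradient F (gradient F) := by
  intro φ hφ hφc v
  have hd := hF.differentiable (by simp)
  have hdφ := hφ.differentiable (by simp)
  have c1 : Continuous fun x => fderiv ℝ F x v :=
    (hF.continuous_fderiv (by simp)).clm_apply continuous_const
  have c2 : Continuous fun x => fderiv ℝ φ x v :=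
    (hφ.continuous_fderiv (by simp)).clm_apply continuous_const
  simp_rw [inner_gradient]
  exact integral_mul_fderiv_eq_neg_fderiv_mul_of_integrable
    ((c1.mul hφ.continuous).integrable_of_hasCompactSupport hφc.mul_left)
    ((hF.continuous.mul c2).integrable_of_hasCompactSupport hc.mul_right)
    ((hF.continuous.mul hφ.continuous).integrable_of_hasCompactSupport hc.mul_right) (fun x _ => hd x) (fun x _ => hdφ x)

/-- The limit `δ → 0` of the regularised divergence identity, where the divergence of `x / |x|²` is
`1 / |x|²`. Hardy's inequality makes the dominating function integrable. -/
lemma integral_hardy_identity_smooth {F : E3 → ℝ} (hF : ContDiff ℝ ∞ F) (hc : HasCompactSupport F) :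
    ∫ x, (2 * (F x / ‖x‖ * inner ℝ (gradient F x) (radialDir x)) + F x / ‖x‖ * (F x / ‖x‖))
      = 0 := by
  have hm6 : MemLp F 6 volume := hF.continuous.memLp_of_hasCompactSupport hc
  have hmg := memLp_gradient hF hc
  have hm2 := (isWeakGradient_gradient hF hc).memLp_div_norm hm6 hmg
  have hmr := hmg.norm
  have hb : Integrable fun x => 2 * (‖F x / ‖x‖‖ * ‖gradient F x‖)
      + 3 * (‖F x / ‖x‖‖ * ‖F x / ‖x‖‖) :=
    ((integrable_mul_of_memLp_two hm2.norm hmr).const_mul 2).add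
      ((integrable_mul_of_memLp_two hm2.norm hm2.norm).const_mul 3)
  have hlim := tendsto_integral_of_dominated_convergence (F := fun n x =>
      (2 * F x * inner ℝ (gradient F x) x / (‖x‖ ^ 2 + 1 / (n + 1))
      + F x ^ 2 * (3 / (‖x‖ ^ 2 + 1 / (n + 1)) - 2 * ‖x‖ ^ 2 / (‖x‖ ^ 2 + 1 / (n + 1)) ^ 2)))
    (f := fun x => 2 * (F x / ‖x‖ * inner ℝ (gradient F x) (radialDir x))
      + F x / ‖x‖ * (F x / ‖x‖)) _ (fun n => ?_) hb (fun n => ?_) ?_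
  · refine tendsto_nhds_unique hlim ?_
    refine tendsto_const_nhds.congr fun n => ?_
    exact (integral_hardy_regularized hF hc (by positivity)).symm
  · have := hF.continuous.measurable
    have := (continuous_gradient hF).measurable
    exact Measurable.aestronglyMeasurable (by fun_prop)
  · filter_upwards [ae_ne_zero] with x hx
    have hd : 0 < 1 / ((n : ℝ) + 1) := by positivity
    obtain ⟨hb1, hb2⟩ := hardy_factor_bounds (sq_nonneg ‖x‖) hd
    set s := ‖x‖ ^ 2 + 1 / (n + 1) with hs
    have hsx : ‖x‖ ^ 2 ≤ s := by linarith
    have hsp : 0 < s := by positivity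
    refine (norm_add_le _ _).trans (add_le_add ?_ ?_)
    · rw [norm_div, norm_mul, norm_mul, Real.norm_two, Real.norm_of_nonneg hsp.le, norm_div,
        norm_norm]
      calc 2 * ‖F x‖ * ‖(inner ℝ (gradient F x) x : ℝ)‖ / s
          ≤ 2 * ‖F x‖ * (‖gradient F x‖ * ‖x‖) / ‖x‖ ^ 2 := by
            gcongr
            exact norm_inner_le_norm _ _
        _ = 2 * (‖F x‖ / ‖x‖ * ‖gradient F x‖) := by field_simp
    · rw [norm_mul, norm_div, norm_norm, norm_pow]
      have hnn := le_trans (by positivity) hb1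
      rw [Real.norm_of_nonneg hnn]
      calc ‖F x‖ ^ 2 * (3 / s - 2 * ‖x‖ ^ 2 / s ^ 2) ≤ ‖F x‖ ^ 2 * (3 / ‖x‖ ^ 2) := by
            refine mul_le_mul_of_nonneg_left (hb2.trans ?_) (by positivity)
            gcongr
        _ = 3 * (‖F x‖ / ‖x‖ * (‖F x‖ / ‖x‖)) := by field_simp
  · filter_upwards [ae_ne_zero] with x hx
    have hs : Tendsto (fun n : ℕ => ‖x‖ ^ 2 + 1 / (n + 1)) atTop (𝓝 (‖x‖ ^ 2)) := by
      simpa using tendsto_one_div_add_atTop_nhds_zero_nat.const_add (‖x‖ ^ 2)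
    have hne : ‖x‖ ^ 2 ≠ 0 := by positivity
    have := ((tendsto_const_nhds (x := 2 * F x * (inner ℝ (gradient F x) x : ℝ))).div hs hne).add
      (((((tendsto_const_nhds (x := 3)).div hs hne).sub
        ((tendsto_const_nhds (x := 2 * ‖x‖ ^ 2)).div (hs.pow 2)
          (pow_ne_zero 2 hne)))).const_mul (F x ^ 2))
    have e : 2 * (F x / ‖x‖ * inner ℝ (gradient F x) (radialDir x)) + F x / ‖x‖ * (F x / ‖x‖) =
        2 * F x * inner ℝ (gradient F x) x / ‖x‖ ^ 2
          + F x ^ 2 * (3 / ‖x‖ ^ 2 - 2 * ‖x‖ ^ 2 / (‖x‖ ^ 2) ^ 2) := by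
      rw [radialDir, real_inner_smul_right]
      field_simp
      ring
    rw [e]
    exact this

/-- The identity behind `∫ (∂ᵣf + f/|x|)² = ∫ (∂ᵣf)²`. -/
lemma IsWeakGradient.integral_hardy_identity {f : E3 → ℝ} {g : E3 → E3} (hf : MemLp f 6 volume)
    (hg : MemLp g 2 volume) (h : IsWeakGradient f g) :
    ∫ x, (2 * (f x / ‖x‖ * inner ℝ (g x) (radialDir x)) + f x / ‖x‖ * (f x / ‖x‖)) = 0 := by
  obtain ⟨F, hF1, hF2, hF3, hF4⟩ := IsWeakGradient.exists_approx hf hg h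
  have hF6 : ∀ n, MemLp (F n) 6 volume := fun n =>
    (hF1 n).continuous.memLp_of_hasCompactSupport (hF2 n)
  have hFg := fun n => memLp_gradient (hF1 n) (hF2 n)
  have hFw := fun n => isWeakGradient_gradient (hF1 n) (hF2 n)
  have hFr := fun n => (hFw n).memLp_div_norm (hF6 n) (hFg n)
  have hfr := h.memLp_div_norm hf hg
  -- Hardy's inequality for the difference `F n - f` makes the singular quotients converge in `L²`.
  have t1 : Tendsto (fun n => eLpNorm (fun x => F n x / ‖x‖ - f x / ‖x‖) 2 volume) atTop (𝓝 0) := by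
    have ht := Tendsto.const_mul hF3 (a := 2) (Or.inr (by simp))
    rw [mul_zero] at ht
    refine tendsto_zero_of_le ht fun n => ?_
    have := ((hFw n).sub h ((hF6 n).locallyIntegrable (by norm_num))
      ((hFg n).locallyIntegrable (by norm_num)) (hf.locallyIntegrable (by norm_num))
      (hg.locallyIntegrable (by norm_num))).eLpNorm_div_norm_le ((hF6 n).sub hf) ((hFg n).sub hg)
    simpa only [sub_div, Pi.sub_apply] using! this
  have t2 : Tendsto (fun n => eLpNorm (fun x => (inner ℝ (gradient (F n) x) (radialDir x) : ℝ) -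
      inner ℝ (g x) (radialDir x)) 2 volume) atTop (𝓝 0) := by
    refine tendsto_zero_of_le hF3 fun n => eLpNorm_mono fun x => ?_
    rw [← inner_sub_left]
    exact (norm_inner_le_norm _ _).trans
      (mul_le_of_le_one_right (norm_nonneg _) (norm_radialDir_le x))
  have l1 := tendsto_integral_mul_of_L2 hfr (memLp_inner_radialDir hg) hFr
    (fun n => memLp_inner_radialDir (hFg n)) t1 t2
  have l2 := tendsto_integral_mul_of_L2 hfr hfr hFr hFr t1 t1
  have l3 := (l1.const_mul 2).add l2
  have key : ∀ {a : E3 → ℝ} {b : E3 → E3}, MemLp (fun x => a x / ‖x‖) 2 volume → MemLp b 2 volume →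
      ∫ x, (2 * (a x / ‖x‖ * inner ℝ (b x) (radialDir x)) + a x / ‖x‖ * (a x / ‖x‖)) =
        (2 * ∫ x, a x / ‖x‖ * inner ℝ (b x) (radialDir x)) + ∫ x, a x / ‖x‖ * (a x / ‖x‖) := by
    intro a b ha hb
    rw [integral_add ((integrable_mul_of_memLp_two ha (memLp_inner_radialDir hb)).const_mul 2)
      (integrable_mul_of_memLp_two ha ha), integral_const_mul]
  rw [key hfr hg]
  refine tendsto_nhds_unique l3 (tendsto_const_nhds.congr fun n => ?_)
  rw [← integral_hardy_identity_smooth (hF1 n) (hF2 n), key (hFr n) (hFg n)]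

end Hardy

/-! ### Time slices and local integrability of the solution -/

section Sections

lemma eLpNorm_two_restrict_eq_lintegral {α V : Type*} [MeasurableSpace α] {μ : Measure α}
    [NormedAddCommGroup V] {s : Set α} (hs : MeasurableSet s) (f : α → V) :
    eLpNorm f 2 (μ.restrict s) = (∫⁻ x, ‖s.indicator f x‖ₑ ^ 2 ∂μ) ^ (1 / 2 : ℝ) := by
  rw [← eLpNorm_indicator_eq_eLpNorm_restrict hs, eLpNorm_eq_lintegral_rpow_enorm_toReal
    (by norm_num) (by norm_num)]
  simp

lemma ae_section {P : Spacetime → Prop} (h : ∀ᵐ z, P z) : ∀ᵐ t, ∀ᵐ x, P (x, t) := by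
  have h2 : ∀ᵐ z ∂((volume : Measure ℝ).prod (volume : Measure E3)), P z.swap := by
    have := (Measure.measurePreserving_swap ).quasiMeasurePreserving.ae h
    exact this
  exact Measure.ae_ae_of_ae_prod h2

lemma lintegral_spacetime {f : Spacetime → ℝ≥0∞} (hf : AEMeasurable f volume) :
    ∫⁻ z, f z = ∫⁻ t, ∫⁻ x, f (x, t) :=
  lintegral_prod_symm f hf

lemma integral_spacetime {V : Type*} [NormedAddCommGroup V] [NormedSpace ℝ V] {f : Spacetime → V}
    (hf : Integrable f volume) : ∫ z, f z = ∫ t, ∫ x, f (x, t) :=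
  integral_prod_symm f hf

lemma aemeasurable_lintegral_section {f : Spacetime → ℝ≥0∞} (hf : AEMeasurable f volume) :
    AEMeasurable (fun t => ∫⁻ x, f (x, t)) volume :=
  AEMeasurable.lintegral_prod_left' hf

lemma aestronglyMeasurable_section {V : Type*} [TopologicalSpace V]
    {f : Spacetime → V} (hf : AEStronglyMeasurable f volume) :
    ∀ᵐ t, AEStronglyMeasurable (fun x => f (x, t)) volume := by
  filter_upwards [ae_section hf.ae_eq_mk] with t ht
  exact (hf.stronglyMeasurable_mk.comp_measurable
    measurable_prodMk_right).aestronglyMeasurable.congr (Filter.EventuallyEq.symm ht)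

lemma aemeasurable_eLpNorm_section {V : Type*} [NormedAddCommGroup V] {f : Spacetime → V}
    (hf : AEStronglyMeasurable f volume) {q : ℝ≥0∞} (hq0 : q ≠ 0) (hq : q ≠ ⊤) :
    AEMeasurable (fun t => eLpNorm (fun x => f (x, t)) q volume) volume := by
  simp_rw [eLpNorm_eq_lintegral_rpow_enorm_toReal hq0 hq]
  exact (aemeasurable_lintegral_section (hf.enorm.pow_const _)).pow_const _

lemma memLp_two_slab {V : Type*} [NormedAddCommGroup V] {f : Spacetime → V}
    (hf : AEStronglyMeasurable f volume) {T : ℝ} {C : ℝ≥0∞} (hC : C ≠ ⊤)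
    (h : ∀ t ∈ Icc (-T) T, eLpNorm (fun x => f (x, t)) 2 volume ≤ C) :
    MemLp f 2 (volume.restrict {z : Spacetime | |z.2| ≤ T}) := by
  have hms : MeasurableSet {z : Spacetime | |z.2| ≤ T} :=
    measurableSet_le measurable_snd.abs measurable_const
  refine ⟨hf.restrict, ?_⟩
  rw [eLpNorm_two_restrict_eq_lintegral hms]
  refine rpow_lt_top_of_nonneg (by norm_num) (ne_of_lt ?_)
  rw [lintegral_spacetime ((hf.indicator hms).enorm.pow_const 2)]
  calc ∫⁻ t, ∫⁻ x, ‖{z : Spacetime | |z.2| ≤ T}.indicator f (x, t)‖ₑ ^ 2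
      ≤ ∫⁻ t, (Icc (-T) T).indicator (fun _ => C ^ 2) t := by
        refine lintegral_mono fun t => ?_
        by_cases ht : t ∈ Icc (-T) T
        · rw [indicator_of_mem ht]
          have h1 := h t ht
          rw [eLpNorm_two_eq] at h1
          calc ∫⁻ x, ‖{z : Spacetime | |z.2| ≤ T}.indicator f (x, t)‖ₑ ^ 2
              ≤ ∫⁻ x, ‖f (x, t)‖ₑ ^ 2 := by
                gcongr
                exact enorm_indicator_le_enorm_self _ _
            _ = ((∫⁻ x, ‖f (x, t)‖ₑ ^ 2) ^ (1 / 2 : ℝ)) ^ 2 := by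
                rw [← rpow_natCast, ← rpow_mul]; norm_num
            _ ≤ C ^ 2 := by gcongr
        · rw [indicator_of_notMem ht]
          have : ∀ x, {z : Spacetime | |z.2| ≤ T}.indicator f (x, t) = 0 := by
            intro x
            apply indicator_of_notMem
            intro hx
            exact ht (abs_le.1 (by simpa using hx))
          simp [this]
    _ < ⊤ := by
        rw [lintegral_indicator_const measurableSet_Icc]
        exact mul_lt_top (pow_lt_top hC.lt_top) (by simp)

lemma closedBall_spacetime_subset (R : ℝ) : closedBall 0 R ⊆ {z : Spacetime | |z.2| ≤ R} := by
  intro z hz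
  rw [mem_closedBall_zero_iff] at hz
  exact (norm_snd_le z).trans hz

lemma locallyIntegrable_of_memLp_closedBall {G V : Type*} [NormedAddCommGroup G] [MeasurableSpace G]
    [ProperSpace G] [OpensMeasurableSpace G] {μ : Measure G} [IsLocallyFiniteMeasure μ]
    [NormedAddCommGroup V]
    {f : G → V} {q : ℝ≥0∞} (hq : 1 ≤ q)
    (hf : ∀ R, MemLp f q (μ.restrict (closedBall 0 R))) :
    LocallyIntegrable f μ := by
  intro x
  refine ⟨closedBall 0 (‖x‖ + 1), ?_, ?_⟩
  · refine mem_of_superset (ball_mem_nhds x one_pos) fun y hy => ?_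
    rw [mem_closedBall_zero_iff]
    rw [mem_ball, dist_eq_norm] at hy
    calc ‖y‖ = ‖(y - x) + x‖ := by rw [sub_add_cancel]
      _ ≤ ‖y - x‖ + ‖x‖ := norm_add_le _ _
      _ ≤ _ := by linarith
  · have : IsFiniteMeasure (μ.restrict (closedBall 0 (‖x‖ + 1))) :=
      ⟨by simpa using (isCompact_closedBall 0 (‖x‖ + 1)).measure_lt_top⟩
    exact (hf _).integrable hq

lemma eLpNorm_restrict_ball_le {f : E3 → ℝ} (hf : AEStronglyMeasurable f volume) {q : ℝ≥0∞}
    (hq : q ≤ 6) (R : ℝ) :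
    eLpNorm f q (volume.restrict (closedBall 0 R)) ≤ eLpNorm f 6 volume *
      volume (closedBall (0 : E3) R) ^ (1 / q.toReal - 1 / (6 : ℝ≥0∞).toReal) := by
  refine (eLpNorm_le_eLpNorm_mul_rpow_measure_univ hq hf.restrict).trans ?_
  rw [Measure.restrict_apply_univ]
  gcongr
  exact Measure.restrict_le_self

end Sections

namespace IsFiniteEnergySolution

variable {p : ℝ} {u : Spacetime → ℝ} {Du : Spacetime → E3} {ut : Spacetime → ℝ}

lemma exists_bound_of_continuous {V : Type*} [NormedAddCommGroup V] {f : Spacetime → V}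
    {q : ℝ≥0∞} (hq : 1 ≤ q) (hm : ∀ t, MemLp (fun x => f (x, t)) q volume)
    (hc : ∀ t₀, Tendsto (fun t => eLpNorm (fun x => f (x, t) - f (x, t₀)) q volume)
      (𝓝 t₀) (𝓝 0)) (T : ℝ) :
    ∃ C, C ≠ ⊤ ∧ ∀ t ∈ Icc (-T) T, eLpNorm (fun x => f (x, t)) q volume ≤ C := by
  have hcont : Continuous fun t => eLpNorm (fun x => f (x, t)) q volume :=
    continuous_iff_continuousAt.2 fun t₀ =>
      tendsto_eLpNorm_of_tendsto_sub hq (fun t => (hm t).1) (hm t₀) (hc t₀)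
  rcases (Icc (-T) T).eq_empty_or_nonempty with he | hne
  · exact ⟨0, by simp, fun t ht => by simp [he] at ht⟩
  · obtain ⟨t₁, -, hmax⟩ := isCompact_Icc.exists_isMaxOn hne hcont.continuousOn
    exact ⟨_, (hm t₁).2.ne, fun t ht => hmax ht⟩

variable (h : IsFiniteEnergySolution p u Du ut)
include h

/-- The Sobolev inequality for differences of slices. Continuity of `u` in time is not assumed
separately; it comes from that of `Du`. -/
lemma continuous_u (t₀ : ℝ) : Tendsto
    (fun t => eLpNorm (fun x => u (x, t) - u (x, t₀)) 6 volume) (𝓝 t₀) (𝓝 0) := by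
  have h1 := Tendsto.const_mul (h.continuous_Du t₀) (a := (sobolevConst : ℝ≥0∞)) (Or.inr (by simp))
  rw [mul_zero] at h1
  refine tendsto_zero_of_le h1 fun t => ?_
  exact ((h.weakGradient t).sub (h.weakGradient t₀) ((h.memLp_u t).locallyIntegrable (by norm_num))
    ((h.memLp_Du t).locallyIntegrable (by norm_num))
    ((h.memLp_u t₀).locallyIntegrable (by norm_num))
    ((h.memLp_Du t₀).locallyIntegrable (by norm_num))).eLpNorm_six_le
    ((h.memLp_u t).sub (h.memLp_u t₀)) ((h.memLp_Du t).sub (h.memLp_Du t₀))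

lemma exists_bound_Du (T : ℝ) : ∃ C, C ≠ ⊤ ∧ ∀ t ∈ Icc (-T) T,
    eLpNorm (fun x => Du (x, t)) 2 volume ≤ C :=
  exists_bound_of_continuous (by norm_num) h.memLp_Du h.continuous_Du T

lemma exists_bound_ut (T : ℝ) : ∃ C, C ≠ ⊤ ∧ ∀ t ∈ Icc (-T) T,
    eLpNorm (fun x => ut (x, t)) 2 volume ≤ C :=
  exists_bound_of_continuous (by norm_num) h.memLp_ut h.continuous_ut T

lemma exists_bound_u (T : ℝ) : ∃ C, C ≠ ⊤ ∧ ∀ t ∈ Icc (-T) T,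
    eLpNorm (fun x => u (x, t)) 6 volume ≤ C :=
  exists_bound_of_continuous (by norm_num) h.memLp_u h.continuous_u T

lemma memLp_Du_slab (T : ℝ) : MemLp Du 2 (volume.restrict {z : Spacetime | |z.2| ≤ T}) := by
  obtain ⟨C, hC, hb⟩ := h.exists_bound_Du T
  exact memLp_two_slab h.aesm_Du hC hb

lemma memLp_ut_slab (T : ℝ) : MemLp ut 2 (volume.restrict {z : Spacetime | |z.2| ≤ T}) := by
  obtain ⟨C, hC, hb⟩ := h.exists_bound_ut T
  exact memLp_two_slab h.aesm_ut hC hb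

lemma memLp_u_div_slab (T : ℝ) :
    MemLp (fun z => u z / ‖z.1‖) 2 (volume.restrict {z : Spacetime | |z.2| ≤ T}) := by
  obtain ⟨C, hC, hb⟩ := h.exists_bound_Du T
  refine memLp_two_slab (C := 2 * C)
    (h.aesm_u.aemeasurable.div measurable_fst.norm.aemeasurable).aestronglyMeasurable
    (mul_ne_top (by simp) hC) fun t ht => ?_
  exact ((h.weakGradient t).eLpNorm_div_norm_le (h.memLp_u t) (h.memLp_Du t)).trans
    (by gcongr; exact hb t ht)

lemma memLp_Du_ball (R : ℝ) : MemLp Du 2 (volume.restrict (closedBall 0 R)) :=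
  (h.memLp_Du_slab R).mono_measure (Measure.restrict_mono (closedBall_spacetime_subset R) le_rfl)

lemma memLp_ut_ball (R : ℝ) : MemLp ut 2 (volume.restrict (closedBall 0 R)) :=
  (h.memLp_ut_slab R).mono_measure (Measure.restrict_mono (closedBall_spacetime_subset R) le_rfl)

/-- On a ball of radius `R` one has `|u| ≤ R |u| / |x|`, and the quotient is controlled by Hardy's
inequality. -/
lemma memLp_u_ball (R : ℝ) : MemLp u 2 (volume.restrict (closedBall 0 R)) := by
  have h1 := (h.memLp_u_div_slab R).mono_measure
    (Measure.restrict_mono (closedBall_spacetime_subset R) le_rfl)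
  refine (h1.const_smul R).mono h.aesm_u.restrict ?_
  have hae : ∀ᵐ z : Spacetime, z.1 ≠ 0 := by
    have := Measure.quasiMeasurePreserving_fst (ν := (volume : Measure ℝ)) |>.ae ae_ne_zero
    exact this
  filter_upwards [ae_restrict_mem measurableSet_closedBall,
    ae_restrict_of_ae hae] with z hz hz0
  rw [mem_closedBall_zero_iff] at hz
  have hz1 : ‖z.1‖ ≤ R := (norm_fst_le z).trans hz
  have hpos : 0 < ‖z.1‖ := norm_pos_iff.2 hz0
  rw [Pi.smul_apply, norm_smul, norm_div, norm_norm, Real.norm_of_nonneg (hpos.le.trans hz1),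
    ← mul_div_assoc, le_div_iff₀ hpos, mul_comm R]
  gcongr

lemma locallyIntegrable_u : LocallyIntegrable u volume :=
  locallyIntegrable_of_memLp_closedBall (by norm_num) h.memLp_u_ball

lemma locallyIntegrable_Du : LocallyIntegrable Du volume :=
  locallyIntegrable_of_memLp_closedBall (by norm_num) h.memLp_Du_ball

lemma locallyIntegrable_ut : LocallyIntegrable ut volume :=
  locallyIntegrable_of_memLp_closedBall (by norm_num) h.memLp_ut_ball

/-- The gradient is given slice by slice. Fubini makes it a weak derivative on space-time, so that
mollification in space and time commutes with it. -/
lemma spaceDerivative {φ : Spacetime → ℝ} (hφ : ContDiff ℝ ∞ φ) (hc : HasCompactSupport φ)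
    (v : E3) : ∫ z, u z * fderiv ℝ φ z (v, 0) = -∫ z, inner ℝ (Du z) v * φ z := by
  have hcf : Continuous fun z => fderiv ℝ φ z (v, 0) := (hφ.continuous_fderiv (by simp)).clm_apply
    continuous_const
  have i1 : Integrable fun z => u z * fderiv ℝ φ z (v, 0) := by
    have := h.locallyIntegrable_u.integrable_smul_left_of_hasCompactSupport hcf
      (hc.fderiv_apply ℝ (v, 0))
    simpa [mul_comm] using this
  have i2 : Integrable fun z => (inner ℝ (Du z) v : ℝ) * φ z := by
    have := (h.locallyIntegrable_Du.integrable_smul_left_of_hasCompactSupport hφ.continuous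
      hc).inner_const (𝕜 := ℝ) v
    simpa [real_inner_smul_left, mul_comm] using this
  rw [integral_spacetime i1, integral_spacetime i2, ← integral_neg]
  congr 1
  ext t
  have hct : HasCompactSupport fun x => φ (x, t) :=
    .intro (hc.isCompact.image continuous_fst) fun x hx =>
      image_eq_zero_of_notMem_tsupport fun hx' => hx ⟨_, hx', rfl⟩
  have := h.weakGradient t (fun x => φ (x, t)) (hφ.comp (by fun_prop)) hct v
  rw [← this]
  congr 1
  ext x
  have hd : HasFDerivAt φ (fderiv ℝ φ (x, t)) (x, t) := (hφ.differentiable (by simp) _).hasFDerivAt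
  have h1 : HasFDerivAt (fun x => (x, t)) ((ContinuousLinearMap.id ℝ E3).prod 0) x :=
    (hasFDerivAt_id x).prodMk (hasFDerivAt_const t x)
  have h2 := hd.comp x h1
  have h3 : fderiv ℝ (fun x => φ (x, t)) x = _ := h2.fderiv
  rw [h3]
  simp

end IsFiniteEnergySolution

/-! ### Products of `L¹ₜL²ₓ` and `L^∞ₜL²ₓ` functions -/

section MixedNorm

instance isAddHaarMeasure_volume_spacetime : (volume : Measure Spacetime).IsAddHaarMeasure :=
  inferInstanceAs ((volume : Measure E3).prod (volume : Measure ℝ)).IsAddHaarMeasure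

lemma lintegral_mul_le_sqrt {α : Type*} [MeasurableSpace α] {μ : Measure α} {f g : α → ℝ≥0∞}
    (hf : AEMeasurable f μ) (hg : AEMeasurable g μ) :
    ∫⁻ x, f x * g x ∂μ ≤ (∫⁻ x, f x ^ 2 ∂μ) ^ (1 / 2 : ℝ) * (∫⁻ x, g x ^ 2 ∂μ) ^ (1 / 2 : ℝ) := by
  have := lintegral_mul_le_Lp_mul_Lq μ Real.HolderConjugate.two_two hf hg
  simpa using this

/-- Cauchy–Schwarz on each slice. The bound does not depend on the translation `y`, so averaging
over `y` against the kernel gives the same bound for the mollification of `G`. -/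
lemma lintegral_translate_mul_le {G H : Spacetime → ℝ} (hG : AEStronglyMeasurable G volume)
    (hH : AEStronglyMeasurable H volume) {S : ℝ≥0∞}
    (hS : ∀ t, ∫⁻ x, ‖H (x, t)‖ₑ ^ 2 ≤ S) (y : Spacetime) :
    ∫⁻ z, ‖G (z - y)‖ₑ * ‖H z‖ₑ ≤
      (∫⁻ t, eLpNorm (fun x => G (x, t)) 2 volume) * S ^ (1 / 2 : ℝ) := by
  have hGy : AEStronglyMeasurable (fun z => G (z - y)) volume :=
    hG.comp_quasiMeasurePreserving (measurePreserving_sub_right volume y).quasiMeasurePreserving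
  rw [lintegral_spacetime (f := fun z => ‖G (z - y)‖ₑ * ‖H z‖ₑ) (hGy.enorm.mul hH.enorm)]
  calc ∫⁻ t, ∫⁻ x, ‖G ((x, t) - y)‖ₑ * ‖H (x, t)‖ₑ
      ≤ ∫⁻ t, eLpNorm (fun x => G (x, t - y.2)) 2 volume * S ^ (1 / 2 : ℝ) := by
        refine lintegral_mono_ae ?_
        filter_upwards [aestronglyMeasurable_section hGy, aestronglyMeasurable_section hH]
          with t h1 h2
        refine (lintegral_mul_le_sqrt h1.enorm h2.enorm).trans ?_
        have e : ∫⁻ x, ‖G ((x, t) - y)‖ₑ ^ 2 = ∫⁻ x, ‖G (x, t - y.2)‖ₑ ^ 2 :=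
          lintegral_sub_right_eq_self (fun x => ‖G (x, t - y.2)‖ₑ ^ 2) y.1
        rw [e, eLpNorm_two_eq]
        gcongr
        exact hS t
    _ = (∫⁻ t, eLpNorm (fun x => G (x, t - y.2)) 2 volume) * S ^ (1 / 2 : ℝ) := by
        have hm : AEMeasurable (fun t => eLpNorm (fun x => G (x, t - y.2)) 2 volume) volume :=
          (aemeasurable_eLpNorm_section hG (by norm_num) (by norm_num)).comp_quasiMeasurePreserving
            (measurePreserving_sub_right volume y.2).quasiMeasurePreserving
        rw [lintegral_mul_const'' _ hm]
    _ = _ := by rw [lintegral_sub_right_eq_self (fun t => eLpNorm (fun x => G (x, t)) 2 volume) y.2]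

lemma lintegral_mul_le_mixed {G H : Spacetime → ℝ} (hG : AEStronglyMeasurable G volume)
    (hH : AEStronglyMeasurable H volume) {S : ℝ≥0∞}
    (hS : ∀ t, ∫⁻ x, ‖H (x, t)‖ₑ ^ 2 ≤ S) :
    ∫⁻ z, ‖G z‖ₑ * ‖H z‖ₑ ≤ (∫⁻ t, eLpNorm (fun x => G (x, t)) 2 volume) * S ^ (1 / 2 : ℝ) := by
  simpa using lintegral_translate_mul_le hG hH hS 0

lemma lintegral_mollify_mul_le {G H : Spacetime → ℝ} (hG : AEStronglyMeasurable G volume)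
    (hH : AEStronglyMeasurable H volume) {S : ℝ≥0∞}
    (hS : ∀ t, ∫⁻ x, ‖H (x, t)‖ₑ ^ 2 ≤ S) (n : ℕ) :
    ∫⁻ z, ‖mollify n G z‖ₑ * ‖H z‖ₑ ≤
      (∫⁻ t, eLpNorm (fun x => G (x, t)) 2 volume) * S ^ (1 / 2 : ℝ) := by
  have hGm : AEMeasurable (fun w : Spacetime × Spacetime => ‖G (w.1 - w.2)‖ₑ)
      (volume.prod volume) :=
    (hG.comp_quasiMeasurePreserving (quasiMeasurePreserving_sub volume volume)).enorm
  have hρ := measurable_ofReal_mollifier (G := Spacetime) n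
  have hmeas : AEMeasurable (fun w : Spacetime × Spacetime =>
      ENNReal.ofReal (mollifier Spacetime n w.2) * (‖G (w.1 - w.2)‖ₑ * ‖H w.1‖ₑ))
      (volume.prod volume) :=
    (hρ.comp measurable_snd).aemeasurable.mul (by fun_prop)
  calc ∫⁻ z, ‖mollify n G z‖ₑ * ‖H z‖ₑ
      ≤ ∫⁻ z, ∫⁻ y, ENNReal.ofReal (mollifier Spacetime n y) * (‖G (z - y)‖ₑ * ‖H z‖ₑ) := by
        refine lintegral_mono fun z => ?_
        simp_rw [← mul_assoc]
        rw [lintegral_mul_const' _ _ enorm_ne_top]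
        gcongr
        exact enorm_mollify_le n G z
    _ = ∫⁻ y, ∫⁻ z, ENNReal.ofReal (mollifier Spacetime n y) * (‖G (z - y)‖ₑ * ‖H z‖ₑ) :=
        lintegral_lintegral_swap hmeas
    _ ≤ ∫⁻ y, ENNReal.ofReal (mollifier Spacetime n y) *
          ((∫⁻ t, eLpNorm (fun x => G (x, t)) 2 volume) * S ^ (1 / 2 : ℝ)) := by
        refine lintegral_mono fun y => ?_
        rw [lintegral_const_mul' _ _ ofReal_ne_top]
        gcongr
        exact lintegral_translate_mul_le hG hH hS y
    _ = _ := by rw [lintegral_mul_const _ hρ, lintegral_mollifier, one_mul]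

lemma integrable_mul_of_lintegral_lt_top {α : Type*} [MeasurableSpace α] {μ : Measure α}
    {f g : α → ℝ} (hf : AEStronglyMeasurable f μ) (hg : AEStronglyMeasurable g μ)
    (h : ∫⁻ x, ‖f x‖ₑ * ‖g x‖ₑ ∂μ < ⊤) : Integrable (fun x => f x * g x) μ := by
  refine ⟨hf.mul hg, ?_⟩
  rw [hasFiniteIntegral_iff_enorm]
  simpa [enorm_mul] using h

lemma enorm_integral_mul_le {α : Type*} [MeasurableSpace α] {μ : Measure α}
    {f g : α → ℝ} : ‖∫ x, f x * g x ∂μ‖ₑ ≤ ∫⁻ x, ‖f x‖ₑ * ‖g x‖ₑ ∂μ := by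
  refine (enorm_integral_le_lintegral_enorm _).trans (le_of_eq ?_)
  simp

/-- Weak-strong convergence of `∫ (ρₙ * F) Hₙ` for `F` locally in `L¹ₜL²ₓ`. -/
lemma tendsto_integral_mollify_mul {F : Spacetime → ℝ} (hF : LocallyIntegrable F volume)
    (hF12 : ∀ T, ∫⁻ t in Icc (-T) T, eLpNorm (fun x => F (x, t)) 2 volume < ⊤)
    {H : Spacetime → ℝ} {Hn : ℕ → Spacetime → ℝ} {R : ℝ}
    (hHR : ∀ z, R < ‖z‖ → H z = 0) (hHnR : ∀ n z, R < ‖z‖ → Hn n z = 0)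
    (hH : MemLp H 2 volume) (hHn : ∀ n, MemLp (Hn n) 2 volume)
    (hlim : Tendsto (fun n => eLpNorm (fun z => Hn n z - H z) 2 volume) atTop (𝓝 0))
    {S : ℝ≥0∞} (hSt : S ≠ ⊤) (hS : ∀ t, ∫⁻ x, ‖H (x, t)‖ₑ ^ 2 ≤ S)
    (hSn : ∀ n t, ∫⁻ x, ‖Hn n (x, t)‖ₑ ^ 2 ≤ S) :
    Tendsto (fun n => ∫ z, mollify n F z * Hn n z) atTop (𝓝 (∫ z, F z * H z)) := by
  have hFm := hF.aestronglyMeasurable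
  set B : Set Spacetime := closedBall 0 (R + 1) with hB
  have hBm : MeasurableSet B := measurableSet_closedBall
  have hBc : IsCompact B := isCompact_closedBall _ _
  set F' := B.indicator F with hF'
  have hF'm : AEStronglyMeasurable F' volume := hFm.indicator hBm
  have hF'i := (integrable_indicator_iff hBm).2 (hF.integrableOn_isCompact hBc)
  have hF'12 : ∫⁻ t, eLpNorm (fun x => F' (x, t)) 2 volume < ⊤ := by
    refine lt_of_le_of_lt ?_ (hF12 (R + 1))
    rw [← lintegral_indicator measurableSet_Icc]
    refine lintegral_mono fun t => ?_
    by_cases ht : t ∈ Icc (-(R + 1)) (R + 1)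
    · rw [indicator_of_mem ht]
      exact eLpNorm_mono fun x => norm_indicator_le_norm_self _ _
    · rw [indicator_of_notMem ht]
      have : (fun x => F' (x, t)) = fun _ => 0 := by
        ext x
        apply indicator_of_notMem
        intro hx
        exact ht (abs_le.1 (closedBall_spacetime_subset _ hx))
      rw [this]; simp
  have hred : ∀ n, ∫ z, mollify n F z * Hn n z = ∫ z, mollify n F' z * Hn n z := by
    intro n
    congr 1
    ext z
    by_cases hz : R < ‖z‖
    · rw [hHnR n z hz, mul_zero, mul_zero]
    · rw [mollify_congr_of_eqOn]
      intro y hy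
      rw [hF', indicator_of_mem]
      rw [hB, mem_closedBall_zero_iff]
      rw [dist_eq_norm] at hy
      calc ‖y‖ = ‖(y - z) + z‖ := by rw [sub_add_cancel]
        _ ≤ ‖y - z‖ + ‖z‖ := norm_add_le _ _
        _ ≤ R + 1 := by linarith [not_lt.1 hz]
  have hred' : ∫ z, F z * H z = ∫ z, F' z * H z := by
    congr 1
    ext z
    by_cases hz : R < ‖z‖
    · rw [hHR z hz, mul_zero, mul_zero]
    · rw [hF', indicator_of_mem]
      rw [hB, mem_closedBall_zero_iff]
      linarith [not_lt.1 hz]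
  simp_rw [hred, hred']
  -- truncation
  set Sk : ℕ → Set Spacetime := fun k => {z | ‖(hF'm.mk F') z‖ ≤ k} with hSk
  have hSkm : ∀ k, MeasurableSet (Sk k) := fun k =>
    measurableSet_le hF'm.stronglyMeasurable_mk.norm.measurable measurable_const
  set F1 := fun k => (Sk k).indicator F' with hF1
  set F2 := fun k => (Sk k)ᶜ.indicator F' with hF2
  have hF1m := fun k => hF'm.indicator (hSkm k)
  have hF2m := fun k => hF'm.indicator (hSkm k).compl
  have hF1i := fun k => hF'i.indicator (hSkm k)
  have hF2i := fun k => hF'i.indicator (hSkm k).compl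
  have hsum := fun k z => (indicator_self_add_compl_apply (Sk k) F' z).symm
  -- The bounded part `F1 k` lies in `L²`, where mollification converges strongly. The part `F2 k`
  -- of large values tends to zero in `L¹ₜL²ₓ` as `k → ∞`, and by the bilinear bound its
  -- contribution is small uniformly in `n`.
  have hF1L : ∀ k, MemLp (F1 k) 2 volume := by
    intro k
    have hbd : MemLp (B.indicator fun _ => (k : ℝ)) 2 (volume : Measure Spacetime) :=
      memLp_indicator_const 2 hBm (k : ℝ) (Or.inr hBc.measure_lt_top.ne)
    refine hbd.mono (hF1m k) ?_
    filter_upwards [hF'm.ae_eq_mk] with z hz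
    by_cases h1 : z ∈ Sk k
    · rw [hF1]
      simp only
      rw [indicator_of_mem h1]
      by_cases h2 : z ∈ B
      · rw [indicator_of_mem h2, hz, Real.norm_of_nonneg (Nat.cast_nonneg k)]
        exact h1
      · rw [hF', indicator_of_notMem h2, indicator_of_notMem h2]
    · rw [hF1]
      simp only
      rw [indicator_of_notMem h1, norm_zero]
      exact norm_nonneg _
  have ha : Tendsto (fun k => ∫⁻ t, eLpNorm (fun x => F2 k (x, t)) 2 volume) atTop (𝓝 0) := by
    have hmF' := aemeasurable_eLpNorm_section hF'm (q := 2) (by norm_num) (by norm_num)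
    have := tendsto_lintegral_of_dominated_convergence'
      (F := fun k t => eLpNorm (fun x => F2 k (x, t)) 2 volume) (f := fun _ => 0)
      (fun t => eLpNorm (fun x => F' (x, t)) 2 volume)
      (fun k => aemeasurable_eLpNorm_section (hF2m k) (by norm_num) (by norm_num))
      (fun k => .of_forall fun t => eLpNorm_mono fun x => norm_indicator_le_norm_self _ _)
      hF'12.ne ?_
    · simpa using this
    · filter_upwards [ae_lt_top' hmF' hF'12.ne, aestronglyMeasurable_section hF'm,
        ae_all_iff.2 fun k => aestronglyMeasurable_section (hF2m k)] with t ht hmt hkt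
      refine tendsto_eLpNorm_zero_of_dominated (f := fun x => F' (x, t)) (by norm_num)
        (by norm_num) hkt ⟨hmt, ht⟩
        (fun k => .of_forall fun x => norm_indicator_le_norm_self _ _)
        (.of_forall fun x => ?_)
      obtain ⟨N, hN⟩ := exists_nat_ge ‖(hF'm.mk F') (x, t)‖
      refine tendsto_const_nhds.congr' ?_
      filter_upwards [eventually_ge_atTop N] with k hk
      rw [hF2]
      simp only
      rw [indicator_of_notMem]
      have hNk : (N : ℝ) ≤ k := by exact_mod_cast hk
      simpa [hSk] using hN.trans hNk
  have ha2 : Tendsto (fun k => (∫⁻ t, eLpNorm (fun x => F2 k (x, t)) 2 volume)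
      * S ^ (1 / 2 : ℝ)) atTop (𝓝 0) := by
    have := Tendsto.mul_const ha (b := S ^ (1 / 2))
      (Or.inr (rpow_lt_top_of_nonneg (by norm_num) hSt).ne)
    rwa [zero_mul] at this
  rw [EMetric.tendsto_atTop]
  intro ε hε
  have hε3 : 0 < ε / 3 := ENNReal.div_pos hε.ne' (by norm_num)
  obtain ⟨k, hk⟩ := (ha2.eventually (gt_mem_nhds (lt_min hε3 zero_lt_top))).exists
  have hk1 := hk.trans_le (min_le_left _ _)
  have hk2 := hk.trans_le (min_le_right _ _)
  have hmain := tendsto_integral_mul_of_L2 (hF1L k) hH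
    (fun n => ⟨aestronglyMeasurable_mollify (hF1m k) n,
      (eLpNorm_mollify_le (hF1m k) n).trans_lt (hF1L k).2⟩) hHn
    (tendsto_eLpNorm_mollify_sub (hF1L k)) hlim
  obtain ⟨N, hN⟩ := EMetric.tendsto_atTop.1 hmain (ε / 3) hε3
  refine ⟨N, fun n hn => ?_⟩
  have hb1 := lintegral_mollify_mul_le (hF2m k) (hHn n).1 (hSn n) n
  have hb2 := lintegral_mul_le_mixed (hF2m k) hH.1 hS
  have i1 : Integrable fun z => mollify n (F1 k) z * Hn n z :=
    integrable_mul_of_memLp_two ⟨aestronglyMeasurable_mollify (hF1m k) n,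
      (eLpNorm_mollify_le (hF1m k) n).trans_lt (hF1L k).2⟩ (hHn n)
  have i2 : Integrable fun z => mollify n (F2 k) z * Hn n z :=
    integrable_mul_of_lintegral_lt_top (aestronglyMeasurable_mollify (hF2m k) n) (hHn n).1
      (hb1.trans_lt hk2)
  have i3 := integrable_mul_of_memLp_two (hF1L k) hH
  have i4 : Integrable fun z => F2 k z * H z :=
    integrable_mul_of_lintegral_lt_top (hF2m k) hH.1 (hb2.trans_lt hk2)
  have e1 : ∫ z, mollify n F' z * Hn n z =
      (∫ z, mollify n (F1 k) z * Hn n z) + ∫ z, mollify n (F2 k) z * Hn n z := by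
    rw [← integral_add i1 i2]
    congr 1
    ext z
    rw [← add_mul, ← mollify_add (hF1i k).locallyIntegrable (hF2i k).locallyIntegrable]
    congr 2
    ext y
    exact hsum k y
  have e2 : ∫ z, F' z * H z = (∫ z, F1 k z * H z) + ∫ z, F2 k z * H z := by
    rw [← integral_add i3 i4]
    congr 1
    ext z
    rw [← add_mul, ← hsum k z]
  rw [e1, e2, edist_eq_enorm_sub]
  have e3 : ∀ a b c d : ℝ, a + b - (c + d) = (a - c) + b + -d := fun a b c d => by ring
  rw [e3]
  have hNn := hN n hn
  calc _ ≤ ‖(∫ z, mollify n (F1 k) z * Hn n z) - ∫ z, F1 k z * H z‖ₑ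
        + ‖∫ z, mollify n (F2 k) z * Hn n z‖ₑ + ‖-∫ z, F2 k z * H z‖ₑ :=
        (enorm_add_le _ _).trans (add_le_add_left (enorm_add_le _ _) _)
    _ < ε / 3 + ε / 3 + ε / 3 := by
        rw [enorm_neg]
        refine ENNReal.add_lt_add (ENNReal.add_lt_add hNn ?_) ?_
        · exact (enorm_integral_mul_le.trans hb1).trans_lt hk1
        · exact (enorm_integral_mul_le.trans hb2).trans_lt hk1
    _ = ε := add_thirds ε

end MixedNorm

/-! ### Slice bounds uniform in time -/

section SliceBounds

/-- `f` is bounded in time with values in `L²` of balls, locally uniformly. -/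
structure LocallySliceL2 {V : Type*} [NormedAddCommGroup V] (f : Spacetime → V) : Prop where
  aesm : AEStronglyMeasurable f volume
  bound : ∀ R : ℝ, ∃ C : ℝ≥0∞, C ≠ ⊤ ∧ ∀ t ∈ Set.Icc (-R) R,
    ∫⁻ x in Metric.closedBall (0 : E3) R, ‖f (x, t)‖ₑ ^ 2 ≤ C

variable {V : Type*} [NormedAddCommGroup V]

lemma mem_closedBall_spacetime {z : Spacetime} {R : ℝ} :
    z ∈ closedBall 0 R ↔ ‖z.1‖ ≤ R ∧ |z.2| ≤ R := by
  rw [mem_closedBall_zero_iff, Prod.norm_def, max_le_iff, Real.norm_eq_abs]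

lemma LocallySliceL2.memLp {f : Spacetime → V} (hf : LocallySliceL2 f) (R : ℝ) :
    MemLp f 2 (volume.restrict (closedBall 0 R)) := by
  obtain ⟨C, hC, hb⟩ := hf.bound R
  have hBm : MeasurableSet (closedBall (0 : Spacetime) R) := measurableSet_closedBall
  rw [← memLp_indicator_iff_restrict hBm]
  have hslab := memLp_two_slab (hf.aesm.indicator hBm) (C := C ^ (1 / 2))
    (rpow_lt_top_of_nonneg (by norm_num) hC).ne fun t ht => by
      rw [eLpNorm_two_eq]
      refine rpow_le_rpow ?_ (by norm_num)
      refine le_trans ?_ (hb t ht)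
      rw [← lintegral_indicator measurableSet_closedBall]
      refine lintegral_mono fun x => ?_
      by_cases hx : (x, t) ∈ closedBall 0 R
      · rw [indicator_of_mem hx, indicator_of_mem]
        simpa using (mem_closedBall_spacetime.1 hx).1
      · simp_all
  rw [memLp_indicator_iff_restrict hBm, Measure.restrict_restrict hBm,
    inter_eq_left.2 (closedBall_spacetime_subset R),
    ← memLp_indicator_iff_restrict hBm] at hslab
  exact hslab

variable [NormedSpace ℝ V]

lemma LocallySliceL2.locallyIntegrable {f : Spacetime → V} (hf : LocallySliceL2 f) :
    LocallyIntegrable f volume :=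
  locallyIntegrable_of_memLp_closedBall (by norm_num) hf.memLp

/-- A slice of the mollification is an average of translated slices at times within distance `1`.
Jensen's inequality keeps the bound that holds for the radius `R + 1`. -/
lemma LocallySliceL2.mollify_bound {f : Spacetime → V} (hf : LocallySliceL2 f) (R : ℝ) :
    ∃ C, C ≠ ⊤ ∧ ∀ n, ∀ t ∈ Icc (-R) R, ∫⁻ x in closedBall 0 R, ‖mollify n f (x, t)‖ₑ ^ 2 ≤ C := by
  obtain ⟨C, hC, hb⟩ := hf.bound (R + 1)
  refine ⟨C, hC, fun n t ht => ?_⟩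
  set B := closedBall (0 : Spacetime) (R + 1) with hB
  have hBm : MeasurableSet B := measurableSet_closedBall
  set g := B.indicator f with hg
  have hgm := hf.aesm.indicator hBm
  have hgb : ∀ s, ∫⁻ x, ‖g (x, s)‖ₑ ^ 2 ≤ C := by
    intro s
    by_cases hs : s ∈ Icc (-(R + 1)) (R + 1)
    · refine le_trans ?_ (hb s hs)
      rw [← lintegral_indicator measurableSet_closedBall]
      refine lintegral_mono fun x => ?_
      by_cases hx : (x, s) ∈ B
      · rw [hg, indicator_of_mem hx, indicator_of_mem]
        simpa using (mem_closedBall_spacetime.1 hx).1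
      · simp_all
    · have : ∀ x, g (x, s) = 0 := fun x => by
        apply indicator_of_notMem
        intro hx
        exact hs (abs_le.1 (mem_closedBall_spacetime.1 hx).2)
      simp [this]
  have hcongr : ∀ x ∈ closedBall 0 R, mollify n f (x, t) = mollify n g (x, t) := by
    intro x hx
    refine mollify_congr_of_eqOn fun y hy => ?_
    rw [hg, indicator_of_mem]
    rw [hB, mem_closedBall_zero_iff]
    have hxt : ‖((x, t) : Spacetime)‖ ≤ R := by
      rw [← mem_closedBall_zero_iff, mem_closedBall_spacetime]
      exact ⟨by simpa using hx, abs_le.2 ht⟩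
    rw [dist_eq_norm] at hy
    calc ‖y‖ = ‖(y - (x, t)) + (x, t)‖ := by rw [sub_add_cancel]
      _ ≤ ‖y - (x, t)‖ + ‖((x, t) : Spacetime)‖ := norm_add_le _ _
      _ ≤ R + 1 := by linarith
  have hρ := measurable_ofReal_mollifier (G := Spacetime) n
  calc ∫⁻ x in closedBall 0 R, ‖mollify n f (x, t)‖ₑ ^ 2
      = ∫⁻ x in closedBall 0 R, ‖mollify n g (x, t)‖ₑ ^ 2 :=
        setLIntegral_congr_fun measurableSet_closedBall fun x hx => by rw [hcongr x hx]
    _ ≤ ∫⁻ x, ‖mollify n g (x, t)‖ₑ ^ 2 := setLIntegral_le_lintegral _ _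
    _ ≤ ∫⁻ x, ∫⁻ y, ENNReal.ofReal (mollifier Spacetime n y) * ‖g ((x, t) - y)‖ₑ ^ 2 :=
        lintegral_mono fun x => enorm_mollify_sq_le hgm n (x, t)
    _ = ∫⁻ y, ∫⁻ x, ENNReal.ofReal (mollifier Spacetime n y) * ‖g ((x, t) - y)‖ₑ ^ 2 := by
        refine lintegral_lintegral_swap ?_
        refine AEMeasurable.mul (hρ.comp measurable_snd).aemeasurable (AEMeasurable.pow_const ?_ 2)
        -- The function `g` is measurable only up to a null set. For fixed `x` the map `y ↦ (x, t) -
        -- y` preserves null sets, hence so does the map of both variables, and composition is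
        -- legitimate.
        have hq : Measure.QuasiMeasurePreserving
            (fun w : E3 × Spacetime => ((w.1, t) - w.2 : Spacetime))
            (volume.prod volume) volume := by
          refine ⟨by fun_prop, ?_⟩
          refine Measure.AbsolutelyContinuous.mk fun s hs h0 => ?_
          rw [Measure.map_apply (by fun_prop) hs, Measure.prod_apply
            ((by fun_prop : Measurable fun w : E3 × Spacetime => ((w.1, t) - w.2 : Spacetime)) hs)]
          rw [lintegral_eq_zero_iff' (Measurable.aemeasurable (measurable_measure_prodMk_left
            ((by fun_prop : Measurable fun w : E3 × Spacetime =>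
              ((w.1, t) - w.2 : Spacetime)) hs)))]
          refine .of_forall fun x => ?_
          exact (quasiMeasurePreserving_sub_left (volume : Measure Spacetime) (x, t)).preimage_null
            h0
        exact (hgm.comp_quasiMeasurePreserving hq).enorm
    _ ≤ ∫⁻ y, ENNReal.ofReal (mollifier Spacetime n y) * C := by
        refine lintegral_mono fun y => ?_
        rw [lintegral_const_mul' _ _ ofReal_ne_top]
        gcongr
        have e : ∫⁻ x, ‖g ((x, t) - y)‖ₑ ^ 2 = ∫⁻ x, ‖g (x, t - y.2)‖ₑ ^ 2 :=
          lintegral_sub_right_eq_self (fun x => ‖g (x, t - y.2)‖ₑ ^ 2) y.1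
        rw [e]
        exact hgb _
    _ = C := by rw [lintegral_mul_const _ hρ, lintegral_mollifier, one_mul]

end SliceBounds

/-! ### The nonlinearity and the mollified equation -/

section Nonlinearity

/-- The nonlinearity `|u|^(p-1) u`. -/
def nonlin (p : ℝ) (u : Spacetime → ℝ) (z : Spacetime) : ℝ := |u z| ^ (p - 1) * u z

lemma abs_nonlin {p : ℝ} (hp : 3 ≤ p) (u : Spacetime → ℝ) (z : Spacetime) :
    |nonlin p u z| = |u z| ^ p := by
  unfold nonlin
  rw [abs_mul, abs_of_nonneg (by positivity)]
  nth_rw 2 [← Real.rpow_one |u z|]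
  rw [← Real.rpow_add_of_nonneg (abs_nonneg _) (by linarith) (by norm_num), sub_add_cancel]

namespace IsFiniteEnergySolution

variable {p : ℝ} {u : Spacetime → ℝ} {Du : Spacetime → E3} {ut : Spacetime → ℝ}
  (h : IsFiniteEnergySolution p u Du ut)
include h

lemma aesm_nonlin : AEStronglyMeasurable (nonlin p u) volume :=
  ((h.aesm_u.aemeasurable.abs.pow_const (p - 1)).mul h.aesm_u.aemeasurable).aestronglyMeasurable

/-- The `L²` norm of `|u|^p` is the `p`-th power of the `L^(2p)` norm of `u`, and the given time
exponent `2p/(p-3)` is at least `p` because `p ≤ 5`. This is where the assumed space-time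
integrability of `u` enters. -/
lemma nonlin_mixed (hp3 : 3 ≤ p) (hp5 : p ≤ 5) (T : ℝ) :
    ∫⁻ t in Icc (-T) T, eLpNorm (fun x => nonlin p u (x, t)) 2 volume < ⊤ := by
  have hp0 : 0 < p := by linarith
  set a := fun t => eLpNorm (fun x => u (x, t)) (ENNReal.ofReal (2 * p)) volume with ha
  have h2p : ENNReal.ofReal (2 * p) ≠ 0 := by rw [Ne, ofReal_eq_zero]; linarith
  have ham := aemeasurable_eLpNorm_section h.aesm_u h2p ofReal_ne_top
  have e : ∀ t, eLpNorm (fun x => nonlin p u (x, t)) 2 volume = a t ^ p := by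
    intro t
    have : eLpNorm (fun x => nonlin p u (x, t)) 2 volume =
        eLpNorm (fun x => ‖u (x, t)‖ ^ p) 2 volume := by
      refine eLpNorm_congr_norm_ae (.of_forall fun x => ?_)
      rw [Real.norm_eq_abs, abs_nonlin hp3, Real.norm_eq_abs, Real.norm_eq_abs,
        abs_of_nonneg (Real.rpow_nonneg (abs_nonneg _) _)]
    rw [this, eLpNorm_norm_rpow _ hp0, ha]
    norm_num
  simp_rw [e]
  have hle : ENNReal.ofReal p ≤ ENNReal.ofReal (2 * p) / ENNReal.ofReal (p - 3) := by
    -- For `p = 3` the exponent is a nonzero number divided by zero, which is `⊤` in `ℝ≥0∞`, as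
    -- intended.
    rcases eq_or_lt_of_le hp3 with h3 | h3
    · have : ENNReal.ofReal (p - 3) = 0 := by rw [← h3]; simp
      rw [this, div_zero h2p]
      exact le_top
    · rw [← ofReal_div_of_pos (by linarith)]
      apply ofReal_le_ofReal
      rw [le_div_iff₀ (by linarith)]
      nlinarith
  have hfin : eLpNorm a (ENNReal.ofReal p) (volume.restrict (Icc (-T) T)) < ⊤ := by
    refine lt_of_le_of_lt (eLpNorm_le_eLpNorm_mul_rpow_measure_univ hle
      ham.aestronglyMeasurable.restrict) ?_
    refine mul_lt_top (h.strichartz (-T) T) ?_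
    refine rpow_lt_top_of_nonneg ?_ (by simp)
    rw [toReal_ofReal hp0.le, toReal_div, toReal_ofReal (by linarith), toReal_ofReal (by linarith)]
    rw [sub_nonneg, one_div, one_div, inv_div, div_le_iff₀ (by linarith)]
    have : p⁻¹ * (2 * p) = 2 := by field_simp
    linarith
  have := lintegral_rpow_enorm_lt_top_of_eLpNorm_lt_top (by rw [Ne, ofReal_eq_zero]; linarith)
    ofReal_ne_top hfin
  rw [toReal_ofReal hp0.le] at this
  simpa using this

lemma locallyIntegrable_nonlin (hp3 : 3 ≤ p) (hp5 : p ≤ 5) :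
    LocallyIntegrable (nonlin p u) volume := by
  refine locallyIntegrable_of_memLp_closedBall le_rfl fun R => ?_
  rw [memLp_one_iff_integrable]
  refine ⟨h.aesm_nonlin.restrict, ?_⟩
  rw [hasFiniteIntegral_iff_enorm]
  set B := closedBall (0 : Spacetime) R
  have hBm : MeasurableSet B := measurableSet_closedBall
  have hBm3 : MeasurableSet (closedBall (0 : E3) R) := measurableSet_closedBall
  set W := volume (closedBall (0 : E3) R) ^ (1 / 2 : ℝ) with hW
  have hWt : W ≠ ⊤ := (rpow_lt_top_of_nonneg (by norm_num)
    (isCompact_closedBall _ _).measure_lt_top.ne).ne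
  rw [← lintegral_indicator hBm, lintegral_spacetime (h.aesm_nonlin.enorm.indicator hBm)]
  calc ∫⁻ t, ∫⁻ x, B.indicator (fun z => ‖nonlin p u z‖ₑ) (x, t) ≤ ∫⁻ t, (Icc (-R) R).indicator
          (fun t => eLpNorm (fun x => nonlin p u (x, t)) 2 volume * W) t := by
        refine lintegral_mono_ae ?_
        filter_upwards [aestronglyMeasurable_section h.aesm_nonlin] with t ht
        by_cases htR : t ∈ Icc (-R) R
        · rw [indicator_of_mem htR]
          calc _ ≤ ∫⁻ x, ‖nonlin p u (x, t)‖ₑ * (closedBall 0 R).indicator (fun _ => 1) x := by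
                refine lintegral_mono fun x => ?_
                by_cases hx : (x, t) ∈ B
                · rw [indicator_of_mem hx, indicator_of_mem, mul_one]
                  simpa using (mem_closedBall_spacetime.1 hx).1
                · rw [indicator_of_notMem hx]; exact bot_le
            _ ≤ _ := by
                refine (lintegral_mul_le_sqrt ht.enorm (by fun_prop)).trans (le_of_eq ?_)
                rw [eLpNorm_two_eq]
                have : ∀ x, ((closedBall 0 R).indicator (fun _ => (1 : ℝ≥0∞)) x) ^ 2 =
                    (closedBall (0 : E3) R).indicator (fun _ => 1) x := by
                  intro x
                  by_cases hx : x ∈ closedBall 0 R <;> simp [hx]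
                simp_rw [this]
                rw [lintegral_indicator_const hBm3, one_mul]
        · rw [indicator_of_notMem htR]
          have : ∀ x, B.indicator (fun z => ‖nonlin p u z‖ₑ) (x, t) = 0 := fun x => by
            apply indicator_of_notMem
            intro hx
            exact htR (abs_le.1 (mem_closedBall_spacetime.1 hx).2)
          simp [this]
    _ = (∫⁻ t in Icc (-R) R, eLpNorm (fun x => nonlin p u (x, t)) 2 volume) * W := by
        rw [lintegral_indicator measurableSet_Icc, lintegral_mul_const' _ _ hWt]
    _ < ⊤ := mul_lt_top (h.nonlin_mixed hp3 hp5 R) hWt.lt_top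

lemma locallySliceL2_Du : LocallySliceL2 Du := by
  refine ⟨h.aesm_Du, fun R => ?_⟩
  obtain ⟨C, hC, hb⟩ := h.exists_bound_Du R
  refine ⟨C ^ 2, pow_ne_top hC, fun t ht => ?_⟩
  refine (setLIntegral_le_lintegral _ _).trans ?_
  have := hb t ht
  rw [eLpNorm_two_eq] at this
  calc ∫⁻ x, ‖Du (x, t)‖ₑ ^ 2 = ((∫⁻ x, ‖Du (x, t)‖ₑ ^ 2) ^ (1 / 2 : ℝ)) ^ 2 := by
        rw [← rpow_natCast, ← rpow_mul]; norm_num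
    _ ≤ _ := by gcongr

lemma locallySliceL2_ut : LocallySliceL2 ut := by
  refine ⟨h.aesm_ut, fun R => ?_⟩
  obtain ⟨C, hC, hb⟩ := h.exists_bound_ut R
  refine ⟨C ^ 2, pow_ne_top hC, fun t ht => ?_⟩
  refine (setLIntegral_le_lintegral _ _).trans ?_
  have := hb t ht
  rw [eLpNorm_two_eq] at this
  calc ∫⁻ x, ‖ut (x, t)‖ₑ ^ 2 = ((∫⁻ x, ‖ut (x, t)‖ₑ ^ 2) ^ (1 / 2 : ℝ)) ^ 2 := by
        rw [← rpow_natCast, ← rpow_mul]; norm_num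
    _ ≤ _ := by gcongr

lemma locallySliceL2_u : LocallySliceL2 u := by
  refine ⟨h.aesm_u, fun R => ?_⟩
  obtain ⟨C, hC, hb⟩ := h.exists_bound_u R
  set W := volume (closedBall (0 : E3) R) ^ (1 / (2 : ℝ≥0∞).toReal - 1 / (6 : ℝ≥0∞).toReal) with hW
  have hWt : W ≠ ⊤ := (rpow_lt_top_of_nonneg (by norm_num)
    (isCompact_closedBall _ _).measure_lt_top.ne).ne
  refine ⟨(C * W) ^ 2, pow_ne_top (mul_ne_top hC hWt), fun t ht => ?_⟩
  have h1 := (eLpNorm_restrict_ball_le (h.memLp_u t).1 (q := 2) (by norm_num) R).trans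
    (mul_le_mul_left (hb t ht) _)
  rw [eLpNorm_two_eq] at h1
  calc _ = ((∫⁻ x in closedBall 0 R, ‖u (x, t)‖ₑ ^ 2) ^ (1 / 2 : ℝ)) ^ 2 := by
        rw [← rpow_natCast, ← rpow_mul]; norm_num
    _ ≤ _ := by gcongr

/-! ### The mollified equation -/

lemma fderiv_mollify_u_space (n : ℕ) (z : Spacetime) (v : E3) :
    fderiv ℝ (mollify n u) z (v, 0) = inner ℝ (mollify n Du z) v := by
  rw [fderiv_mollify h.locallyIntegrable_u fun φ h1 h2 => h.spaceDerivative h1 h2 v,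
    mollify_inner h.locallyIntegrable_Du]

lemma fderiv_mollify_u_time (n : ℕ) (z : Spacetime) :
    fderiv ℝ (mollify n u) z (0, 1) = mollify n ut z :=
  fderiv_mollify h.locallyIntegrable_u h.timeDerivative n z

/-- The distributional equation tested with `y ↦ ρ (z - y)`: the mollified function is a smooth
solution whose source is the mollified nonlinearity. -/
lemma wave_mollify (n : ℕ) (z : Spacetime) : fderiv ℝ (mollify n ut) z (0, 1) -
      ∑ i, fderiv ℝ (fun y => (inner ℝ (mollify n Du y) (EuclideanSpace.single i 1) : ℝ)) z
        (EuclideanSpace.single i 1, 0) = -mollify n (nonlin p u) z := by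
  set φ := fun y => mollifier Spacetime n (z - y) with hφ
  have hφs := contDiff_mollifier_sub n z
  have hφc := hasCompactSupport_mollifier_sub n z
  have heq := h.equation φ hφs hφc
  have hDi : ∀ v, LocallyIntegrable (fun y => (inner ℝ (Du y) v : ℝ)) volume := by
    intro v x
    obtain ⟨s, hs, hi⟩ := h.locallyIntegrable_Du x
    exact ⟨s, hs, hi.inner_const v⟩
  have e1 := fderiv_mollify_eq h.locallyIntegrable_ut n z (0, 1)
  have e2 : ∀ i, fderiv ℝ (fun y => (inner ℝ (mollify n Du y) (EuclideanSpace.single i 1) : ℝ)) z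
        (EuclideanSpace.single i 1, 0) =
      -∫ y, inner ℝ (Du y) (EuclideanSpace.single i 1) *
        fderiv ℝ φ y (EuclideanSpace.single i 1, 0) := by
    intro i
    have : (fun y => (inner ℝ (mollify n Du y) (EuclideanSpace.single i 1) : ℝ)) =
        mollify n fun y => (inner ℝ (Du y) (EuclideanSpace.single i 1) : ℝ) := by
      ext y
      rw [mollify_inner h.locallyIntegrable_Du]
    rw [this, fderiv_mollify_eq (hDi _)]
  have hint : ∀ i, Integrable fun y => (inner ℝ (Du y) (EuclideanSpace.single i 1) : ℝ) *
        fderiv ℝ φ y (EuclideanSpace.single i 1, 0) := by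
    intro i
    have hcf : Continuous fun y => fderiv ℝ φ y (EuclideanSpace.single i 1, 0) :=
      (hφs.continuous_fderiv (by simp)).clm_apply continuous_const
    have := (hDi (EuclideanSpace.single i 1)).integrable_smul_left_of_hasCompactSupport hcf
      (hφc.fderiv_apply ℝ (EuclideanSpace.single i 1, 0))
    simpa [mul_comm] using this
  have e3 : ∀ y, fderiv ℝ φ y (Du y, 0) = ∑ i, (inner ℝ (Du y) (EuclideanSpace.single i 1) : ℝ) *
        fderiv ℝ φ y (EuclideanSpace.single i 1, 0) := by
    intro y
    have hd : ((Du y, 0) : Spacetime) = ∑ i,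
        (inner ℝ (Du y) (EuclideanSpace.single i 1) : ℝ) • ((EuclideanSpace.single i 1, 0) : Spacetime) := by
      refine Prod.ext ?_ ?_
      · rw [Prod.fst_sum]
        have := ((EuclideanSpace.basisFun (Fin 3) ℝ).sum_repr (Du y)).symm
        simpa [EuclideanSpace.inner_single_right] using this
      · simp [Prod.snd_sum]
    rw [hd, map_sum]
    simp only [map_smul, smul_eq_mul]
  have e4 : mollify n (nonlin p u) z = ∫ y, |u y| ^ (p - 1) * u y * φ y := by
    rw [mollify_apply_swap]
    simp [nonlin, hφ, mul_comm]
  simp_rw [e3] at heq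
  rw [integral_finsetSum _ fun i _ => hint i] at heq
  rw [e1, e4, ← heq]
  simp_rw [e2]
  rw [Finset.sum_neg_distrib]
  ring

end IsFiniteEnergySolution

end Nonlinearity

/-! ### Limits of integrals of products -/

section SliceConv

/-- Convergence of functions on space-time locally in `L²`, with a uniform bound in `L^∞ₜL²ₓ`. -/
structure SliceConv (Fn : ℕ → Spacetime → ℝ) (F : Spacetime → ℝ) : Prop where
  aesm : AEStronglyMeasurable F volume
  aesm_seq : ∀ n, AEStronglyMeasurable (Fn n) volume
  slice : ∀ t : ℝ, AEStronglyMeasurable (fun x : E3 => F (x, t)) volume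
  slice_seq : ∀ n, ∀ t : ℝ, AEStronglyMeasurable (fun x : E3 => Fn n (x, t)) volume
  bound : ∀ R : ℝ, ∃ C : ℝ≥0∞, C ≠ ⊤ ∧
    (∀ t ∈ Set.Icc (-R) R,
      eLpNorm (fun x : E3 => F (x, t)) 2 (volume.restrict (Metric.closedBall 0 R)) ≤ C) ∧
    ∀ n, ∀ t ∈ Set.Icc (-R) R,
      eLpNorm (fun x : E3 => Fn n (x, t)) 2 (volume.restrict (Metric.closedBall 0 R)) ≤ C
  lim : ∀ R : ℝ, Tendsto (fun n => eLpNorm (fun z => Fn n z - F z) 2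
    (volume.restrict (Metric.closedBall 0 R))) atTop (𝓝 0)

variable {Fn Hn : ℕ → Spacetime → ℝ} {F H : Spacetime → ℝ}

lemma SliceConv.mollify {f : Spacetime → ℝ} (hf : LocallySliceL2 f)
    (hs : ∀ t, AEStronglyMeasurable (fun x => f (x, t)) volume) :
    SliceConv (fun n => mollify n f) f where
  aesm := hf.aesm
  aesm_seq n := (contDiff_mollify hf.locallyIntegrable n).continuous.aestronglyMeasurable
  slice := hs
  slice_seq n t := ((contDiff_mollify hf.locallyIntegrable n).continuous.comp
    (by fun_prop)).aestronglyMeasurable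
  bound R := by
    obtain ⟨C, hC, hb⟩ := hf.bound R
    obtain ⟨C', hC', hb'⟩ := hf.mollify_bound R
    refine ⟨max C C' ^ (1 / 2), (rpow_lt_top_of_nonneg (by norm_num)
      (max_lt hC.lt_top hC'.lt_top).ne).ne, fun t ht => ?_, fun n t ht => ?_⟩
    · rw [eLpNorm_two_eq]
      exact rpow_le_rpow ((hb t ht).trans (le_max_left _ _)) (by norm_num)
    · rw [eLpNorm_two_eq]
      exact rpow_le_rpow ((hb' n t ht).trans (le_max_right _ _)) (by norm_num)
  lim := tendsto_eLpNorm_mollify_sub_local hf.memLp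

lemma SliceConv.add (hF : SliceConv Fn F) (hH : SliceConv Hn H) :
    SliceConv (fun n z => Fn n z + Hn n z) (fun z => F z + H z) where
  aesm := hF.aesm.add hH.aesm
  aesm_seq n := (hF.aesm_seq n).add (hH.aesm_seq n)
  slice t := (hF.slice t).add (hH.slice t)
  slice_seq n t := (hF.slice_seq n t).add (hH.slice_seq n t)
  bound R := by
    obtain ⟨C, hC, h1, h2⟩ := hF.bound R
    obtain ⟨C', hC', h1', h2'⟩ := hH.bound R
    refine ⟨C + C', add_ne_top.2 ⟨hC, hC'⟩, fun t ht => ?_, fun n t ht => ?_⟩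
    · exact (eLpNorm_add_le (hF.slice t).restrict (hH.slice t).restrict (by norm_num)).trans
        (add_le_add (h1 t ht) (h1' t ht))
    · exact (eLpNorm_add_le (hF.slice_seq n t).restrict (hH.slice_seq n t).restrict
        (by norm_num)).trans (add_le_add (h2 n t ht) (h2' n t ht))
  lim R := by
    have h0 := (hF.lim R).add (hH.lim R)
    rw [add_zero] at h0
    refine tendsto_zero_of_le h0 fun n => ?_
    have e : (fun z => Fn n z + Hn n z - (F z + H z)) =
        (fun z => Fn n z - F z) + fun z => Hn n z - H z := by
      ext z; simp only [Pi.add_apply]; ring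
    rw [e]
    exact eLpNorm_add_le ((hF.aesm_seq n).sub hF.aesm).restrict
      ((hH.aesm_seq n).sub hH.aesm).restrict (by norm_num)

lemma SliceConv.bdd_mul (hF : SliceConv Fn F) {c : Spacetime → ℝ} (hc : Measurable c) {M : ℝ}
    (hM : ∀ z, |c z| ≤ M) :
    SliceConv (fun n z => c z * Fn n z) (fun z => c z * F z) := by
  have key : ∀ {α : Type} [MeasurableSpace α] (μ : Measure α) (f d : α → ℝ)
      (_ : ∀ x, |d x| ≤ M), eLpNorm (fun x => d x * f x) 2 μ ≤
        ENNReal.ofReal M * eLpNorm f 2 μ := by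
    intro α _ μ f d hd
    refine eLpNorm_le_mul_eLpNorm_of_ae_le_mul (.of_forall fun x => ?_) 2
    rw [norm_mul]
    exact mul_le_mul_of_nonneg_right (hd x) (norm_nonneg _)
  have hcs : ∀ t, AEStronglyMeasurable (fun x => c (x, t)) volume := fun t =>
    (hc.comp (by fun_prop)).aestronglyMeasurable
  refine ⟨hc.aestronglyMeasurable.mul hF.aesm, fun n => hc.aestronglyMeasurable.mul (hF.aesm_seq n),
    fun t => (hcs t).mul (hF.slice t), fun n t => (hcs t).mul (hF.slice_seq n t), fun R => ?_,
    fun R => ?_⟩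
  · obtain ⟨C, hC, h1, h2⟩ := hF.bound R
    refine ⟨ENNReal.ofReal M * C, mul_ne_top ofReal_ne_top hC, fun t ht => ?_, fun n t ht => ?_⟩
    · exact (key _ _ (fun x => c (x, t)) fun x => hM _).trans (by gcongr; exact h1 t ht)
    · exact (key _ _ (fun x => c (x, t)) fun x => hM _).trans (by gcongr; exact h2 n t ht)
  · have h0 := Tendsto.const_mul (hF.lim R) (Or.inr (ofReal_ne_top (r := M)))
    rw [mul_zero] at h0
    refine tendsto_zero_of_le h0 fun n => ?_
    have e : (fun z => c z * Fn n z - c z * F z) = fun z => c z * (Fn n z - F z) := by ext z; ring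
    simp only [e]
    exact key _ _ c hM

lemma SliceConv.memLp (hF : SliceConv Fn F) (R : ℝ) :
    MemLp F 2 (volume.restrict (closedBall 0 R)) := by
  refine LocallySliceL2.memLp ⟨hF.aesm, fun R => ?_⟩ R
  obtain ⟨C, hC, h1, -⟩ := hF.bound R
  refine ⟨C ^ 2, pow_ne_top hC, fun t ht => ?_⟩
  have := h1 t ht
  rw [eLpNorm_two_eq] at this
  calc _ = ((∫⁻ x in closedBall 0 R, ‖F (x, t)‖ₑ ^ 2) ^ (1 / 2 : ℝ)) ^ 2 := by
        rw [← rpow_natCast, ← rpow_mul]; norm_num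
    _ ≤ _ := by gcongr

lemma SliceConv.memLp_seq (hF : SliceConv Fn F) (n : ℕ) (R : ℝ) :
    MemLp (Fn n) 2 (volume.restrict (closedBall 0 R)) := by
  refine LocallySliceL2.memLp ⟨hF.aesm_seq n, fun R => ?_⟩ R
  obtain ⟨C, hC, -, h1⟩ := hF.bound R
  refine ⟨C ^ 2, pow_ne_top hC, fun t ht => ?_⟩
  have := h1 n t ht
  rw [eLpNorm_two_eq] at this
  calc _ = ((∫⁻ x in closedBall 0 R, ‖Fn n (x, t)‖ₑ ^ 2) ^ (1 / 2 : ℝ)) ^ 2 := by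
        rw [← rpow_natCast, ← rpow_mul]; norm_num
    _ ≤ _ := by gcongr

structure IsBoundedWeight (w : Spacetime → ℝ) : Prop where
  measurable : Measurable w
  bounded : ∃ M : ℝ, ∀ z, |w z| ≤ M
  support : ∃ R : ℝ, ∀ z, R < ‖z‖ → w z = 0

lemma IsBoundedWeight.of_continuous {w : Spacetime → ℝ} (hw : Continuous w) {R : ℝ}
    (hR : ∀ z, R < ‖z‖ → w z = 0) : IsBoundedWeight w := by
  refine ⟨hw.measurable, ?_, R, hR⟩
  have hc : HasCompactSupport w := by
    refine .intro (isCompact_closedBall 0 R) fun z hz => hR z ?_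
    simpa using hz
  obtain ⟨M, hM⟩ := hw.bounded_above_of_compact_support hc
  exact ⟨M, hM⟩

variable {w : Spacetime → ℝ}

lemma IsBoundedWeight.integral_eq (hw : IsBoundedWeight w) : ∃ R, ∀ f : Spacetime → ℝ,
    ∫ z, w z * f z = ∫ z in closedBall 0 R, w z * f z := by
  obtain ⟨R, hR⟩ := hw.support
  refine ⟨R, fun f => (setIntegral_eq_integral_of_forall_compl_eq_zero fun z hz => ?_).symm⟩
  rw [hR z (by simpa using hz), zero_mul]

lemma SliceConv.tendsto_integral_mul (hF : SliceConv Fn F) (hH : SliceConv Hn H)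
    (hw : IsBoundedWeight w) :
    Tendsto (fun n => ∫ z, w z * (Fn n z * Hn n z)) atTop (𝓝 (∫ z, w z * (F z * H z))) := by
  obtain ⟨R, hR⟩ := hw.integral_eq
  obtain ⟨M, hM⟩ := hw.bounded
  have hF' := hF.bdd_mul hw.measurable hM
  simp_rw [hR, ← mul_assoc]
  exact tendsto_integral_mul_of_L2 (hF'.memLp R) (hH.memLp R) (fun n => hF'.memLp_seq n R)
    (fun n => hH.memLp_seq n R) (hF'.lim R) (hH.lim R)

lemma IsBoundedWeight.integrable_mul_of_memLp {f g : Spacetime → ℝ} (hw : IsBoundedWeight w)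
    (hf : ∀ R, MemLp f 2 (volume.restrict (closedBall 0 R)))
    (hg : ∀ R, MemLp g 2 (volume.restrict (closedBall 0 R))) :
    Integrable (fun z => w z * (f z * g z)) := by
  obtain ⟨R, hR⟩ := hw.support
  obtain ⟨M, hM⟩ := hw.bounded
  have h1 : IntegrableOn (fun z => w z * (f z * g z)) (closedBall 0 R) :=
    (integrable_mul_of_memLp_two (hf R) (hg R)).bdd_mul
      hw.measurable.aestronglyMeasurable (.of_forall hM)
  refine (integrableOn_iff_integrable_of_support_subset fun z hz => ?_).1 h1
  by_contra hz'
  exact hz (by simp [hR z (by simpa using hz')])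

lemma SliceConv.integrable_mul (hF : SliceConv Fn F) (hH : SliceConv Hn H)
    (hw : IsBoundedWeight w) : Integrable (fun z => w z * (F z * H z)) :=
  hw.integrable_mul_of_memLp hF.memLp hH.memLp

/-- A bounded weight of bounded support turns the local bounds and limits into the global hypotheses
of `InOutEnergy.tendsto_integral_mollify_mul`. -/
lemma SliceConv.weight_mul (hF : SliceConv Fn F) (hw : IsBoundedWeight w) :
    ∃ R, ∃ S, S ≠ ⊤ ∧ (∀ z, R < ‖z‖ → w z * F z = 0) ∧
      (∀ n z, R < ‖z‖ → w z * Fn n z = 0) ∧ MemLp (fun z => w z * F z) 2 volume ∧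
      (∀ n, MemLp (fun z => w z * Fn n z) 2 volume) ∧
      Tendsto (fun n => eLpNorm (fun z => w z * Fn n z - w z * F z) 2 volume) atTop (𝓝 0) ∧
      (∀ t, ∫⁻ x, ‖w (x, t) * F (x, t)‖ₑ ^ 2 ≤ S) ∧
      ∀ n t, ∫⁻ x, ‖w (x, t) * Fn n (x, t)‖ₑ ^ 2 ≤ S := by
  obtain ⟨R, hR⟩ := hw.support
  obtain ⟨M, hM⟩ := hw.bounded
  have hF' := hF.bdd_mul hw.measurable hM
  obtain ⟨C, hC, h1, h2⟩ := hF'.bound R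
  have hBm : MeasurableSet (closedBall (0 : Spacetime) R) := measurableSet_closedBall
  have hglob : ∀ f : Spacetime → ℝ, (∀ z, R < ‖z‖ → f z = 0) →
      (closedBall 0 R).indicator f = f := by
    intro f hf
    refine indicator_eq_self.2 fun z hz => ?_
    by_contra hz'
    exact hz (hf z (by simpa using hz'))
  have hslice : ∀ f : Spacetime → ℝ, (∀ z, R < ‖z‖ → f z = 0) →
      (∀ t ∈ Icc (-R) R, eLpNorm (fun x => f (x, t)) 2
        (volume.restrict (closedBall 0 R)) ≤ C) → ∀ t,
      ∫⁻ x, ‖f (x, t)‖ₑ ^ 2 ≤ C ^ 2 := by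
    intro f hf hb t
    by_cases ht : t ∈ Icc (-R) R
    · have := hb t ht
      rw [eLpNorm_two_eq] at this
      calc _ = ∫⁻ x in closedBall 0 R, ‖f (x, t)‖ₑ ^ 2 := by
            rw [← lintegral_indicator measurableSet_closedBall]
            refine lintegral_congr fun x => ?_
            by_cases hx : x ∈ closedBall 0 R
            · rw [indicator_of_mem hx]
            · rw [indicator_of_notMem hx, hf]
              · simp
              · rw [Prod.norm_def]
                exact lt_max_of_lt_left (by simpa using hx)
        _ = ((∫⁻ x in closedBall 0 R, ‖f (x, t)‖ₑ ^ 2) ^ (1 / 2 : ℝ)) ^ 2 := by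
            rw [← rpow_natCast, ← rpow_mul]; norm_num
        _ ≤ _ := by gcongr
    · have : ∀ x, f (x, t) = 0 := fun x => hf _ (by
        refine lt_max_of_lt_right ?_
        by_contra hc
        exact ht (abs_le.1 (not_lt.1 hc)))
      simp [this]
  have e1 : ∀ z, R < ‖z‖ → w z * F z = 0 := fun z hz => by rw [hR z hz, zero_mul]
  have e2 : ∀ n z, R < ‖z‖ → w z * Fn n z = 0 := fun n z hz => by rw [hR z hz, zero_mul]
  refine ⟨R, C ^ 2, pow_ne_top hC, e1, e2, ?_, fun n => ?_, ?_, ?_, fun n => ?_⟩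
  · rw [← hglob _ e1, memLp_indicator_iff_restrict hBm]
    exact hF'.memLp R
  · rw [← hglob _ (e2 n), memLp_indicator_iff_restrict hBm]
    exact hF'.memLp_seq n R
  · refine (hF'.lim R).congr fun n => ?_
    rw [← eLpNorm_indicator_eq_eLpNorm_restrict hBm, hglob]
    intro z hz
    rw [e1 z hz, e2 n z hz, sub_zero]
  · exact hslice _ e1 h1
  · exact hslice _ (e2 n) (h2 n)

lemma SliceConv.tendsto_integral_mollify_mul (hH : SliceConv Hn H) (hw : IsBoundedWeight w)
    {G : Spacetime → ℝ} (hG : LocallyIntegrable G volume)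
    (hG12 : ∀ T, ∫⁻ t in Icc (-T) T, eLpNorm (fun x => G (x, t)) 2 volume < ⊤) :
    Tendsto (fun n => ∫ z, w z * (InOutEnergy.mollify n G z * Hn n z)) atTop
      (𝓝 (∫ z, w z * (G z * H z))) := by
  obtain ⟨R, S, hS, h1, h2, h3, h4, h5, h6, h7⟩ := hH.weight_mul hw
  have := InOutEnergy.tendsto_integral_mollify_mul hG hG12 h1 h2 h3 h4 h5 hS h6 h7
  refine Tendsto.congr (fun n => ?_) (this.trans (le_of_eq ?_))
  · congr 1; ext z; ring
  · congr 2; ext z; ring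

lemma SliceConv.integrable_mixed_mul (hH : SliceConv Hn H) (hw : IsBoundedWeight w)
    {G : Spacetime → ℝ} (hG : AEStronglyMeasurable G volume)
    (hG12 : ∀ T, ∫⁻ t in Icc (-T) T, eLpNorm (fun x => G (x, t)) 2 volume < ⊤) :
    Integrable (fun z => w z * (G z * H z)) := by
  obtain ⟨R, S, hS, h1, -, h3, -, -, h6, -⟩ := hH.weight_mul hw
  -- `G` is integrable in time only locally, so it is cut off to the time interval that contains the
  -- support of the weight.
  set G' := {z : Spacetime | z.2 ∈ Icc (-R) R}.indicator G with hG'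
  have hms : MeasurableSet {z : Spacetime | z.2 ∈ Icc (-R) R} := measurable_snd measurableSet_Icc
  have hfin : ∫⁻ z, ‖G' z‖ₑ * ‖w z * H z‖ₑ < ⊤ := by
    refine (lintegral_mul_le_mixed (hG.indicator hms) h3.1 h6).trans_lt ?_
    refine mul_lt_top (lt_of_le_of_lt ?_ (hG12 R)) (rpow_lt_top_of_nonneg (by norm_num) hS)
    rw [← lintegral_indicator measurableSet_Icc]
    refine lintegral_mono fun t => ?_
    by_cases ht : t ∈ Icc (-R) R
    · rw [indicator_of_mem ht]
      refine le_of_eq (congrArg (fun f => eLpNorm f 2 volume) ?_)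
      ext x
      exact indicator_of_mem (s := {z : Spacetime | z.2 ∈ Icc (-R) R}) ht G
    · simp_all
  refine (integrable_mul_of_lintegral_lt_top (hG.indicator hms) h3.1 hfin).congr
    (.of_forall fun z => ?_)
  show G' z * (w z * H z) = _
  by_cases hz : z ∈ {z : Spacetime | z.2 ∈ Icc (-R) R}
  · rw [hG', indicator_of_mem hz]; ring
  · have hz0 : w z * H z = 0 := h1 z (by
      refine lt_max_of_lt_right ?_
      by_contra hc
      exact hz (abs_le.1 (not_lt.1 hc)))
    rw [hz0, mul_zero]
    show 0 = w z * (G z * H z)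
    rw [mul_left_comm, hz0, mul_zero]

end SliceConv

/-! ### The chain rule for the power nonlinearity -/

section ChainRule

lemma SliceConv.comp {Fn : ℕ → Spacetime → ℝ} {F : Spacetime → ℝ} (hF : SliceConv Fn F)
    {g : ℝ → ℝ} {L : ℝ} (hg : ∀ a b, |g a - g b| ≤ L * |a - b|) (h0 : g 0 = 0) :
    SliceConv (fun n z => g (Fn n z)) (fun z => g (F z)) := by
  have hgc : Continuous g := by
    have hL : LipschitzWith (Real.toNNReal L) g := by
      refine LipschitzWith.of_dist_le_mul fun a b => ?_
      exact (hg a b).trans (mul_le_mul_of_nonneg_right (Real.le_coe_toNNReal L) (abs_nonneg _))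
    exact hL.continuous
  have key : ∀ {α : Type} [MeasurableSpace α] (μ : Measure α) (f : α → ℝ),
      eLpNorm (fun x => g (f x)) 2 μ ≤ ENNReal.ofReal L * eLpNorm f 2 μ := by
    intro α _ μ f
    refine eLpNorm_le_mul_eLpNorm_of_ae_le_mul (.of_forall fun x => ?_) 2
    simpa [h0] using hg (f x) 0
  refine ⟨hgc.comp_aestronglyMeasurable hF.aesm, fun n =>
    hgc.comp_aestronglyMeasurable (hF.aesm_seq n), fun t =>
    hgc.comp_aestronglyMeasurable (hF.slice t), fun n t =>
    hgc.comp_aestronglyMeasurable (hF.slice_seq n t), fun R => ?_, fun R => ?_⟩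
  · obtain ⟨C, hC, h1, h2⟩ := hF.bound R
    refine ⟨ENNReal.ofReal L * C, mul_ne_top ofReal_ne_top hC, fun t ht => ?_, fun n t ht => ?_⟩
    · exact (key _ fun x => F (x, t)).trans (by gcongr; exact h1 t ht)
    · exact (key _ fun x => Fn n (x, t)).trans (by gcongr; exact h2 n t ht)
  · have h0 := Tendsto.const_mul (hF.lim R) (Or.inr (ofReal_ne_top (r := L)))
    rw [mul_zero] at h0
    refine tendsto_zero_of_le h0 fun n => ?_
    exact eLpNorm_le_mul_eLpNorm_of_ae_le_mul (.of_forall fun x => (hg _ _)) 2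

lemma SliceConv.const (c : ℝ) : SliceConv (fun _ _ => c) (fun _ => c) where
  aesm := aestronglyMeasurable_const
  aesm_seq _ := aestronglyMeasurable_const
  slice _ := aestronglyMeasurable_const
  slice_seq _ _ := aestronglyMeasurable_const
  bound R := by
    have : MemLp (fun _ : E3 => c) 2 (volume.restrict (closedBall 0 R)) := by
      have : IsFiniteMeasure (volume.restrict (closedBall (0 : E3) R)) :=
        ⟨by simpa using (isCompact_closedBall (0 : E3) R).measure_lt_top (μ := volume)⟩
      exact memLp_const c
    exact ⟨_, this.2.ne, fun _ _ => le_rfl, fun _ _ _ => le_rfl⟩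
  lim R := by simp

/-- Bounded Lipschitz truncations of the power nonlinearity, with primitives. -/
lemma exists_power_truncation {p : ℝ} (hp : 3 ≤ p) (k : ℕ) : ∃ g G : ℝ → ℝ,
    Continuous g ∧ (∃ L, ∀ a b, |g a - g b| ≤ L * |a - b|) ∧ (∃ M, ∀ s, |g s| ≤ M) ∧
    (∀ s, |g s| ≤ |s| ^ p) ∧ (∀ s, HasDerivAt G (g s) s) ∧ (∀ s, |G s| ≤ |s| ^ (p + 1)) ∧
    G 0 = 0 ∧ ∀ s : ℝ, |s| ≤ k → g s = |s| ^ (p - 1) * s ∧ G s = |s| ^ (p + 1) / (p + 1) := by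
  set f : ℝ → ℝ := fun s => |s| ^ (p - 1) * s with hf
  have habs : ∀ s, |f s| = |s| ^ p := by
    intro s
    exact abs_nonlin hp (fun _ => s) 0
  set d := fun s => (p - 1) * |s| ^ (p - 1 - 2) * s * s + |s| ^ (p - 1) * 1 with hd
  have hfd := fun s => (hasDerivAt_abs_rpow s (by linarith : 1 < p - 1)).mul (hasDerivAt_id s)
  have hdc : Continuous d := by
    have h1 : Continuous fun s => |s| ^ (p - 1 - 2) :=
      continuous_abs.rpow_const fun _ => Or.inr (by linarith)
    have h2 : Continuous fun s => |s| ^ (p - 1) :=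
      continuous_abs.rpow_const fun _ => Or.inr (by linarith)
    fun_prop
  have hfc : Continuous f := continuous_iff_continuousAt.2 fun s => (hfd s).continuousAt
  -- Composition with the projection onto `[-k, k]` leaves `f` unchanged for `|s| ≤ k`, bounds it by
  -- `k^p`, and makes it Lipschitz, since `f` is `C¹` on the compact interval.
  set c : ℝ → ℝ := fun s => max (-(k)) (min k s) with hc
  have hcc : Continuous c := by fun_prop
  have hcmem : ∀ s, c s ∈ Icc (-(k : ℝ)) k := fun s =>
    ⟨le_max_left _ _, max_le (by linarith) (min_le_left _ _)⟩
  have hclip : ∀ a b, |c a - c b| ≤ |a - b| := by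
    intro a b
    calc |c a - c b| ≤ max |(-(k)) - (-(k : ℝ))| |min (k : ℝ) a - min (k : ℝ) b| :=
          abs_max_sub_max_le_max _ _ _ _
      _ ≤ max 0 (max |(k : ℝ) - k| |a - b|) := by
          refine max_le_max (by simp) (abs_min_sub_min_le_max _ _ _ _)
      _ = |a - b| := by simp
  have hceq : ∀ s : ℝ, |s| ≤ k → c s = s := by
    intro s hs
    rw [abs_le] at hs
    simp only [hc]
    rw [min_eq_right hs.2, max_eq_right hs.1]
  have hcabs : ∀ s, |c s| ≤ |s| := by
    intro s
    have := hclip s 0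
    rwa [hceq 0 (by simp), sub_zero, sub_zero] at this
  have hgc := hfc.comp hcc
  have hgle : ∀ s, |f (c s)| ≤ |s| ^ p := fun s => by
    rw [habs]
    exact Real.rpow_le_rpow (abs_nonneg _) (hcabs s) (by linarith)
  refine ⟨fun s => f (c s), fun s => ∫ x in 0..s, f (c x), hgc, ?_, ?_, hgle, ?_, ?_, by simp, ?_⟩
  · obtain ⟨L, hL⟩ := (isCompact_Icc (a := -(k : ℝ))).exists_bound_of_continuousOn hdc.continuousOn
    refine ⟨L, fun a b => ?_⟩
    have h1 := (convex_Icc (-(k : ℝ)) k).norm_image_sub_le_of_norm_hasDerivWithin_le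
      (fun x _ => (hfd x).hasDerivWithinAt) hL (hcmem b) (hcmem a)
    exact h1.trans (mul_le_mul_of_nonneg_left (hclip a b) ((norm_nonneg _).trans (hL _ (hcmem a))))
  · refine ⟨(k) ^ p, fun s => ?_⟩
    rw [habs]
    exact Real.rpow_le_rpow (abs_nonneg _) (abs_le.2 (hcmem s)) (by linarith)
  · exact fun s => intervalIntegral.integral_hasDerivAt_right (hgc.intervalIntegrable _ _)
      hgc.stronglyMeasurable.stronglyMeasurableAtFilter hgc.continuousAt
  · intro s
    have := intervalIntegral.norm_integral_le_of_norm_le_const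
      (f := fun x => f (c x)) (C := |s| ^ p) fun x hx => by
        refine (hgle x).trans (Real.rpow_le_rpow (abs_nonneg _) ?_ (by linarith))
        rcases le_total 0 s with h | h
        · rw [uIoc_of_le h] at hx
          rw [abs_of_pos hx.1, abs_of_nonneg h]; exact hx.2
        · rw [uIoc_of_ge h] at hx
          rw [abs_of_nonpos hx.2, abs_of_nonpos h]; linarith [hx.1]
    rw [sub_zero, Real.norm_eq_abs] at this
    refine this.trans (le_of_eq ?_)
    rw [Real.rpow_add_of_nonneg (abs_nonneg _) (by linarith) (by norm_num), Real.rpow_one]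
  · intro s hs
    refine ⟨by simp only [hceq s hs, hf], ?_⟩
    have e : ∫ x in 0..s, f (c x) = ∫ x in 0..s, f x := by
      refine intervalIntegral.integral_congr fun x hx => ?_
      rw [hceq]
      refine le_trans ?_ hs
      rcases le_total 0 s with h | h
      · rw [uIcc_of_le h] at hx
        rw [abs_of_nonneg hx.1, abs_of_nonneg h]; exact hx.2
      · rw [uIcc_of_ge h] at hx
        rw [abs_of_nonpos hx.2, abs_of_nonpos h]; linarith [hx.1]
    show ∫ x in 0..s, f (c x) = _
    rw [e, intervalIntegral.integral_eq_sub_of_hasDerivAt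
      (f := fun x => |x| ^ (p + 1) / (p + 1)) _ (hfc.intervalIntegrable _ _)]
    · simp [Real.zero_rpow (by linarith : p + 1 ≠ 0)]
    · intro x _
      have := (hasDerivAt_abs_rpow x (by linarith : 1 < p + 1)).div_const (p + 1)
      refine this.congr_deriv ?_
      rw [hf, show p + 1 - 2 = p - 1 by ring]
      field_simp

namespace IsFiniteEnergySolution

variable {p : ℝ} {u : Spacetime → ℝ} {Du : Spacetime → E3} {ut : Spacetime → ℝ}
  (h : IsFiniteEnergySolution p u Du ut)
include h

lemma sliceConv_u : SliceConv (fun n => mollify n u) u :=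
  SliceConv.mollify h.locallySliceL2_u fun t => (h.memLp_u t).1

lemma sliceConv_ut : SliceConv (fun n => mollify n ut) ut :=
  SliceConv.mollify h.locallySliceL2_ut fun t => (h.memLp_ut t).1

lemma locallySliceL2_Du_apply (i : Fin 3) : LocallySliceL2 fun z => Du z i := by
  have hm := h.locallySliceL2_Du
  refine ⟨?_, fun R => ?_⟩
  · exact ((EuclideanSpace.proj i).continuous.comp_aestronglyMeasurable hm.aesm)
  · obtain ⟨C, hC, hb⟩ := hm.bound R
    refine ⟨C, hC, fun t ht => le_trans (lintegral_mono fun x => ?_) (hb t ht)⟩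
    gcongr
    exact enorm_le_iff_norm_le.2 (PiLp.norm_apply_le (Du (x, t)) i)

lemma sliceConv_Du (i : Fin 3) : SliceConv (fun n => mollify n fun z => Du z i) fun z => Du z i :=
  SliceConv.mollify (h.locallySliceL2_Du_apply i) fun t =>
    (EuclideanSpace.proj i).continuous.comp_aestronglyMeasurable (h.memLp_Du t).1

omit h in
lemma nonlin_mul_self (hp : 0 ≤ p) (z : Spacetime) : nonlin p u z * u z = |u z| ^ (p + 1) := by
  rw [nonlin, mul_assoc, ← abs_mul_abs_self (u z), ← mul_assoc]
  rcases eq_or_ne (u z) 0 with h0 | h0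
  · simp [h0, Real.zero_rpow (by linarith : p + 1 ≠ 0)]
  have := abs_pos.2 h0
  rw [← Real.rpow_add_one this.ne', ← Real.rpow_add_one this.ne']
  ring_nf

/-- The power is the product of the nonlinearity, in `L¹ₜL²ₓ`, with `u`, in `L^∞ₜL²ₓ`, both locally.
-/
lemma integrable_weight_mul_power (hp3 : 3 ≤ p) (hp5 : p ≤ 5) {w : Spacetime → ℝ}
    (hw : IsBoundedWeight w) : Integrable fun z => w z * |u z| ^ (p + 1) := by
  have := h.sliceConv_u.integrable_mixed_mul hw h.aesm_nonlin (h.nonlin_mixed hp3 hp5)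
  refine this.congr (.of_forall fun z => ?_)
  simp only [← nonlin_mul_self (by linarith)]

/-- The chain rule for `|u|^(p+1)/(p+1)` in weak form. -/
lemma integral_nonlin_mul_deriv (hp3 : 3 ≤ p) (hp5 : p ≤ 5) {D : Spacetime → ℝ} {v : Spacetime}
    (hD : SliceConv (fun n => mollify n D) D)
    (hfd : ∀ n z, fderiv ℝ (mollify n u) z v = mollify n D z) {η η' : Spacetime → ℝ} {R : ℝ}
    (hη : Continuous η) (hη' : Continuous η') (hR : ∀ z, R < ‖z‖ → η z = 0)
    (hR' : ∀ z, R < ‖z‖ → η' z = 0) (hd : ∀ z, HasLineDerivAt ℝ η (η' z) z v) :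
    ∫ z, η z * (nonlin p u z * D z) = -∫ z, η' z * (|u z| ^ (p + 1) / (p + 1)) := by
  have hw := IsBoundedWeight.of_continuous hη hR
  have hw' := IsBoundedWeight.of_continuous hη' hR'
  choose g G hgc hgL hgM hgle hG hGle hG0 hk using exists_power_truncation hp3
  have hGM : ∀ k, ∃ M, ∀ a b, |G k a - G k b| ≤ M * |a - b| := by
    intro k
    obtain ⟨M, hM⟩ := hgM k
    refine ⟨M, fun a b => ?_⟩
    exact convex_univ.norm_image_sub_le_of_norm_hasDerivWithin_le
      (fun x _ => (hG k x).hasDerivWithinAt) (fun x _ => hM x) (mem_univ b) (mem_univ a)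
  have hg0 := fun k => by
    have := hgle k 0
    rw [abs_zero, Real.zero_rpow (by linarith)] at this
    exact abs_eq_zero.1 (le_antisymm this (abs_nonneg _))
  -- For fixed `k` the truncated power and its primitive are Lipschitz, so the chain rule for the
  -- mollified functions passes to the limit in `L²`. The truncation is removed afterwards by
  -- dominated convergence, the untruncated integrands being integrable.
  have step : ∀ k, ∫ z, η z * (g k (u z) * D z) = -∫ z, η' z * (G k (u z) * 1) := by
    intro k
    obtain ⟨L, hL⟩ := hgL k
    obtain ⟨M, hM⟩ := hGM k
    have hcg := h.sliceConv_u.comp hL (hg0 k)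
    have hcG := h.sliceConv_u.comp hM (hG0 k)
    have l1 := hcg.tendsto_integral_mul hD hw
    have l2 := hcG.tendsto_integral_mul (SliceConv.const 1) hw'
    refine tendsto_nhds_unique l1 (l2.neg.congr fun n => ?_)
    have hvs := contDiff_mollify h.locallyIntegrable_u n
    have hvc := hvs.continuous
    have hDc : Continuous (mollify n D) := by
      have : mollify n D = fun z => fderiv ℝ (mollify n u) z v := by ext z; rw [hfd]
      rw [this]
      exact (hvs.continuous_fderiv (by simp)).clm_apply continuous_const
    have hGc := continuous_iff_continuousAt.2 fun s => (hG k s).continuousAt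
    have hηc : HasCompactSupport η := .intro (isCompact_closedBall 0 R) fun z hz =>
        hR z (by simpa using hz)
    have hηc' : HasCompactSupport η' := .intro (isCompact_closedBall 0 R) fun z hz =>
        hR' z (by simpa using hz)
    have i1 : Integrable (fun z => η' z * (G k (mollify n u z) * 1)) :=
      (by fun_prop : Continuous fun z => η' z * (G k (mollify n u z) * 1)
        ).integrable_of_hasCompactSupport hηc'.mul_right
    have i2 : Integrable (fun z => η z * (g k (mollify n u z) * mollify n D z)) :=
      (hη.mul (((hgc k).comp hvc).mul hDc)).integrable_of_hasCompactSupport hηc.mul_right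
    have hz := integral_lineDeriv_eq_zero (f := fun z => η z * G k (mollify n u z))
      (f' := fun z => η' z * (G k (mollify n u z) * 1) + η z * (g k (mollify n u z) * mollify n D z))
      ((hη.mul (hGc.comp hvc)).integrable_of_hasCompactSupport hηc.mul_right)
      (i1.add i2) fun z => by
        have e1 : HasLineDerivAt ℝ (mollify n u) (mollify n D z) z v := by
          rw [← hfd]
          exact ((hvs.differentiable (by simp)) z).hasFDerivAt.hasLineDerivAt v
        have h0 : (mollify n u) (z + (0 : ℝ) • v) = mollify n u z := by simp
        have e2 : HasDerivAt (fun t : ℝ => G k (mollify n u (z + t • v)))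
            (g k (mollify n u z) * mollify n D z) 0 := by
          have := (hG k (mollify n u (z + 0 • v))).comp 0 e1
          rwa [h0] at this
        have e3 := HasDerivAt.mul (hd z) e2
        refine e3.congr_deriv ?_
        simp
    rw [integral_add i1 i2] at hz
    linarith
  have hmix := hD.integrable_mixed_mul hw h.aesm_nonlin (h.nonlin_mixed hp3 hp5)
  have hpow := h.integrable_weight_mul_power hp3 hp5 hw'
  have habs := fun z => (abs_nonlin hp3 u z).symm
  have l1 : Tendsto (fun k => ∫ z, η z * (g k (u z) * D z)) atTop
      (𝓝 (∫ z, η z * (nonlin p u z * D z))) := by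
    refine tendsto_integral_of_dominated_convergence (fun z => ‖η z * (nonlin p u z * D z)‖)
      (fun k => hη.aestronglyMeasurable.mul (((hgc k).comp_aestronglyMeasurable h.aesm_u).mul
        hD.aesm)) hmix.norm (fun k => .of_forall fun z => ?_)
      (.of_forall fun z => ?_)
    · rw [norm_mul, norm_mul, norm_mul, norm_mul]
      gcongr
      rw [Real.norm_eq_abs, Real.norm_eq_abs, ← habs]
      exact hgle k _
    · refine tendsto_const_nhds.congr' ?_
      filter_upwards [eventually_ge_atTop ⌈|u z|⌉₊] with k hkz
      rw [(hk k (u z) (Nat.ceil_le.1 hkz)).1, nonlin]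
  have l2 : Tendsto (fun k => ∫ z, η' z * (G k (u z) * 1)) atTop
      (𝓝 (∫ z, η' z * (|u z| ^ (p + 1) / (p + 1)))) := by
    have hGc := fun k => continuous_iff_continuousAt.2 fun s => (hG k s).continuousAt
    refine tendsto_integral_of_dominated_convergence (fun z => ‖η' z * |u z| ^ (p + 1)‖)
      (fun k => hη'.aestronglyMeasurable.mul (((hGc k).comp_aestronglyMeasurable h.aesm_u).mul
        aestronglyMeasurable_const)) hpow.norm (fun k => .of_forall fun z => ?_)
      (.of_forall fun z => ?_)
    · rw [mul_one, norm_mul, norm_mul]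
      gcongr
      rw [Real.norm_eq_abs, Real.norm_eq_abs, abs_of_nonneg (Real.rpow_nonneg (abs_nonneg _) _)]
      exact hGle k _
    · refine tendsto_const_nhds.congr' ?_
      filter_upwards [eventually_ge_atTop ⌈|u z|⌉₊] with k hkz
      rw [(hk k (u z) (Nat.ceil_le.1 hkz)).2, mul_one]
  exact tendsto_nhds_unique l1 (l2.neg.congr fun k => (step k).symm)

end IsFiniteEnergySolution

end ChainRule

/-! ### Line derivatives of functions of `|x|` and `t` -/

section LineDeriv

variable {f g : Spacetime → ℝ} {f' g' : ℝ} {z v : Spacetime}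

lemma hasLineDerivAt_add (hf : HasLineDerivAt ℝ f f' z v) (hg : HasLineDerivAt ℝ g g' z v) :
    HasLineDerivAt ℝ (fun y => f y + g y) (f' + g') z v :=
  HasDerivAt.add hf hg

lemma hasLineDerivAt_sub (hf : HasLineDerivAt ℝ f f' z v) (hg : HasLineDerivAt ℝ g g' z v) :
    HasLineDerivAt ℝ (fun y => f y - g y) (f' - g') z v :=
  HasDerivAt.sub hf hg

lemma hasLineDerivAt_mul (hf : HasLineDerivAt ℝ f f' z v) (hg : HasLineDerivAt ℝ g g' z v) :
    HasLineDerivAt ℝ (fun y => f y * g y) (f' * g z + f z * g') z v := by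
  have := HasDerivAt.mul hf hg
  refine HasDerivAt.congr_deriv this ?_
  simp

lemma hasLineDerivAt_const_mul (c : ℝ) (hf : HasLineDerivAt ℝ f f' z v) :
    HasLineDerivAt ℝ (fun y => c * f y) (c * f') z v :=
  HasDerivAt.const_mul c hf

lemma hasLineDerivAt_sum {f : Fin 3 → Spacetime → ℝ} {f' : Fin 3 → ℝ}
    (hf : ∀ i, HasLineDerivAt ℝ (f i) (f' i) z v) :
    HasLineDerivAt ℝ (fun y => ∑ i, f i y) (∑ i, f' i) z v :=
  HasDerivAt.fun_sum fun i _ => hf i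

/-- The `i`-th unit vector of space, as a vector in space-time. -/
def spaceDir (i : Fin 3) : Spacetime := (EuclideanSpace.single i 1, 0)

/-- The unit vector of the time axis. -/
def timeDir : Spacetime := (0, 1)

lemma hasLineDerivAt_coord (i j : Fin 3) (z : Spacetime) :
    HasLineDerivAt ℝ (fun y => y.1 j) (if j = i then 1 else 0) z (spaceDir i) := by
  have : (fun s => (z + s • spaceDir i).1 j) = fun s => z.1 j + s * (if j = i then 1 else 0) := by
    simp [spaceDir]
  unfold HasLineDerivAt
  rw [this]
  simpa using ((hasDerivAt_id (0 : ℝ)).mul_const (if j = i then 1 else 0)).const_add (z.1 j)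

lemma hasLineDerivAt_norm (i : Fin 3) {z : Spacetime} (hz : z.1 ≠ 0) :
    HasLineDerivAt ℝ (fun y => ‖y.1‖) (z.1 i * ‖z.1‖⁻¹) z (spaceDir i) := by
  have hsq := hasLineDerivAt_sum fun j =>
      hasLineDerivAt_mul (hasLineDerivAt_coord i j z) (hasLineDerivAt_coord i j z)
  have e : ∀ y : E3, ∑ j, y j * y j = ‖y‖ ^ 2 := fun y => by
    rw [EuclideanSpace.norm_sq_eq]
    simp [pow_two]
  have h1 := HasDerivAt.sqrt hsq (by
    simp only [zero_smul, add_zero, e]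
    exact pow_ne_zero 2 (norm_ne_zero_iff.2 hz))
  simp only [e, zero_smul, add_zero] at h1
  have e2 : ∀ y : E3, √(‖y‖ ^ 2) = ‖y‖ := fun y => Real.sqrt_sq (norm_nonneg y)
  simp only [e2] at h1
  refine HasDerivAt.congr_deriv h1 ?_
  field_simp
  simp
  ring

lemma hasLineDerivAt_inv_norm (i : Fin 3) {z : Spacetime} (hz : z.1 ≠ 0) :
    HasLineDerivAt ℝ (fun y => ‖y.1‖⁻¹) (-(z.1 i * ‖z.1‖⁻¹) * (‖z.1‖⁻¹ * ‖z.1‖⁻¹)) z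
      (spaceDir i) := by
  have := HasDerivAt.inv (hasLineDerivAt_norm i hz) (by simpa using hz)
  refine HasDerivAt.congr_deriv this ?_
  simp only [zero_smul, add_zero]
  field_simp

lemma hasLineDerivAt_dir (i j : Fin 3) {z : Spacetime} (hz : z.1 ≠ 0) :
    HasLineDerivAt ℝ (fun y : Spacetime => y.1 j * ‖y.1‖⁻¹)
      (((if j = i then 1 else 0) - z.1 j * ‖z.1‖⁻¹ * (z.1 i * ‖z.1‖⁻¹)) * ‖z.1‖⁻¹) z
      (spaceDir i) := by
  refine HasDerivAt.congr_deriv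
    (hasLineDerivAt_mul (hasLineDerivAt_coord i j z) (hasLineDerivAt_inv_norm i hz)) ?_
  ring

lemma hasLineDerivAt_of_fst (f : E3 → ℝ) (z : Spacetime) :
    HasLineDerivAt ℝ (fun y => f y.1) 0 z timeDir := by
  have : (fun s : ℝ => f (z + s • timeDir).1) = fun _ => f z.1 := by simp [timeDir]
  unfold HasLineDerivAt
  rw [this]
  exact hasDerivAt_const _ _

lemma sum_dir_mul_self {z : Spacetime} (hz : z.1 ≠ 0) :
    ∑ i, (z.1 i * ‖z.1‖⁻¹) * (z.1 i * ‖z.1‖⁻¹) = 1 := by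
  have e : ∑ j, z.1 j * z.1 j = ‖z.1‖ ^ 2 := by
    rw [EuclideanSpace.norm_sq_eq]
    simp [pow_two]
  rw [Fin.sum_univ_three] at e ⊢
  field_simp
  linarith

/-- A `C¹` function of `(|x|, t)` supported away from the `t`-axis and from infinity. -/
structure IsRadialTest (ψ ψr ψt : ℝ → ℝ → ℝ) (δ R : ℝ) : Prop where
  pos : 0 < δ
  continuous : Continuous (Function.uncurry ψ)
  continuous_r : Continuous (Function.uncurry ψr)
  continuous_t : Continuous (Function.uncurry ψt)
  hasDerivAt_r : ∀ r t, 0 < r → HasDerivAt (fun r => ψ r t) (ψr r t) r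
  hasDerivAt_t : ∀ r t, 0 < r → HasDerivAt (fun t => ψ r t) (ψt r t) t
  vanish : ∀ r t, r ≤ δ ∨ R ≤ r ∨ R ≤ |t| → ψ r t = 0 ∧ ψr r t = 0 ∧ ψt r t = 0

lemma hasLineDerivAt_radial {ψ ψr ψt : ℝ → ℝ → ℝ} {δ R : ℝ} (hψ : IsRadialTest ψ ψr ψt δ R)
    (i : Fin 3) {z : Spacetime} (hz : z.1 ≠ 0) :
    HasLineDerivAt ℝ (fun y => ψ ‖y.1‖ y.2) (ψr ‖z.1‖ z.2 * (z.1 i * ‖z.1‖⁻¹)) z (spaceDir i) := by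
  have e : ∀ s : ℝ, (z + s • spaceDir i).2 = z.2 := fun s => by simp [spaceDir]
  have h1 : HasDerivAt (fun r => ψ r z.2) (ψr ‖z.1‖ z.2) ‖(z + (0 : ℝ) • spaceDir i).1‖ := by
    simpa using hψ.hasDerivAt_r ‖z.1‖ z.2 (norm_pos_iff.2 hz)
  have := h1.comp (0 : ℝ) (hasLineDerivAt_norm i hz)
  unfold HasLineDerivAt
  simp only [e]
  exact this

lemma hasLineDerivAt_radial_time {ψ ψr ψt : ℝ → ℝ → ℝ} {δ R : ℝ}
    (hψ : IsRadialTest ψ ψr ψt δ R) {z : Spacetime} (hz : z.1 ≠ 0) :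
    HasLineDerivAt ℝ (fun y => ψ ‖y.1‖ y.2) (ψt ‖z.1‖ z.2) z timeDir := by
  have e : ∀ s : ℝ, (z + s • timeDir).1 = z.1 := fun s => by simp [timeDir]
  have e' : ∀ s, (z + s • timeDir).2 = z.2 + s := fun s => by simp [timeDir]
  unfold HasLineDerivAt
  simp only [e, e']
  have h1 : HasDerivAt (fun t => ψ ‖z.1‖ t) (ψt ‖z.1‖ z.2) (z.2 + 0) := by
    simpa using hψ.hasDerivAt_t ‖z.1‖ z.2 (norm_pos_iff.2 hz)
  simpa using h1.comp_const_add z.2 0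

end LineDeriv

/-! ### Divergence identities for smooth solutions -/

section SmoothIdentity

/-- A smooth solution `v` of `∂ₜ²v - Δv = -G`, with spatial derivatives `a` and time
derivative `b`. -/
structure SmoothWave (v : Spacetime → ℝ) (a : Fin 3 → Spacetime → ℝ) (b G : Spacetime → ℝ) :
    Prop where
  contDiff_v : ContDiff ℝ ∞ v
  contDiff_a : ∀ i, ContDiff ℝ ∞ (a i)
  contDiff_b : ContDiff ℝ ∞ b
  deriv_space : ∀ i z, fderiv ℝ v z (spaceDir i) = a i z
  deriv_time : ∀ z, fderiv ℝ v z timeDir = b z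
  continuous_G : Continuous G
  wave : ∀ z, fderiv ℝ b z timeDir = ∑ i, fderiv ℝ (a i) z (spaceDir i) - G z

variable {v : Spacetime → ℝ} {a : Fin 3 → Spacetime → ℝ} {b G : Spacetime → ℝ}
  (h : SmoothWave v a b G)
include h

/-- Symmetry of the second derivative, stated for the named first derivatives so that it can be used
in the algebra below. -/
lemma SmoothWave.second_symm {w w' : Spacetime} {c c' : Spacetime → ℝ}
    (hc : ∀ z, fderiv ℝ v z w = c z) (hc' : ∀ z, fderiv ℝ v z w' = c' z) (z : Spacetime) :
    fderiv ℝ c z w' = fderiv ℝ c' z w := by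
  have hd : DifferentiableAt ℝ (fderiv ℝ v) z :=
    ((h.contDiff_v.fderiv_right (m := ∞) (by simp)).differentiable (by simp)) z
  have e : ∀ w (c : Spacetime → ℝ), (∀ z, fderiv ℝ v z w = c z) → ∀ y,
      fderiv ℝ c z y = fderiv ℝ (fderiv ℝ v) z y w := by
    intro w c hc y
    have : c = fun z => fderiv ℝ v z w := by ext z; rw [hc]
    rw [this, fderiv_clm_apply hd (differentiableAt_const w)]
    simp
  rw [e w c hc, e w' c' hc']
  exact ((h.contDiff_v.contDiffAt).isSymmSndFDerivAt
    (by rw [minSmoothness_of_isRCLikeNormedField]; exact WithTop.coe_le_coe.2 (le_top : (2 : ℕ∞) ≤ ⊤))).eq _ _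

lemma SmoothWave.line_v_space (i : Fin 3) (z : Spacetime) :
    HasLineDerivAt ℝ v (a i z) z (spaceDir i) := by
  rw [← h.deriv_space]
  exact ((h.contDiff_v.differentiable (by simp)) z).hasFDerivAt.hasLineDerivAt _

lemma SmoothWave.line_v_time (z : Spacetime) : HasLineDerivAt ℝ v (b z) z timeDir := by
  rw [← h.deriv_time]
  exact ((h.contDiff_v.differentiable (by simp)) z).hasFDerivAt.hasLineDerivAt _

lemma SmoothWave.line_a (j : Fin 3) (z w : Spacetime) :
    HasLineDerivAt ℝ (a j) (fderiv ℝ (a j) z w) z w :=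
  (((h.contDiff_a j).differentiable (by simp)) z).hasFDerivAt.hasLineDerivAt _

lemma SmoothWave.line_b (z w : Spacetime) : HasLineDerivAt ℝ b (fderiv ℝ b z w) z w :=
  ((h.contDiff_b.differentiable (by simp)) z).hasFDerivAt.hasLineDerivAt _

omit h in
lemma hasCompactSupport_of_ball {f : Spacetime → ℝ} {R : ℝ} (hf : ∀ z, R < ‖z‖ → f z = 0) :
    HasCompactSupport f :=
  .intro (isCompact_closedBall 0 R) fun z hz => hf z (by simpa using hz)

omit h in
lemma integral_deriv_mul_eq_zero {η η' Y Y' : Spacetime → ℝ} {R : ℝ} {w : Spacetime}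
    (hη : Continuous η) (hη' : Continuous η') (hY : Continuous Y) (hY' : Continuous Y')
    (hR : ∀ z, R < ‖z‖ → η z = 0) (hR' : ∀ z, R < ‖z‖ → η' z = 0)
    (hd : ∀ z, HasLineDerivAt ℝ η (η' z) z w) (hdY : ∀ z, HasLineDerivAt ℝ Y (Y' z) z w) :
    Integrable (fun z => η' z * Y z + η z * Y' z) ∧ ∫ z, (η' z * Y z + η z * Y' z) = 0 := by
  have hi := (by fun_prop : Continuous fun z => η' z * Y z + η z * Y' z
    ).integrable_of_hasCompactSupport (μ := volume) (hasCompactSupport_of_ball fun z hz => by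
      rw [hR z hz, hR' z hz]; ring)
  exact ⟨hi, integral_lineDeriv_eq_zero ((hη.mul hY).integrable_of_hasCompactSupport
    (hasCompactSupport_of_ball hR).mul_right) hi fun z => hasLineDerivAt_mul (hd z) (hdY z)⟩

/-- The local energy law: the wave equation multiplied by the time derivative `b`. -/
lemma SmoothWave.integral_energy_identity {η ηt : Spacetime → ℝ} {ηx : Fin 3 → Spacetime → ℝ}
    {R : ℝ} (hη : Continuous η) (hηt : Continuous ηt) (hηx : ∀ i, Continuous (ηx i))
    (hR : ∀ z, R < ‖z‖ → η z = 0) (hRt : ∀ z, R < ‖z‖ → ηt z = 0)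
    (hRx : ∀ i z, R < ‖z‖ → ηx i z = 0) (hdt : ∀ z, HasLineDerivAt ℝ η (ηt z) z timeDir)
    (hdx : ∀ i z, HasLineDerivAt ℝ η (ηx i z) z (spaceDir i)) :
    ∫ z, (ηt z * (1 / 2 * b z * b z + 1 / 2 * ∑ i, a i z * a i z) - ∑ i, ηx i z * (b z * a i z)
      - η z * (G z * b z)) = 0 := by
  have hac := fun i => (h.contDiff_a i).continuous
  have hbc : Continuous b := h.contDiff_b.continuous
  have hadc : ∀ i w, Continuous fun z => fderiv ℝ (a i) z w := fun i w =>
    ((h.contDiff_a i).continuous_fderiv (by simp)).clm_apply continuous_const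
  have hbdc : ∀ w, Continuous fun z => fderiv ℝ b z w := fun w =>
    (h.contDiff_b.continuous_fderiv (by simp)).clm_apply continuous_const
  -- the divergence of `(-η b a, η (b²/2 + |a|²/2))`
  have hX := fun i => integral_deriv_mul_eq_zero hη (hηx i)
    (Y' := fun z => fderiv ℝ b z (spaceDir i) * a i z + b z * fderiv ℝ (a i) z (spaceDir i))
    (by fun_prop) (by fun_prop) hR (hRx i) (hdx i) fun z =>
      hasLineDerivAt_mul (h.line_b z _) (h.line_a i z _)
  have hT := integral_deriv_mul_eq_zero hη hηt
    (Y := fun z => 1 / 2 * (b z * b z) + 1 / 2 * ∑ i, a i z * a i z)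
    (Y' := fun z => 1 / 2 * (fderiv ℝ b z timeDir * b z + b z * fderiv ℝ b z timeDir) +
      1 / 2 * ∑ i, (fderiv ℝ b z (spaceDir i) * a i z + a i z * fderiv ℝ b z (spaceDir i)))
    (by fun_prop) (by fun_prop) hR hRt hdt fun z => by
      simp only [← fun i => h.second_symm (h.deriv_space i) h.deriv_time z]
      exact hasLineDerivAt_add
        (hasLineDerivAt_const_mul _ (hasLineDerivAt_mul (h.line_b z _) (h.line_b z _)))
        (hasLineDerivAt_const_mul _ (hasLineDerivAt_sum fun i => hasLineDerivAt_mul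
          (h.line_a i z _) (h.line_a i z _)))
  have := integral_sub hT.1 (integrable_finsetSum Finset.univ fun i _ => (hX i).1)
  rw [hT.2, integral_finsetSum _ fun i _ => (hX i).1, Finset.sum_eq_zero fun i _ => (hX i).2,
    sub_zero] at this
  rw [← this]
  congr 1
  ext z
  rw [h.wave z]
  simp only [Fin.sum_univ_three]
  ring

omit h in
lemma eventuallyEq_zero_near_axis {f : Spacetime → ℝ} {δ : ℝ} (hδ : 0 < δ)
    (hf : ∀ z, ‖z.1‖ ≤ δ → f z = 0) {z : Spacetime} (hz : z.1 = 0) : f =ᶠ[𝓝 z] fun _ => 0 := by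
  have hU : IsOpen {z : Spacetime | ‖z.1‖ < δ} := isOpen_lt (by fun_prop) continuous_const
  filter_upwards [hU.mem_nhds (by simpa [hz] using hδ)] with y hy using hf y (le_of_lt hy)

omit h in
lemma hasLineDerivAt_near_axis {f f' : Spacetime → ℝ} {δ : ℝ} (hδ : 0 < δ)
    (hf : ∀ z, ‖z.1‖ ≤ δ → f z = 0 ∧ f' z = 0) {z : Spacetime} (hz : z.1 = 0) (v : Spacetime) :
    HasLineDerivAt ℝ f (f' z) z v := by
  rw [(hf z (by simp [hz, hδ.le])).2]
  simpa using ((hasFDerivAt_const (0 : ℝ) z).congr_of_eventuallyEq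
    (eventuallyEq_zero_near_axis hδ (fun y hy => (hf y hy).1) hz)).hasLineDerivAt v

-- Radial tests vanish for `r ≤ δ`, so the singularities of `1/|x|` and `x/|x|` on the axis do no
-- harm.
omit h in
lemma IsRadialTest.continuous_mul {ψ ψr ψt : ℝ → ℝ → ℝ} {δ R : ℝ}
    (hψ : IsRadialTest ψ ψr ψt δ R) {χ : ℝ → ℝ → ℝ} (hχ : Continuous (Function.uncurry χ))
    (hχ0 : ∀ r t, r ≤ δ → χ r t = 0) {f : Spacetime → ℝ}
    (hf : ContinuousOn f {z | z.1 ≠ 0}) : Continuous fun z => χ ‖z.1‖ z.2 * f z := by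
  have hχc : Continuous fun z : Spacetime => χ ‖z.1‖ z.2 :=
    hχ.comp (by fun_prop : Continuous fun z : Spacetime => (‖z.1‖, z.2))
  have ho : IsOpen {z : Spacetime | z.1 ≠ 0} := isOpen_ne_fun continuous_fst continuous_const
  refine continuous_iff_continuousAt.2 fun z => ?_
  by_cases hz : z.1 = 0
  · exact continuousAt_const.congr (eventuallyEq_zero_near_axis hψ.pos (fun y hy => by
      rw [hχ0 _ _ hy, zero_mul]) hz).symm
  · exact hχc.continuousAt.mul (hf.continuousAt (ho.mem_nhds hz))

omit h in
lemma IsRadialTest.eq_zero_of_ball {ψ ψr ψt : ℝ → ℝ → ℝ} {δ R : ℝ}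
    (hψ : IsRadialTest ψ ψr ψt δ R) {z : Spacetime} (hz : R < ‖z‖) :
    ψ ‖z.1‖ z.2 = 0 ∧ ψr ‖z.1‖ z.2 = 0 ∧ ψt ‖z.1‖ z.2 = 0 := by
  refine hψ.vanish _ _ (Or.inr ?_)
  rw [Prod.norm_def, lt_max_iff, Real.norm_eq_abs] at hz
  exact hz.imp le_of_lt le_of_lt

omit h in
lemma IsRadialTest.integral_deriv_eq_zero {ψ ψr ψt : ℝ → ℝ → ℝ} {δ R : ℝ}
    (hψ : IsRadialTest ψ ψr ψt δ R) {χ : ℝ → ℝ → ℝ} (hχ : Continuous (Function.uncurry χ))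
    (hχ0 : ∀ r t, r ≤ δ → χ r t = 0) (hχR : ∀ z : Spacetime, R < ‖z‖ → χ ‖z.1‖ z.2 = 0)
    {w : Spacetime} {c Y Y' : Spacetime → ℝ} (hc : ContinuousOn c {z | z.1 ≠ 0})
    (hY : ContinuousOn Y {z | z.1 ≠ 0}) (hY' : ContinuousOn Y' {z | z.1 ≠ 0})
    (hd : ∀ z, z.1 ≠ 0 → HasLineDerivAt ℝ (fun z => ψ ‖z.1‖ z.2) (χ ‖z.1‖ z.2 * c z) z w)
    (hdY : ∀ z, z.1 ≠ 0 → HasLineDerivAt ℝ Y (Y' z) z w) :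
    Integrable (fun z => χ ‖z.1‖ z.2 * (c z * Y z) + ψ ‖z.1‖ z.2 * Y' z) ∧
      ∫ z, (χ ‖z.1‖ z.2 * (c z * Y z) + ψ ‖z.1‖ z.2 * Y' z) = 0 := by
  have hψ0 := fun r t hr => (hψ.vanish r t (Or.inl hr)).1
  have hi : Integrable (fun z => χ ‖z.1‖ z.2 * (c z * Y z) + ψ ‖z.1‖ z.2 * Y' z) := by
    refine Continuous.integrable_of_hasCompactSupport ((hψ.continuous_mul hχ hχ0 (hc.mul hY)).add
      (hψ.continuous_mul hψ.continuous hψ0 hY')) (hasCompactSupport_of_ball (R := R) fun z hz => ?_)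
    rw [hχR z hz, (hψ.eq_zero_of_ball hz).1]
    ring
  refine ⟨hi, integral_lineDeriv_eq_zero (v := w)
    ((hψ.continuous_mul hψ.continuous hψ0 hY).integrable_of_hasCompactSupport
      (hasCompactSupport_of_ball fun z hz => by
        rw [(hψ.eq_zero_of_ball hz).1, zero_mul])) hi fun z => ?_⟩
  by_cases hz : z.1 = 0
  · exact hasLineDerivAt_near_axis (f' := fun z => χ ‖z.1‖ z.2 * (c z * Y z) + ψ ‖z.1‖ z.2 * Y' z)
      hψ.pos (fun y hy => by simp [hχ0 _ _ hy, hψ0 _ _ hy]) hz w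
  · refine HasDerivAt.congr_deriv (hasLineDerivAt_mul (hd z hz) (hdY z hz)) ?_
    ring

/-- This is the wave equation multiplied by `Q/2`. The choice of `Q` matters: `∂ᵣ + 1/|x|`
conjugates the radial part of the Laplacian to `∂ᵣ²`, so that `Q²` is transported along one family
of light rays, and the angular derivatives leave the positive term `S/(2|x|)`. The power part is
added later, since here the source `G` is arbitrary. -/
lemma SmoothWave.integral_radial_identity {σ : ℝ} (hσ : σ * σ = 1) {ψ ψr ψt : ℝ → ℝ → ℝ}
    {δ R : ℝ} (hψ : IsRadialTest ψ ψr ψt δ R) {n : Fin 3 → Spacetime → ℝ}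
    {k Q S : Spacetime → ℝ} (hn : ∀ i, n i = fun z => z.1 i * ‖z.1‖⁻¹)
    (hk : k = fun z => ‖z.1‖⁻¹) (hQ : Q = fun z => ∑ i, a i z * n i z + v z * k z + σ * b z)
    (hS : S = fun z => ∑ i, a i z * a i z - (∑ i, a i z * n i z) * (∑ i, a i z * n i z)) :
    ∫ z, (ψr ‖z.1‖ z.2 * (-(1 / 4) * (Q z * Q z) + 1 / 4 * S z) +
      ψt ‖z.1‖ z.2 * (σ * (1 / 4 * (Q z * Q z) + 1 / 4 * S z)) -
      ψ ‖z.1‖ z.2 * (1 / 2 * (S z * k z) + 1 / 2 * (G z * Q z))) = 0 := by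
  have hac : ∀ i, Continuous (a i) := fun i => (h.contDiff_a i).continuous
  have hbc : Continuous b := h.contDiff_b.continuous
  have hvc : Continuous v := h.contDiff_v.continuous
  have hadc : ∀ i w, Continuous fun z => fderiv ℝ (a i) z w := fun i w =>
    ((h.contDiff_a i).continuous_fderiv (by simp)).clm_apply continuous_const
  have hbdc : ∀ w, Continuous fun z => fderiv ℝ b z w := fun w =>
    (h.contDiff_b.continuous_fderiv (by simp)).clm_apply continuous_const
  have hkc : ContinuousOn k {z | z.1 ≠ 0} := by
    rw [hk]
    exact ContinuousOn.inv₀ (by fun_prop) fun z hz => norm_ne_zero_iff.2 hz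
  have hnc : ∀ i, ContinuousOn (n i) {z | z.1 ≠ 0} := fun i => by
    have : n i = fun z => z.1 i * k z := by rw [hn, hk]
    rw [this]
    exact ContinuousOn.mul (by fun_prop) hkc
  have hN : ∀ z, z.1 ≠ 0 → n 0 z * n 0 z + n 1 z * n 1 z + n 2 z * n 2 z = 1 := fun z hz => by
    simpa only [Fin.sum_univ_three, hn] using sum_dir_mul_self hz
  have hdn : ∀ i j z, z.1 ≠ 0 → HasLineDerivAt ℝ (n j)
      (((if j = i then 1 else 0) - n j z * n i z) * k z) z (spaceDir i) := by
    intro i j z hz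
    rw [hn, hn, hk]
    exact hasLineDerivAt_dir i j hz
  have hdk : ∀ i z, z.1 ≠ 0 → HasLineDerivAt ℝ k (-(n i z) * (k z * k z)) z (spaceDir i) := by
    intro i z hz
    rw [hn, hk]
    exact hasLineDerivAt_inv_norm i hz
  have hdnt : ∀ j z, HasLineDerivAt ℝ (n j) 0 z timeDir := fun j z => by
    rw [hn]
    exact hasLineDerivAt_of_fst (fun x => x j * ‖x‖⁻¹) z
  have hdkt : ∀ z, HasLineDerivAt ℝ k 0 z timeDir := fun z => by
    rw [hk]
    exact hasLineDerivAt_of_fst (fun x => ‖x‖⁻¹) z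
  have hsym := fun i z => h.second_symm (h.deriv_space i) h.deriv_time z
  have hsym' : ∀ i j z, fderiv ℝ (a i) z (spaceDir j) = fderiv ℝ (a j) z (spaceDir i) :=
    fun i j z => h.second_symm (h.deriv_space i) (h.deriv_space j) z
  -- derivatives of `∂ᵣv`, `Q`, `S`
  set q := fun z => ∑ i, a i z * n i z with hq
  have hQc : ContinuousOn Q {z | z.1 ≠ 0} := by rw [hQ]; fun_prop
  have hSc : ContinuousOn S {z | z.1 ≠ 0} := by rw [hS]; fun_prop
  set dq := fun i z => ∑ j, (fderiv ℝ (a j) z (spaceDir i) * n j z +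
    a j z * (((if j = i then 1 else 0) - n j z * n i z) * k z)) with hdq
  set dQ := fun i z => dq i z +
    (a i z * k z + v z * (-(n i z) * (k z * k z))) + σ * fderiv ℝ b z (spaceDir i) with hdQ
  set dS := fun i z => ∑ j, (fderiv ℝ (a j) z (spaceDir i) * a j z +
    a j z * fderiv ℝ (a j) z (spaceDir i)) - (dq i z * q z + q z * dq i z) with hdS
  have lq := fun i z hz =>
    hasLineDerivAt_sum fun j => hasLineDerivAt_mul (h.line_a j z _) (hdn i j z hz)
  have lQ : ∀ i z, z.1 ≠ 0 → HasLineDerivAt ℝ Q (dQ i z) z (spaceDir i) := fun i z hz => by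
    rw [hQ]
    exact hasLineDerivAt_add (hasLineDerivAt_add (lq i z hz) (hasLineDerivAt_mul
      (h.line_v_space i z) (hdk i z hz))) (hasLineDerivAt_const_mul σ (h.line_b z _))
  have lS : ∀ i z, z.1 ≠ 0 → HasLineDerivAt ℝ S (dS i z) z (spaceDir i) := fun i z hz => by
    rw [hS]
    exact hasLineDerivAt_sub (hasLineDerivAt_sum fun j => hasLineDerivAt_mul (h.line_a j z _)
      (h.line_a j z _)) (hasLineDerivAt_mul (lq i z hz) (lq i z hz))
  set Tq := fun z => ∑ j, (fderiv ℝ b z (spaceDir j) * n j z + a j z * 0) with hTq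
  set TQ := fun z => Tq z + (b z * k z + v z * 0) + σ * fderiv ℝ b z timeDir with hTQ
  set TS := fun z => ∑ j, (fderiv ℝ b z (spaceDir j) * a j z +
    a j z * fderiv ℝ b z (spaceDir j)) - (Tq z * q z + q z * Tq z) with hTS
  have hTQc : ContinuousOn TQ {z | z.1 ≠ 0} := by
    have := hbdc timeDir
    rw [hTQ]; fun_prop
  have lTq := fun z => hasLineDerivAt_sum fun j => by
      have := hasLineDerivAt_mul (h.line_a j z timeDir) (hdnt j z)
      rwa [hsym] at this
  have lTQ : ∀ z, HasLineDerivAt ℝ Q (TQ z) z timeDir := fun z => by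
    rw [hQ]
    exact hasLineDerivAt_add (hasLineDerivAt_add (lTq z) (hasLineDerivAt_mul
      (h.line_v_time z) (hdkt z))) (hasLineDerivAt_const_mul σ (h.line_b z _))
  have lTS : ∀ z, HasLineDerivAt ℝ S (TS z) z timeDir := fun z => by
    rw [hS]
    refine hasLineDerivAt_sub (hasLineDerivAt_sum fun j => ?_) (hasLineDerivAt_mul (lTq z) (lTq z))
    have := hasLineDerivAt_mul (h.line_a j z timeDir) (h.line_a j z timeDir)
    rwa [hsym] at this
  -- The second summand of `Y` is tangential to the spheres. It is orthogonal to the gradient of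
  -- `ψ`, which is radial, hence invisible in the conclusion; its divergence cancels the terms that
  -- come from angular derivatives.
  have hX : ∀ i, _ := fun i => hψ.integral_deriv_eq_zero hψ.continuous_r
    (fun r t hr => (hψ.vanish r t (Or.inl hr)).2.1) (fun z hz => (hψ.eq_zero_of_ball hz).2.1)
    (Y := fun z => (-(1 / 4) * (Q z * Q z) + 1 / 4 * S z) * n i z -
      1 / 2 * (Q z * (a i z - q z * n i z)))
    (Y' := fun z => (-(1 / 4) * (dQ i z * Q z + Q z * dQ i z) + 1 / 4 * dS i z) * n i z +
      (-(1 / 4) * (Q z * Q z) + 1 / 4 * S z) * (((if i = i then 1 else 0) - n i z * n i z) * k z) -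
      1 / 2 * (dQ i z * (a i z - q z * n i z) + Q z * (fderiv ℝ (a i) z (spaceDir i) -
        (dq i z * n i z + q z * (((if i = i then 1 else 0) - n i z * n i z) * k z)))))
    (hnc i) (by fun_prop) (by fun_prop)
    (fun z hz => by rw [hn]; exact hasLineDerivAt_radial hψ i hz)
    (fun z hz => hasLineDerivAt_sub (hasLineDerivAt_mul (hasLineDerivAt_add
      (hasLineDerivAt_const_mul _ (hasLineDerivAt_mul (lQ i z hz) (lQ i z hz)))
      (hasLineDerivAt_const_mul _ (lS i z hz))) (hdn i i z hz))
      (hasLineDerivAt_const_mul _ (hasLineDerivAt_mul (lQ i z hz) (hasLineDerivAt_sub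
        (h.line_a i z _) (hasLineDerivAt_mul (lq i z hz) (hdn i i z hz))))))
  have hT := hψ.integral_deriv_eq_zero hψ.continuous_t
    (fun r t hr => (hψ.vanish r t (Or.inl hr)).2.2) (fun z hz => (hψ.eq_zero_of_ball hz).2.2)
    (Y := fun z => σ * (1 / 4 * (Q z * Q z) + 1 / 4 * S z))
    (Y' := fun z => σ * (1 / 4 * (TQ z * Q z + Q z * TQ z) + 1 / 4 * TS z))
    continuousOn_const (by fun_prop) (by fun_prop)
    (fun z hz => by rw [mul_one]; exact hasLineDerivAt_radial_time hψ hz)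
    (fun z _ => hasLineDerivAt_const_mul _ (hasLineDerivAt_add
      (hasLineDerivAt_const_mul _ (hasLineDerivAt_mul (lTQ z) (lTQ z)))
      (hasLineDerivAt_const_mul _ (lTS z))))
  have hsum := integral_add (integrable_finsetSum Finset.univ fun i _ => (hX i).1) hT.1
  rw [hT.2, integral_finsetSum _ fun i _ => (hX i).1, Finset.sum_eq_zero fun i _ => (hX i).2,
    add_zero] at hsum
  rw [← hsum]
  congr 1
  ext z
  by_cases hz : z.1 = 0
  · have hz' : ‖z.1‖ ≤ δ := by rw [hz, norm_zero]; exact hψ.pos.le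
    obtain ⟨h1, h2, h3⟩ := hψ.vanish ‖z.1‖ z.2 (Or.inl hz')
    simp [h1, h2]
  · have hN := hN z hz
    have hw := h.wave z
    have s1 := hsym' 1 0 z
    have s2 := hsym' 2 0 z
    have s3 := hsym' 2 1 z
    have vQ : Q z = q z + v z * k z + σ * b z := by rw [hQ]
    have vS : S z = ∑ i, a i z * a i z - q z * q z := by rw [hS]
    have vq : q z = ∑ i, a i z * n i z := rfl
    clear_value q
    simp only [Fin.sum_univ_three] at hw vS vq
    simp only [hdQ, hdS, hdq, hTQ, hTS, hTq, Fin.sum_univ_three, s1, s2, s3, Fin.reduceEq, if_true,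
      if_false]
    -- What remains is a polynomial identity between values at `z`, modulo `|n| = 1`, `σ² = 1`, the
    -- wave equation, and the definitions of `∂ᵣv`, `Q` and `S`.
    linear_combination
      (-ψ ‖z.1‖ z.2 * (-1 / 2 * Q z * k z * q z + 1 / 2 * Q z * v z * k z ^ 2 + 1 / 4 * Q z ^ 2 * k z
        - 1 / 4 * S z * k z - 1 / 2 * v z * k z ^ 2 * q z)
        - ψr ‖z.1‖ z.2 * (-1 / 4 * Q z ^ 2 + 1 / 4 * S z + 1 / 2 * Q z * q z)) * hN
      + (ψ ‖z.1‖ z.2 * (-1 / 2 * Q z * k z + q z * k z + 1 / 2 * v z * k z ^ 2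
          + 1 / 2 * k z * (a 0 z * n 0 z + a 1 z * n 1 z + a 2 z * n 2 z))
        - 1 / 2 * Q z * ψr ‖z.1‖ z.2) * vq
      - 1 / 2 * Q z * fderiv ℝ b z timeDir * ψ ‖z.1‖ z.2 * hσ - 1 / 2 * Q z * ψ ‖z.1‖ z.2 * hw
      + 1 / 2 * Q z * k z * ψ ‖z.1‖ z.2 * vQ - k z * ψ ‖z.1‖ z.2 * vS

end SmoothIdentity

/-! ### The identities for finite-energy solutions -/

section RadialIdentity

lemma radialDeriv_eq_sum (Du : Spacetime → E3) (z : Spacetime) :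
    radialDeriv Du z = ∑ i, Du z i * (z.1 i * ‖z.1‖⁻¹) := by
  unfold radialDeriv radialDir
  refine Finset.sum_congr rfl fun i _ => ?_
  simp
  ring

lemma norm_angularGrad_sq (Du : Spacetime → E3) {z : Spacetime} (hz : z.1 ≠ 0) :
    ‖angularGrad Du z‖ ^ 2 = ∑ i, Du z i * Du z i - radialDeriv Du z * radialDeriv Du z := by
  have hr : ‖z.1‖ ≠ 0 := norm_ne_zero_iff.2 hz
  have h1 : ‖radialDir z.1‖ = 1 := by
    unfold radialDir
    rw [norm_smul, norm_inv, norm_norm, inv_mul_cancel₀ hr]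
  have h2 : ‖Du z‖ ^ 2 = ∑ i, Du z i * Du z i := by
    rw [EuclideanSpace.norm_sq_eq]
    simp [pow_two]
  unfold angularGrad
  rw [norm_sub_sq_real, inner_smul_right, norm_smul, h1, h2]
  change _ - 2 * (radialDeriv Du z * radialDeriv Du z) + _ = _
  rw [Real.norm_eq_abs, mul_one, sq_abs]
  ring

variable (p : ℝ) (u : Spacetime → ℝ) (Du : Spacetime → E3) (ut : Spacetime → ℝ) (σ : ℝ)

/-- `∂ᵣu + u/|x| + σ uₜ`. -/
def nullDeriv (z : Spacetime) : ℝ := radialDeriv Du z + u z / ‖z.1‖ + σ * ut z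

/-- The part `¼|∇̸u|² + |u|^(p+1)/(2(p+1))` common to the components of the energy fields. -/
def sideDensity (z : Spacetime) : ℝ :=
  1 / 4 * ‖angularGrad Du z‖ ^ 2 + |u z| ^ (p + 1) / (2 * (p + 1))

/-- The radial component of the energy field. -/
def fluxRadial (z : Spacetime) : ℝ := -(1 / 4) * nullDeriv u Du ut σ z ^ 2 + sideDensity p u Du z

/-- The time component of the energy field. -/
def fluxTime (z : Spacetime) : ℝ := 1 / 4 * nullDeriv u Du ut σ z ^ 2 + sideDensity p u Du z

namespace IsFiniteEnergySolution

variable {p u Du ut} (h : IsFiniteEnergySolution p u Du ut)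
include h

lemma mollify_spaceDir (i : Fin 3) (n : ℕ) (z : Spacetime) :
    fderiv ℝ (mollify n u) z (spaceDir i) = mollify n (fun z => Du z i) z := by
  rw [spaceDir, h.fderiv_mollify_u_space, ← mollify_inner h.locallyIntegrable_Du]
  simp [EuclideanSpace.inner_single_right]

lemma smoothWave_mollify (hp3 : 3 ≤ p) (hp5 : p ≤ 5) (n : ℕ) :
    SmoothWave (mollify n u) (fun i => mollify n fun z => Du z i) (mollify n ut)
      (mollify n (nonlin p u)) where
  contDiff_v := contDiff_mollify h.locallyIntegrable_u n
  contDiff_a i := contDiff_mollify (h.locallySliceL2_Du_apply i).locallyIntegrable n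
  contDiff_b := contDiff_mollify h.locallyIntegrable_ut n
  deriv_space i z := h.mollify_spaceDir i n z
  deriv_time z := h.fderiv_mollify_u_time n z
  continuous_G := (contDiff_mollify (h.locallyIntegrable_nonlin hp3 hp5) n).continuous
  wave z := by
    have := h.wave_mollify n z
    have e : ∀ i, (fun y => (inner ℝ (mollify n Du y) (EuclideanSpace.single i 1) : ℝ)) =
        mollify n fun z => Du z i := by
      intro i
      ext y
      rw [← mollify_inner h.locallyIntegrable_Du]
      simp [EuclideanSpace.inner_single_right]
    simp only [e] at this
    simp only [timeDir, spaceDir]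
    linarith

/-- The limit of the energy law for the mollified solution; the chain rule turns the nonlinear term
into the potential energy. -/
lemma integral_energy_identity (hp3 : 3 ≤ p) (hp5 : p ≤ 5) {η ηt : Spacetime → ℝ}
    {ηx : Fin 3 → Spacetime → ℝ}
    {R : ℝ} (hη : Continuous η) (hηt : Continuous ηt) (hηx : ∀ i, Continuous (ηx i))
    (hR : ∀ z, R < ‖z‖ → η z = 0) (hRt : ∀ z, R < ‖z‖ → ηt z = 0)
    (hRx : ∀ i z, R < ‖z‖ → ηx i z = 0) (hdt : ∀ z, HasLineDerivAt ℝ η (ηt z) z timeDir)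
    (hdx : ∀ i z, HasLineDerivAt ℝ η (ηx i z) z (spaceDir i)) :
    ∫ z, ηt z * energyDensity p u Du ut z = ∑ i, ∫ z, ηx i z * (ut z * Du z i) := by
  have hw := IsBoundedWeight.of_continuous hη hR
  have hwt := IsBoundedWeight.of_continuous hηt hRt
  have hwx := fun i => IsBoundedWeight.of_continuous (hηx i) (hRx i)
  have cb := h.sliceConv_ut
  have ca := h.sliceConv_Du
  have l1 := cb.tendsto_integral_mul cb hwt
  have l2 := fun i => (ca i).tendsto_integral_mul (ca i) hwt
  have l3 := fun i => cb.tendsto_integral_mul (ca i) (hwx i)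
  have l4 := cb.tendsto_integral_mollify_mul hw (h.locallyIntegrable_nonlin hp3 hp5)
    (h.nonlin_mixed hp3 hp5)
  have hlim := ((((l1.const_mul (1 / 2)).add ((tendsto_finsetSum Finset.univ fun i _ =>
    l2 i).const_mul (1 / 2))).sub (tendsto_finsetSum Finset.univ fun i _ => l3 i)).sub l4)
  have hzero : ∀ n, 1 / 2 * ∫ z, ηt z * (mollify n ut z * mollify n ut z) =
      ∑ i, (∫ z, ηx i z * (mollify n ut z * mollify n (fun z => Du z i) z)) +
      (∫ z, η z * (mollify n (nonlin p u) z * mollify n ut z)) -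
      1 / 2 * ∑ i, ∫ z, ηt z * (mollify n (fun z => Du z i) z * mollify n (fun z => Du z i) z) := by
    intro n
    have hs := h.smoothWave_mollify hp3 hp5 n
    have hid := hs.integral_energy_identity hη hηt hηx hR hRt hRx hdt hdx
    have hbc := hs.contDiff_b.continuous
    have hac := fun i => (hs.contDiff_a i).continuous
    have hGc := hs.continuous_G
    have hcs := fun {f : Spacetime → ℝ} (hf : ∀ z, R < ‖z‖ → f z = 0) => hasCompactSupport_of_ball hf
    have i1 : Integrable fun z => ηt z * (mollify n ut z * mollify n ut z) :=
      (by fun_prop : Continuous fun z => ηt z * (mollify n ut z * mollify n ut z)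
        ).integrable_of_hasCompactSupport (hcs fun z hz => by simp [hRt z hz])
    have i2 : ∀ i, Integrable fun z => ηt z *
        (mollify n (fun z => Du z i) z * mollify n (fun z => Du z i) z) := fun i =>
      (hηt.mul ((hac i).mul (hac i))).integrable_of_hasCompactSupport
        (hcs fun z hz => by simp [hRt z hz])
    have i3 : ∀ i, Integrable fun z => ηx i z *
        (mollify n ut z * mollify n (fun z => Du z i) z) := fun i =>
      ((hηx i).mul (hbc.mul (hac i))).integrable_of_hasCompactSupport
        (hcs fun z hz => by simp [hRx i z hz])
    have i4 : Integrable fun z => η z * (mollify n (nonlin p u) z * mollify n ut z) :=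
      (hη.mul (hGc.mul hbc)).integrable_of_hasCompactSupport (hcs fun z hz => by simp [hR z hz])
    have e : ∀ z, (ηt z * (1 / 2 * mollify n ut z * mollify n ut z + 1 / 2 * ∑ i,
        mollify n (fun z => Du z i) z * mollify n (fun z => Du z i) z) -
        ∑ i, ηx i z * (mollify n ut z * mollify n (fun z => Du z i) z) -
        η z * (mollify n (nonlin p u) z * mollify n ut z)) =
        1 / 2 * (ηt z * (mollify n ut z * mollify n ut z)) + 1 / 2 * (∑ i, ηt z *
          (mollify n (fun z => Du z i) z * mollify n (fun z => Du z i) z)) -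
        ∑ i, ηx i z * (mollify n ut z * mollify n (fun z => Du z i) z) -
        η z * (mollify n (nonlin p u) z * mollify n ut z) := by
      intro z
      rw [← Finset.mul_sum]
      ring
    simp_rw [e] at hid
    rw [integral_sub, integral_sub, integral_add, integral_const_mul, integral_const_mul,
      integral_finsetSum _ fun i _ => i2 i, integral_finsetSum _ fun i _ => i3 i] at hid
    · linarith
    · exact i1.const_mul _
    · exact (integrable_finsetSum Finset.univ fun i _ => i2 i).const_mul _
    · exact (i1.const_mul _).add ((integrable_finsetSum Finset.univ fun i _ => i2 i).const_mul _)
    · exact integrable_finsetSum Finset.univ fun i _ => i3 i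
    · exact ((i1.const_mul _).add ((integrable_finsetSum Finset.univ fun i _ =>
        i2 i).const_mul _)).sub (integrable_finsetSum Finset.univ fun i _ => i3 i)
    · exact i4
  have h0 := tendsto_nhds_unique hlim (tendsto_const_nhds.congr fun n => by
    show 0 = _
    rw [hzero n]
    ring)
  have hch := h.integral_nonlin_mul_deriv hp3 hp5 cb (fun n z => h.fderiv_mollify_u_time n z)
    hη hηt hR hRt hdt
  have j1 := cb.integrable_mul cb hwt
  have j2 := fun i => (ca i).integrable_mul (ca i) hwt
  have j3 := (h.integrable_weight_mul_power hp3 hp5 hwt).div_const (p + 1)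
  have e : ∀ z, ηt z * energyDensity p u Du ut z = 1 / 2 * (ηt z * (ut z * ut z)) +
      1 / 2 * (∑ i, ηt z * (Du z i * Du z i)) + ηt z * (|u z| ^ (p + 1)) / (p + 1) := by
    intro z
    have h2 : ‖Du z‖ ^ 2 = ∑ i, Du z i * Du z i := by
      rw [EuclideanSpace.norm_sq_eq]
      simp [pow_two]
    unfold energyDensity
    rw [h2, ← Finset.mul_sum]
    ring
  simp_rw [e]
  rw [integral_add, integral_add, integral_const_mul, integral_const_mul,
    integral_finsetSum _ fun i _ => j2 i]
  · simp_rw [mul_div_assoc]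
    linarith
  · exact j1.const_mul _
  · exact (integrable_finsetSum Finset.univ fun i _ => j2 i).const_mul _
  · exact (j1.const_mul _).add ((integrable_finsetSum Finset.univ fun i _ => j2 i).const_mul _)
  · exact j3

/-- The local identity for the inward (`σ = 1`) and outward (`σ = -1`) energy fields in weak
form. -/
lemma integral_radial_identity (hp3 : 3 ≤ p) (hp5 : p ≤ 5) (hσ : σ * σ = 1)
    {ψ ψr ψt : ℝ → ℝ → ℝ} {δ R : ℝ} (hψ : IsRadialTest ψ ψr ψt δ R) :
    ∫ z, (ψr ‖z.1‖ z.2 * fluxRadial p u Du ut σ z + ψt ‖z.1‖ z.2 * (σ * fluxTime p u Du ut σ z) -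
      ψ ‖z.1‖ z.2 * morawetzDensity p u Du z) = 0 := by
  have hδ := hψ.pos
  set n : Fin 3 → Spacetime → ℝ := fun i z => z.1 i * ‖z.1‖⁻¹ with hn
  -- A bounded continuous substitute for `1/|x|`, equal to it wherever `ψ` does not vanish.
  set k : Spacetime → ℝ := fun z => (max δ ‖z.1‖)⁻¹ with hk
  have hkc : Continuous k := Continuous.inv₀ (by fun_prop) fun z =>
    (lt_of_lt_of_le hδ (le_max_left _ _)).ne'
  have hkb : ∀ z, |k z| ≤ δ⁻¹ := fun z => by
    rw [abs_of_nonneg (inv_nonneg.2 (hδ.le.trans (le_max_left _ _)))]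
    exact inv_anti₀ hδ (le_max_left _ _)
  have hnm : ∀ i, Measurable (n i) := fun i => by
    have h1 : Measurable fun z : Spacetime => z.1 i := by fun_prop
    have h2 : Measurable fun z : Spacetime => ‖z.1‖⁻¹ := by fun_prop
    exact h1.mul h2
  have hnb : ∀ i z, |n i z| ≤ 1 := fun i z => by
    simp only [hn]
    rw [abs_mul, abs_inv, abs_norm, ← div_eq_mul_inv]
    exact div_le_one_of_le₀ (PiLp.norm_apply_le z.1 i) (norm_nonneg _)
  have cb := h.sliceConv_ut
  have ca := h.sliceConv_Du
  have can : ∀ i, SliceConv (fun m z => mollify m (fun z => Du z i) z * n i z)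
      (fun z => Du z i * n i z) := fun i => by
    simpa only [mul_comm] using (ca i).bdd_mul (hnm i) (hnb i)
  have cq : SliceConv (fun m z => ∑ i, mollify m (fun z => Du z i) z * n i z)
      (fun z => ∑ i, Du z i * n i z) := by
    simp only [Fin.sum_univ_three]
    exact ((can 0).add (can 1)).add (can 2)
  have cuk : SliceConv (fun m z => mollify m u z * k z) (fun z => u z * k z) := by
    simpa only [mul_comm] using h.sliceConv_u.bdd_mul hkc.measurable hkb
  have cQ := (cq.add cuk).add (cb.bdd_mul measurable_const (M := |σ|) fun _ => le_rfl)
  set q := fun z => ∑ i, Du z i * n i z with hq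
  set Q := fun z => q z + u z * k z + σ * ut z with hQ
  set qs := fun m z => ∑ i, mollify m (fun z => Du z i) z * n i z with hqs
  set Qs := fun m z => qs m z + mollify m u z * k z + σ * mollify m ut z with hQs
  have hrad : ∀ {χ : ℝ → ℝ → ℝ}, Continuous (Function.uncurry χ) →
      Continuous fun z : Spacetime => χ ‖z.1‖ z.2 := fun hχ =>
    hχ.comp (by fun_prop : Continuous fun z : Spacetime => (‖z.1‖, z.2))
  have c0 := hrad hψ.continuous
  have cr := hrad hψ.continuous_r
  have ct := hrad hψ.continuous_t
  set wQ : Spacetime → ℝ := fun z => -(1 / 4) * ψr ‖z.1‖ z.2 + 1 / 4 * (σ * ψt ‖z.1‖ z.2) with hwQ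
  set wS := fun z => 1 / 4 * ψr ‖z.1‖ z.2 + 1 / 4 * (σ * ψt ‖z.1‖ z.2) -
    1 / 2 * (ψ ‖z.1‖ z.2 * k z) with hwS
  set w0 : Spacetime → ℝ := fun z => ψ ‖z.1‖ z.2 with hw0
  have bQ : IsBoundedWeight wQ := IsBoundedWeight.of_continuous
    ((continuous_const.mul cr).add (continuous_const.mul (continuous_const.mul ct)))
    fun z hz => by
      obtain ⟨h1, h2, h3⟩ := hψ.eq_zero_of_ball hz
      simp [hwQ, h2, h3]
  have bS : IsBoundedWeight wS := IsBoundedWeight.of_continuous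
    (((continuous_const.mul cr).add (continuous_const.mul (continuous_const.mul ct))).sub
      (continuous_const.mul (c0.mul hkc)))
    fun z hz => by
      obtain ⟨h1, h2, h3⟩ := hψ.eq_zero_of_ball hz
      simp [hwS, h1, h2, h3]
  have b0 := IsBoundedWeight.of_continuous c0 fun z hz => (hψ.eq_zero_of_ball hz).1
  -- passage to the limit in the identity for the mollified solution
  have l1 := cQ.tendsto_integral_mul cQ bQ
  have l2 := fun i => (ca i).tendsto_integral_mul (ca i) bS
  have l3 := cq.tendsto_integral_mul cq bS
  have l4 := cQ.tendsto_integral_mollify_mul b0 (h.locallyIntegrable_nonlin hp3 hp5)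
    (h.nonlin_mixed hp3 hp5)
  have hlim := ((l1.add (tendsto_finsetSum Finset.univ fun i _ => l2 i)).sub l3).sub
    (l4.const_mul (1 / 2))
  have hzero : ∀ m, ((∫ z, wQ z * (Qs m z * Qs m z)) + (∑ i, ∫ z, wS z *
      (mollify m (fun z => Du z i) z * mollify m (fun z => Du z i) z)) -
      (∫ z, wS z * (qs m z * qs m z))) -
      1 / 2 * ∫ z, w0 z * (mollify m (nonlin p u) z * Qs m z) = 0 := by
    intro m
    have hs := h.smoothWave_mollify hp3 hp5 m
    have hid := hs.integral_radial_identity hσ hψ (fun _ => rfl) rfl rfl rfl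
    have i1 := bQ.integrable_mul_of_memLp (cQ.memLp_seq m) (cQ.memLp_seq m)
    have i2 := fun i => bS.integrable_mul_of_memLp ((ca i).memLp_seq m) ((ca i).memLp_seq m)
    have i3 := bS.integrable_mul_of_memLp (cq.memLp_seq m) (cq.memLp_seq m)
    have i4 : Integrable fun z => w0 z * (mollify m (nonlin p u) z * Qs m z) := by
      have b : IsBoundedWeight fun z => w0 z * mollify m (nonlin p u) z :=
        IsBoundedWeight.of_continuous (R := R) (c0.mul hs.continuous_G) fun z hz => by
          simp [hw0, (hψ.eq_zero_of_ball hz).1]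
      refine (b.integrable_mul_of_memLp (cQ.memLp_seq m)
        ((SliceConv.const 1).memLp)).congr (.of_forall fun z => ?_)
      simp only [hQs]
      ring
    have s2 := integrable_finsetSum Finset.univ fun i _ => i2 i
    refine Eq.trans (b := ∫ z, (wQ z * (Qs m z * Qs m z) + (∑ i, wS z *
        (mollify m (fun z => Du z i) z * mollify m (fun z => Du z i) z)) -
        wS z * (qs m z * qs m z) -
        1 / 2 * (w0 z * (mollify m (nonlin p u) z * Qs m z)))) (Eq.symm ?_) ?_
    · rw [integral_sub, integral_sub, integral_add i1 s2, integral_finsetSum _ fun i _ => i2 i,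
        integral_const_mul]
      exacts [i1.add s2, i3, (i1.add s2).sub i3, i4.const_mul _]
    rw [← hid]
    congr 1
    ext z
    by_cases hz : ‖z.1‖ ≤ δ
    · obtain ⟨h1, h2, h3⟩ := hψ.vanish ‖z.1‖ z.2 (Or.inl hz)
      simp [hwQ, hwS, hw0, h1, h2, h3]
    · have hkz : k z = ‖z.1‖⁻¹ := by simp only [hk]; rw [max_eq_right (le_of_not_ge hz)]
      simp only [hwS, hQs, hqs, hkz, Fin.sum_univ_three]
      ring
  have h0 := tendsto_nhds_unique hlim (tendsto_const_nhds.congr fun m => (hzero m).symm)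
  -- the chain rule
  have hn1 : ∀ z : Spacetime, z.1 ≠ 0 → ∑ i, n i z * n i z = 1 := fun z hz => sum_dir_mul_self hz
  have hvan0 := fun r t hr => (hψ.vanish r t (Or.inl hr)).1
  have hvanr := fun r t hr => (hψ.vanish r t (Or.inl hr)).2.1
  have hkinv : ContinuousOn (fun z : Spacetime => ‖z.1‖⁻¹) {z | z.1 ≠ 0} :=
    ContinuousOn.inv₀ (by fun_prop) fun z hz => norm_ne_zero_iff.2 hz
  have hnc : ∀ i, ContinuousOn (n i) {z | z.1 ≠ 0} := fun i => ContinuousOn.mul (by fun_prop) hkinv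
  -- The derivative of `ψ xᵢ/|x|` in direction `i`. Summed over `i` it is `ψr + 2 ψ/|x|`. The term
  -- `2/|x|` combines with `|u|^(p+1)/|x|`, which comes from the part `u/|x|` of `Q`, into the
  -- Morawetz coefficient `½ (1 - 2/(p+1)) = (p-1)/(2(p+1))`.
  set ηx := fun i z => ψr ‖z.1‖ z.2 * (n i z * n i z) +
    ψ ‖z.1‖ z.2 * ((1 - n i z * n i z) * ‖z.1‖⁻¹) with hηx
  have cηx : ∀ i, Continuous (ηx i) := fun i =>
    (hψ.continuous_mul hψ.continuous_r hvanr ((hnc i).mul (hnc i))).add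
      (hψ.continuous_mul hψ.continuous hvan0 ((continuousOn_const.sub
        ((hnc i).mul (hnc i))).mul hkinv))
  have zηx : ∀ i z, R < ‖z‖ → ηx i z = 0 := fun i z hz => by
    obtain ⟨h1, h2, h3⟩ := hψ.eq_zero_of_ball hz
    simp [hηx, h1, h2]
  have cx : ∀ i, ∫ z, w0 z * n i z * (nonlin p u z * Du z i) =
      -∫ z, ηx i z * (|u z| ^ (p + 1) / (p + 1)) := fun i =>
    h.integral_nonlin_mul_deriv hp3 hp5 (ca i) (fun m z => h.mollify_spaceDir i m z)
      (hψ.continuous_mul hψ.continuous hvan0 (hnc i)) (cηx i)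
      (fun z hz => by simp [hw0, (hψ.eq_zero_of_ball hz).1]) (zηx i) fun z => by
        by_cases hz : z.1 = 0
        · exact hasLineDerivAt_near_axis hδ (fun y hy => by
            simp [hw0, hηx, hvan0 _ _ hy, hvanr _ _ hy]) hz _
        · refine HasDerivAt.congr_deriv (hasLineDerivAt_mul (hasLineDerivAt_radial hψ i hz)
            (hasLineDerivAt_dir i i hz)) ?_
          simp only [hηx, if_true, hn]
          ring
  have cxt : ∫ z, w0 z * (nonlin p u z * ut z) = -∫ z, ψt ‖z.1‖ z.2 * (|u z| ^ (p + 1) / (p + 1)) :=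
    h.integral_nonlin_mul_deriv hp3 hp5 cb (fun m z => h.fderiv_mollify_u_time m z) c0 ct
      (fun z hz => (hψ.eq_zero_of_ball hz).1) (fun z hz => (hψ.eq_zero_of_ball hz).2.2) fun z => by
        by_cases hz : z.1 = 0
        · exact hasLineDerivAt_near_axis (f' := fun z => ψt ‖z.1‖ z.2) hδ (fun y hy =>
            ⟨hvan0 _ _ hy, (hψ.vanish _ _ (Or.inl hy)).2.2⟩) hz _
        · exact hasLineDerivAt_radial_time hψ hz
  -- collecting the terms
  have bt : IsBoundedWeight fun z => ψt ‖z.1‖ z.2 :=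
    IsBoundedWeight.of_continuous ct fun z hz => (hψ.eq_zero_of_ball hz).2.2
  have b0k : IsBoundedWeight fun z => w0 z * k z :=
    IsBoundedWeight.of_continuous (R := R) (c0.mul hkc) fun z hz => by
      simp [hw0, (hψ.eq_zero_of_ball hz).1]
  have i1 := cQ.integrable_mul cQ bQ
  have i2 := fun i => (ca i).integrable_mul (ca i) bS
  have i3 := cq.integrable_mul cq bS
  have hU : ∀ {w : Spacetime → ℝ}, IsBoundedWeight w →
      Integrable fun z => w z * (|u z| ^ (p + 1) / (p + 1)) := fun hw => by
    exact ((h.integrable_weight_mul_power hp3 hp5 hw).div_const (p + 1)).congr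
      (.of_forall fun z => mul_div_assoc _ _ _)
  have j1 := fun i => (can i).integrable_mixed_mul b0 h.aesm_nonlin (h.nonlin_mixed hp3 hp5)
  have j2 := cuk.integrable_mixed_mul b0 h.aesm_nonlin (h.nonlin_mixed hp3 hp5)
  have j3 := cb.integrable_mixed_mul b0 h.aesm_nonlin (h.nonlin_mixed hp3 hp5)
  have e4 : ∫ z, w0 z * (nonlin p u z * Q z) = (∑ i, ∫ z, w0 z * n i z * (nonlin p u z * Du z i)) +
      (∫ z, w0 z * k z * |u z| ^ (p + 1)) + σ * ∫ z, w0 z * (nonlin p u z * ut z) := by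
    have hpow := fun z => nonlin_mul_self (u := u) (by linarith : 0 ≤ p) z
    have j1' : ∀ i, Integrable fun z => w0 z * n i z * (nonlin p u z * Du z i) := fun i =>
      (j1 i).congr (.of_forall fun z => by ring)
    have j2' : Integrable fun z => w0 z * k z * |u z| ^ (p + 1) :=
      j2.congr (.of_forall fun z => by simp only [← hpow]; ring)
    have s1 := integrable_finsetSum Finset.univ fun i _ => j1' i
    refine Eq.trans (b := ∫ z, ((∑ i, w0 z * n i z * (nonlin p u z * Du z i)) +
        w0 z * k z * |u z| ^ (p + 1) + σ * (w0 z * (nonlin p u z * ut z)))) ?_ (Eq.symm ?_)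
    swap
    · rw [integral_add, integral_add s1 j2', integral_finsetSum _ fun i _ => j1' i,
        integral_const_mul]
      exacts [s1.add j2', j3.const_mul σ]
    congr 1
    ext z
    simp only [hQ, hq, Fin.sum_univ_three, ← hpow]
    ring
  have bx := fun i => IsBoundedWeight.of_continuous (cηx i) (zηx i)
  rw [e4, cxt] at h0
  simp_rw [cx] at h0
  rw [Finset.sum_neg_distrib] at h0
  have k1 := hU bt
  have k2 := fun i => hU (bx i)
  have k3 := h.integrable_weight_mul_power hp3 hp5 b0k
  have hfin : (∫ z, wQ z * (Q z * Q z)) + (∑ i, ∫ z, wS z * (Du z i * Du z i)) -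
      (∫ z, wS z * (q z * q z)) - 1 / 2 * (-∑ i, (∫ z, ηx i z * (|u z| ^ (p + 1) / (p + 1))) +
      (∫ z, w0 z * k z * |u z| ^ (p + 1)) +
      σ * -∫ z, ψt ‖z.1‖ z.2 * (|u z| ^ (p + 1) / (p + 1))) =
      ∫ z, (wQ z * (Q z * Q z) + (∑ i, wS z * (Du z i * Du z i)) - wS z * (q z * q z) +
        1 / 2 * (∑ i, ηx i z * (|u z| ^ (p + 1) / (p + 1))) -
        1 / 2 * (w0 z * k z * |u z| ^ (p + 1)) +
        σ / 2 * (ψt ‖z.1‖ z.2 * (|u z| ^ (p + 1) / (p + 1)))) := by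
    have s2 := integrable_finsetSum Finset.univ fun i _ => i2 i
    have s4 := (integrable_finsetSum Finset.univ fun i _ => k2 i).const_mul (1 / 2)
    rw [integral_add, integral_sub, integral_add, integral_sub, integral_add i1 s2,
      integral_finsetSum _ fun i _ => i2 i, integral_const_mul, integral_const_mul,
      integral_const_mul, integral_finsetSum _ fun i _ => k2 i]
    · ring
    exacts [i1.add s2, i3, (i1.add s2).sub i3, s4, ((i1.add s2).sub i3).add s4, k3.const_mul _,
      (((i1.add s2).sub i3).add s4).sub (k3.const_mul _), k1.const_mul _]
  rw [hfin] at h0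
  rw [← h0]
  congr 1
  ext z
  by_cases hz : ‖z.1‖ ≤ δ
  · obtain ⟨h1, h2, h3⟩ := hψ.vanish ‖z.1‖ z.2 (Or.inl hz)
    simp [hwQ, hwS, hw0, hηx, h1, h2, h3]
  · have hkz : k z = ‖z.1‖⁻¹ := by simp only [hk]; rw [max_eq_right (le_of_not_ge hz)]
    have hz0 : z.1 ≠ 0 := fun h0 => hz (by rw [h0, norm_zero]; exact hδ.le)
    have hN := hn1 z hz0
    have eq : radialDeriv Du z = q z := radialDeriv_eq_sum Du z
    have eS := norm_angularGrad_sq Du hz0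
    have ex : ∑ i, ηx i z * (|u z| ^ (p + 1) / (p + 1)) =
        (ψr ‖z.1‖ z.2 + 2 * (ψ ‖z.1‖ z.2 * ‖z.1‖⁻¹)) * (|u z| ^ (p + 1) / (p + 1)) := by
      rw [← Finset.sum_mul]
      congr 1
      rw [Fin.sum_univ_three] at hN ⊢
      linear_combination (ψr ‖z.1‖ z.2 - ψ ‖z.1‖ z.2 * ‖z.1‖⁻¹) * hN
    rw [ex, ← Finset.mul_sum]
    simp only [fluxRadial, fluxTime, morawetzDensity, sideDensity, nullDeriv, hQ, hkz, eS, eq,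
      hwS, hw0]
    generalize |u z| ^ (p + 1) = U
    field_simp
    ring

end IsFiniteEnergySolution

end RadialIdentity

/-! ### Continuity in time -/

section TimeContinuity

lemma memLp_bdd_mul {α : Type*} [MeasurableSpace α] {μ : Measure α} {q : ℝ≥0∞} {c f : α → ℝ}
    (hf : MemLp f q μ) (hc : AEStronglyMeasurable c μ) {M : ℝ} (hM : ∀ x, ‖c x‖ ≤ M) :
    MemLp (fun x => c x * f x) q μ :=
  hf.of_le_mul (hc.mul hf.1) (.of_forall fun x => by
    rw [norm_mul]
    exact mul_le_mul_of_nonneg_right (hM x) (norm_nonneg _))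

lemma norm_sq_eq_sum (y : E3) : ‖y‖ ^ 2 = ∑ i, y i * y i := by
  rw [EuclideanSpace.norm_sq_eq]
  simp [pow_two]

/-- A function on space-time that is a continuous function of time with values in `L²(ℝ³)`. -/
structure L2Continuous (F : Spacetime → ℝ) : Prop where
  memLp : ∀ t : ℝ, MemLp (fun x : E3 => F (x, t)) 2 volume
  lim : ∀ t₀ : ℝ, Tendsto (fun t : ℝ => eLpNorm (fun x : E3 => F (x, t) - F (x, t₀)) 2 volume)
    (𝓝 t₀) (𝓝 0)

variable {F H : Spacetime → ℝ}

lemma L2Continuous.add (hF : L2Continuous F) (hH : L2Continuous H) :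
    L2Continuous fun z => F z + H z where
  memLp t := (hF.memLp t).add (hH.memLp t)
  lim t₀ := by
    have h0 := (hF.lim t₀).add (hH.lim t₀)
    rw [add_zero] at h0
    refine tendsto_zero_of_le h0 fun t => ?_
    have e : (fun x => F (x, t) + H (x, t) - (F (x, t₀) + H (x, t₀))) =
        (fun x => F (x, t) - F (x, t₀)) + fun x => H (x, t) - H (x, t₀) := by
      ext x; simp only [Pi.add_apply]; ring
    simp only [e]
    exact eLpNorm_add_le ((hF.memLp t).sub (hF.memLp t₀)).1 ((hH.memLp t).sub (hH.memLp t₀)).1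
      (by norm_num)

lemma L2Continuous.of_norm_le {c : E3 → ℝ} (hc : Measurable c) {M : ℝ} (hM : ∀ x, |c x| ≤ M)
    (hF : L2Continuous F) : L2Continuous fun z => c z.1 * F z where
  memLp t := memLp_bdd_mul (hF.memLp t) hc.aestronglyMeasurable hM
  lim t₀ := by
    have h0 := Tendsto.const_mul (hF.lim t₀) (Or.inr (ofReal_ne_top (r := M)))
    rw [mul_zero] at h0
    refine tendsto_zero_of_le h0 fun t => ?_
    refine eLpNorm_le_mul_eLpNorm_of_ae_le_mul (.of_forall fun x => ?_) 2
    rw [← mul_sub, norm_mul]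
    exact mul_le_mul_of_nonneg_right (hM x) (norm_nonneg _)

lemma L2Continuous.continuous_integral_mul (hF : L2Continuous F) {c : E3 → ℝ} (hc : Measurable c)
    {M : ℝ} (hM : ∀ x, |c x| ≤ M) :
    Continuous fun t => ∫ x, c x * (F (x, t) * F (x, t)) := by
  refine continuous_iff_continuousAt.2 fun t₀ => tendsto_of_seq_tendsto fun s hs => ?_
  have hcF := hF.of_norm_le hc hM
  have := tendsto_integral_mul_of_L2 (hcF.memLp t₀) (hF.memLp t₀) (fun n => hcF.memLp (s n))
    (fun n => hF.memLp (s n)) ((hcF.lim t₀).comp hs) ((hF.lim t₀).comp hs)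
  simpa only [mul_assoc, Function.comp_def] using this

lemma L2Continuous.integrable_mul (hF : L2Continuous F) {c : E3 → ℝ} (hc : Measurable c)
    {M : ℝ} (hM : ∀ x, |c x| ≤ M) (t : ℝ) :
    Integrable fun x => c x * (F (x, t) * F (x, t)) :=
  (integrable_mul_of_memLp_two (hF.memLp t) (hF.memLp t)).bdd_mul hc.aestronglyMeasurable
    (.of_forall hM)

namespace IsFiniteEnergySolution

variable {p : ℝ} {u : Spacetime → ℝ} {Du : Spacetime → E3} {ut : Spacetime → ℝ}
  (h : IsFiniteEnergySolution p u Du ut)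
include h

lemma l2Continuous_ut : L2Continuous ut := ⟨h.memLp_ut, h.continuous_ut⟩

lemma l2Continuous_Du (i : Fin 3) : L2Continuous fun z => Du z i where
  memLp t := by
    refine (h.memLp_Du t).mono ((EuclideanSpace.proj i).continuous.comp_aestronglyMeasurable
      (h.memLp_Du t).1) (.of_forall fun x => PiLp.norm_apply_le (Du (x, t)) i)
  lim t₀ := by
    refine tendsto_zero_of_le (h.continuous_Du t₀) fun t => eLpNorm_mono fun x => ?_
    exact PiLp.norm_apply_le (Du (x, t) - Du (x, t₀)) i

lemma l2Continuous_u_div : L2Continuous fun z => u z / ‖z.1‖ where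
  memLp t := (h.weakGradient t).memLp_div_norm (h.memLp_u t) (h.memLp_Du t)
  lim t₀ := by
    have h0 := Tendsto.const_mul (h.continuous_Du t₀) (a := 2) (Or.inr (by simp))
    rw [mul_zero] at h0
    refine tendsto_zero_of_le h0 fun t => ?_
    have hs := (h.weakGradient t).sub (h.weakGradient t₀)
      ((h.memLp_u t).locallyIntegrable (by norm_num))
      ((h.memLp_Du t).locallyIntegrable (by norm_num))
      ((h.memLp_u t₀).locallyIntegrable (by norm_num))
      ((h.memLp_Du t₀).locallyIntegrable (by norm_num))
    have := hs.eLpNorm_div_norm_le ((h.memLp_u t).sub (h.memLp_u t₀))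
      ((h.memLp_Du t).sub (h.memLp_Du t₀))
    simpa only [sub_div, Pi.sub_apply, Pi.sub_def] using this

lemma l2Continuous_radialDeriv : L2Continuous (radialDeriv Du) := by
  have hn := fun i => by
    refine (h.l2Continuous_Du i).of_norm_le (c := fun x => x i * ‖x‖⁻¹) (M := 1) ?_ fun x => ?_
    · have h1 : Measurable fun x : E3 => x i := by fun_prop
      have h2 : Measurable fun x : E3 => ‖x‖⁻¹ := by fun_prop
      exact h1.mul h2
    · rw [abs_mul, abs_inv, abs_norm, ← div_eq_mul_inv]
      exact div_le_one_of_le₀ (PiLp.norm_apply_le x i) (norm_nonneg _)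
  have e : radialDeriv Du = fun z => z.1 0 * ‖z.1‖⁻¹ * Du z 0 + z.1 1 * ‖z.1‖⁻¹ * Du z 1 +
      z.1 2 * ‖z.1‖⁻¹ * Du z 2 := by
    ext z
    rw [radialDeriv_eq_sum, Fin.sum_univ_three]
    ring
  rw [e]
  exact ((hn 0).add (hn 1)).add (hn 2)

lemma l2Continuous_nullDeriv (σ : ℝ) : L2Continuous (nullDeriv u Du ut σ) :=
  (h.l2Continuous_radialDeriv.add h.l2Continuous_u_div).add
    (h.l2Continuous_ut.of_norm_le measurable_const fun _ => le_rfl)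

lemma memLp_power_ball (hp5 : p ≤ 5) (R t : ℝ) : MemLp (fun x => u (x, t)) (ENNReal.ofReal (p + 1))
      (volume.restrict (closedBall 0 R)) := by
  have hle : ENNReal.ofReal (p + 1) ≤ 6 := by
    rw [show 6 = ENNReal.ofReal 6 by norm_num]
    exact ofReal_le_ofReal (by linarith)
  have : IsFiniteMeasure (volume.restrict (closedBall (0 : E3) R)) :=
    ⟨by simpa using (isCompact_closedBall (0 : E3) R).measure_lt_top (μ := volume)⟩
  exact (h.memLp_u t).restrict _ |>.mono_exponent hle

/-- The weight is moved inside the norm as `c^(1/(p+1))`. On a ball, continuity in `L^(p+1)` follows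
from continuity in `L⁶`, since `p + 1 ≤ 6`. -/
lemma continuous_integral_power_ball (hp3 : 3 ≤ p) (hp5 : p ≤ 5) {c : E3 → ℝ} (hc : Measurable c)
    (hc0 : ∀ x, 0 ≤ c x) (hc1 : ∀ x, c x ≤ 1) {R : ℝ} (hR : ∀ x, R < ‖x‖ → c x = 0) :
    (∀ t, Integrable fun x => c x * |u (x, t)| ^ (p + 1)) ∧
      Continuous fun t => ∫ x, c x * |u (x, t)| ^ (p + 1) := by
  have hp1 : 0 < p + 1 := by linarith
  set q := ENNReal.ofReal (p + 1) with hq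
  have hq0 : q ≠ 0 := by rw [hq, Ne, ofReal_eq_zero]; linarith
  have hqt := toReal_ofReal hp1.le
  have hq6 : q ≤ 6 := by
    rw [show 6 = ENNReal.ofReal 6 by norm_num]
    exact ofReal_le_ofReal (by linarith)
  have hq1 : 1 ≤ q := by
    rw [show 1 = ENNReal.ofReal 1 by norm_num]
    exact ofReal_le_ofReal (by linarith)
  set μ := volume.restrict (closedBall (0 : E3) R) with hμ
  set d := fun x => c x ^ (p + 1)⁻¹ with hd
  have hdm : Measurable d := hc.pow_const _
  have hd1 : ∀ x, ‖d x‖ ≤ 1 := fun x => by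
    rw [Real.norm_of_nonneg (Real.rpow_nonneg (hc0 x) _)]
    exact Real.rpow_le_one (hc0 x) (hc1 x) (inv_nonneg.2 hp1.le)
  have hmem : ∀ t, MemLp (fun x => d x * u (x, t)) q μ := fun t =>
    memLp_bdd_mul (h.memLp_power_ball hp5 R t) hdm.aestronglyMeasurable hd1
  have hpow : ∀ t x, ‖d x * u (x, t)‖ ^ q.toReal = c x * |u (x, t)| ^ (p + 1) := by
    intro t x
    rw [hqt, norm_mul, Real.mul_rpow (norm_nonneg _) (norm_nonneg _), Real.norm_eq_abs,
      abs_of_nonneg (Real.rpow_nonneg (hc0 x) _), ← Real.rpow_mul (hc0 x),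
      inv_mul_cancel₀ hp1.ne', Real.rpow_one, Real.norm_eq_abs]
  have hint := fun t => by simpa only [hpow] using (hmem t).integrable_norm_rpow hq0 ofReal_ne_top
  have hsupp : ∀ t, ∀ x ∉ closedBall 0 R, c x * |u (x, t)| ^ (p + 1) = 0 :=
    fun t x hx => by rw [hR x (by simpa using hx), zero_mul]
  have hglob : ∀ t, ∫ x, c x * |u (x, t)| ^ (p + 1) = ∫ x, c x * |u (x, t)| ^ (p + 1) ∂μ := fun t =>
    (setIntegral_eq_integral_of_forall_compl_eq_zero (hsupp t)).symm
  have hnorm : ∀ t, ∫ x, c x * |u (x, t)| ^ (p + 1) =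
      (eLpNorm (fun x => d x * u (x, t)) q μ).toReal ^ (p + 1) := by
    intro t
    rw [hglob, (hmem t).eLpNorm_eq_integral_rpow_norm hq0 ofReal_ne_top]
    simp only [hpow]
    have h0 : 0 ≤ ∫ x, c x * |u (x, t)| ^ (p + 1) ∂μ :=
      integral_nonneg fun x => mul_nonneg (hc0 x) (Real.rpow_nonneg (abs_nonneg _) _)
    rw [toReal_ofReal (Real.rpow_nonneg h0 _), hqt, ← Real.rpow_mul h0,
      inv_mul_cancel₀ hp1.ne', Real.rpow_one]
  refine ⟨fun t => ?_, ?_⟩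
  · refine (integrableOn_iff_integrable_of_support_subset fun x hx => ?_).1 (hint t)
    by_contra hx'
    exact hx (hsupp t x hx')
  · simp_rw [hnorm]
    refine Continuous.rpow_const ?_ fun _ => Or.inr hp1.le
    refine continuous_iff_continuousAt.2 fun t₀ => ?_
    refine (tendsto_toReal (hmem t₀).2.ne).comp ?_
    refine tendsto_eLpNorm_of_tendsto_sub hq1 (fun t => (hmem t).1) (hmem t₀) ?_
    have h0 := Tendsto.mul_const (h.continuous_u t₀)
      (b := volume (closedBall (0 : E3) R) ^ (1 / q.toReal - 1 / (6 : ℝ≥0∞).toReal))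
      (Or.inr (rpow_lt_top_of_nonneg (by
        rw [hqt, sub_nonneg]
        norm_num
        rw [inv_eq_one_div, div_le_div_iff₀ (by norm_num) hp1]
        linarith) (isCompact_closedBall _ _).measure_lt_top.ne).ne)
    rw [zero_mul] at h0
    refine tendsto_zero_of_le h0 fun t => ?_
    refine le_trans (eLpNorm_mono (g := fun x => u (x, t) - u (x, t₀)) fun x => ?_)
      (eLpNorm_restrict_ball_le ((h.memLp_u t).sub (h.memLp_u t₀)).1 hq6 R)
    rw [← mul_sub, norm_mul]
    exact mul_le_of_le_one_left (norm_nonneg _) (hd1 x)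

lemma continuous_integral_energyDensity_ball (hp3 : 3 ≤ p) (hp5 : p ≤ 5) {c : E3 → ℝ}
    (hc : Measurable c) (hc0 : ∀ x, 0 ≤ c x) (hc1 : ∀ x, c x ≤ 1) {R : ℝ}
    (hR : ∀ x, R < ‖x‖ → c x = 0) :
    (∀ t, Integrable fun x => c x * energyDensity p u Du ut (x, t)) ∧
      Continuous fun t => ∫ x, c x * energyDensity p u Du ut (x, t) := by
  have hM : ∀ x, |c x| ≤ 1 := fun x => by rw [abs_of_nonneg (hc0 x)]; exact hc1 x
  obtain ⟨i1, k1⟩ := h.continuous_integral_power_ball hp3 hp5 hc hc0 hc1 hR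
  have i2 := h.l2Continuous_ut.integrable_mul hc hM
  have k2 := h.l2Continuous_ut.continuous_integral_mul hc hM
  have i3 := fun i => (h.l2Continuous_Du i).integrable_mul hc hM
  have k3 := fun i => (h.l2Continuous_Du i).continuous_integral_mul hc hM
  have e : ∀ x t, c x * energyDensity p u Du ut (x, t) =
      1 / 2 * (∑ i, c x * (Du (x, t) i * Du (x, t) i)) + 1 / 2 * (c x * (ut (x, t) * ut (x, t))) +
      c x * |u (x, t)| ^ (p + 1) / (p + 1) := by
    intro x t
    unfold energyDensity
    rw [norm_sq_eq_sum, ← Finset.mul_sum]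
    ring
  have j3 := fun t => integrable_finsetSum Finset.univ fun i _ => i3 i t
  simp_rw [e]
  refine ⟨fun t => (((j3 t).const_mul _).add ((i2 t).const_mul _)).add ((i1 t).div_const _), ?_⟩
  have e2 : ∀ t, ∫ x, (1 / 2 * (∑ i, c x * (Du (x, t) i * Du (x, t) i)) +
      1 / 2 * (c x * (ut (x, t) * ut (x, t))) + c x * |u (x, t)| ^ (p + 1) / (p + 1)) =
      1 / 2 * (∑ i, ∫ x, c x * (Du (x, t) i * Du (x, t) i)) +
      1 / 2 * (∫ x, c x * (ut (x, t) * ut (x, t))) +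
      (∫ x, c x * |u (x, t)| ^ (p + 1)) / (p + 1) := by
    intro t
    rw [integral_add, integral_add, integral_const_mul, integral_const_mul, integral_div,
      integral_finsetSum _ fun i _ => i3 i t]
    exacts [(j3 t).const_mul _, (i2 t).const_mul _, ((j3 t).const_mul _).add ((i2 t).const_mul _),
      (i1 t).div_const _]
  simp_rw [e2]
  fun_prop

end IsFiniteEnergySolution

end TimeContinuity

/-! ### Conservation of energy -/

section EnergyConservation

namespace IsFiniteEnergySolution

variable {p : ℝ} {u : Spacetime → ℝ} {Du : Spacetime → E3} {ut : Spacetime → ℝ}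
  (h : IsFiniteEnergySolution p u Du ut)
include h

lemma energyDensity_nonneg (hp3 : 3 ≤ p) (z : Spacetime) : 0 ≤ energyDensity p u Du ut z := by
  unfold energyDensity
  positivity

lemma integrable_weight_mul_energyDensity (hp3 : 3 ≤ p) (hp5 : p ≤ 5) {w : Spacetime → ℝ}
    (hw : IsBoundedWeight w) : Integrable fun z => w z * energyDensity p u Du ut z := by
  have j1 := h.sliceConv_ut.integrable_mul h.sliceConv_ut hw
  have j2 := fun i => (h.sliceConv_Du i).integrable_mul (h.sliceConv_Du i) hw
  have j3 := (h.integrable_weight_mul_power hp3 hp5 hw).div_const (p + 1)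
  refine (((j1.const_mul (1 / 2)).add ((integrable_finsetSum Finset.univ fun i _ =>
    j2 i).const_mul (1 / 2))).add j3).congr (.of_forall fun z => ?_)
  simp only [Pi.add_apply, energyDensity]
  rw [norm_sq_eq_sum, ← Finset.mul_sum]
  ring

/-- The energy law is tested with a cutoff at scale `R` times a time cutoff that tends to the
indicator function of `(a, b)`. The flux term carries the gradient of the cutoff, of size `1/R`,
while `ut` and `Du` are square integrable on the slab. -/
lemma exists_cutoff_energy_sub_le (hp3 : 3 ≤ p) (hp5 : p ≤ 5) {a b : ℝ} (hab : a < b) :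
    ∃ K, ∀ R, 0 < R → |(∫ x, cutoff R x * energyDensity p u Du ut (x, a)) -
        ∫ x, cutoff R x * energyDensity p u Du ut (x, b)| ≤ K / R := by
  obtain ⟨C, hC0, hC⟩ := exists_norm_fderiv_cutoff_le
  let T := |a| + |b|
  have hT : ∀ t ∈ Icc a b, |t| ≤ T := fun t ht => abs_le.2
    ⟨by linarith [neg_abs_le a, abs_nonneg b, ht.1], by linarith [le_abs_self b, abs_nonneg a, ht.2]⟩
  have hT0 : 0 ≤ T := by positivity
  let S : Set Spacetime := {z | |z.2| ≤ T}
  have hS : MeasurableSet S := measurableSet_le measurable_snd.abs measurable_const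
  have hI := (h.memLp_ut_slab T).integrable_sq.add (h.memLp_Du_slab T).norm.integrable_sq
  refine ⟨∑ i : Fin 3, C * ∫ z in S, (ut z ^ 2 + ‖Du z‖ ^ 2), fun R hR => ?_⟩
  have hcc := (contDiff_cutoff R).continuous
  have hcz : ∀ x, 2 * R < ‖x‖ → cutoff R x = 0 := fun x hx => cutoff_eq_zero hR hx.le
  obtain ⟨hiR, hcR⟩ := h.continuous_integral_energyDensity_ball hp3 hp5 hcc.measurable
    (fun x => cutoff_nonneg R x) (fun x => cutoff_le_one R x) hcz
  obtain ⟨γ, γ', hγ'c, hγd, hγ0, hγ1, hγs, -, hγlim⟩ := exists_smooth_indicator hab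
  have hγc := fun n => continuous_iff_continuousAt.2 fun t => (hγd n t).continuousAt
  have hγz := fun n t (ht : t ∉ Icc a b) => hγs n t fun h => ht (Ioo_subset_Icc_self h)
  have hLz : ∀ z : Spacetime, 2 * R + T < ‖z‖ → 2 * R < ‖z.1‖ ∨ z.2 ∉ Icc a b := by
    intro z hz
    rw [Prod.norm_def, lt_max_iff] at hz
    exact hz.imp (fun hz => by linarith) fun hz hm => by linarith [hT _ hm, Real.norm_eq_abs z.2]
  set cd := fun i x => fderiv ℝ (cutoff R) x (EuclideanSpace.single i 1) with hcd
  have hcdc : ∀ i, Continuous (cd i) := fun i =>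
    ((contDiff_cutoff R).continuous_fderiv (by simp)).clm_apply continuous_const
  have hcdb : ∀ i x, |cd i x| ≤ C / R := fun i x => by
    refine ((fderiv ℝ (cutoff R) x).le_opNorm _).trans ?_
    simpa using hC R hR x
  have key : ∀ n, |∫ t, γ' n t * ∫ x, cutoff R x * energyDensity p u Du ut (x, t)| ≤
      (∑ i : Fin 3, C * ∫ z in S, (ut z ^ 2 + ‖Du z‖ ^ 2)) / R := by
    intro n
    have hη : Continuous fun z : Spacetime => cutoff R z.1 * γ n z.2 :=
      (hcc.comp continuous_fst).mul ((hγc n).comp continuous_snd)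
    have hηt : Continuous fun z : Spacetime => cutoff R z.1 * γ' n z.2 :=
      (hcc.comp continuous_fst).mul ((hγ'c n).comp continuous_snd)
    have hηx := fun i => ((hcdc i).comp continuous_fst).mul ((hγc n).comp continuous_snd)
    have zη : ∀ z : Spacetime, 2 * R + T < ‖z‖ → cutoff R z.1 * γ n z.2 = 0 := fun z hz => by
      rcases hLz z hz with h1 | h1
      · rw [hcz _ h1, zero_mul]
      · rw [(hγz n _ h1).1, mul_zero]
    have zηt : ∀ z : Spacetime, 2 * R + T < ‖z‖ → cutoff R z.1 * γ' n z.2 = 0 := fun z hz => by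
      rcases hLz z hz with h1 | h1
      · rw [hcz _ h1, zero_mul]
      · rw [(hγz n _ h1).2, mul_zero]
    have zηx : ∀ i, ∀ z : Spacetime, 2 * R + T < ‖z‖ → cd i z.1 * γ n z.2 = 0 := fun i z hz => by
      rcases hLz z hz with h1 | h1
      · simp only [hcd]
        rw [fderiv_cutoff_eq_zero hR (Or.inr h1)]
        simp
      · rw [(hγz n _ h1).1, mul_zero]
    have hid := h.integral_energy_identity hp3 hp5 hη hηt hηx zη zηt zηx (fun z => by
        have e : ∀ s, (fun z => cutoff R z.1 * γ n z.2) (z + s • timeDir) =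
            cutoff R z.1 * γ n (z.2 + s) := fun s => by simp [timeDir]
        unfold HasLineDerivAt
        simp_rw [e]
        have h1 : HasDerivAt (γ n) (γ' n z.2) (z.2 + 0) := by rw [add_zero]; exact hγd n z.2
        exact (h1.comp_const_add z.2 0).const_mul _)
      (fun i z => by
        have e : ∀ s : ℝ, (fun z => cutoff R z.1 * γ n z.2) (z + s • spaceDir i) =
            cutoff R (z.1 + s • EuclideanSpace.single i 1) * γ n z.2 := fun s => by simp [spaceDir]
        unfold HasLineDerivAt
        simp_rw [e]
        exact ((((contDiff_cutoff R).differentiable (by simp)) z.1).hasFDerivAt.hasLineDerivAt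
          (EuclideanSpace.single i 1)).mul_const _)
    have hwt := IsBoundedWeight.of_continuous hηt zηt
    have hL1 : ∫ t, γ' n t * ∫ x, cutoff R x * energyDensity p u Du ut (x, t) =
        ∫ z, cutoff R z.1 * γ' n z.2 * energyDensity p u Du ut z := by
      rw [integral_spacetime (h.integrable_weight_mul_energyDensity hp3 hp5 hwt)]
      congr 1
      ext t
      rw [← integral_const_mul]
      ring
    rw [hL1, hid, Finset.sum_div]
    refine (Finset.abs_sum_le_sum_abs _ _).trans (Finset.sum_le_sum fun i _ => ?_)
    refine (norm_integral_le_of_norm_le (f := fun z => cd i z.1 * γ n z.2 * (ut z * Du z i))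
      ((integrable_indicator_iff hS).2 (hI.const_mul (C / R)))
      (.of_forall fun z => ?_)).trans (le_of_eq ?_)
    · by_cases hz : z ∈ S
      · have h1 : |cd i z.1 * γ n z.2| ≤ C / R := by
          rw [abs_mul, abs_of_nonneg (hγ0 n _)]
          exact (mul_le_of_le_one_right (abs_nonneg _) (hγ1 n _)).trans (hcdb i _)
        have h2 : |ut z * Du z i| ≤ ut z ^ 2 + ‖Du z‖ ^ 2 := by
          have := mul_le_mul_of_nonneg_left (PiLp.norm_apply_le (Du z) i) (abs_nonneg (ut z))
          rw [Real.norm_eq_abs, ← abs_mul] at this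
          nlinarith [sq_nonneg (|ut z| - ‖Du z‖), sq_abs (ut z), sq_nonneg (ut z)]
        rw [indicator_of_mem hz, Real.norm_eq_abs, abs_mul]
        exact mul_le_mul h1 h2 (abs_nonneg _) ((abs_nonneg _).trans h1)
      · rw [indicator_of_notMem hz, (hγz n _ fun hm => hz (hT _ hm)).1]
        simp
    · rw [integral_indicator hS, integral_const_mul]
      simp only [Pi.add_apply]
      ring
  have := hγlim _ hcR
  exact le_of_tendsto this.abs (.of_forall key)

lemma tendsto_cutoff (x : E3) : Tendsto (fun n : ℕ => cutoff ((n : ℝ) + 1) x) atTop (𝓝 1) := by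
  refine tendsto_const_nhds.congr' ?_
  filter_upwards [eventually_ge_atTop ⌈‖x‖⌉₊] with n hn
  have := Nat.ceil_le.1 hn
  exact (cutoff_eq_one (by positivity) (by linarith)).symm

lemma tendsto_cutoff_energy_zero (hp3 : 3 ≤ p) {t : ℝ}
    (hi : Integrable fun x => energyDensity p u Du ut (x, t)) :
    Tendsto (fun n : ℕ => ∫ x, cutoff ((n : ℝ) + 1) x * energyDensity p u Du ut (x, t)) atTop
      (𝓝 (∫ x, energyDensity p u Du ut (x, t))) := by
  refine tendsto_integral_of_dominated_convergence _
    (fun n => (contDiff_cutoff _).continuous.aestronglyMeasurable.mul hi.1) hi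
    (fun n => .of_forall fun x => ?_) (.of_forall fun x => ?_)
  · rw [Real.norm_of_nonneg (mul_nonneg (cutoff_nonneg _ x) (h.energyDensity_nonneg hp3 _))]
    exact mul_le_of_le_one_left (h.energyDensity_nonneg hp3 _) (cutoff_le_one _ x)
  · simpa using (h.tendsto_cutoff x).mul_const (energyDensity p u Du ut (x, t))

/-- As `R → ∞` the truncated energies at times `0` and `t` have the same limit. Finiteness is known
only at time `0`; Fatou's lemma gives it at time `t`, and dominated convergence then identifies the
limit. -/
theorem energy_conservation (hp3 : 3 ≤ p) (hp5 : p ≤ 5) (t : ℝ) :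
    Integrable (fun x => energyDensity p u Du ut (x, t)) ∧
      ∫ x, energyDensity p u Du ut (x, t) = energy p u Du ut := by
  have hball : ∀ n : ℕ, _ := fun n => h.continuous_integral_energyDensity_ball hp3 hp5
    (contDiff_cutoff (n + 1)).continuous.measurable
    (fun x => cutoff_nonneg _ x) (fun x => cutoff_le_one _ x)
    (R := 2 * (n + 1)) fun x hx => cutoff_eq_zero (by positivity) hx.le
  have h0 := h.tendsto_cutoff_energy_zero hp3 h.finite_energy
  have hdiff : ∃ K, ∀ R, 0 < R → |(∫ x, cutoff R x * energyDensity p u Du ut (x, 0)) -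
        ∫ x, cutoff R x * energyDensity p u Du ut (x, t)| ≤ K / R := by
    rcases lt_trichotomy 0 t with ht | ht | ht
    · exact h.exists_cutoff_energy_sub_le hp3 hp5 ht
    · exact ⟨0, fun R _ => by simp [← ht]⟩
    · obtain ⟨K, hK⟩ := h.exists_cutoff_energy_sub_le hp3 hp5 ht
      exact ⟨K, fun R hR => by rw [abs_sub_comm]; exact hK R hR⟩
  obtain ⟨K, hK⟩ := hdiff
  have hlim : Tendsto (fun n : ℕ => ∫ x, cutoff (n + 1) x *
      energyDensity p u Du ut (x, t)) atTop (𝓝 (energy p u Du ut)) := by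
    have hK0 : Tendsto (fun n : ℕ => K / (n + 1)) atTop (𝓝 0) :=
      tendsto_const_nhds.div_atTop (tendsto_natCast_atTop_atTop.atTop_add tendsto_const_nhds)
    have : Tendsto (fun n : ℕ => (∫ x, cutoff (n + 1) x *
        energyDensity p u Du ut (x, 0)) - ∫ x, cutoff (n + 1) x *
        energyDensity p u Du ut (x, t)) atTop (𝓝 0) :=
      squeeze_zero_norm (fun n => hK (n + 1) (by positivity)) hK0
    have h2 := h0.sub this
    simpa [energy] using h2
  have hmeas : AEStronglyMeasurable (fun x => energyDensity p u Du ut (x, t)) volume := by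
    have h1 := (h.memLp_Du t).1.norm.pow 2
    have h2 := (h.memLp_ut t).1.pow 2
    have h3 : AEStronglyMeasurable (fun x => |u (x, t)| ^ (p + 1)) volume :=
      ((h.memLp_u t).1.aemeasurable.abs.pow_const (p + 1)).aestronglyMeasurable
    exact ((h1.const_mul (1 / 2)).add (h2.const_mul (1 / 2))).add
      (by simpa only [div_eq_mul_inv] using h3.mul_const (p + 1)⁻¹)
  have hi : Integrable fun x => energyDensity p u Du ut (x, t) := by
    refine ⟨hmeas, ?_⟩
    rw [hasFiniteIntegral_iff_enorm]
    have hpt : ∀ x, ‖energyDensity p u Du ut (x, t)‖ₑ =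
        liminf (fun n : ℕ => ‖cutoff (n + 1) x * energyDensity p u Du ut (x, t)‖ₑ) atTop :=
      fun x => by
        have := ((h.tendsto_cutoff x).mul_const (energyDensity p u Du ut (x, t))).enorm.liminf_eq
        rw [this, one_mul]
    simp_rw [hpt]
    refine (lintegral_liminf_le' fun n => ((hball n).1 t).1.enorm).trans_lt ?_
    · have : ∀ n : ℕ, ∫⁻ x, ‖cutoff (n + 1) x * energyDensity p u Du ut (x, t)‖ₑ =
          ENNReal.ofReal (∫ x, cutoff (n + 1) x * energyDensity p u Du ut (x, t)) := by
        intro n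
        have hnn : ∀ x, 0 ≤ cutoff (n + 1) x * energyDensity p u Du ut (x, t) := fun x =>
          mul_nonneg (cutoff_nonneg _ x) (h.energyDensity_nonneg hp3 _)
        rw [ofReal_integral_eq_lintegral_ofReal ((hball n).1 t) (.of_forall hnn)]
        exact lintegral_congr fun x => Real.enorm_of_nonneg (hnn x)
      simp_rw [this]
      have hl := ((continuous_ofReal.tendsto _).comp hlim).liminf_eq
      simp only [Function.comp_def] at hl
      rw [hl]
      exact ofReal_lt_top
  exact ⟨hi, tendsto_nhds_unique (h.tendsto_cutoff_energy_zero hp3 hi) hlim⟩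

end IsFiniteEnergySolution

end EnergyConservation

/-! ### Pointwise bounds and integrals of the densities -/

section FluxDensities

lemma fluxTime_nonneg {p : ℝ} (hp3 : 3 ≤ p) (u : Spacetime → ℝ) (Du : Spacetime → E3)
    (ut : Spacetime → ℝ) (σ : ℝ) (z : Spacetime) : 0 ≤ fluxTime p u Du ut σ z := by
  unfold fluxTime sideDensity
  positivity

lemma abs_fluxRadial_le {p : ℝ} (hp3 : 3 ≤ p) (u : Spacetime → ℝ) (Du : Spacetime → E3)
    (ut : Spacetime → ℝ) (σ : ℝ) (z : Spacetime) :
    |fluxRadial p u Du ut σ z| ≤ fluxTime p u Du ut σ z := by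
  have : 0 ≤ |u z| ^ (p + 1) / (2 * (p + 1)) :=
    div_nonneg (Real.rpow_nonneg (abs_nonneg _) _) (by linarith)
  unfold fluxRadial fluxTime sideDensity
  rw [abs_le]
  constructor <;> nlinarith [sq_nonneg (nullDeriv u Du ut σ z), sq_nonneg ‖angularGrad Du z‖]

lemma morawetzDensity_nonneg {p : ℝ} (hp3 : 3 ≤ p) (u : Spacetime → ℝ) (Du : Spacetime → E3)
    (z : Spacetime) : 0 ≤ morawetzDensity p u Du z := by
  have h1 : 0 ≤ (p - 1) / (2 * (p + 1)) := div_nonneg (by linarith) (by linarith)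
  unfold morawetzDensity
  positivity

lemma norm_mul_morawetzDensity (p : ℝ) (u : Spacetime → ℝ) (Du : Spacetime → E3)
    {z : Spacetime} (hz : z.1 ≠ 0) : ‖z.1‖ * morawetzDensity p u Du z =
      (p - 1) * (|u z| ^ (p + 1) / (2 * (p + 1))) + 1 / 2 * ‖angularGrad Du z‖ ^ 2 := by
  unfold morawetzDensity
  field_simp

/-- The square of the null derivative has the favourable sign and is dropped. For the power term the
bound amounts to `(p - 1)/2 ≥ 1`, that is, `p ≥ 3`. This one-sided bound drives both the Morawetz
estimate and the sign of the measure on the axis. -/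
lemma fluxRadial_le {p : ℝ} (hp3 : 3 ≤ p) (u : Spacetime → ℝ) (Du : Spacetime → E3)
    (ut : Spacetime → ℝ) (σ : ℝ) {z : Spacetime} (hz : z.1 ≠ 0) :
    fluxRadial p u Du ut σ z ≤ 1 / 2 * (‖z.1‖ * morawetzDensity p u Du z) := by
  have : 0 ≤ |u z| ^ (p + 1) / (2 * (p + 1)) :=
    div_nonneg (Real.rpow_nonneg (abs_nonneg _) _) (by linarith)
  rw [norm_mul_morawetzDensity p u Du hz]
  unfold fluxRadial sideDensity
  nlinarith [sq_nonneg (nullDeriv u Du ut σ z)]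

/-- For the power term this is `p - 1 ≤ 4`. It lets test functions that are only `O(r)` at the axis
be paired with the Morawetz density. -/
lemma norm_mul_morawetzDensity_le {p : ℝ} (hp3 : 3 ≤ p) (hp5 : p ≤ 5) (u : Spacetime → ℝ)
    (Du : Spacetime → E3) (ut : Spacetime → ℝ) (σ : ℝ) (z : Spacetime) :
    ‖z.1‖ * morawetzDensity p u Du z ≤ 4 * fluxTime p u Du ut σ z := by
  by_cases hz : z.1 = 0
  · rw [hz, norm_zero, zero_mul]
    exact mul_nonneg (by norm_num) (fluxTime_nonneg hp3 u Du ut σ z)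
  have : 0 ≤ |u z| ^ (p + 1) / (2 * (p + 1)) :=
    div_nonneg (Real.rpow_nonneg (abs_nonneg _) _) (by linarith)
  rw [norm_mul_morawetzDensity p u Du hz]
  unfold fluxTime sideDensity
  nlinarith [sq_nonneg (nullDeriv u Du ut σ z), sq_nonneg ‖angularGrad Du z‖]

namespace IsFiniteEnergySolution

variable {p : ℝ} {u : Spacetime → ℝ} {Du : Spacetime → E3} {ut : Spacetime → ℝ}
  (h : IsFiniteEnergySolution p u Du ut)
include h

lemma aesm_power : AEStronglyMeasurable (fun z => |u z| ^ (p + 1)) volume :=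
  (h.aesm_u.aemeasurable.abs.pow_const (p + 1)).aestronglyMeasurable

lemma aesm_radialDeriv : AEStronglyMeasurable (radialDeriv Du) volume :=
  h.aesm_Du.inner (measurable_radialDir.comp measurable_fst).aestronglyMeasurable

lemma aesm_angularGrad : AEStronglyMeasurable (angularGrad Du) volume :=
  h.aesm_Du.sub (h.aesm_radialDeriv.smul
    (measurable_radialDir.comp measurable_fst).aestronglyMeasurable)

lemma aesm_nullDeriv (σ : ℝ) : AEStronglyMeasurable (nullDeriv u Du ut σ) volume :=
  (h.aesm_radialDeriv.add (h.aesm_u.aemeasurable.div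
    (by fun_prop : Measurable fun z : Spacetime => ‖z.1‖).aemeasurable).aestronglyMeasurable).add
    (h.aesm_ut.const_mul σ)

lemma aesm_sideDensity : AEStronglyMeasurable (sideDensity p u Du) volume :=
  ((h.aesm_angularGrad.norm.pow 2).const_mul (1 / 4)).add
    (h.aesm_power.aemeasurable.div_const _).aestronglyMeasurable

lemma aesm_fluxTime (σ : ℝ) : AEStronglyMeasurable (fluxTime p u Du ut σ) volume :=
  (((h.aesm_nullDeriv σ).pow 2).const_mul (1 / 4)).add h.aesm_sideDensity

lemma aesm_fluxRadial (σ : ℝ) : AEStronglyMeasurable (fluxRadial p u Du ut σ) volume :=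
  (((h.aesm_nullDeriv σ).pow 2).const_mul (-(1 / 4))).add h.aesm_sideDensity

lemma aesm_morawetzDensity : AEStronglyMeasurable (morawetzDensity p u Du) volume := by
  have hm : AEMeasurable (fun z : Spacetime => ‖z.1‖) volume :=
    (by fun_prop : Measurable fun z : Spacetime => ‖z.1‖).aemeasurable
  exact ((h.aesm_power.aemeasurable.div hm).aestronglyMeasurable.const_mul _).add
    (((h.aesm_angularGrad.norm.pow 2).aemeasurable.div hm).aestronglyMeasurable.const_mul _)

lemma fluxTime_eq {σ : ℝ} {c : E3 → ℝ} {x : E3} (hx : x ≠ 0) (t : ℝ) :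
    c x * fluxTime p u Du ut σ (x, t) =
      1 / 4 * (c x * (nullDeriv u Du ut σ (x, t) * nullDeriv u Du ut σ (x, t))) +
      1 / 4 * (∑ i, c x * (Du (x, t) i * Du (x, t) i)) -
      1 / 4 * (c x * (radialDeriv Du (x, t) * radialDeriv Du (x, t))) +
      c x * |u (x, t)| ^ (p + 1) / (2 * (p + 1)) := by
  unfold fluxTime sideDensity
  rw [norm_angularGrad_sq Du hx, ← Finset.mul_sum]
  ring

/-- All terms but the power are squares of functions continuous in time with values in `L²`. For the
power, integrability and continuity are hypotheses: they come from `L⁶` on balls and from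
conservation of energy on the whole space. -/
lemma continuous_integral_fluxTime_of_power (σ : ℝ) {c : E3 → ℝ}
    (hc : Measurable c) {M : ℝ} (hM : ∀ x, |c x| ≤ M)
    (i1 : ∀ t, Integrable fun x => c x * |u (x, t)| ^ (p + 1))
    (k1 : Continuous fun t => ∫ x, c x * |u (x, t)| ^ (p + 1)) :
    (∀ t, Integrable fun x => c x * fluxTime p u Du ut σ (x, t)) ∧
      Continuous fun t => ∫ x, c x * fluxTime p u Du ut σ (x, t) := by
  have iQ := (h.l2Continuous_nullDeriv σ).integrable_mul hc hM
  have kQ := (h.l2Continuous_nullDeriv σ).continuous_integral_mul hc hM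
  have iq := h.l2Continuous_radialDeriv.integrable_mul hc hM
  have kq := h.l2Continuous_radialDeriv.continuous_integral_mul hc hM
  have iD := fun i t => (h.l2Continuous_Du i).integrable_mul hc hM t
  have kD := fun i => (h.l2Continuous_Du i).continuous_integral_mul hc hM
  have jD := fun t => integrable_finsetSum Finset.univ fun i _ => iD i t
  have hae : ∀ t, ∀ᵐ x, _ := fun t => ae_ne_zero.mono fun x hx =>
    h.fluxTime_eq (σ := σ) (c := c) hx t
  have int1 := fun t => (((iQ t).const_mul (1 / 4)).add ((jD t).const_mul (1 / 4))).sub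
    ((iq t).const_mul (1 / 4))
  have int2 := fun t => (int1 t).add ((i1 t).div_const (2 * (p + 1)))
  refine ⟨fun t => (int2 t).congr ((hae t).mono fun x hx => hx.symm), ?_⟩
  have e2 : ∀ t, ∫ x, c x * fluxTime p u Du ut σ (x, t) =
      1 / 4 * (∫ x, c x * (nullDeriv u Du ut σ (x, t) * nullDeriv u Du ut σ (x, t))) +
      1 / 4 * (∑ i, ∫ x, c x * (Du (x, t) i * Du (x, t) i)) -
      1 / 4 * (∫ x, c x * (radialDeriv Du (x, t) * radialDeriv Du (x, t))) +
      (∫ x, c x * |u (x, t)| ^ (p + 1)) / (2 * (p + 1)) := by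
    intro t
    rw [integral_congr_ae (hae t), integral_add, integral_sub, integral_add, integral_const_mul,
      integral_const_mul, integral_const_mul, integral_div, integral_finsetSum _ fun i _ => iD i t]
    exacts [(iQ t).const_mul _, (jD t).const_mul _,
      ((iQ t).const_mul (1 / 4)).add ((jD t).const_mul (1 / 4)), (iq t).const_mul _, int1 t,
      (i1 t).div_const _]
  simp_rw [e2]
  fun_prop

lemma continuous_integral_fluxTime_ball (hp3 : 3 ≤ p) (hp5 : p ≤ 5) (σ R : ℝ) :
    Continuous fun t => ∫ x in closedBall 0 R, fluxTime p u Du ut σ (x, t) := by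
  set c : E3 → ℝ := (closedBall 0 R).indicator fun _ => 1 with hc
  have hBm : MeasurableSet (closedBall (0 : E3) R) := measurableSet_closedBall
  have hcm : Measurable c := measurable_const.indicator hBm
  have hc0 : ∀ x, 0 ≤ c x := fun x => indicator_nonneg (fun _ _ => zero_le_one) x
  have hc1 : ∀ x, c x ≤ 1 := fun x => indicator_le_self' (fun _ _ => zero_le_one) x
  obtain ⟨i1, k1⟩ := h.continuous_integral_power_ball hp3 hp5 hcm hc0 hc1 fun x hx =>
    indicator_of_notMem (by simpa using hx) _
  have := (h.continuous_integral_fluxTime_of_power σ hcm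
    (fun x => by rw [abs_of_nonneg (hc0 x)]; exact hc1 x) i1 k1).2
  refine this.congr fun t => ?_
  rw [← integral_indicator hBm]
  congr 1
  ext x
  by_cases hx : x ∈ closedBall 0 R
  · simp only [hc]
    rw [indicator_of_mem hx, indicator_of_mem hx, one_mul]
  · simp only [hc]
    rw [indicator_of_notMem hx, indicator_of_notMem hx, zero_mul]

lemma integrable_power (hp3 : 3 ≤ p) (hp5 : p ≤ 5) (t : ℝ) :
    Integrable fun x => |u (x, t)| ^ (p + 1) := by
  refine ((h.energy_conservation hp3 hp5 t).1.const_mul (p + 1)).mono'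
    ((h.memLp_u t).1.aemeasurable.abs.pow_const (p + 1)).aestronglyMeasurable
    (.of_forall fun x => ?_)
  rw [Real.norm_of_nonneg (Real.rpow_nonneg (abs_nonneg _) _)]
  unfold energyDensity
  have : |u (x, t)| ^ (p + 1) = (p + 1) * (|u (x, t)| ^ (p + 1) / (p + 1)) := by field_simp
  have h2 : 0 ≤ (p + 1) * (1 / 2 * ‖Du (x, t)‖ ^ 2 + 1 / 2 * ut (x, t) ^ 2) := by positivity
  linarith

lemma integral_energyDensity_eq (hp3 : 3 ≤ p) (hp5 : p ≤ 5) (t : ℝ) :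
    energy p u Du ut = 1 / 2 * (∑ i, ∫ x, 1 * (Du (x, t) i * Du (x, t) i)) +
      1 / 2 * (∫ x, 1 * (ut (x, t) * ut (x, t))) +
      (∫ x, |u (x, t)| ^ (p + 1)) / (p + 1) := by
  have one_le : ∀ x, |(fun _ : E3 => (1 : ℝ)) x| ≤ 1 := fun x => by simp
  have i1 := h.integrable_power hp3 hp5 t
  have i2 := h.l2Continuous_ut.integrable_mul measurable_const one_le t
  have i3 := fun i => (h.l2Continuous_Du i).integrable_mul measurable_const one_le t
  have j3 := integrable_finsetSum Finset.univ fun i _ => i3 i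
  rw [← (h.energy_conservation hp3 hp5 t).2]
  have e : ∀ x, energyDensity p u Du ut (x, t) =
      1 / 2 * (∑ i, 1 * (Du (x, t) i * Du (x, t) i)) + 1 / 2 * (1 * (ut (x, t) * ut (x, t))) +
      |u (x, t)| ^ (p + 1) / (p + 1) := by
    intro x
    unfold energyDensity
    rw [norm_sq_eq_sum, ← Finset.mul_sum]
    ring
  simp_rw [e]
  rw [integral_add, integral_add, integral_const_mul, integral_const_mul, integral_div,
    integral_finsetSum _ fun i _ => i3 i]
  exacts [j3.const_mul _, i2.const_mul _, (j3.const_mul _).add (i2.const_mul _), i1.div_const _]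

/-- On the whole space, continuity in `L⁶` says nothing about `∫ |u|^(p+1)`. Its continuity is read
off from conservation of energy, as the kinetic and gradient terms are continuous. -/
lemma continuous_integral_fluxTime (hp3 : 3 ≤ p) (hp5 : p ≤ 5) (σ : ℝ) :
    (∀ t, Integrable fun x => fluxTime p u Du ut σ (x, t)) ∧
      Continuous fun t => ∫ x, fluxTime p u Du ut σ (x, t) := by
  have one_le : ∀ x, |(fun _ : E3 => (1 : ℝ)) x| ≤ 1 := fun x => by simp
  have k2 := h.l2Continuous_ut.continuous_integral_mul measurable_const one_le
  have k3 := fun i => (h.l2Continuous_Du i).continuous_integral_mul measurable_const one_le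
  have e : ∀ t, ∫ x, |u (x, t)| ^ (p + 1) = (p + 1) * (energy p u Du ut -
      1 / 2 * (∑ i, ∫ x, 1 * (Du (x, t) i * Du (x, t) i)) -
      1 / 2 * (∫ x, 1 * (ut (x, t) * ut (x, t)))) := by
    intro t
    have := h.integral_energyDensity_eq hp3 hp5 t
    rw [this]
    field_simp
    ring
  have k1 : Continuous fun t => ∫ x, |u (x, t)| ^ (p + 1) := by
    simp_rw [e]
    fun_prop
  have := h.continuous_integral_fluxTime_of_power σ measurable_const one_le
    (by simpa only [one_mul] using h.integrable_power hp3 hp5) (by simpa only [one_mul] using k1)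
  simpa only [one_mul] using this

/-- Pointwise off the axis, the sum of the two densities exceeds the energy density by `½ (2 (u/|x|)
∂ᵣu + u²/|x|²)`, whose integral vanishes by the Hardy identity. -/
lemma integral_fluxTime_add (hp3 : 3 ≤ p) (hp5 : p ≤ 5) (t : ℝ) :
    (∫ x, fluxTime p u Du ut 1 (x, t)) + ∫ x, fluxTime p u Du ut (-1) (x, t) =
      energy p u Du ut := by
  have hH := (h.weakGradient t).integral_hardy_identity (h.memLp_u t) (h.memLp_Du t)
  have hi : Integrable fun x => 2 * (u (x, t) / ‖x‖ * (inner ℝ (Du (x, t)) (radialDir x) : ℝ))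
      + u (x, t) / ‖x‖ * (u (x, t) / ‖x‖) := by
    have h1 := h.l2Continuous_u_div.memLp t
    have h2 := h.l2Continuous_radialDeriv.memLp t
    exact ((integrable_mul_of_memLp_two h1 h2).const_mul 2).add (integrable_mul_of_memLp_two h1 h1)
  rw [← integral_add ((h.continuous_integral_fluxTime hp3 hp5 1).1 t)
    ((h.continuous_integral_fluxTime hp3 hp5 (-1)).1 t)]
  obtain ⟨hE, hE2⟩ := h.energy_conservation hp3 hp5 t
  rw [← hE2]
  have := integral_add hE (hi.const_mul (1 / 2))
  rw [integral_const_mul, hH, mul_zero, add_zero] at this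
  rw [← this]
  refine integral_congr_ae (ae_ne_zero.mono fun x hx => ?_)
  simp only [fluxTime, sideDensity, energyDensity, nullDeriv]
  rw [norm_angularGrad_sq Du hx, norm_sq_eq_sum]
  simp only [radialDeriv]
  generalize |u (x, t)| ^ (p + 1) = U
  generalize ∑ i, Du (x, t) i * Du (x, t) i = S
  field_simp
  ring

lemma integral_fluxTime_le (hp3 : 3 ≤ p) (hp5 : p ≤ 5) {σ : ℝ} (hσ : σ = 1 ∨ σ = -1) (t : ℝ) :
    ∫ x, fluxTime p u Du ut σ (x, t) ≤ energy p u Du ut := by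
  have := h.integral_fluxTime_add hp3 hp5 t
  have h1 : ∀ σ, 0 ≤ ∫ x, fluxTime p u Du ut σ (x, t) := fun σ =>
    integral_nonneg fun x => fluxTime_nonneg hp3 u Du ut σ (x, t)
  rcases hσ with rfl | rfl
  · linarith [h1 (-1)]
  · linarith [h1 1]

end IsFiniteEnergySolution

end FluxDensities

/-! ### Radial currents and admissible test functions -/

section RadialCurrent

/-- Pair of densities `(w, σ e)` on space-time whose spatially radial divergence is `m`. -/
structure RadialCurrent (w e m : Spacetime → ℝ) (σ K : ℝ) : Prop where
  aesm_w : AEStronglyMeasurable w volume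
  aesm_e : AEStronglyMeasurable e volume
  aesm_m : AEStronglyMeasurable m volume
  sign : σ = 1 ∨ σ = -1
  e_nonneg : ∀ z, 0 ≤ e z
  m_nonneg : ∀ z, 0 ≤ m z
  abs_w_le : ∀ z, |w z| ≤ e z
  w_le : ∀ z : Spacetime, z.1 ≠ 0 → w z ≤ 1 / 2 * (‖z.1‖ * m z)
  norm_mul_m_le : ∀ z : Spacetime, z.1 ≠ 0 → ‖z.1‖ * m z ≤ 4 * e z
  integrable_e : ∀ t : ℝ, Integrable (fun x : E3 => e (x, t)) volume
  integral_e_le : ∀ t : ℝ, ∫ x : E3, e (x, t) ≤ K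
  continuous_ball : ∀ R : ℝ, Continuous fun t : ℝ => ∫ x in Metric.closedBall (0 : E3) R, e (x, t)
  continuous_e : Continuous fun t : ℝ => ∫ x : E3, e (x, t)
  identity : ∀ {ψ ψr ψt : ℝ → ℝ → ℝ} {δ R : ℝ}, IsRadialTest ψ ψr ψt δ R →
    ∫ z : Spacetime, (ψr ‖z.1‖ z.2 * w z + ψt ‖z.1‖ z.2 * (σ * e z) - ψ ‖z.1‖ z.2 * m z) = 0

/-- Bounded measurable functions `ψ, ψr, ψt` of `(r, t)` with bounded support in `t`, such that
`ψ` vanishes linearly on the axis. -/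
structure IsAxisTest (ψ ψr ψt : ℝ → ℝ → ℝ) (M R : ℝ) : Prop where
  measurable : Measurable (Function.uncurry ψ)
  measurable_r : Measurable (Function.uncurry ψr)
  measurable_t : Measurable (Function.uncurry ψt)
  bound : ∀ r t, 0 < r → |ψ r t| ≤ M * r
  bound_r : ∀ r t, 0 < r → |ψr r t| ≤ M
  bound_t : ∀ r t, 0 < r → |ψt r t| ≤ M
  vanish : ∀ r t, 0 < r → R ≤ |t| → ψ r t = 0 ∧ ψr r t = 0 ∧ ψt r t = 0

lemma measurable_radial_comp {ψ : ℝ → ℝ → ℝ} (h : Measurable (Function.uncurry ψ)) :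
    Measurable fun z : Spacetime => ψ ‖z.1‖ z.2 :=
  h.comp (measurable_fst.norm.prodMk measurable_snd)

lemma ae_fst_ne_zero : ∀ᵐ z : Spacetime, z.1 ≠ 0 := (Measure.quasiMeasurePreserving_fst).ae
    ae_ne_zero

namespace RadialCurrent

variable {w e m : Spacetime → ℝ} {σ K : ℝ} (h : RadialCurrent w e m σ K)
include h

lemma abs_sign : |σ| = 1 := by rcases h.sign with rfl | rfl <;> simp

lemma nonneg : 0 ≤ K := (integral_nonneg fun x => h.e_nonneg (x, 0)).trans (h.integral_e_le 0)

lemma lintegral_mul_e_le {g : Spacetime → ℝ} (hg : AEStronglyMeasurable g volume) {G : ℝ → ℝ}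
    (hle : ∀ z, |g z| ≤ G z.2) :
    ∫⁻ z, ‖g z * e z‖ₑ ≤ ∫⁻ t, ENNReal.ofReal (G t) * ENNReal.ofReal K := by
  rw [lintegral_spacetime (f := fun z => ‖g z * e z‖ₑ) (hg.mul h.aesm_e).enorm]
  refine lintegral_mono fun t => ?_
  calc ∫⁻ x, ‖g (x, t) * e (x, t)‖ₑ ≤ ∫⁻ x, ENNReal.ofReal (G t) * ENNReal.ofReal (e (x, t)) := by
        refine lintegral_mono fun x => ?_
        rw [enorm_mul, Real.enorm_of_nonneg (h.e_nonneg _)]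
        gcongr
        rw [Real.enorm_eq_ofReal_abs]
        exact ofReal_le_ofReal (hle (x, t))
    _ = ENNReal.ofReal (G t) * ENNReal.ofReal (∫ x, e (x, t)) := by
        rw [lintegral_const_mul' _ _ ofReal_ne_top, ofReal_integral_eq_lintegral_ofReal
          (h.integrable_e t) (.of_forall fun x => h.e_nonneg _)]
    _ ≤ _ := by gcongr; exact h.integral_e_le t

lemma integrable_mul_e {g : Spacetime → ℝ} (hg : AEStronglyMeasurable g volume) {G : ℝ → ℝ}
    (hG : Integrable G) (hle : ∀ z, |g z| ≤ G z.2) : Integrable (fun z => g z * e z) := by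
  refine ⟨hg.mul h.aesm_e, (h.lintegral_mul_e_le hg hle).trans_lt ?_⟩
  rw [lintegral_mul_const' _ _ ofReal_ne_top]
  refine mul_lt_top (lt_of_le_of_lt (lintegral_mono fun t => ?_) hG.2) ofReal_lt_top
  rw [Real.enorm_eq_ofReal_abs]
  exact ofReal_le_ofReal (le_abs_self _)

lemma integrable_slab_mul_e (R : ℝ) :
    Integrable (fun z => (Icc (-R) R).indicator (fun _ => 1) z.2 * e z) := by
  have hm : Measurable ((Icc (-R) R).indicator (fun _ => (1 : ℝ))) :=
    measurable_const.indicator measurableSet_Icc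
  refine h.integrable_mul_e (hm.comp measurable_snd).aestronglyMeasurable
    (G := (Icc (-R) R).indicator (fun _ => 1)) ?_ fun z => ?_
  · exact (integrable_indicator_iff measurableSet_Icc).2 (integrableOn_const (by simp))
  · rw [abs_of_nonneg (indicator_nonneg (fun _ _ => zero_le_one) _)]

lemma integral_mul_e_le {g : Spacetime → ℝ} (hg : AEStronglyMeasurable g volume) {G : ℝ → ℝ}
    (hG : Integrable G) (hG0 : ∀ t, 0 ≤ G t) (hle : ∀ z, |g z| ≤ G z.2) :
    ∫ z, |g z| * e z ≤ (∫ t, G t) * K := by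
  have := h.lintegral_mul_e_le hg hle
  rw [← ofReal_le_ofReal_iff (mul_nonneg (integral_nonneg hG0) h.nonneg),
    ofReal_integral_eq_lintegral_ofReal _ (.of_forall fun z =>
      mul_nonneg (abs_nonneg _) (h.e_nonneg z)), ofReal_mul (integral_nonneg hG0),
    ofReal_integral_eq_lintegral_ofReal hG (.of_forall hG0),
    ← lintegral_mul_const' _ _ ofReal_ne_top]
  · refine le_trans (lintegral_mono fun z => ?_) this
    rw [enorm_mul, Real.enorm_of_nonneg (h.e_nonneg z), Real.enorm_eq_ofReal_abs,
      ofReal_mul (abs_nonneg _)]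
  · refine (h.integrable_mul_e hg hG hle).norm.congr (.of_forall fun z => ?_)
    simp [abs_of_nonneg (h.e_nonneg z)]

/-- As `ψ = O(r)`, the term `ψ m` is controlled by `r m ≤ 4 e`. Thus all three terms are dominated
by multiples of `e` on a slab in time, which is integrable. -/
lemma abs_pairing_le {ψ ψr ψt : ℝ → ℝ → ℝ} {M R : ℝ} (hψ : IsAxisTest ψ ψr ψt M R) {z : Spacetime}
    (hz : z.1 ≠ 0) :
    |ψ ‖z.1‖ z.2 * m z| ≤ 4 * M * ((Icc (-R) R).indicator (fun _ => 1) z.2 * e z) ∧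
    |ψr ‖z.1‖ z.2 * w z| ≤ M * ((Icc (-R) R).indicator (fun _ => 1) z.2 * e z) ∧
    |ψt ‖z.1‖ z.2 * (σ * e z)| ≤ M * ((Icc (-R) R).indicator (fun _ => 1) z.2 * e z) := by
  have hr : 0 < ‖z.1‖ := norm_pos_iff.2 hz
  by_cases ht : z.2 ∈ Icc (-R) R
  · have hM : 0 ≤ M := (abs_nonneg _).trans (hψ.bound_r _ z.2 hr)
    have h0 := h.e_nonneg z
    rw [indicator_of_mem ht, one_mul, abs_mul, abs_mul, abs_mul, abs_mul, h.abs_sign, one_mul,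
      abs_of_nonneg h0, abs_of_nonneg (h.m_nonneg z)]
    refine ⟨?_, ?_, ?_⟩
    · calc |ψ ‖z.1‖ z.2| * m z ≤ M * ‖z.1‖ * m z :=
            mul_le_mul_of_nonneg_right (hψ.bound _ _ hr) (h.m_nonneg z)
        _ = M * (‖z.1‖ * m z) := by ring
        _ ≤ M * (4 * e z) := mul_le_mul_of_nonneg_left (h.norm_mul_m_le z hz) hM
        _ = 4 * M * e z := by ring
    · exact mul_le_mul (hψ.bound_r _ _ hr) (h.abs_w_le z) (abs_nonneg _) hM
    · exact mul_le_mul_of_nonneg_right (hψ.bound_t _ _ hr) h0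
  · have ht' : R ≤ |z.2| := by
      by_contra hc
      exact ht (abs_le.1 (not_le.1 hc).le)
    obtain ⟨h1, h2, h3⟩ := hψ.vanish _ _ hr ht'
    simp [h1, h2, h3, ht]

lemma integrable_pairing {ψ ψr ψt : ℝ → ℝ → ℝ} {M R : ℝ} (hψ : IsAxisTest ψ ψr ψt M R) :
    Integrable (fun z => ψ ‖z.1‖ z.2 * m z) ∧
    Integrable (fun z => ψr ‖z.1‖ z.2 * w z) ∧
    Integrable (fun z => ψt ‖z.1‖ z.2 * (σ * e z)) := by
  have hi := h.integrable_slab_mul_e R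
  refine ⟨(hi.const_mul (4 * M)).mono'
      ((measurable_radial_comp hψ.measurable).aestronglyMeasurable.mul h.aesm_m) ?_,
    (hi.const_mul M).mono'
      ((measurable_radial_comp hψ.measurable_r).aestronglyMeasurable.mul h.aesm_w) ?_,
    (hi.const_mul M).mono' ((measurable_radial_comp hψ.measurable_t).aestronglyMeasurable.mul
      (h.aesm_e.const_mul σ)) ?_⟩ <;>
  filter_upwards [ae_fst_ne_zero] with z hz
  · exact (h.abs_pairing_le hψ hz).1
  · exact (h.abs_pairing_le hψ hz).2.1
  · exact (h.abs_pairing_le hψ hz).2.2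

lemma tendsto_pairing {ψn ψrn ψtn : ℕ → ℝ → ℝ → ℝ} {ψ ψr ψt : ℝ → ℝ → ℝ} {M R : ℝ}
    (hψn : ∀ n, IsAxisTest (ψn n) (ψrn n) (ψtn n) M R)
    (hlim : ∀ᵐ z : Spacetime, Tendsto (fun n => ψn n ‖z.1‖ z.2) atTop (𝓝 (ψ ‖z.1‖ z.2)) ∧
      Tendsto (fun n => ψrn n ‖z.1‖ z.2) atTop (𝓝 (ψr ‖z.1‖ z.2)) ∧
      Tendsto (fun n => ψtn n ‖z.1‖ z.2) atTop (𝓝 (ψt ‖z.1‖ z.2))) :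
    Tendsto (fun n => ∫ z, (ψrn n ‖z.1‖ z.2 * w z + ψtn n ‖z.1‖ z.2 * (σ * e z)
      - ψn n ‖z.1‖ z.2 * m z)) atTop
      (𝓝 (∫ z, (ψr ‖z.1‖ z.2 * w z + ψt ‖z.1‖ z.2 * (σ * e z) - ψ ‖z.1‖ z.2 * m z))) := by
  -- The factor `6 M` is the sum `4 M + M + M` of the three bounds in `abs_pairing_le`.
  refine tendsto_integral_of_dominated_convergence
    (fun z => (6 * M) * ((Icc (-R) R).indicator (fun _ => 1) z.2 * e z))
    (fun n => ?_) ((h.integrable_slab_mul_e R).const_mul _) (fun n => ?_) ?_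
  · obtain ⟨h1, h2, h3⟩ := h.integrable_pairing (hψn n)
    exact ((h2.add h3).sub h1).1
  · filter_upwards [ae_fst_ne_zero] with z hz
    obtain ⟨h1, h2, h3⟩ := h.abs_pairing_le (hψn n) hz
    refine (abs_sub _ _).trans ((add_le_add (abs_add_le _ _) le_rfl).trans ?_)
    linarith
  · filter_upwards [hlim] with z hz
    exact ((hz.2.1.mul_const _).add (hz.2.2.mul_const _)).sub (hz.1.mul_const _)

lemma identity_of_tendsto {ψn ψrn ψtn : ℕ → ℝ → ℝ → ℝ} {ψ ψr ψt : ℝ → ℝ → ℝ} {M R : ℝ}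
    (hψn : ∀ n, IsAxisTest (ψn n) (ψrn n) (ψtn n) M R)
    (hid : ∀ n, ∫ z, (ψrn n ‖z.1‖ z.2 * w z + ψtn n ‖z.1‖ z.2 * (σ * e z)
      - ψn n ‖z.1‖ z.2 * m z) = 0)
    (hlim : ∀ᵐ z : Spacetime, Tendsto (fun n => ψn n ‖z.1‖ z.2) atTop (𝓝 (ψ ‖z.1‖ z.2)) ∧
      Tendsto (fun n => ψrn n ‖z.1‖ z.2) atTop (𝓝 (ψr ‖z.1‖ z.2)) ∧
      Tendsto (fun n => ψtn n ‖z.1‖ z.2) atTop (𝓝 (ψt ‖z.1‖ z.2))) :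
    ∫ z, (ψr ‖z.1‖ z.2 * w z + ψt ‖z.1‖ z.2 * (σ * e z) - ψ ‖z.1‖ z.2 * m z) = 0 := by
  have := h.tendsto_pairing hψn hlim
  simp_rw [hid] at this
  exact (tendsto_nhds_unique tendsto_const_nhds this).symm

end RadialCurrent

lemma exists_bump : ∃ (φ φ' : ℝ → ℝ) (C : ℝ), Continuous φ' ∧ (∀ s, HasDerivAt φ (φ' s) s) ∧
    (∀ s, 0 ≤ φ s) ∧ (∀ s, φ s ≤ 1) ∧ (∀ s, |φ' s| ≤ C) ∧
    (∀ s, |s| < 1 → φ s = 1 ∧ φ' s = 0) ∧ ∀ s, 2 ≤ |s| → φ s = 0 ∧ φ' s = 0 := by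
  let φ : ContDiffBump (0 : ℝ) := ⟨1, 2, one_pos, one_lt_two⟩
  have hφ : ContDiff ℝ ∞ φ := φ.contDiff
  have hφc := hφ.continuous_deriv (by simp)
  obtain ⟨C, hC⟩ := hφc.bounded_above_of_compact_support φ.hasCompactSupport.deriv
  have h0 : ∀ s, 2 ≤ |s| → φ s = 0 := fun s hs => φ.zero_of_le_dist (by simpa)
  have h1 : ∀ s, |s| < 1 → φ s = 1 := fun s hs => φ.one_of_mem_closedBall (by simpa using hs.le)
  exact ⟨φ, deriv φ, C, hφc, fun s => (hφ.differentiable (by simp) s).hasDerivAt,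
    fun s => φ.nonneg, fun s => φ.le_one, hC,
    fun s hs => ⟨h1 s hs, IsLocalMax.deriv_eq_zero (.of_forall fun y => by
      rw [h1 s hs]; exact φ.le_one)⟩,
    fun s hs => ⟨h0 s hs, IsLocalMin.deriv_eq_zero (.of_forall fun y => by
      rw [h0 s hs]; exact φ.nonneg)⟩⟩

/-- Cutoffs away from the axis and from infinity. -/
lemma exists_axis_cutoff : ∃ (C : ℝ) (χ χ' : ℕ → ℝ → ℝ), 0 ≤ C ∧ (∀ n, Continuous (χ' n)) ∧
    (∀ n r, HasDerivAt (χ n) (χ' n r) r) ∧ (∀ n r, |χ n r| ≤ 1) ∧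
    (∀ n r, |r * χ' n r| ≤ C) ∧
    (∀ n, ∃ δ R, 0 < δ ∧ ∀ r, r ≤ δ ∨ R ≤ r → χ n r = 0 ∧ χ' n r = 0) ∧
    ∀ r, 0 < r → ∀ᶠ n in atTop, χ n r = 1 ∧ χ' n r = 0 := by
  obtain ⟨φ, φ', C, hc, hd, h0, h1, hC, hin, hout⟩ := exists_bump
  have hC0 := (abs_nonneg _).trans (hC 0)
  let N : ℕ → ℝ := fun n => n + 1
  have hN : ∀ n, 0 < N n := fun n => by positivity
  -- A cutoff on the logarithmic scale: `r χ'(r) = φ'(log r / N) / N` is bounded uniformly, and `χ =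
  -- 1` for `e^(-N) < r < e^N`.
  let χ : ℕ → ℝ → ℝ := fun n r => if 0 < r then φ (Real.log r / N n) else 0
  let χ' : ℕ → ℝ → ℝ := fun n r => if 0 < r then φ' (Real.log r / N n) * (r⁻¹ / N n) else 0
  have hv : ∀ n r, r ≤ Real.exp (-(2 * N n)) ∨ Real.exp (2 * N n) ≤ r →
      χ n r = 0 ∧ χ' n r = 0 := by
    intro n r h
    by_cases hr : 0 < r
    · have : 2 ≤ |Real.log r / N n| := by
        rw [abs_div, abs_of_pos (hN n), le_div_iff₀ (hN n), le_abs']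
        exact h.imp (Real.log_le_iff_le_exp hr).2 (Real.le_log_iff_exp_le hr).2
      simp [χ, χ', hout _ this]
    · simp [χ, χ', hr]
  have hz : ∀ n r, ¬0 < r → ∀ᶠ s in 𝓝 r, χ n s = 0 ∧ χ' n s = 0 := fun n r hr => by
    filter_upwards [Iio_mem_nhds ((not_lt.1 hr).trans_lt (Real.exp_pos (-(2 * N n))))] with s hs
      using hv n s (Or.inl (mem_Iio.1 hs).le)
  refine ⟨C, χ, χ', hC0, fun n => continuous_iff_continuousAt.2 fun r => ?_, fun n r => ?_,
    fun n r => ?_, fun n r => ?_, fun n => ⟨_, _, Real.exp_pos _, hv n⟩, fun r hr => ?_⟩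
  · by_cases hr : 0 < r
    · have h := (Real.continuousAt_log hr.ne').div_const (N n)
      refine ((hc.continuousAt.comp h).mul ((continuousAt_inv₀ hr.ne').div_const (N n))).congr ?_
      filter_upwards [lt_mem_nhds hr] with s hs
      simp [χ', hs]
    · exact continuousAt_const.congr ((hz n r hr).mono fun s hs => hs.2.symm)
  · by_cases hr : 0 < r
    · refine (((hd _).comp r ((Real.hasDerivAt_log hr.ne').div_const (N n))).congr_deriv
        (by simp [χ', hr])).congr_of_eventuallyEq ?_
      filter_upwards [lt_mem_nhds hr] with s hs
      simp [χ, hs]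
    · rw [(hz n r hr).self_of_nhds.2]
      exact (hasDerivAt_const r 0).congr_of_eventuallyEq ((hz n r hr).mono fun s hs => hs.1)
  · by_cases hr : 0 < r
    · simpa [χ, hr, abs_of_nonneg (h0 _)] using h1 _
    · simp [χ, hr]
  · by_cases hr : 0 < r
    · have : r * χ' n r = φ' (Real.log r / N n) / N n := by simp [χ', hr]; field_simp
      rw [this, abs_div, abs_of_pos (hN n)]
      exact (div_le_self (abs_nonneg _) (by simp [N])).trans (hC _)
    · simpa [χ', hr]
  · have hNt : Tendsto N atTop atTop := tendsto_natCast_atTop_atTop.atTop_add tendsto_const_nhds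
    filter_upwards [hNt.eventually_gt_atTop |Real.log r|] with n hn
    have := hin (Real.log r / N n) (by rwa [abs_div, abs_of_pos (hN n), div_lt_one (hN n)])
    simp [χ, χ', hr, this]

end RadialCurrent

/-! ### The identity up to the axis and the Morawetz estimate -/

section RadialCurrentIdentity

namespace RadialCurrent

variable {w e m : Spacetime → ℝ} {σ K : ℝ} (h : RadialCurrent w e m σ K)
include h

/-- Multiply by the logarithmic cutoffs. The extra term `χ' ψ w` is dominated because `|ψ| ≤ M r`
and `|r χ'| ≤ C`, and it tends to zero pointwise. Hence the axis contributes nothing for tests that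
vanish linearly there. -/
lemma identity_of_hasDerivAt {ψ ψr ψt : ℝ → ℝ → ℝ} {M R : ℝ} (hψ : IsAxisTest ψ ψr ψt M R)
    (hc : Continuous (Function.uncurry ψ)) (hcr : Continuous (Function.uncurry ψr))
    (hct : Continuous (Function.uncurry ψt))
    (hdr : ∀ r t, 0 < r → HasDerivAt (fun r => ψ r t) (ψr r t) r)
    (hdt : ∀ r t, 0 < r → HasDerivAt (fun t => ψ r t) (ψt r t) t) :
    ∫ z, (ψr ‖z.1‖ z.2 * w z + ψt ‖z.1‖ z.2 * (σ * e z) - ψ ‖z.1‖ z.2 * m z) = 0 := by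
  obtain ⟨C, χ, χ', hC, hχ'c, hχd, hχ1, hχC, hχ0, hχlim⟩ := exists_axis_cutoff
  have hχc := fun n => continuous_iff_continuousAt.2 fun r => (hχd n r).continuousAt
  have hM : 0 ≤ M := (abs_nonneg _).trans (hψ.bound_r 1 0 one_pos)
  have cont : ∀ {f : ℝ → ℝ} {g : ℝ → ℝ → ℝ}, Continuous f → Continuous (Function.uncurry g) →
      Continuous (Function.uncurry fun r t => f r * g r t) := fun {f g} hf hg =>
    (hf.comp continuous_fst).mul hg
  have hc2 : ∀ n, Continuous (Function.uncurry fun r t => χ' n r * ψ r t + χ n r * ψr r t) :=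
    fun n => (cont (hχ'c n) hc).add (cont (hχc n) hcr)
  refine h.identity_of_tendsto (ψn := fun n r t => χ n r * ψ r t)
    (ψrn := fun n r t => χ' n r * ψ r t + χ n r * ψr r t) (ψtn := fun n r t => χ n r * ψt r t)
    (M := M + C * M) (R := R) (fun n => ?_) (fun n => ?_) ?_
  · refine ⟨(cont (hχc n) hc).measurable, (hc2 n).measurable, (cont (hχc n) hct).measurable,
      fun r t hr => ?_, fun r t hr => ?_, fun r t hr => ?_, fun r t hr ht => ?_⟩
    · rw [abs_mul]
      have h1 := mul_le_mul (hχ1 n r) (hψ.bound r t hr) (abs_nonneg _) zero_le_one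
      have h2 : 0 ≤ C * M * r := by positivity
      linarith
    · refine (abs_add_le _ _).trans ?_
      rw [abs_mul, abs_mul]
      have h1 := mul_le_mul (hχ1 n r) (hψ.bound_r r t hr) (abs_nonneg _) zero_le_one
      have h2 := hχC n r
      rw [abs_mul, abs_of_pos hr] at h2
      have h3 : |χ' n r| * |ψ r t| ≤ |χ' n r| * (M * r) :=
        mul_le_mul_of_nonneg_left (hψ.bound r t hr) (abs_nonneg _)
      have h4 : |χ' n r| * (M * r) ≤ C * M := by
        calc |χ' n r| * (M * r) = (r * |χ' n r|) * M := by ring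
          _ ≤ C * M := mul_le_mul_of_nonneg_right h2 hM
      linarith
    · rw [abs_mul]
      have h1 := mul_le_mul (hχ1 n r) (hψ.bound_t r t hr) (abs_nonneg _) zero_le_one
      have h2 : 0 ≤ C * M := by positivity
      linarith
    · obtain ⟨h1, h2, h3⟩ := hψ.vanish r t hr ht
      simp [h1, h2, h3]
  · obtain ⟨δ, R', hδ, hv⟩ := hχ0 n
    refine h.identity (R := max R R') ⟨hδ, cont (hχc n) hc, hc2 n, cont (hχc n) hct,
      fun r t hr => (hχd n r).mul (hdr r t hr), fun r t hr => (hdt r t hr).const_mul _,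
      fun r t hrt => ?_⟩
    by_cases h1 : r ≤ δ ∨ R' ≤ r
    · simp [(hv r h1).1, (hv r h1).2]
    · rw [not_or, not_le, not_le] at h1
      have hr : 0 < r := hδ.trans h1.1
      have ht : R ≤ |t| := by
        rcases hrt with h2 | h2 | h2
        · linarith [h1.1]
        · linarith [h1.2, le_max_right R R']
        · exact (le_max_left _ _).trans h2
      obtain ⟨h3, h4, h5⟩ := hψ.vanish r t hr ht
      simp [h3, h4, h5]
  · filter_upwards [ae_fst_ne_zero] with z hz
    have := hχlim ‖z.1‖ (norm_pos_iff.2 hz)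
    refine ⟨tendsto_const_nhds.congr' ?_, tendsto_const_nhds.congr' ?_,
      tendsto_const_nhds.congr' ?_⟩ <;>
    filter_upwards [this] with n hn <;> simp [hn.1, hn.2]

lemma identity_of_product {A A' γ γ' : ℝ → ℝ} {L N C R : ℝ} (hA : Continuous A)
    (hA' : Continuous A') (hAd : ∀ r, 0 < r → HasDerivAt A (A' r) r) (hA0 : ∀ r, 0 ≤ A r)
    (hA'0 : ∀ r, 0 ≤ A' r) (hAL : ∀ r, 0 < r → A r ≤ L * r) (hAN : ∀ r, A r ≤ N)
    (hA'L : ∀ r, A' r ≤ L) (hγ' : Continuous γ') (hγd : ∀ t, HasDerivAt γ (γ' t) t)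
    (hγ0 : ∀ t, 0 ≤ γ t) (hγ1 : ∀ t, γ t ≤ 1) (hγC : ∀ t, |γ' t| ≤ C)
    (hz : ∀ t, R ≤ |t| → γ t = 0 ∧ γ' t = 0) :
    Integrable (fun z => A ‖z.1‖ * γ z.2 * m z) ∧ Integrable (fun z => A' ‖z.1‖ * γ z.2 * w z) ∧
      Integrable (fun z => A ‖z.1‖ * γ' z.2 * (σ * e z)) ∧
      (∫ z, A' ‖z.1‖ * γ z.2 * w z) + (∫ z, A ‖z.1‖ * γ' z.2 * (σ * e z)) -
        ∫ z, A ‖z.1‖ * γ z.2 * m z = 0 := by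
  have hγ : Continuous γ := continuous_iff_continuousAt.2 fun t => (hγd t).continuousAt
  have c0 : Continuous fun q : ℝ × ℝ => A q.1 * γ q.2 := by fun_prop
  have c1 : Continuous fun q : ℝ × ℝ => A' q.1 * γ q.2 := by fun_prop
  have c2 : Continuous fun q : ℝ × ℝ => A q.1 * γ' q.2 := by fun_prop
  have hb := fun x t (hx : 0 ≤ x) => mul_le_of_le_one_right hx (hγ1 t)
  have hL := (hA'0 0).trans (hA'L 0)
  have hNC : 0 ≤ N * C := mul_nonneg ((hA0 0).trans (hAN 0)) ((abs_nonneg _).trans (hγC 0))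
  have ht : IsAxisTest (fun r t => A r * γ t) (fun r t => A' r * γ t) (fun r t => A r * γ' t)
      (L + N * C) R := by
    refine ⟨c0.measurable, c1.measurable, c2.measurable, fun r t hr => ?_, fun r t hr => ?_,
      fun r t hr => ?_, fun r t hr ht => by simp [hz t ht]⟩
    · rw [abs_of_nonneg (mul_nonneg (hA0 r) (hγ0 t)), add_mul]
      exact (hb _ _ (hA0 r)).trans ((hAL r hr).trans (le_add_of_nonneg_right (by positivity)))
    · rw [abs_of_nonneg (mul_nonneg (hA'0 r) (hγ0 t))]
      exact (hb _ _ (hA'0 r)).trans ((hA'L r).trans (le_add_of_nonneg_right hNC))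
    · rw [abs_mul, abs_of_nonneg (hA0 r)]
      exact (mul_le_mul (hAN r) (hγC t) (abs_nonneg _) ((hA0 0).trans (hAN 0))).trans
        (le_add_of_nonneg_left hL)
  obtain ⟨i1, i2, i3⟩ := h.integrable_pairing ht
  refine ⟨i1, i2, i3, ?_⟩
  rw [← h.identity_of_hasDerivAt ht c0 c1 c2 (fun r t hr => (hAd r hr).mul_const _)
    (fun r t hr => (hγd t).const_mul _), integral_sub, integral_add]
  exacts [i2, i3, i2.add i3, i1]

/-- Test with `A(r) γ(t)`, where `A = r/(r + d)`. Since `w ≤ r m / 2` and `r A' ≤ A`, the radial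
term is at most half of `∫ A γ m` and is absorbed. The time derivative is at most `C/T` on an
interval of length `4T`, so its term is at most `4 C K` for every `T`; hence the bound `8 C K`. With
`T = n + 1` and `d = 1/T` both cutoffs disappear as `n → ∞`. -/
lemma integral_morawetz_le : ∃ C, ∀ n : ℕ, ∃ γ : ℝ → ℝ,
    (∀ t, 0 ≤ γ t) ∧ (∀ t : ℝ, |t| ≤ n → γ t = 1) ∧
    Integrable (fun z => ‖z.1‖ / (‖z.1‖ + 1 / ((n : ℝ) + 1)) * γ z.2 * m z) ∧
    ∫ z, ‖z.1‖ / (‖z.1‖ + 1 / ((n : ℝ) + 1)) * γ z.2 * m z ≤ C := by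
  obtain ⟨φ, φ', C, hφc, hφd, hφ0, hφ1, hC, hin, hout⟩ := exists_bump
  have hC0 := (abs_nonneg _).trans (hC 0)
  refine ⟨8 * C * K, fun n => ?_⟩
  let T : ℝ := n + 1
  have hT : 0 < T := by positivity
  let d : ℝ := 1 / T
  have hd : 0 < d := by positivity
  let γ : ℝ → ℝ := fun t => φ (t / T)
  let γ' : ℝ → ℝ := fun t => φ' (t / T) * (1 / T)
  have hγd : ∀ t, HasDerivAt γ (γ' t) t := fun t =>
    HasDerivAt.comp (h := fun t => t / T) t (hφd (t / T)) (by simpa using (hasDerivAt_id t).div_const T)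
  have hγc : Continuous γ := continuous_iff_continuousAt.2 fun t => (hγd t).continuousAt
  have hγ'c : Continuous γ' := (hφc.comp (by fun_prop)).mul_const _
  have hγ0 : ∀ t, 0 ≤ γ t := fun t => hφ0 _
  have hγ1 : ∀ t, γ t ≤ 1 := fun t => hφ1 _
  have hγ'C : ∀ t, |γ' t| ≤ C / T := fun t => by
    rw [abs_mul, abs_of_pos (by positivity : 0 < 1 / T), mul_one_div]
    gcongr
    exact hC _
  have hsupp : ∀ t, 2 * T ≤ |t| → γ t = 0 ∧ γ' t = 0 := fun t ht => by
    have : 2 ≤ |t / T| := by rw [abs_div, abs_of_pos hT, le_div_iff₀ hT]; exact ht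
    simp [γ, γ', hout _ this]
  let A : ℝ → ℝ := fun r => |r| / (|r| + d)
  let A' : ℝ → ℝ := fun r => d / (|r| + d) ^ 2
  have hpos : ∀ r, 0 < |r| + d := fun r => by positivity
  have hAc : Continuous A := by refine continuous_abs.div (by fun_prop) fun r => (hpos r).ne'
  have hA'c : Continuous A' := by
    refine continuous_const.div (by fun_prop) fun r => (by have := hpos r; positivity)
  have hA0 : ∀ r, 0 ≤ A r := fun r => by have := hpos r; positivity
  have hA1 : ∀ r, A r ≤ 1 := fun r => (div_le_one (hpos r)).2 (by linarith)
  have hA'0 : ∀ r, 0 ≤ A' r := fun r => by have := hpos r; positivity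
  have hAd : ∀ r, 0 < r → HasDerivAt A (A' r) r := by
    intro r hr
    have h1 : HasDerivAt (fun r => r / (r + d)) ((1 * (r + d) - r * 1) / (r + d) ^ 2) r :=
      (hasDerivAt_id r).div ((hasDerivAt_id r).add_const d) (by positivity)
    have h2 : A' r = (1 * (r + d) - r * 1) / (r + d) ^ 2 := by simp only [A', abs_of_pos hr]; ring
    rw [h2]
    refine h1.congr_of_eventuallyEq ?_
    filter_upwards [lt_mem_nhds hr] with s hs
    simp only [A, abs_of_pos hs]
  have hAr : ∀ r, 0 < r → A r ≤ 1 / d * r := by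
    intro r hr
    simp only [A, abs_of_pos hr]
    rw [div_le_iff₀ (by positivity)]
    have : 1 / d * r * (r + d) = r + 1 / d * r * r := by field_simp; ring
    rw [this]; have : 0 ≤ 1 / d * r * r := by positivity
    linarith
  have hA'M : ∀ r, A' r ≤ 1 / d := by
    intro r
    rw [div_le_div_iff₀ (by have := hpos r; positivity) hd]
    nlinarith [abs_nonneg r]
  have hrA' : ∀ r, 0 < r → r * A' r ≤ A r := by
    intro r hr
    simp only [A, A', abs_of_pos hr]
    rw [mul_div_assoc', div_le_div_iff₀ (by positivity) (by positivity)]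
    nlinarith [mul_pos hr hr, mul_pos hr hd]
  obtain ⟨i1, i2, i3, hid⟩ := h.identity_of_product hAc hA'c hAd hA0 hA'0 hAr hA1 hA'M hγ'c hγd
    hγ0 hγ1 hγ'C hsupp
  have hmeq : (fun z => ‖z.1‖ / (‖z.1‖ + 1 / (n + 1)) * γ z.2 * m z) =
      fun z => A ‖z.1‖ * γ z.2 * m z := by
    funext z; simp only [A, abs_norm, d, T]
  refine ⟨γ, hγ0, fun t ht => (hin _ ?_).1, ?_, ?_⟩
  · rw [abs_div, abs_of_pos hT, div_lt_one hT]; exact ht.trans_lt (by simp [T])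
  · rw [hmeq]; exact i1
  · rw [hmeq]
    have hw : ∫ z, A' ‖z.1‖ * γ z.2 * w z ≤ 1 / 2 * ∫ z, A ‖z.1‖ * γ z.2 * m z := by
      rw [← integral_const_mul]
      refine integral_mono_ae i2 (i1.const_mul _) ?_
      filter_upwards [ae_fst_ne_zero] with z hz
      calc A' ‖z.1‖ * γ z.2 * w z ≤ A' ‖z.1‖ * γ z.2 * (1 / 2 * (‖z.1‖ * m z)) :=
            mul_le_mul_of_nonneg_left (h.w_le z hz) (mul_nonneg (hA'0 _) (hγ0 _))
        _ = 1 / 2 * (‖z.1‖ * A' ‖z.1‖ * (γ z.2 * m z)) := by ring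
        _ ≤ 1 / 2 * (A ‖z.1‖ * (γ z.2 * m z)) := by
            have := mul_le_mul_of_nonneg_right (hrA' ‖z.1‖ (norm_pos_iff.2 hz))
              (mul_nonneg (hγ0 z.2) (h.m_nonneg z))
            linarith
        _ = _ := by ring
    have he : ∫ z, A ‖z.1‖ * γ' z.2 * (σ * e z) ≤ 4 * C * K := by
      have hGi : Integrable ((Icc (-(2 * T)) (2 * T)).indicator fun _ => C / T) :=
        (integrable_indicator_iff measurableSet_Icc).2 (integrableOn_const (by simp))
      have h1 := h.integral_mul_e_le
        (by fun_prop : Continuous fun z => A ‖z.1‖ * γ' z.2).aestronglyMeasurable hGi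
        (fun t => indicator_nonneg (fun _ _ => by positivity) _) (fun z => ?_)
      · rw [integral_indicator measurableSet_Icc, setIntegral_const] at h1
        have h2 : (volume.real (Icc (-(2 * T)) (2 * T)) • (C / T)) * K = 4 * C * K := by
          rw [Real.volume_real_Icc_of_le (by linarith), smul_eq_mul]
          field_simp
          ring
        rw [h2] at h1
        refine le_trans (integral_mono i3 ?_ fun z => ?_) h1
        · refine i3.norm.congr (.of_forall fun z => ?_)
          simp only [Real.norm_eq_abs, abs_mul, h.abs_sign, one_mul, abs_of_nonneg (h.e_nonneg z)]
        · calc A ‖z.1‖ * γ' z.2 * (σ * e z) ≤ |A ‖z.1‖ * γ' z.2 * (σ * e z)| := le_abs_self _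
            _ = |A ‖z.1‖ * γ' z.2| * e z := by
              rw [abs_mul _ (σ * e z), abs_mul σ, h.abs_sign, one_mul, abs_of_nonneg (h.e_nonneg z)]
      · by_cases ht : z.2 ∈ Icc (-(2 * T)) (2 * T)
        · rw [indicator_of_mem ht, abs_mul, abs_of_nonneg (hA0 _)]
          calc A ‖z.1‖ * |γ' z.2| ≤ 1 * (C / T) :=
                mul_le_mul (hA1 _) (hγ'C _) (abs_nonneg _) zero_le_one
            _ = C / T := one_mul _
        · have ht' : 2 * T ≤ |z.2| := by
            by_contra hc
            exact ht (abs_le.1 (not_le.1 hc).le)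
          simp [(hsupp _ ht').2, ht]
    linarith

/-- Fatou's lemma in the bound above, which is uniform in `n`. The integrability is global in
space-time, which also makes the measure on the axis finite. -/
lemma integrable_m : Integrable m := by
  obtain ⟨C, hC⟩ := h.integral_morawetz_le
  refine ⟨h.aesm_m, ?_⟩
  choose γ hγ0 hγ1 hi hle using hC
  have hlim : ∀ᵐ z, ‖m z‖ₑ ≤ liminf (fun n : ℕ =>
      ‖‖z.1‖ / (‖z.1‖ + 1 / (n + 1)) * γ n z.2 * m z‖ₑ) atTop := by
    filter_upwards [ae_fst_ne_zero] with z hz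
    have hz' := norm_pos_iff.2 hz
    have h1 : Tendsto (fun n : ℕ => ‖z.1‖ / (‖z.1‖ + 1 / (n + 1)) * γ n z.2 * m z) atTop
        (𝓝 (‖z.1‖ / (‖z.1‖ + 0) * 1 * m z)) := by
      refine ((tendsto_const_nhds.div (tendsto_const_nhds.add
        tendsto_one_div_add_atTop_nhds_zero_nat) (by simpa using hz)).mul ?_).mul_const _
      refine tendsto_const_nhds.congr' ?_
      filter_upwards [tendsto_natCast_atTop_atTop.eventually_ge_atTop |z.2|] with n hn
      rw [hγ1 n _ hn]
    rw [add_zero, div_self hz'.ne', one_mul, one_mul] at h1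
    exact h1.enorm.liminf_eq.ge
  calc ∫⁻ z, ‖m z‖ₑ ≤ ∫⁻ z, liminf (fun n : ℕ =>
      ‖‖z.1‖ / (‖z.1‖ + 1 / (n + 1)) * γ n z.2 * m z‖ₑ) atTop := lintegral_mono_ae hlim
    _ ≤ liminf (fun n : ℕ => ∫⁻ z, ‖‖z.1‖ / (‖z.1‖ + 1 / (n + 1)) * γ n z.2 * m z‖ₑ) atTop :=
        lintegral_liminf_le' fun n => (hi n).1.enorm
    _ ≤ liminf (fun _ => ENNReal.ofReal C) atTop := by
        refine liminf_le_liminf (.of_forall fun n => ?_)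
        have hnn : ∀ z, 0 ≤ ‖z.1‖ / (‖z.1‖ + 1 / (n + 1)) * γ n z.2 * m z :=
          fun z => mul_nonneg (mul_nonneg (by positivity) (hγ0 _ _)) (h.m_nonneg z)
        simp_rw [Real.enorm_of_nonneg (hnn _)]
        rw [← ofReal_integral_eq_lintegral_ofReal (hi n) (.of_forall hnn)]
        exact ofReal_le_ofReal (hle n)
    _ < ⊤ := by simp

end RadialCurrent

end RadialCurrentIdentity

/-! ### Piecewise linear test functions -/

section Ramp

/-- The primitive, vanishing at `α`, of the indicator function of `(α, β)`. -/
def ramp (α β s : ℝ) : ℝ := max 0 (min (s - α) (β - α))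

lemma continuous_ramp (α β : ℝ) : Continuous (ramp α β) := by unfold ramp; fun_prop

lemma ramp_nonneg (α β s : ℝ) : 0 ≤ ramp α β s := le_max_left _ _

lemma ramp_of_le {α s : ℝ} (β : ℝ) (h : s ≤ α) : ramp α β s = 0 :=
  max_eq_left ((min_le_left _ _).trans (by linarith))

lemma ramp_of_ge {α β s : ℝ} (hab : α ≤ β) (h : β ≤ s) : ramp α β s = β - α := by
  rw [ramp, min_eq_right (by linarith), max_eq_right (by linarith)]

lemma ramp_of_mem {α β s : ℝ} (h : s ∈ Icc α β) : ramp α β s = s - α := by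
  rw [ramp, min_eq_left (by linarith [h.2]), max_eq_right (by linarith [h.1])]

lemma ramp_le {α β s : ℝ} (hab : α ≤ β) : ramp α β s ≤ β - α :=
  max_le (by linarith) (min_le_right _ _)

lemma ramp_le_self {α β s : ℝ} (hα : 0 ≤ α) (hs : 0 ≤ s) : ramp α β s ≤ s :=
  max_le hs ((min_le_left _ _).trans (by linarith))

/-- The function `A` is `C¹` with derivative `a`, `a` and `A` being dominated by the indicator
function of `(α, β)` and its primitive. -/
structure IsSmoothRamp (α β : ℝ) (A a : ℝ → ℝ) : Prop where
  continuous_deriv : Continuous a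
  hasDerivAt : ∀ s, HasDerivAt A (a s) s
  deriv_nonneg : ∀ s, 0 ≤ a s
  deriv_le : ∀ s, a s ≤ 1
  deriv_eq_zero : ∀ s, s ≤ α ∨ β ≤ s → a s = 0
  eq_zero : ∀ s, s ≤ α → A s = 0
  eq_of_ge : ∀ s, β ≤ s → A s = A β
  nonneg : ∀ s, 0 ≤ A s
  le_ramp : ∀ s, A s ≤ ramp α β s
  eq_integral : ∀ s, A s = ∫ y in α..s, a y

lemma IsSmoothRamp.continuous {α β : ℝ} {A a : ℝ → ℝ} (h : IsSmoothRamp α β A a) : Continuous A :=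
  continuous_iff_continuousAt.2 fun s => (h.hasDerivAt s).continuousAt

lemma IsSmoothRamp.abs_sub_le {α β : ℝ} {A a : ℝ → ℝ} (h : IsSmoothRamp α β A a) (s s' : ℝ) :
    |A s - A s'| ≤ |s - s'| := by
  have hi : ∀ x y, IntervalIntegrable a volume x y := fun x y =>
    h.continuous_deriv.intervalIntegrable x y
  rw [h.eq_integral, h.eq_integral, intervalIntegral.integral_interval_sub_left (hi _ _) (hi _ _)]
  have := intervalIntegral.norm_integral_le_of_norm_le_const (a := s') (b := s)
    fun x _ => by rw [Real.norm_of_nonneg (h.deriv_nonneg x)]; exact h.deriv_le x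
  simpa using this

/-- The derivatives are trapezoids: the minimum of `1` and `n` times the distance to the complement
of the interval. They increase to the indicator function, and their primitives are `C¹`, unlike
`ramp` itself. -/
lemma exists_smooth_ramp {α β : ℝ} (hab : α < β) : ∃ A a : ℕ → ℝ → ℝ,
    (∀ n, IsSmoothRamp α β (A n) (a n)) ∧
    (∀ s, Tendsto (fun n => A n s) atTop (𝓝 (ramp α β s))) ∧
    ∀ s, Tendsto (fun n => a n s) atTop (𝓝 ((Ioo α β).indicator (fun _ => 1) s)) := by
  let a : ℕ → ℝ → ℝ := fun n s => min 1 (n * max 0 (min (s - α) (β - s)))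
  let A : ℕ → ℝ → ℝ := fun n s => ∫ y in α..s, a n y
  have hc : ∀ n, Continuous (a n) := fun n => by fun_prop
  have h0 : ∀ n s, 0 ≤ a n s := fun n s => le_min zero_le_one (by positivity)
  have h1 : ∀ n s, a n s ≤ 1 := fun n s => min_le_left _ _
  have hz : ∀ n s, s ≤ α ∨ β ≤ s → a n s = 0 := by
    intro n s hs
    have : max 0 (min (s - α) (β - s)) = 0 := by
      refine max_eq_left ?_
      rcases hs with hs | hs
      · exact (min_le_left _ _).trans (by linarith)
      · exact (min_le_right _ _).trans (by linarith)
    simp [a, this]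
  have hi : ∀ n x y, IntervalIntegrable (a n) volume x y := fun n x y =>
    (hc n).intervalIntegrable x y
  have hA0 : ∀ n s, s ≤ α → A n s = 0 := by
    intro n s hs
    have : ∫ y in α..s, a n y = ∫ y in α..s, 0 := by
      refine intervalIntegral.integral_congr fun y hy => hz n y (Or.inl ?_)
      rw [uIcc_of_ge hs] at hy; exact hy.2
    simp [A, this]
  have hAβ : ∀ n s, β ≤ s → A n s = A n β := by
    intro n s hs
    have h2 : ∫ y in β..s, a n y = ∫ y in β..s, 0 := by
      refine intervalIntegral.integral_congr fun y hy => hz n y (Or.inr ?_)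
      rw [uIcc_of_le hs] at hy; exact hy.1
    have h3 := intervalIntegral.integral_add_adjacent_intervals (hi n α β) (hi n β s)
    simp only [h2, intervalIntegral.integral_zero, add_zero] at h3
    exact h3.symm
  have hmid : ∀ n s, s ∈ Icc α β → 0 ≤ A n s ∧ A n s ≤ s - α := by
    intro n s hs
    refine ⟨intervalIntegral.integral_nonneg hs.1 fun y _ => h0 n y, ?_⟩
    have := intervalIntegral.integral_mono_on hs.1 (hi n α s)
      intervalIntegrable_const fun y _ => h1 n y
    simpa using this
  have hbd : ∀ n s, 0 ≤ A n s ∧ A n s ≤ ramp α β s := by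
    intro n s
    rcases le_total s α with hs | hs
    · rw [hA0 n s hs, ramp_of_le β hs]; simp
    rcases le_total β s with hs' | hs'
    · rw [hAβ n s hs', ramp_of_ge hab.le hs']; exact hmid n β ⟨hab.le, le_rfl⟩
    · rw [ramp_of_mem ⟨hs, hs'⟩]; exact hmid n s ⟨hs, hs'⟩
  have hlim : ∀ s, s ∈ Ioo α β → Tendsto (fun n => a n s) atTop (𝓝 1) := by
    intro s hs
    refine tendsto_const_nhds.congr' ?_
    have hpos : 0 < min (s - α) (β - s) := lt_min (by linarith [hs.1]) (by linarith [hs.2])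
    filter_upwards [tendsto_natCast_atTop_atTop.eventually_ge_atTop (1 / min (s - α) (β - s))]
      with n hn
    rw [div_le_iff₀ hpos] at hn
    simp only [a]
    rw [max_eq_right hpos.le, min_eq_left hn]
  refine ⟨A, a, fun n => ⟨hc n, fun s => ?_, h0 n, h1 n, hz n, hA0 n, hAβ n, fun s => (hbd n s).1,
    fun s => (hbd n s).2, fun s => rfl⟩, fun s => ?_, fun s => ?_⟩
  · exact intervalIntegral.integral_hasDerivAt_right (hi n α s)
      (hc n).stronglyMeasurable.stronglyMeasurableAtFilter (hc n).continuousAt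
  · have hmidlim : ∀ s ∈ Icc α β, Tendsto (fun n => A n s) atTop (𝓝 (s - α)) := by
      intro s hs
      have hint : ∫ y in α..s, 1 = s - α := by simp
      rw [← hint]
      refine intervalIntegral.tendsto_integral_filter_of_dominated_convergence (fun _ => 1)
        (.of_forall fun n => (hc n).aestronglyMeasurable) (.of_forall fun n =>
          .of_forall fun y _ => by rw [Real.norm_of_nonneg (h0 n y)]; exact h1 n y)
        intervalIntegrable_const ?_
      have hne : ∀ᵐ y, y ≠ s := by simp [ae_iff]
      filter_upwards [hne] with y hy hys
      rw [uIoc_of_le hs.1] at hys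
      exact hlim y ⟨hys.1, (lt_of_le_of_ne hys.2 hy).trans_le hs.2⟩
    rcases le_total s α with hs | hs
    · rw [ramp_of_le β hs]
      simp_rw [hA0 _ s hs]; exact tendsto_const_nhds
    rcases le_total β s with hs' | hs'
    · rw [ramp_of_ge hab.le hs']
      simp_rw [hAβ _ s hs']
      exact hmidlim β ⟨hab.le, le_rfl⟩
    · rw [ramp_of_mem ⟨hs, hs'⟩]
      exact hmidlim s ⟨hs, hs'⟩
  · by_cases hs : s ∈ Ioo α β
    · rw [indicator_of_mem hs]; exact hlim s hs
    · rw [indicator_of_notMem hs]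
      have : s ≤ α ∨ β ≤ s := by
        by_contra hcon
        rw [not_or, not_le, not_le] at hcon
        exact hs hcon
      simp_rw [hz _ s this]; exact tendsto_const_nhds

end Ramp

/-! ### The identity on layers around cones -/

section

variable {w e m : Spacetime → ℝ} {σ K : ℝ}

lemma IsAxisTest.of_tendsto {ψn ψrn ψtn : ℕ → ℝ → ℝ → ℝ} {ψ ψr ψt : ℝ → ℝ → ℝ} {M R : ℝ}
    (hψn : ∀ n, IsAxisTest (ψn n) (ψrn n) (ψtn n) M R)
    (hl : ∀ r t, Tendsto (fun n => ψn n r t) atTop (𝓝 (ψ r t)))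
    (hlr : ∀ r t, Tendsto (fun n => ψrn n r t) atTop (𝓝 (ψr r t)))
    (hlt : ∀ r t, Tendsto (fun n => ψtn n r t) atTop (𝓝 (ψt r t))) : IsAxisTest ψ ψr ψt M R where
  measurable := measurable_of_tendsto_metrizable (fun n => (hψn n).measurable)
    (tendsto_pi_nhds.2 fun z => hl z.1 z.2)
  measurable_r := measurable_of_tendsto_metrizable (fun n => (hψn n).measurable_r)
    (tendsto_pi_nhds.2 fun z => hlr z.1 z.2)
  measurable_t := measurable_of_tendsto_metrizable (fun n => (hψn n).measurable_t)
    (tendsto_pi_nhds.2 fun z => hlt z.1 z.2)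
  bound r t hr := le_of_tendsto (hl r t).abs (.of_forall fun n => (hψn n).bound r t hr)
  bound_r r t hr := le_of_tendsto (hlr r t).abs (.of_forall fun n => (hψn n).bound_r r t hr)
  bound_t r t hr := le_of_tendsto (hlt r t).abs (.of_forall fun n => (hψn n).bound_t r t hr)
  vanish r t hr ht := by
    have h := fun n => (hψn n).vanish r t hr ht
    refine ⟨tendsto_nhds_unique (hl r t) ?_, tendsto_nhds_unique (hlr r t) ?_,
      tendsto_nhds_unique (hlt r t) ?_⟩
    · simp_rw [(h _).1]; exact tendsto_const_nhds
    · simp_rw [(h _).2.1]; exact tendsto_const_nhds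
    · simp_rw [(h _).2.2]; exact tendsto_const_nhds

namespace RadialCurrent

variable (h : RadialCurrent w e m σ K)
include h

/-- The identity over the layer between two translates of the graph of `t = t₀ + c ramp r₁ r₂ r`. -/
lemma cone_identity {r₁ r₂ k : ℝ} (hr₁ : 0 ≤ r₁) (hr : r₁ < r₂) (hk : 0 < k) (c t₀ : ℝ) :
    (∃ M R, IsAxisTest (fun r t => ramp (-k) k (t - t₀) - ramp (-k) k (t - t₀ - c * ramp r₁ r₂ r))
      (fun r t => c * (Ioo r₁ r₂).indicator (fun _ => 1) r *
        (Ioo (-k) k).indicator (fun _ => 1) (t - t₀ - c * ramp r₁ r₂ r))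
      (fun r t => (Ioo (-k) k).indicator (fun _ => 1) (t - t₀) -
        (Ioo (-k) k).indicator (fun _ => 1) (t - t₀ - c * ramp r₁ r₂ r)) M R) ∧
    ∫ z, (c * (Ioo r₁ r₂).indicator (fun _ => 1) ‖z.1‖ *
        (Ioo (-k) k).indicator (fun _ => 1) (z.2 - t₀ - c * ramp r₁ r₂ ‖z.1‖) * w z +
      ((Ioo (-k) k).indicator (fun _ => 1) (z.2 - t₀) -
        (Ioo (-k) k).indicator (fun _ => 1) (z.2 - t₀ - c * ramp r₁ r₂ ‖z.1‖)) * (σ * e z) -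
      (ramp (-k) k (z.2 - t₀) - ramp (-k) k (z.2 - t₀ - c * ramp r₁ r₂ ‖z.1‖)) * m z) = 0 := by
  obtain ⟨A, a, hA, hAl, hal⟩ := exists_smooth_ramp hr
  obtain ⟨B, b, hB, hBl, hbl⟩ := exists_smooth_ramp (show -k < k by linarith)
  let M : ℝ := |c| + 2
  let R : ℝ := |t₀| + |c| * (r₂ - r₁) + k
  have hM : |c| ≤ M := by simp [M]
  have hAabs : ∀ n r, |c * A n r| ≤ |c| * (r₂ - r₁) := fun n r => by
    rw [abs_mul, abs_of_nonneg ((hA n).nonneg r)]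
    exact mul_le_mul_of_nonneg_left (((hA n).le_ramp r).trans (ramp_le hr.le)) (abs_nonneg _)
  have hb01 : ∀ j s s', |b j s - b j s'| ≤ 2 := fun j s s' => by
    rw [abs_le]; constructor <;>
      linarith [(hB j).deriv_nonneg s, (hB j).deriv_nonneg s', (hB j).deriv_le s,
        (hB j).deriv_le s']
  have hcA : ∀ n, Continuous fun q : ℝ × ℝ => q.2 - t₀ - c * A n q.1 := fun n => by
    have := (hA n).continuous; fun_prop
  have hct : Continuous fun q : ℝ × ℝ => q.2 - t₀ := by fun_prop
  have hc0 : ∀ j n, Continuous (Function.uncurry fun r t =>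
      B j (t - t₀) - B j (t - t₀ - c * A n r)) := fun j n =>
    ((hB j).continuous.comp hct).sub ((hB j).continuous.comp (hcA n))
  have hcr : ∀ j n, Continuous (Function.uncurry fun r t =>
      c * a n r * b j (t - t₀ - c * A n r)) := fun j n =>
    (continuous_const.mul ((hA n).continuous_deriv.comp continuous_fst)).mul
      ((hB j).continuous_deriv.comp (hcA n))
  have hcT : ∀ j n, Continuous (Function.uncurry fun r t =>
      b j (t - t₀) - b j (t - t₀ - c * A n r)) := fun j n =>
    ((hB j).continuous_deriv.comp hct).sub ((hB j).continuous_deriv.comp (hcA n))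
  -- Subtracting two shifts of the same `B j` makes the test vanish where `A n` does, hence linearly
  -- at the axis, and also for large `|t|`, where `B j` is constant. The smooth ramp in `r` is
  -- sharpened first, with `j` fixed, and the one in `t` afterwards; one bound `M` serves both
  -- limits.
  have htest : ∀ j n, IsAxisTest (fun r t => B j (t - t₀) - B j (t - t₀ - c * A n r))
      (fun r t => c * a n r * b j (t - t₀ - c * A n r))
      (fun r t => b j (t - t₀) - b j (t - t₀ - c * A n r)) M R := by
    intro j n
    refine ⟨(hc0 j n).measurable, (hcr j n).measurable, (hcT j n).measurable,
      fun r t hr => ?_, fun r t hr => ?_, fun r t hr => ?_, fun r t hr ht => ?_⟩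
    · refine ((hB j).abs_sub_le _ _).trans ?_
      rw [_root_.sub_sub_cancel, abs_mul, abs_of_nonneg ((hA n).nonneg r)]
      exact mul_le_mul hM (((hA n).le_ramp r).trans (ramp_le_self hr₁ hr.le)) ((hA n).nonneg r)
        (by positivity)
    · rw [abs_mul, abs_mul, abs_of_nonneg ((hA n).deriv_nonneg r),
        abs_of_nonneg ((hB j).deriv_nonneg _)]
      calc |c| * a n r * b j _ ≤ |c| * 1 * 1 := by
            gcongr
            · exact (hB j).deriv_nonneg _
            · exact (hA n).deriv_le r
            · exact (hB j).deriv_le _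
        _ ≤ M := by simpa using hM
    · exact (hb01 j _ _).trans (by simp [M])
    · have h1 := hAabs n r
      have h2 : (t - t₀ ≤ -k ∧ t - t₀ - c * A n r ≤ -k) ∨ (k ≤ t - t₀ ∧ k ≤ t - t₀ - c * A n r) := by
        have h3 := abs_le.1 h1
        have h4 := neg_abs_le t₀
        have h5 := le_abs_self t₀
        rcases le_abs.1 ht with ht | ht
        · right; constructor <;> linarith
        · left; constructor <;> linarith
      rcases h2 with ⟨h3, h4⟩ | ⟨h3, h4⟩
      · simp [(hB j).eq_zero _ h3, (hB j).eq_zero _ h4, (hB j).deriv_eq_zero _ (Or.inl h3),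
          (hB j).deriv_eq_zero _ (Or.inl h4)]
      · simp [(hB j).eq_of_ge _ h3, (hB j).eq_of_ge _ h4, (hB j).deriv_eq_zero _ (Or.inr h3),
          (hB j).deriv_eq_zero _ (Or.inr h4)]
  have hid : ∀ j n, _ := fun j n => h.identity_of_hasDerivAt (htest j n) (hc0 j n) (hcr j n)
    (hcT j n) (fun r t _ => by
      have h1 : HasDerivAt (fun r => t - t₀ - c * A n r) (-(c * a n r)) r :=
        (((hA n).hasDerivAt r).const_mul c).const_sub _
      have h2 := (((hB j).hasDerivAt (t - t₀ - c * A n r)).comp r h1).const_sub (B j (t - t₀))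
      exact h2.congr_deriv (by ring)) (fun r t _ => by
      have h1 : HasDerivAt (fun t => t - t₀) 1 t := (hasDerivAt_id t).sub_const _
      have h2 : HasDerivAt (fun t => t - t₀ - c * A n r) 1 t := h1.sub_const _
      have h3 := (((hB j).hasDerivAt (t - t₀)).comp t h1).sub
        (((hB j).hasDerivAt (t - t₀ - c * A n r)).comp t h2)
      exact h3.congr_deriv (by ring))
  have hl : ∀ (t r), Tendsto (fun n => t - t₀ - c * A n r) atTop
      (𝓝 (t - t₀ - c * ramp r₁ r₂ r)) := fun t r => ((hAl r).const_mul c).const_sub _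
  have lB : ∀ j r t, Tendsto (fun n => B j (t - t₀) - B j (t - t₀ - c * A n r)) atTop
      (𝓝 (B j (t - t₀) - B j (t - t₀ - c * ramp r₁ r₂ r))) := fun j r t =>
    (((hB j).continuous.tendsto _).comp (hl t r)).const_sub _
  have lr : ∀ j r t, Tendsto (fun n => c * a n r * b j (t - t₀ - c * A n r)) atTop
      (𝓝 (c * (Ioo r₁ r₂).indicator (fun _ => 1) r *
        b j (t - t₀ - c * ramp r₁ r₂ r))) := fun j r t =>
    ((hal r).const_mul c).mul (((hB j).continuous_deriv.tendsto _).comp (hl t r))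
  have lt : ∀ j r t, Tendsto (fun n => b j (t - t₀) - b j (t - t₀ - c * A n r)) atTop
      (𝓝 (b j (t - t₀) - b j (t - t₀ - c * ramp r₁ r₂ r))) := fun j r t =>
    (((hB j).continuous_deriv.tendsto _).comp (hl t r)).const_sub _
  have htest' := fun j => IsAxisTest.of_tendsto (htest j) (lB j) (lr j) (lt j)
  have hid' := fun j => h.identity_of_tendsto
    (ψ := fun r t => B j (t - t₀) - B j (t - t₀ - c * ramp r₁ r₂ r))
    (ψr := fun r t => c * (Ioo r₁ r₂).indicator (fun _ => 1) r * b j (t - t₀ - c * ramp r₁ r₂ r))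
    (ψt := fun r t => b j (t - t₀) - b j (t - t₀ - c * ramp r₁ r₂ r)) (htest j) (hid j)
    (.of_forall fun z => ⟨lB j ‖z.1‖ z.2, lr j ‖z.1‖ z.2, lt j ‖z.1‖ z.2⟩)
  have LB : ∀ r t, Tendsto (fun j => B j (t - t₀) - B j (t - t₀ - c * ramp r₁ r₂ r)) atTop
      (𝓝 (ramp (-k) k (t - t₀) - ramp (-k) k (t - t₀ - c * ramp r₁ r₂ r))) := fun r t =>
    (hBl _).sub (hBl _)
  have Lr : ∀ r t, Tendsto (fun j => c * (Ioo r₁ r₂).indicator (fun _ => 1) r *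
      b j (t - t₀ - c * ramp r₁ r₂ r)) atTop
      (𝓝 (c * (Ioo r₁ r₂).indicator (fun _ => 1) r *
        (Ioo (-k) k).indicator (fun _ => 1) (t - t₀ - c * ramp r₁ r₂ r))) := fun r t =>
    (hbl _).const_mul _
  have Lt : ∀ r t, Tendsto (fun j => b j (t - t₀) - b j (t - t₀ - c * ramp r₁ r₂ r)) atTop
      (𝓝 ((Ioo (-k) k).indicator (fun _ => 1) (t - t₀) -
        (Ioo (-k) k).indicator (fun _ => 1) (t - t₀ - c * ramp r₁ r₂ r))) := fun r t =>
    (hbl _).sub (hbl _)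
  exact ⟨⟨M, R, IsAxisTest.of_tendsto htest' LB Lr Lt⟩, h.identity_of_tendsto
    (ψ := fun r t => ramp (-k) k (t - t₀) - ramp (-k) k (t - t₀ - c * ramp r₁ r₂ r))
    (ψr := fun r t => c * (Ioo r₁ r₂).indicator (fun _ => 1) r *
        (Ioo (-k) k).indicator (fun _ => 1) (t - t₀ - c * ramp r₁ r₂ r))
    (ψt := fun r t => (Ioo (-k) k).indicator (fun _ => 1) (t - t₀) -
        (Ioo (-k) k).indicator (fun _ => 1) (t - t₀ - c * ramp r₁ r₂ r)) htest' hid'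
    (.of_forall fun z => ⟨LB ‖z.1‖ z.2, Lr ‖z.1‖ z.2, Lt ‖z.1‖ z.2⟩)⟩

end RadialCurrent

end

/-! ### The identity on layers around cylinders -/

section CylinderIdentity

variable {w e m : Spacetime → ℝ} {σ K : ℝ}

/-- The integral of `e (·, t)` outside of a ball. -/
def exteriorIntegral (e : Spacetime → ℝ) (R t : ℝ) : ℝ := ∫ x in {x : E3 | R < ‖x‖}, e (x, t)

lemma measurableSet_exterior (R : ℝ) : MeasurableSet {x : E3 | R < ‖x‖} :=
  measurableSet_lt measurable_const measurable_norm

namespace RadialCurrent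

variable (h : RadialCurrent w e m σ K)
include h

lemma exteriorIntegral_eq (R t : ℝ) : exteriorIntegral e R t =
    (∫ x, e (x, t)) - ∫ x in closedBall 0 R, e (x, t) := by
  have hc : (closedBall 0 R)ᶜ = {x : E3 | R < ‖x‖} := by ext x; simp
  rw [exteriorIntegral, ← hc, ← integral_add_compl measurableSet_closedBall
    (h.integrable_e t)]
  ring

lemma continuous_exteriorIntegral (R : ℝ) : Continuous (exteriorIntegral e R) := by
  rw [funext (h.exteriorIntegral_eq R)]
  exact h.continuous_e.sub (h.continuous_ball R)

lemma exteriorIntegral_nonneg (R t : ℝ) : 0 ≤ exteriorIntegral e R t :=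
  integral_nonneg fun _ => h.e_nonneg _

lemma exteriorIntegral_le (R t : ℝ) : exteriorIntegral e R t ≤ K :=
  (setIntegral_le_integral (h.integrable_e t) (.of_forall fun _ => h.e_nonneg _)).trans
    (h.integral_e_le t)

lemma antitone_exteriorIntegral (t : ℝ) : Antitone fun R => exteriorIntegral e R t := by
  intro R R' hR
  exact setIntegral_mono_set (h.integrable_e t).integrableOn (.of_forall fun _ => h.e_nonneg _)
    (.of_forall fun x (hx : R' < ‖x‖) => lt_of_le_of_lt hR hx)

/-- A layer-cake formula: `A(|x|)` is the integral of `a(ρ)` over `ρ < |x|`. It reduces the time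
continuity of weighted integrals of `e` to that of its integrals outside of balls. -/
lemma integral_ramp_mul_e {α β : ℝ} {A a : ℝ → ℝ} (hA : IsSmoothRamp α β A a) (t : ℝ) :
    ∫ x, A ‖x‖ * e (x, t) = ∫ ρ, a ρ * exteriorIntegral e ρ t := by
  have hsupp : ∀ s, A s = ∫ ρ, a ρ * (Iio s).indicator (fun _ => 1) ρ := by
    intro s
    have h1 : ∀ ρ, a ρ * (Iio s).indicator (fun _ => 1) ρ = (Iio s).indicator a ρ := fun ρ => by
      by_cases hρ : ρ ∈ Iio s <;> simp [hρ]
    simp_rw [h1]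
    rw [integral_indicator measurableSet_Iio]
    rcases le_total s α with hs | hs
    · rw [hA.eq_zero s hs, setIntegral_eq_zero_of_forall_eq_zero]
      intro ρ hρ
      exact hA.deriv_eq_zero ρ (Or.inl (le_of_lt (lt_of_lt_of_le hρ hs)))
    · rw [hA.eq_integral, intervalIntegral.integral_of_le hs, integral_Ioc_eq_integral_Ioo]
      refine (setIntegral_eq_of_subset_of_forall_sdiff_eq_zero measurableSet_Iio
        (fun y hy => hy.2) fun ρ hρ => hA.deriv_eq_zero ρ (Or.inl ?_)).symm
      by_contra hc
      exact hρ.2 ⟨not_le.1 hc, hρ.1⟩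
  have haint : Integrable a := by
    refine hA.continuous_deriv.integrable_of_hasCompactSupport
      (HasCompactSupport.of_support_subset_isCompact (isCompact_Icc (a := α) (b := β))
        fun s hs => ?_)
    by_contra hc
    apply hs
    refine hA.deriv_eq_zero s ?_
    rw [mem_Icc, not_and_or, not_le, not_le] at hc
    exact hc.imp le_of_lt le_of_lt
  have hmeas : MeasurableSet {q : E3 × ℝ | q.2 < ‖q.1‖} :=
    measurableSet_lt measurable_snd measurable_fst.norm
  have hint : Integrable (Function.uncurry fun x ρ =>
      a ρ * (Iio ‖x‖).indicator (fun _ => 1) ρ * e (x, t))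
      ((volume : Measure E3).prod (volume : Measure ℝ)) := by
    refine (((h.integrable_e t).mul_prod haint).indicator hmeas).congr (.of_forall fun q => ?_)
    by_cases hq : q.2 < ‖q.1‖
    · simp [Function.uncurry, hq, mul_comm]
    · simp [Function.uncurry, hq]
  calc ∫ x, A ‖x‖ * e (x, t) = ∫ x, ∫ ρ, a ρ * (Iio ‖x‖).indicator (fun _ => 1) ρ * e (x, t) := by
        refine integral_congr_ae (.of_forall fun x => ?_)
        simp only
        rw [integral_mul_const, ← hsupp]
    _ = ∫ ρ, ∫ x, a ρ * (Iio ‖x‖).indicator (fun _ => 1) ρ * e (x, t) :=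
        integral_integral_swap hint
    _ = _ := by
        refine integral_congr_ae (.of_forall fun ρ => ?_)
        simp only [exteriorIntegral]
        rw [← integral_indicator (measurableSet_exterior ρ), ← integral_const_mul]
        refine integral_congr_ae (.of_forall fun x => ?_)
        by_cases hq : ρ < ‖x‖ <;> simp [hq]

lemma continuous_integral_ramp_mul_e {α β : ℝ} {A a : ℝ → ℝ} (hA : IsSmoothRamp α β A a) :
    Continuous fun t => ∫ x, A ‖x‖ * e (x, t) := by
  simp_rw [h.integral_ramp_mul_e hA]
  refine continuous_of_dominated (bound := fun ρ => (Icc α β).indicator (fun _ => K) ρ)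
    (fun t => ?_) (fun t => .of_forall fun ρ => ?_) ?_ (.of_forall fun ρ =>
      continuous_const.mul (h.continuous_exteriorIntegral ρ))
  · exact (hA.continuous_deriv.measurable.mul
      (h.antitone_exteriorIntegral t).measurable).aestronglyMeasurable
  · rw [norm_mul, Real.norm_of_nonneg (hA.deriv_nonneg ρ),
      Real.norm_of_nonneg (h.exteriorIntegral_nonneg ρ t)]
    by_cases hρ : ρ ∈ Icc α β
    · rw [indicator_of_mem hρ]
      calc a ρ * exteriorIntegral e ρ t ≤ 1 * K := mul_le_mul (hA.deriv_le ρ)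
            (h.exteriorIntegral_le ρ t) (h.exteriorIntegral_nonneg ρ t) zero_le_one
        _ = K := one_mul K
    · rw [indicator_of_notMem hρ, hA.deriv_eq_zero ρ, zero_mul]
      rw [mem_Icc, not_and_or, not_le, not_le] at hρ
      exact hρ.imp le_of_lt le_of_lt
  · exact (integrable_indicator_iff measurableSet_Icc).2 (integrableOn_const (by simp))

/-- Test with `A(r) γ(t)` and let `γ` tend to the indicator function of `(s₁, s₂)`. Its derivative
tends to the difference of point masses, which can be evaluated because the weighted integrals of
`e` are continuous in time. -/
lemma smooth_cylinder_identity {α β s₁ s₂ : ℝ} (hα : 0 ≤ α) (hs : s₁ < s₂)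
    {A a : ℝ → ℝ} (hA : IsSmoothRamp α β A a) :
    ∫ z, a ‖z.1‖ * (Ioo s₁ s₂).indicator (fun _ => 1) z.2 * w z =
      σ * (∫ x, A ‖x‖ * e (x, s₂)) - σ * (∫ x, A ‖x‖ * e (x, s₁)) +
      ∫ z, A ‖z.1‖ * (Ioo s₁ s₂).indicator (fun _ => 1) z.2 * m z := by
  obtain ⟨γ, γ', hγ'c, hγd, hγ0, hγ1, hz, hγlim, hγt⟩ := exists_smooth_indicator hs
  have hγc := fun n => continuous_iff_continuousAt.2 fun s => (hγd n s).continuousAt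
  let R : ℝ := max |s₁| |s₂|
  have hR : ∀ t, R ≤ |t| → t ∉ Ioo s₁ s₂ := fun t ht hmem => by
    have h1 : |t| < R := by
      rw [abs_lt]
      constructor
      · linarith [hmem.1, neg_abs_le s₁, le_max_left |s₁| |s₂|]
      · linarith [hmem.2, le_abs_self s₂, le_max_right |s₁| |s₂|]
    linarith
  have hAle' : ∀ s, A s ≤ |β - α| := fun s => by
    rcases le_total α β with hab | hab
    · exact (hA.le_ramp s).trans ((ramp_le hab).trans (le_abs_self _))
    · refine (hA.le_ramp s).trans ((max_le le_rfl ?_).trans (abs_nonneg _))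
      exact (min_le_right _ _).trans (by linarith)
  have hid : ∀ n, (∫ z, a ‖z.1‖ * γ n z.2 * w z) + (∫ t, γ' n t * (σ * ∫ x, A ‖x‖ * e (x, t))) -
      ∫ z, A ‖z.1‖ * γ n z.2 * m z = 0 := by
    intro n
    obtain ⟨C, hC⟩ := isCompact_Icc.exists_bound_of_continuousOn (hγ'c n).continuousOn
    have hC' : ∀ t, |γ' n t| ≤ |C| := fun t => by
      by_cases ht : t ∈ Ioo s₁ s₂
      · exact (hC t (Ioo_subset_Icc_self ht)).trans (le_abs_self C)
      · rw [(hz n t ht).2, abs_zero]; exact abs_nonneg _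
    obtain ⟨-, -, i3, h1⟩ := h.identity_of_product (L := 1) hA.continuous hA.continuous_deriv
      (fun r _ => hA.hasDerivAt r) hA.nonneg hA.deriv_nonneg
      (fun r hr => by rw [one_mul]; exact (hA.le_ramp r).trans (ramp_le_self hα hr.le)) hAle'
      hA.deriv_le (hγ'c n) (hγd n) (hγ0 n) (hγ1 n) hC' fun t ht => hz n t (hR t ht)
    have h2 : ∫ z, A ‖z.1‖ * γ' n z.2 * (σ * e z) = ∫ t, γ' n t * (σ * ∫ x, A ‖x‖ * e (x, t)) := by
      rw [integral_spacetime i3]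
      congr 1
      funext t
      rw [← integral_const_mul, ← integral_const_mul]
      refine integral_congr_ae (.of_forall fun x => ?_)
      ring
    rw [← h2, ← h1]
  have hγI : ∀ t, Tendsto (fun n => γ n t) atTop (𝓝 ((Ioo s₁ s₂).indicator (fun _ => 1) t)) := by
    intro t
    by_cases ht : t ∈ Ioo s₁ s₂
    · rw [indicator_of_mem ht]
      exact tendsto_const_nhds.congr' ((hγlim t ht).mono fun n hn => hn.symm)
    · rw [indicator_of_notMem ht]
      simp_rw [(hz _ t ht).1]; exact tendsto_const_nhds
  have hL1 : Tendsto (fun n => ∫ z, a ‖z.1‖ * γ n z.2 * w z) atTop (𝓝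
      (∫ z, a ‖z.1‖ * (Ioo s₁ s₂).indicator (fun _ => 1) z.2 * w z)) := by
    refine tendsto_integral_of_dominated_convergence _ (fun n => ?_)
      (h.integrable_slab_mul_e R) (fun n => .of_forall fun z => ?_)
      (.of_forall fun z => ((hγI z.2).const_mul _).mul_const _)
    · exact ((hA.continuous_deriv.comp continuous_fst.norm).mul
        ((hγc n).comp continuous_snd)).aestronglyMeasurable.mul h.aesm_w
    · rw [norm_mul, norm_mul, Real.norm_of_nonneg (hA.deriv_nonneg _),
        Real.norm_of_nonneg (hγ0 n _)]
      refine mul_le_mul ?_ (h.abs_w_le z) (abs_nonneg _) (indicator_nonneg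
        (fun _ _ => zero_le_one) _)
      by_cases ht : z.2 ∈ Ioo s₁ s₂
      · have : z.2 ∈ Icc (-R) R := by
          by_contra hc
          rw [mem_Icc, ← abs_le, not_le] at hc
          exact hR _ hc.le ht
        rw [indicator_of_mem this]
        exact mul_le_one₀ (hA.deriv_le _) (hγ0 n _) (hγ1 n _)
      · rw [(hz n _ ht).1, mul_zero]
        exact indicator_nonneg (fun _ _ => zero_le_one) _
  have hL2 : Tendsto (fun n => ∫ z, A ‖z.1‖ * γ n z.2 * m z) atTop (𝓝
      (∫ z, A ‖z.1‖ * (Ioo s₁ s₂).indicator (fun _ => 1) z.2 * m z)) := by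
    refine tendsto_integral_of_dominated_convergence (fun z => |β - α| * m z) (fun n => ?_)
      (h.integrable_m.const_mul _) (fun n => .of_forall fun z => ?_)
      (.of_forall fun z => ((hγI z.2).const_mul _).mul_const _)
    · exact ((hA.continuous.comp continuous_fst.norm).mul
        ((hγc n).comp continuous_snd)).aestronglyMeasurable.mul h.aesm_m
    · rw [norm_mul, norm_mul, Real.norm_of_nonneg (hA.nonneg _), Real.norm_of_nonneg (hγ0 n _),
        Real.norm_of_nonneg (h.m_nonneg z)]
      refine mul_le_mul_of_nonneg_right ?_ (h.m_nonneg z)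
      calc A ‖z.1‖ * γ n z.2 ≤ |β - α| * 1 :=
            mul_le_mul (hAle' _) (hγ1 n _) (hγ0 n _) (abs_nonneg _)
        _ = _ := mul_one _
  have hL3 := hγt (fun t => σ * ∫ x, A ‖x‖ * e (x, t))
    (continuous_const.mul (h.continuous_integral_ramp_mul_e hA))
  have hlim := (hL1.add hL3).sub hL2
  simp_rw [hid] at hlim
  have := tendsto_nhds_unique tendsto_const_nhds hlim
  linarith

lemma cylinder_identity {α β s₁ s₂ : ℝ} (hα : 0 ≤ α) (hab : α < β) (hs : s₁ < s₂) :
    ∫ z, (Ioo α β).indicator (fun _ => 1) ‖z.1‖ * (Ioo s₁ s₂).indicator (fun _ => 1) z.2 * w z =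
      σ * (∫ x, ramp α β ‖x‖ * e (x, s₂)) - σ * (∫ x, ramp α β ‖x‖ * e (x, s₁)) +
      ∫ z, ramp α β ‖z.1‖ * (Ioo s₁ s₂).indicator (fun _ => 1) z.2 * m z := by
  obtain ⟨A, a, hA, hAl, hal⟩ := exists_smooth_ramp hab
  let R : ℝ := max |s₁| |s₂|
  have hI0 : ∀ t, 0 ≤ (Ioo s₁ s₂).indicator (fun _ => (1 : ℝ)) t := fun t =>
    indicator_nonneg (fun _ _ => zero_le_one) _
  have hIm : Measurable fun z : Spacetime => (Ioo s₁ s₂).indicator (fun _ => (1 : ℝ)) z.2 :=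
    (measurable_const.indicator measurableSet_Ioo).comp measurable_snd
  have hI1 : ∀ t, (Ioo s₁ s₂).indicator (fun _ => 1) t ≤
      (Icc (-R) R).indicator (fun _ => (1 : ℝ)) t := by
    refine indicator_le_indicator_of_subset ?_ fun _ => zero_le_one
    intro t ht
    constructor
    · linarith [ht.1, neg_abs_le s₁, le_max_left |s₁| |s₂|]
    · linarith [ht.2, le_abs_self s₂, le_max_right |s₁| |s₂|]
  have hI2 : ∀ t, (Ioo s₁ s₂).indicator (fun _ => (1 : ℝ)) t ≤ 1 :=
    indicator_le_self' (fun _ _ => zero_le_one)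
  have hAle := fun n s => ((hA n).le_ramp s).trans (ramp_le hab.le)
  have hL1 : Tendsto (fun n => ∫ z, a n ‖z.1‖ *
      (Ioo s₁ s₂).indicator (fun _ => 1) z.2 * w z) atTop (𝓝
      (∫ z, (Ioo α β).indicator (fun _ => 1) ‖z.1‖ *
        (Ioo s₁ s₂).indicator (fun _ => 1) z.2 * w z)) := by
    refine tendsto_integral_of_dominated_convergence _ (fun n => ?_)
      (h.integrable_slab_mul_e R) (fun n => .of_forall fun z => ?_)
      (.of_forall fun z => ((hal ‖z.1‖).mul_const _).mul_const _)
    · exact (((hA n).continuous_deriv.comp continuous_fst.norm).measurable.mul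
        hIm).aestronglyMeasurable.mul h.aesm_w
    · rw [norm_mul, norm_mul, Real.norm_of_nonneg ((hA n).deriv_nonneg _),
        Real.norm_of_nonneg (hI0 _)]
      refine mul_le_mul ?_ (h.abs_w_le z) (abs_nonneg _) (indicator_nonneg
        (fun _ _ => zero_le_one) _)
      calc a n ‖z.1‖ * _ ≤ 1 * _ := mul_le_mul_of_nonneg_right ((hA n).deriv_le _) (hI0 _)
        _ ≤ _ := by rw [one_mul]; exact hI1 _
  have hL2 : Tendsto (fun n => ∫ z, A n ‖z.1‖ *
      (Ioo s₁ s₂).indicator (fun _ => 1) z.2 * m z) atTop (𝓝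
      (∫ z, ramp α β ‖z.1‖ * (Ioo s₁ s₂).indicator (fun _ => 1) z.2 * m z)) := by
    refine tendsto_integral_of_dominated_convergence (fun z => (β - α) * m z) (fun n => ?_)
      (h.integrable_m.const_mul _) (fun n => .of_forall fun z => ?_)
      (.of_forall fun z => ((hAl ‖z.1‖).mul_const _).mul_const _)
    · exact (((hA n).continuous.comp continuous_fst.norm).measurable.mul
        hIm).aestronglyMeasurable.mul h.aesm_m
    · rw [norm_mul, norm_mul, Real.norm_of_nonneg ((hA n).nonneg _), Real.norm_of_nonneg (hI0 _),
        Real.norm_of_nonneg (h.m_nonneg z)]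
      refine mul_le_mul_of_nonneg_right ?_ (h.m_nonneg z)
      calc A n ‖z.1‖ * _ ≤ (β - α) * 1 := mul_le_mul (hAle n _) (hI2 _) (hI0 _) (by linarith)
        _ = _ := mul_one _
  have hL3 : ∀ t, Tendsto (fun n => σ * ∫ x, A n ‖x‖ * e (x, t)) atTop
      (𝓝 (σ * ∫ x, ramp α β ‖x‖ * e (x, t))) := by
    intro t
    refine (tendsto_integral_of_dominated_convergence (fun x => (β - α) * e (x, t))
      (fun n => ?_) ((h.integrable_e t).const_mul _) (fun n => .of_forall fun x => ?_)
      (.of_forall fun x => (hAl ‖x‖).mul_const _)).const_mul _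
    · exact ((hA n).continuous.comp continuous_norm).aestronglyMeasurable.mul (h.integrable_e t).1
    · rw [norm_mul, Real.norm_of_nonneg ((hA n).nonneg _), Real.norm_of_nonneg (h.e_nonneg _)]
      exact mul_le_mul_of_nonneg_right (hAle n _) (h.e_nonneg _)
  refine tendsto_nhds_unique hL1 ?_
  simp_rw [h.smooth_cylinder_identity hα hs (hA _)]
  exact ((hL3 s₂).sub (hL3 s₁)).add hL2

end RadialCurrent

end CylinderIdentity

/-! ### Thin layers around cylinders and around the axis -/

section LayerLimits

variable {w e m : Spacetime → ℝ} {σ K : ℝ}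

/-- The indicator function of a set, with real values. -/
abbrev ind {X : Type*} (S : Set X) : X → ℝ := S.indicator fun _ => (1 : ℝ)

lemma ind_nonneg {X : Type*} (S : Set X) (x : X) : 0 ≤ ind S x :=
  indicator_nonneg (fun _ _ => zero_le_one) _

lemma ind_le_one {X : Type*} (S : Set X) (x : X) : ind S x ≤ 1 :=
  indicator_le_self' (fun _ _ => zero_le_one) _

lemma setIntegral_eq_ind {X : Type*} [MeasurableSpace X] {μ : Measure X} {S : Set X}
    (hS : MeasurableSet S) (f : X → ℝ) : ∫ x in S, f x ∂μ = ∫ x, ind S x * f x ∂μ := by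
  rw [← integral_indicator hS]
  congr 1
  funext x
  by_cases hx : x ∈ S <;> simp [hx]

lemma integrable_ind_mul {X : Type*} [MeasurableSpace X] {μ : Measure X} {S : Set X}
    (hS : MeasurableSet S) {f : X → ℝ} (hf : Integrable f μ) : Integrable (fun x => ind S x * f x) μ := by
  refine (hf.indicator hS).congr (.of_forall fun x => ?_)
  by_cases hx : x ∈ S <;> simp [hx]

lemma ae_norm_ne (R : ℝ) : ∀ᵐ x : E3, ‖x‖ ≠ R := by
  rw [ae_iff]
  have : {x : E3 | ¬ ‖x‖ ≠ R} = sphere 0 R := by ext x; simp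
  rw [this]
  exact Measure.addHaar_sphere _ _ _

lemma ae_norm_fst_ne (R : ℝ) : ∀ᵐ z : Spacetime, ‖z.1‖ ≠ R :=
  (Measure.quasiMeasurePreserving_fst).ae (ae_norm_ne R)

lemma ae_snd_ne {g : E3 → ℝ} (hg : Measurable g) : ∀ᵐ z : Spacetime, z.2 ≠ g z.1 := by
  have hS : MeasurableSet {z : Spacetime | z.2 ≠ g z.1} :=
    (measurableSet_eq_fun measurable_snd (hg.comp measurable_fst)).compl
  refine (Measure.ae_prod_iff_ae_ae hS).2 (.of_forall fun x => ?_)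
  simp [ae_iff]

/-- The centre `c h` may move with `h`. A constant centre gives the layer around a cylinder; `c h =
h` gives the one-sided layer `(0, 2h)` at the axis. -/
lemma eventually_ramp_eq {c : ℝ → ℝ} {r₀ s : ℝ} (hc : Tendsto c (𝓝[>] 0) (𝓝 r₀)) (hs : s ≠ r₀) :
    ∀ᶠ h in 𝓝[>] 0, 1 / (2 * h) * ramp (c h - h) (c h + h) s = ind (Ioi r₀) s := by
  have hd := half_pos (abs_pos.2 (sub_ne_zero.2 hs))
  filter_upwards [self_mem_nhdsWithin, mem_nhdsWithin_of_mem_nhds (gt_mem_nhds hd),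
    hc (ball_mem_nhds r₀ hd)] with h h0 h1 h2
  have h0' : 0 < h := h0
  have h3 : |c h - r₀| < |s - r₀| / 2 := h2
  rw [abs_lt] at h3
  rcases lt_or_gt_of_ne hs with hlt | hgt
  · rw [abs_of_neg (by linarith)] at h1 h3
    rw [ramp_of_le _ (by linarith)]
    simp [hlt.le]
  · rw [abs_of_pos (by linarith)] at h1 h3
    rw [ramp_of_ge (by linarith) (by linarith)]
    simp only [indicator_of_mem (mem_Ioi.2 hgt)]
    field_simp
    ring

lemma ramp_mul_mem {h : ℝ} (h0 : 0 < h) (c s : ℝ) :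
    0 ≤ 1 / (2 * h) * ramp (c - h) (c + h) s ∧ 1 / (2 * h) * ramp (c - h) (c + h) s ≤ 1 := by
  refine ⟨mul_nonneg (by positivity) (ramp_nonneg _ _ _), ?_⟩
  rw [one_div_mul_eq_div, div_le_one (by positivity)]
  exact (ramp_le (by linarith)).trans (by linarith)

lemma tendsto_integral_bounded_mul {X : Type*} [MeasurableSpace X] {μ : Measure X} {f : X → ℝ}
    (hf : Integrable f μ) {l : Filter ℝ} [l.IsCountablyGenerated] {g : ℝ → X → ℝ} {g₀ : X → ℝ}
    {C : ℝ} (hg : ∀ᶠ h in l, AEStronglyMeasurable (g h) μ) (hC : ∀ᶠ h in l, ∀ x, |g h x| ≤ C)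
    (hl : ∀ᵐ x ∂μ, Tendsto (fun h => g h x) l (𝓝 (g₀ x))) :
    Tendsto (fun h => ∫ x, g h x * f x ∂μ) l (𝓝 (∫ x, g₀ x * f x ∂μ)) := by
  refine tendsto_integral_filter_of_dominated_convergence (fun x => C * |f x|)
    (hg.mono fun h hh => hh.mul hf.1) (hC.mono fun h hh => .of_forall fun x => ?_)
    (hf.abs.const_mul C) (hl.mono fun x hx => hx.mul_const _)
  rw [norm_mul]
  exact mul_le_mul_of_nonneg_right (hh x) (abs_nonneg _)

lemma tendsto_average {f : ℝ → ℝ} (hf : Continuous f) (t₀ : ℝ) :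
    Tendsto (fun k => 1 / (2 * k) * ∫ t, ind (Ioo (-k) k) (t - t₀) * f t) (𝓝[>] 0) (𝓝 (f t₀)) := by
  rw [Metric.tendsto_nhds]
  intro ε hε
  obtain ⟨δ, hδ, hfδ⟩ := continuous_iff.1 hf t₀ (ε / 2) (by positivity)
  filter_upwards [self_mem_nhdsWithin, mem_nhdsWithin_of_mem_nhds (gt_mem_nhds hδ)] with k h0 h1
  have hk : 0 < k := h0
  have hI : ∀ t, ind (Ioo (-k) k) (t - t₀) = ind (Ioo (t₀ - k) (t₀ + k)) t := by
    intro t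
    have : t - t₀ ∈ Ioo (-k) k ↔ t ∈ Ioo (t₀ - k) (t₀ + k) := by
      constructor <;> rintro ⟨h2, h3⟩ <;> constructor <;> linarith
    simp only [ind, indicator, this]
  simp_rw [hI]
  rw [← setIntegral_eq_ind measurableSet_Ioo]
  have hv : volume.real (Ioo (t₀ - k) (t₀ + k)) = 2 * k := by
    rw [Real.volume_real_Ioo_of_le (by linarith)]; ring
  have hfi : IntegrableOn f (Ioo (t₀ - k) (t₀ + k)) :=
    (hf.integrableOn_Icc).mono_set Ioo_subset_Icc_self
  have h2 : 1 / (2 * k) * (∫ t in Ioo (t₀ - k) (t₀ + k), f t) - f t₀ =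
      1 / (2 * k) * ∫ t in Ioo (t₀ - k) (t₀ + k), (f t - f t₀) := by
    rw [integral_sub hfi (integrableOn_const (by simp)), setIntegral_const, hv, smul_eq_mul]
    field_simp
  rw [Real.dist_eq, h2, abs_mul, abs_of_pos (by positivity : 0 < 1 / (2 * k))]
  have h3 := norm_setIntegral_le_of_norm_le_const (μ := volume)
    (s := Ioo (t₀ - k) (t₀ + k)) (f := fun t => f t - f t₀) (by simp) fun t ht => by
      have : dist t t₀ < δ := by rw [Real.dist_eq, abs_lt]; constructor <;> linarith [ht.1, ht.2]
      exact (hfδ t this).le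
  rw [hv] at h3
  calc 1 / (2 * k) * |∫ t in Ioo (t₀ - k) (t₀ + k), (f t - f t₀)|
      ≤ 1 / (2 * k) * (ε / 2 * (2 * k)) := mul_le_mul_of_nonneg_left h3 (by positivity)
    _ = ε / 2 := by field_simp
    _ < ε := by linarith

/-- The part of `∬ m` outside of a cylinder and before a given time. -/
def pastIntegral (m : Spacetime → ℝ) (r t : ℝ) : ℝ := ∫ z in {z : Spacetime | r < ‖z.1‖ ∧ z.2 < t}, m z

/-- The potential of the current `(w, σ e)`, whose differences are the fluxes up to multiples
of `∬ m`. -/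
def potential (e m : Spacetime → ℝ) (σ r t : ℝ) : ℝ :=
  σ * exteriorIntegral e r t + pastIntegral m r t

lemma measurableSet_past (r t : ℝ) : MeasurableSet {z : Spacetime | r < ‖z.1‖ ∧ z.2 < t} :=
  (measurableSet_lt measurable_const measurable_fst.norm).inter
    (measurableSet_lt measurable_snd measurable_const)

namespace RadialCurrent

variable (h : RadialCurrent w e m σ K)
include h

lemma tendsto_ramp_exterior {c : ℝ → ℝ} {r₀ : ℝ} (hc : Tendsto c (𝓝[>] 0) (𝓝 r₀)) (t : ℝ) :
    Tendsto (fun k => 1 / (2 * k) * ∫ x, ramp (c k - k) (c k + k) ‖x‖ * e (x, t)) (𝓝[>] 0)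
      (𝓝 (exteriorIntegral e r₀ t)) := by
  rw [exteriorIntegral, setIntegral_eq_ind (measurableSet_exterior r₀)]
  simp_rw [← integral_const_mul, ← mul_assoc]
  refine tendsto_integral_bounded_mul (h.integrable_e t) (C := 1)
    (.of_forall fun k => ((continuous_ramp _ _).comp
      continuous_norm).aestronglyMeasurable.const_mul _) ?_ ?_
  · filter_upwards [self_mem_nhdsWithin] with k hk x
    have := ramp_mul_mem hk (c k) ‖x‖
    rw [abs_of_nonneg this.1]; exact this.2
  · filter_upwards [ae_norm_ne r₀] with x hx
    refine tendsto_const_nhds.congr' ?_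
    filter_upwards [eventually_ramp_eq hc hx] with k hk
    rw [hk]
    simp [indicator]

lemma integral_strip_eq (r₀ : ℝ) {s₁ s₂ : ℝ} (hs : s₁ ≤ s₂) :
    ∫ z, ind {x : E3 | r₀ < ‖x‖} z.1 * ind (Ioo s₁ s₂) z.2 * m z =
      pastIntegral m r₀ s₂ - pastIntegral m r₀ s₁ := by
  rw [pastIntegral, pastIntegral, setIntegral_eq_ind (measurableSet_past _ _),
    setIntegral_eq_ind (measurableSet_past _ _),
    ← integral_sub (integrable_ind_mul (measurableSet_past _ _) h.integrable_m)
      (integrable_ind_mul (measurableSet_past _ _) h.integrable_m)]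
  refine integral_congr_ae ?_
  filter_upwards [ae_snd_ne (g := fun _ => s₁) measurable_const] with z hz
  by_cases hr : r₀ < ‖z.1‖
  · rcases lt_or_gt_of_ne hz with h1 | h1
    · simp [indicator, h1, h1.trans_le hs, not_lt.2 h1.le]
    · simp [indicator, hr, h1, not_lt.2 h1.le]
  · simp [indicator, hr]

lemma tendsto_ramp_strip {c : ℝ → ℝ} {r₀ : ℝ} (hc : Tendsto c (𝓝[>] 0) (𝓝 r₀)) {s₁ s₂ : ℝ}
    (hs : s₁ ≤ s₂) :
    Tendsto (fun k => 1 / (2 * k) * ∫ z, ramp (c k - k) (c k + k) ‖z.1‖ *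
      ind (Ioo s₁ s₂) z.2 * m z) (𝓝[>] 0)
      (𝓝 (pastIntegral m r₀ s₂ - pastIntegral m r₀ s₁)) := by
  rw [← h.integral_strip_eq r₀ hs]
  simp_rw [← integral_const_mul, ← mul_assoc]
  refine tendsto_integral_bounded_mul h.integrable_m (C := 1)
    (.of_forall fun k => ((((continuous_ramp _ _).comp
      continuous_fst.norm).aestronglyMeasurable.const_mul _).mul
      ((measurable_const.indicator measurableSet_Ioo).comp
        measurable_snd).aestronglyMeasurable)) ?_ ?_
  · filter_upwards [self_mem_nhdsWithin] with k hk z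
    have := ramp_mul_mem hk (c k) ‖z.1‖
    rw [abs_of_nonneg (mul_nonneg this.1 (ind_nonneg _ _))]
    exact mul_le_one₀ this.2 (ind_nonneg _ _) (ind_le_one _ _)
  · filter_upwards [ae_norm_fst_ne r₀] with z hz
    refine tendsto_const_nhds.congr' ?_
    filter_upwards [eventually_ramp_eq hc hz] with k hk
    rw [hk]
    simp [indicator]

/-- Divide `cylinder_identity` on `(r₀ - k, r₀ + k)` by `2k`: the ramp divided by `2k` tends to the
indicator function of `r > r₀`, which produces the exterior integrals in the potential. -/
lemma tendsto_cylinder_layer {r₀ s₁ s₂ : ℝ} (hr₀ : 0 < r₀) (hs : s₁ < s₂) :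
    (∀ᶠ k in 𝓝[>] 0, IntegrableOn w {z : Spacetime | |‖z.1‖ - r₀| < k ∧ z.2 ∈ Icc s₁ s₂}) ∧
    Tendsto (fun k => 1 / (2 * k) *
      ∫ z in {z : Spacetime | |‖z.1‖ - r₀| < k ∧ z.2 ∈ Icc s₁ s₂}, w z) (𝓝[>] 0)
      (𝓝 (potential e m σ r₀ s₂ - potential e m σ r₀ s₁)) := by
  have hmeas : ∀ k, MeasurableSet {z : Spacetime | |‖z.1‖ - r₀| < k ∧ z.2 ∈ Icc s₁ s₂} :=
    fun k => (measurableSet_lt (measurable_fst.norm.sub_const r₀).abs measurable_const).inter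
      (measurable_snd measurableSet_Icc)
  constructor
  · refine .of_forall fun k => ?_
    rw [← integrable_indicator_iff (hmeas k)]
    refine (h.integrable_slab_mul_e (max |s₁| |s₂|)).mono' (h.aesm_w.indicator (hmeas k))
      (.of_forall fun z => ?_)
    by_cases hz : z ∈ {z : Spacetime | |‖z.1‖ - r₀| < k ∧ z.2 ∈ Icc s₁ s₂}
    · have : z.2 ∈ Icc (-max |s₁| |s₂|) (max |s₁| |s₂|) := by
        constructor
        · linarith [hz.2.1, neg_abs_le s₁, le_max_left |s₁| |s₂|]
        · linarith [hz.2.2, le_abs_self s₂, le_max_right |s₁| |s₂|]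
      rw [indicator_of_mem hz, indicator_of_mem this, one_mul]
      exact h.abs_w_le z
    · rw [indicator_of_notMem hz, norm_zero]
      exact mul_nonneg (ind_nonneg _ _) (h.e_nonneg z)
  · have hcst : Tendsto (fun _ : ℝ => r₀) (𝓝[>] 0) (𝓝 r₀) := tendsto_const_nhds
    have hlim := (((h.tendsto_ramp_exterior hcst s₂).const_mul σ).sub
      ((h.tendsto_ramp_exterior hcst s₁).const_mul σ)).add (h.tendsto_ramp_strip hcst hs.le)
    have heq : σ * exteriorIntegral e r₀ s₂ - σ * exteriorIntegral e r₀ s₁ +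
        (pastIntegral m r₀ s₂ - pastIntegral m r₀ s₁) =
        potential e m σ r₀ s₂ - potential e m σ r₀ s₁ := by
      unfold potential; ring
    rw [heq] at hlim
    refine hlim.congr' ?_
    filter_upwards [self_mem_nhdsWithin, mem_nhdsWithin_of_mem_nhds (gt_mem_nhds hr₀)]
      with k hk0 hk1
    have hk : 0 < k := hk0
    have hid := h.cylinder_identity (α := r₀ - k) (β := r₀ + k) (by linarith) (by linarith) hs
    have hlayer : ∫ z in {z : Spacetime | |‖z.1‖ - r₀| < k ∧ z.2 ∈ Icc s₁ s₂}, w z =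
        ∫ z, (Ioo (r₀ - k) (r₀ + k)).indicator (fun _ => 1) ‖z.1‖ *
        (Ioo s₁ s₂).indicator (fun _ => 1) z.2 * w z := by
      rw [setIntegral_eq_ind (hmeas k)]
      refine integral_congr_ae ?_
      filter_upwards [ae_snd_ne measurable_const, ae_snd_ne measurable_const] with z h1 h2
      congr 1
      have h3 : z ∈ {z : Spacetime | |‖z.1‖ - r₀| < k ∧ z.2 ∈ Icc s₁ s₂} ↔
          ‖z.1‖ ∈ Ioo (r₀ - k) (r₀ + k) ∧ z.2 ∈ Ioo s₁ s₂ := by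
        rw [mem_ofPred_eq, abs_lt]
        constructor
        · rintro ⟨⟨ha, hb⟩, hc, hd⟩
          exact ⟨⟨by linarith, by linarith⟩, lt_of_le_of_ne hc (Ne.symm h1), lt_of_le_of_ne hd h2⟩
        · rintro ⟨⟨ha, hb⟩, hc, hd⟩
          exact ⟨⟨by linarith, by linarith⟩, hc.le, hd.le⟩
      by_cases hz : ‖z.1‖ ∈ Ioo (r₀ - k) (r₀ + k) ∧ z.2 ∈ Ioo s₁ s₂
      · rw [ind, indicator_of_mem (h3.2 hz), indicator_of_mem hz.1, indicator_of_mem hz.2, one_mul]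
      · rw [ind, indicator_of_notMem (fun hc => hz (h3.1 hc))]
        rw [not_and_or] at hz
        rcases hz with hz | hz <;> simp [hz]
    rw [hlayer, hid]
    ring

/-- The mean flux through the layer `0 < r < 2k` tends to the increment of the potential. By `w ≤ r
m / 2` it is at most half the integral of `m` over `|x| < 2k`, which tends to zero because `m` is
integrable. No lower bound holds in general; the loss is the measure on the axis. -/
lemma potential_axis_antitone : Antitone (potential e m σ 0) := by
  intro s₁ s₂ hs
  rcases hs.eq_or_lt with rfl | hs
  · exact le_rfl
  have hid0 : Tendsto (fun k : ℝ => k) (𝓝[>] 0) (𝓝 0) := nhdsWithin_le_nhds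
  have hlim := (((h.tendsto_ramp_exterior hid0 s₂).const_mul σ).sub
      ((h.tendsto_ramp_exterior hid0 s₁).const_mul σ)).add (h.tendsto_ramp_strip hid0 hs.le)
  have heq : σ * exteriorIntegral e 0 s₂ - σ * exteriorIntegral e 0 s₁ +
      (pastIntegral m 0 s₂ - pastIntegral m 0 s₁) =
      potential e m σ 0 s₂ - potential e m σ 0 s₁ := by
    unfold potential; ring
  have hm0 : Tendsto (fun k => ∫ z, ind (ball 0 (2 * k)) z.1 * m z)
      (𝓝[>] 0) (𝓝 (∫ z, 0 * m z)) := by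
    refine tendsto_integral_bounded_mul h.integrable_m (C := 1) (.of_forall fun k =>
      ((measurable_const.indicator isOpen_ball.measurableSet).comp
        measurable_fst).aestronglyMeasurable) (.of_forall fun k z => ?_) ?_
    · rw [abs_of_nonneg (ind_nonneg _ _)]; exact ind_le_one _ _
    · filter_upwards [ae_fst_ne_zero] with z hz
      refine tendsto_const_nhds.congr' ?_
      filter_upwards [mem_nhdsWithin_of_mem_nhds
        (gt_mem_nhds (half_pos (norm_pos_iff.2 hz)))] with k hk
      rw [ind, indicator_of_notMem]
      rw [mem_ball_zero_iff]; linarith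
  simp only [zero_mul, integral_zero] at hm0
  have := le_of_tendsto_of_tendsto hlim (hm0.const_mul (1 / 2)) ?_
  · linarith
  filter_upwards [self_mem_nhdsWithin] with k hk0
  have hk : 0 < k := hk0
  -- The endpoints `0` and `2k` are written in this way to match the ramp with moving centre `c k =
  -- k`.
  have hid := h.cylinder_identity (α := k - k) (β := k + k) (by simp) (by linarith) hs
  have hle : ∫ z, ind (Ioo (k - k) (k + k)) ‖z.1‖ * ind (Ioo s₁ s₂) z.2 * w z ≤
      ∫ z, k * (ind (ball 0 (2 * k)) z.1 * m z) := by
    have hS : MeasurableSet (Ioo (k - k) (k + k)) := measurableSet_Ioo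
    have hball : MeasurableSet {z : Spacetime | z.1 ∈ ball 0 (2 * k)} :=
      measurable_fst isOpen_ball.measurableSet
    refine integral_mono_ae ?_ ((integrable_ind_mul hball h.integrable_m).const_mul k) ?_
    · refine (h.integrable_slab_mul_e (max |s₁| |s₂|)).mono'
        ((((measurable_const.indicator hS).comp measurable_fst.norm).mul
        ((measurable_const.indicator measurableSet_Ioo).comp
          measurable_snd)).aestronglyMeasurable.mul h.aesm_w) (.of_forall fun z => ?_)
      rw [norm_mul, Real.norm_of_nonneg (mul_nonneg (ind_nonneg _ _) (ind_nonneg _ _))]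
      refine mul_le_mul ?_ (h.abs_w_le z) (abs_nonneg _) (ind_nonneg _ _)
      by_cases hz : z.2 ∈ Ioo s₁ s₂
      · have : z.2 ∈ Icc (-max |s₁| |s₂|) (max |s₁| |s₂|) := by
          constructor
          · linarith [hz.1, neg_abs_le s₁, le_max_left |s₁| |s₂|]
          · linarith [hz.2, le_abs_self s₂, le_max_right |s₁| |s₂|]
        rw [indicator_of_mem this]
        exact mul_le_one₀ (ind_le_one _ _) (ind_nonneg _ _) (ind_le_one _ _)
      · simp only [indicator_of_notMem hz, mul_zero]
        exact ind_nonneg _ _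
    · filter_upwards [ae_fst_ne_zero] with z hz
      by_cases hr : ‖z.1‖ ∈ Ioo (k - k) (k + k)
      · have hb : z.1 ∈ ball 0 (2 * k) := by rw [mem_ball_zero_iff]; linarith [hr.2]
        simp only [ind, indicator_of_mem hr, indicator_of_mem hb, one_mul]
        have h1 : 1 / 2 * (‖z.1‖ * m z) ≤ k * m z := by
          have := mul_le_mul_of_nonneg_right hr.2.le (h.m_nonneg z)
          linarith
        have h2 := mul_nonneg hk.le (h.m_nonneg z)
        by_cases hz2 : z.2 ∈ Ioo s₁ s₂
        · rw [indicator_of_mem hz2, one_mul]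
          exact (h.w_le z hz).trans h1
        · rw [indicator_of_notMem hz2, zero_mul]; exact h2
      · simp only [indicator_of_notMem hr, zero_mul]
        exact mul_nonneg hk.le (mul_nonneg (ind_nonneg _ _) (h.m_nonneg z))
  rw [integral_const_mul] at hle
  rw [hid] at hle
  have h2 := mul_le_mul_of_nonneg_left hle (by positivity : 0 ≤ 1 / (2 * k))
  rw [← mul_assoc (1 / (2 * k)) k] at h2
  have h3 : 1 / (2 * k) * k = 1 / 2 := by field_simp
  rw [h3] at h2
  refine le_trans (le_of_eq ?_) h2
  ring

end RadialCurrent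

end LayerLimits

/-! ### Thin layers around cones -/

section ConeLimit

lemma integral_sub_add_integral {X : Type*} [MeasurableSpace X] {μ : Measure X} {f g k : X → ℝ}
    (hf : Integrable f μ) (hg : Integrable g μ) (hk : Integrable k μ) :
    (∫ x, f x ∂μ) - (∫ x, g x ∂μ) + (∫ x, k x ∂μ) = ∫ x, (f x - g x + k x) ∂μ := by
  rw [integral_add, integral_sub hf hg]
  exacts [hf.sub hg, hk]

variable {w e m : Spacetime → ℝ} {σ K : ℝ}

namespace RadialCurrent

variable (h : RadialCurrent w e m σ K)
include h

lemma integrable_exterior_layer (R k t : ℝ) : Integrable fun z =>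
    ind {x : E3 | R < ‖x‖} z.1 * ind (Ioo (-k) k) (z.2 - t) * e z := by
  have hm : Measurable fun s => ind (Ioo (-k) k) (s - t) :=
    (measurable_const.indicator measurableSet_Ioo).comp (measurable_id.sub_const t)
  refine h.integrable_mul_e (((measurable_const.indicator (measurableSet_exterior R)).comp
    measurable_fst).mul (hm.comp measurable_snd)).aestronglyMeasurable
    (G := fun s => ind (Ioo (-k) k) (s - t)) ?_ fun z => ?_
  · exact ((integrable_indicator_iff measurableSet_Ioo).2
      (integrableOn_const (by simp))).comp_sub_right t
  · rw [abs_of_nonneg (mul_nonneg (ind_nonneg _ _) (ind_nonneg _ _))]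
    exact mul_le_of_le_one_left (ind_nonneg _ _) (ind_le_one _ _)

lemma tendsto_exterior_layer (R t : ℝ) : Tendsto (fun k => 1 / (2 * k) *
    ∫ z, ind {x : E3 | R < ‖x‖} z.1 * ind (Ioo (-k) k) (z.2 - t) * e z) (𝓝[>] 0)
    (𝓝 (exteriorIntegral e R t)) := by
  refine (tendsto_average (h.continuous_exteriorIntegral R) t).congr fun k => ?_
  rw [integral_spacetime (h.integrable_exterior_layer R k t)]
  congr 2
  funext s
  rw [exteriorIntegral, setIntegral_eq_ind (measurableSet_exterior R),
    ← integral_const_mul]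
  ring

/-- The layer around a piece of the graph of `t = t₀ + c (r - r₁)`. -/
def coneLayer (r₁ r₂ t₀ c k : ℝ) : Set Spacetime :=
  {z | ‖z.1‖ ∈ Icc r₁ r₂ ∧ |z.2 - (t₀ + c * (‖z.1‖ - r₁))| < k}

/-- The part of space-time between two cylinders below the graph of `t = t₀ + c (r - r₁)`. -/
def coneRegion (r₁ r₂ t₀ c : ℝ) : Set Spacetime :=
  {z | ‖z.1‖ ∈ Icc r₁ r₂ ∧ z.2 < t₀ + c * (‖z.1‖ - r₁)}

omit h in
lemma measurableSet_coneLayer (r₁ r₂ t₀ c k : ℝ) : MeasurableSet (coneLayer r₁ r₂ t₀ c k) := by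
  have h1 : Measurable fun z : Spacetime => |z.2 - (t₀ + c * (‖z.1‖ - r₁))| :=
    Continuous.measurable (by fun_prop)
  exact (measurable_fst.norm measurableSet_Icc).inter (measurableSet_lt h1 measurable_const)

omit h in
lemma measurableSet_coneRegion (r₁ r₂ t₀ c : ℝ) : MeasurableSet (coneRegion r₁ r₂ t₀ c) := by
  have h1 : Measurable fun z : Spacetime => t₀ + c * (‖z.1‖ - r₁) :=
    Continuous.measurable (by fun_prop)
  exact (measurable_fst.norm measurableSet_Icc).inter (measurableSet_lt measurable_snd h1)

lemma integrableOn_coneLayer (r₁ r₂ t₀ c k : ℝ) :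
    IntegrableOn w (coneLayer r₁ r₂ t₀ c k) ∧ IntegrableOn e (coneLayer r₁ r₂ t₀ c k) := by
  have hmeas := measurableSet_coneLayer r₁ r₂ t₀ c k
  let R : ℝ := |t₀| + |c| * |r₂ - r₁| + |k|
  have hsub : ∀ z, z ∈ coneLayer r₁ r₂ t₀ c k → z.2 ∈ Icc (-R) R := by
    rintro z ⟨hz1, hz2⟩
    have h1 : |c * (‖z.1‖ - r₁)| ≤ |c| * |r₂ - r₁| := by
      rw [abs_mul]
      refine mul_le_mul_of_nonneg_left ?_ (abs_nonneg _)
      rw [abs_of_nonneg (by linarith [hz1.1]), abs_of_nonneg (by linarith [hz1.1, hz1.2])]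
      linarith [hz1.2]
    have h2 := abs_le.1 h1
    have h3 := abs_lt.1 hz2
    constructor <;> linarith [neg_abs_le t₀, le_abs_self t₀, le_abs_self k, neg_abs_le k]
  have key : ∀ f : Spacetime → ℝ, AEStronglyMeasurable f volume → (∀ z, |f z| ≤ e z) →
      IntegrableOn f (coneLayer r₁ r₂ t₀ c k) := by
    intro f hf hfe
    rw [← integrable_indicator_iff hmeas]
    refine (h.integrable_slab_mul_e R).mono' (hf.indicator hmeas) (.of_forall fun z => ?_)
    by_cases hz : z ∈ coneLayer r₁ r₂ t₀ c k
    · rw [indicator_of_mem hz, indicator_of_mem (hsub z hz), one_mul]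
      exact hfe z
    · rw [indicator_of_notMem hz, norm_zero]
      exact mul_nonneg (ind_nonneg _ _) (h.e_nonneg z)
  exact ⟨key w h.aesm_w h.abs_w_le, key e h.aesm_e fun z => (abs_of_nonneg (h.e_nonneg z)).le⟩

/-- `cone_identity` sorted by radius: for `r < r₁` nothing is left, between `r₁` and `r₂` the layer
around the cone appears, and for `r > r₂` the ramp is constant, so that the horizontal layers around
the heights of the two ends remain. -/
lemma integral_coneLayer {r₁ r₂ k : ℝ} (hr₁ : 0 ≤ r₁) (hr : r₁ < r₂) (hk : 0 < k) (c t₀ : ℝ) :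
    ∫ z in coneLayer r₁ r₂ t₀ c k, (c * w z - σ * e z) = σ * (∫ z, ind {x : E3 | r₂ < ‖x‖} z.1 *
        ind (Ioo (-k) k) (z.2 - (t₀ + c * (r₂ - r₁))) * e z) -
      σ * (∫ z, ind {x : E3 | r₁ < ‖x‖} z.1 * ind (Ioo (-k) k) (z.2 - t₀) * e z) +
      ∫ z, (ramp (0 - k) (0 + k) (z.2 - t₀) -
        ramp (0 - k) (0 + k) (z.2 - t₀ - c * ramp r₁ r₂ ‖z.1‖)) * m z := by
  obtain ⟨⟨M, R, htest⟩, hid⟩ := h.cone_identity hr₁ hr hk c t₀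
  obtain ⟨i1, i2, i3⟩ := h.integrable_pairing htest
  have i4 := (h.integrable_exterior_layer r₂ k (t₀ + c * (r₂ - r₁))).const_mul σ
  have i5 := (h.integrable_exterior_layer r₁ k t₀).const_mul σ
  rw [zero_sub, zero_add, setIntegral_eq_ind (measurableSet_coneLayer _ _ _ _ _),
    ← integral_const_mul, ← integral_const_mul, integral_sub_add_integral i4 i5 i1]
  rw [← sub_eq_zero, ← hid, ← integral_sub]
  · refine integral_congr_ae ?_
    filter_upwards [ae_norm_fst_ne r₁, ae_norm_fst_ne r₂] with z h1 h2
    rcases lt_or_gt_of_ne h1 with h3 | h3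
    · have a1 : z ∉ coneLayer r₁ r₂ t₀ c k := fun hz => not_lt.2 hz.1.1 h3
      have a2 : ‖z.1‖ ∉ Ioo r₁ r₂ := fun hz => not_lt.2 hz.1.le h3
      have a3 : z.1 ∉ {x : E3 | r₂ < ‖x‖} := fun hz => not_lt.2 (hr.trans hz).le h3
      have a4 : z.1 ∉ {x : E3 | r₁ < ‖x‖} := fun hz => not_lt.2 (le_of_lt hz) h3
      simp only [indicator_of_notMem a1, indicator_of_notMem a2,
        indicator_of_notMem a3, indicator_of_notMem a4, ramp_of_le _ h3.le]
      ring_nf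
    rcases lt_or_gt_of_ne h2 with h4 | h4
    · have a1 : z ∈ coneLayer r₁ r₂ t₀ c k ↔ z.2 - t₀ - c * (‖z.1‖ - r₁) ∈ Ioo (-k) k := by
        simp only [coneLayer, mem_ofPred_eq, mem_Icc, h3.le, h4.le, true_and, abs_lt,
          mem_Ioo, sub_sub]
      have a2 : ‖z.1‖ ∈ Ioo r₁ r₂ := ⟨h3, h4⟩
      have a3 : z.1 ∉ {x : E3 | r₂ < ‖x‖} := fun hz => not_lt.2 (le_of_lt hz) h4
      have a4 : z.1 ∈ {x : E3 | r₁ < ‖x‖} := h3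
      have a5 : ind (coneLayer r₁ r₂ t₀ c k) z =
          ind (Ioo (-k) k) (z.2 - t₀ - c * (‖z.1‖ - r₁)) := by
        simp only [ind, indicator, a1]
      rw [a5]
      simp only [indicator_of_mem a2,
        indicator_of_notMem a3, indicator_of_mem a4, ramp_of_mem ⟨h3.le, h4.le⟩]
      ring
    · have a1 : z ∉ coneLayer r₁ r₂ t₀ c k := fun hz => not_lt.2 hz.1.2 h4
      have a2 : ‖z.1‖ ∉ Ioo r₁ r₂ := fun hz => not_lt.2 hz.2.le h4
      have a3 : z.1 ∈ {x : E3 | r₂ < ‖x‖} := h4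
      have a4 : z.1 ∈ {x : E3 | r₁ < ‖x‖} := h3
      simp only [indicator_of_notMem a1, indicator_of_notMem a2,
        indicator_of_mem a3, indicator_of_mem a4, ramp_of_ge hr.le h4.le]
      ring
  · obtain ⟨i6, i7⟩ := h.integrableOn_coneLayer r₁ r₂ t₀ c k
    have i8 := (i6.const_mul c).sub (i7.const_mul σ)
    refine ((integrable_indicator_iff (measurableSet_coneLayer r₁ r₂ t₀ c k)).2 i8).congr
      (.of_forall fun z => ?_)
    by_cases hz : z ∈ coneLayer r₁ r₂ t₀ c k <;> simp [hz]
  · exact (i4.sub i5).add i1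

/-- Divide by `2k`. The horizontal layers become exterior integrals at the two end times. The
quotients of ramps become step functions, leaving the integral of `m` between the level `t₀` and the
graph continued horizontally; this is regrouped into past integrals and the region below the piece
of cone. -/
lemma tendsto_coneLayer {r₁ r₂ : ℝ} (hr₁ : 0 ≤ r₁) (hr : r₁ < r₂) (c t₀ : ℝ) :
    Tendsto (fun k => 1 / (2 * k) * ∫ z in coneLayer r₁ r₂ t₀ c k, (c * w z - σ * e z)) (𝓝[>] 0)
      (𝓝 (potential e m σ r₂ (t₀ + c * (r₂ - r₁)) - potential e m σ r₁ t₀ +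
        ∫ z in coneRegion r₁ r₂ t₀ c, m z)) := by
  have hcst : Tendsto (fun _ : ℝ => (0 : ℝ)) (𝓝[>] 0) (𝓝 0) := tendsto_const_nhds
  have hg : Measurable fun x : E3 => t₀ + c * ramp r₁ r₂ ‖x‖ := by
    refine Continuous.measurable ?_
    have := (continuous_ramp r₁ r₂).comp (continuous_norm (E := E3))
    exact continuous_const.add (continuous_const.mul this)
  have hmlim : Tendsto (fun k => ∫ z, (1 / (2 * k) * ramp (0 - k) (0 + k) (z.2 - t₀) -
      1 / (2 * k) * ramp (0 - k) (0 + k) (z.2 - t₀ - c * ramp r₁ r₂ ‖z.1‖)) * m z) (𝓝[>] 0)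
      (𝓝 (∫ z, (ind (Ioi 0) (z.2 - t₀) -
        ind (Ioi 0) (z.2 - t₀ - c * ramp r₁ r₂ ‖z.1‖)) * m z)) := by
    refine tendsto_integral_bounded_mul h.integrable_m (C := 1) (.of_forall fun k => ?_) ?_ ?_
    · refine Continuous.aestronglyMeasurable ?_
      have h1 := continuous_ramp (0 - k) (0 + k)
      have h2 := (continuous_ramp r₁ r₂).comp (continuous_fst.norm (f := fun z : Spacetime => z.1))
      have h3 : Continuous fun z : Spacetime => z.2 - t₀ := by fun_prop
      exact (continuous_const.mul (h1.comp h3)).sub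
        (continuous_const.mul (h1.comp (h3.sub (continuous_const.mul h2))))
    · filter_upwards [self_mem_nhdsWithin] with k hk z
      have b1 := ramp_mul_mem hk 0 (z.2 - t₀)
      have b2 := ramp_mul_mem hk 0 (z.2 - t₀ - c * ramp r₁ r₂ ‖z.1‖)
      rw [abs_le]; constructor <;> linarith [b1.1, b1.2, b2.1, b2.2]
    · filter_upwards [ae_snd_ne measurable_const, ae_snd_ne hg] with z h1 h2
      refine tendsto_const_nhds.congr' ?_
      filter_upwards [eventually_ramp_eq hcst (sub_ne_zero.2 h1),
        eventually_ramp_eq hcst (s := z.2 - t₀ - c * ramp r₁ r₂ ‖z.1‖)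
          (fun hc => h2 (by linarith))] with k h3 h4
      rw [h3, h4]
  have hlim := (((h.tendsto_exterior_layer r₂ (t₀ + c * (r₂ - r₁))).const_mul σ).sub
    ((h.tendsto_exterior_layer r₁ t₀).const_mul σ)).add hmlim
  have heq : σ * exteriorIntegral e r₂ (t₀ + c * (r₂ - r₁)) - σ * exteriorIntegral e r₁ t₀ +
      (∫ z, (ind (Ioi 0) (z.2 - t₀) - ind (Ioi 0) (z.2 - t₀ - c * ramp r₁ r₂ ‖z.1‖)) * m z) =
      potential e m σ r₂ (t₀ + c * (r₂ - r₁)) - potential e m σ r₁ t₀ +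
        ∫ z in coneRegion r₁ r₂ t₀ c, m z := by
    have : (∫ z, (ind (Ioi 0) (z.2 - t₀) - ind (Ioi 0) (z.2 - t₀ - c * ramp r₁ r₂ ‖z.1‖)) * m z) =
        pastIntegral m r₂ (t₀ + c * (r₂ - r₁)) - pastIntegral m r₁ t₀ +
        ∫ z in coneRegion r₁ r₂ t₀ c, m z := by
      have j1 := integrable_ind_mul (measurableSet_past r₂ (t₀ + c * (r₂ - r₁))) h.integrable_m
      have j2 := integrable_ind_mul (measurableSet_past r₁ t₀) h.integrable_m
      have j3 := integrable_ind_mul (measurableSet_coneRegion r₁ r₂ t₀ c) h.integrable_m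
      rw [pastIntegral, pastIntegral, setIntegral_eq_ind (measurableSet_past _ _),
        setIntegral_eq_ind (measurableSet_past _ _),
        setIntegral_eq_ind (measurableSet_coneRegion _ _ _ _),
        integral_sub_add_integral j1 j2 j3]
      refine integral_congr_ae ?_
      filter_upwards [ae_norm_fst_ne r₁, ae_norm_fst_ne r₂,
        ae_snd_ne (g := fun _ => t₀) measurable_const, ae_snd_ne hg] with z h1 h2 h5 h6
      rw [← sub_mul, ← add_mul]
      congr 1
      have f1 : ind (Ioi 0) (z.2 - t₀) = 1 - ind (Iio t₀) z.2 := by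
        rcases lt_or_gt_of_ne h5 with h7 | h7 <;> simp [h7, not_lt.2 h7.le]
      have f2 : ind (Ioi 0) (z.2 - t₀ - c * ramp r₁ r₂ ‖z.1‖) =
          1 - ind (Iio (t₀ + c * ramp r₁ r₂ ‖z.1‖)) z.2 := by
        rw [sub_sub]
        rcases lt_or_gt_of_ne h6 with h7 | h7 <;> simp [h7, not_lt.2 h7.le]
      rw [f1, f2]
      rcases lt_or_gt_of_ne h1 with h3 | h3
      · have h3' : ¬ r₁ < ‖z.1‖ := not_lt.2 h3.le
        have h4' : ¬ r₂ < ‖z.1‖ := not_lt.2 (h3.trans hr).le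
        have h5' : ¬ r₁ ≤ ‖z.1‖ := not_le.2 h3
        simp [coneRegion, h3', h4', h5', ramp_of_le _ h3.le]
      rcases lt_or_gt_of_ne h2 with h4 | h4
      · have h4' : ¬ r₂ < ‖z.1‖ := not_lt.2 h4.le
        simp [indicator, coneRegion, h3, h3.le, h4.le, ramp_of_mem ⟨h3.le, h4.le⟩]
        ring
      · have h5' : ¬ ‖z.1‖ ≤ r₂ := not_le.2 h4
        simp [indicator, coneRegion, h3, h4, ramp_of_ge hr.le h4.le]
    rw [this]
    unfold potential
    ring
  rw [heq] at hlim
  refine hlim.congr' ?_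
  filter_upwards [self_mem_nhdsWithin] with k hk
  simp_rw [h.integral_coneLayer hr₁ hr hk c t₀, ← mul_sub, mul_assoc, integral_const_mul]
  ring

lemma integral_annulus {r₁ r₂ : ℝ} (hr : r₁ ≤ r₂) (t : ℝ) :
    ∫ x in {x : E3 | ‖x‖ ∈ Icc r₁ r₂}, e (x, t) =
      exteriorIntegral e r₁ t - exteriorIntegral e r₂ t := by
  have hA : MeasurableSet {x : E3 | ‖x‖ ∈ Icc r₁ r₂} := measurable_norm measurableSet_Icc
  rw [exteriorIntegral, exteriorIntegral, setIntegral_eq_ind hA,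
    setIntegral_eq_ind (measurableSet_exterior _),
    setIntegral_eq_ind (measurableSet_exterior _),
    ← integral_sub (integrable_ind_mul (measurableSet_exterior _) (h.integrable_e t))
      (integrable_ind_mul (measurableSet_exterior _) (h.integrable_e t))]
  refine integral_congr_ae ?_
  filter_upwards [ae_norm_ne r₁] with x h1
  rcases lt_or_gt_of_ne h1 with h3 | h3
  · simp [indicator, not_le.2 h3, not_lt.2 h3.le, not_lt.2 (h3.trans_le hr).le]
  · by_cases h2 : ‖x‖ ≤ r₂
    · simp [indicator, h3, h3.le, not_lt.2 h2]
    · simp [indicator, h3, not_le.1 h2]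

end RadialCurrent

end ConeLimit

/-! ### Plane topology of the polygon -/

section Polygon

namespace IsAdmissibleRegion

variable {m : ℕ} {Φ : Set (ℝ × ℝ)} {P : Fin (m + 1) → ℝ × ℝ} (h : IsAdmissibleRegion Φ P)
include h

lemma isClosed : IsClosed Φ := h.isCompact.isClosed

lemma segment_subset (i : Fin (m + 1)) : segment ℝ (P i) (P (i + 1)) ⊆ Φ := by
  refine subset_trans ?_ h.isClosed.frontier_subset
  rw [h.frontier_eq]
  exact subset_iUnion (fun i => segment ℝ (P i) (P (i + 1))) i

lemma vertex_nonneg (i : Fin (m + 1)) : 0 ≤ (P i).1 :=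
  h.radius_nonneg _ (h.segment_subset i (left_mem_segment ℝ _ _))

omit h in
lemma _root_.InOutEnergy.openSegment_subset_halfOpenSegment (P Q : ℝ × ℝ) :
    openSegment ℝ P Q ⊆ halfOpenSegment P Q := by
  rw [openSegment_eq_image']
  rintro _ ⟨s, hs, rfl⟩
  exact ⟨s, hs.1.le, hs.2, rfl⟩

omit h in
lemma _root_.InOutEnergy.left_mem_halfOpenSegment (P Q : ℝ × ℝ) : P ∈ halfOpenSegment P Q :=
  ⟨0, le_rfl, one_pos, by simp⟩

omit h in
lemma _root_.InOutEnergy.mem_halfOpenSegment_or_eq {P Q z : ℝ × ℝ} (hz : z ∈ segment ℝ P Q) :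
    z ∈ halfOpenSegment P Q ∨ z = Q := by
  rw [segment_eq_image'] at hz
  obtain ⟨s, hs, rfl⟩ := hz
  rcases hs.2.eq_or_lt with h1 | h1
  · right; simp [h1]
  · exact Or.inl ⟨s, hs.1, h1, rfl⟩

lemma notMem_segment {i j : Fin (m + 1)} (hij : i ≠ j) {z : ℝ × ℝ}
    (hz : z ∈ openSegment ℝ (P i) (P (i + 1))) : z ∉ segment ℝ (P j) (P (j + 1)) := by
  intro hzj
  have hzi := openSegment_subset_halfOpenSegment _ _ hz
  rcases mem_halfOpenSegment_or_eq hzj with h1 | h1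
  · exact disjoint_left.1 (h.simple i j hij) hzi h1
  · by_cases hji : i = j + 1
    · rw [← hji] at h1
      rw [h1, left_mem_openSegment_iff] at hz
      exact h.side_ne i hz
    · refine disjoint_left.1 (h.simple i (j + 1) hji) hzi ?_
      rw [h1]
      exact left_mem_halfOpenSegment _ _

/-- Near an interior point of a side, the region is a half plane. -/
lemma exists_half_ball (i : Fin (m + 1)) {z : ℝ × ℝ}
    (hz : z ∈ openSegment ℝ (P i) (P (i + 1))) : ∃ ε > 0, ∀ w ∈ ball z ε,
      (0 < -((P (i + 1)).2 - (P i).2) * (w.1 - z.1) + ((P (i + 1)).1 - (P i).1) * (w.2 - z.2) →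
        w ∈ Φ) ∧
      (-((P (i + 1)).2 - (P i).2) * (w.1 - z.1) + ((P (i + 1)).1 - (P i).1) * (w.2 - z.2) < 0 →
        w ∉ Φ) := by
  set dr := (P (i + 1)).1 - (P i).1 with hdr
  set dt := (P (i + 1)).2 - (P i).2 with hdt
  have hclosed : IsClosed (⋃ j ∈ {j : Fin (m + 1) | j ≠ i}, segment ℝ (P j) (P (j + 1))) :=
    (toFinite _).isClosed_biUnion fun j _ => by
      rw [segment_eq_image']
      exact (isCompact_Icc.image (by fun_prop)).isClosed
  have hnot : z ∉ ⋃ j ∈ {j : Fin (m + 1) | j ≠ i}, segment ℝ (P j) (P (j + 1)) := by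
    simp only [mem_iUnion, not_exists]
    intro j hj
    exact h.notMem_segment (Ne.symm hj) hz
  obtain ⟨ε, hε, hball⟩ := isOpen_iff.1 hclosed.isOpen_compl z hnot
  let L : ℝ × ℝ → ℝ := fun w => -dt * (w.1 - z.1) + dr * (w.2 - z.2)
  have hline : ∀ w ∈ segment ℝ (P i) (P (i + 1)), L w = 0 := by
    intro w hw
    rw [openSegment_eq_image'] at hz
    rw [segment_eq_image'] at hw
    obtain ⟨s, -, rfl⟩ := hz
    obtain ⟨s', -, rfl⟩ := hw
    simp only [L, Prod.fst_add, Prod.snd_add, Prod.smul_fst, Prod.smul_snd,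
      Prod.fst_sub, Prod.snd_sub]
    ring
  have hfr : ∀ w ∈ ball z ε, L w ≠ 0 → w ∈ interior Φ ∪ Φᶜ := by
    intro w hw hL
    by_contra hc
    rw [mem_union, not_or, mem_compl_iff, not_not] at hc
    have hf : w ∈ frontier Φ := ⟨subset_closure hc.2, hc.1⟩
    rw [h.frontier_eq, mem_iUnion] at hf
    obtain ⟨j, hj⟩ := hf
    by_cases hji : j = i
    · subst hji
      exact hL (hline w hj)
    · exact hball hw (mem_biUnion hji hj)
  have hLlin : ∀ (a b), a + b = 1 → ∀ v w, L (a • v + b • w) = a * L v + b * L w := by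
    intro a b hab v w
    obtain rfl : b = 1 - a := by linarith
    simp only [L, Prod.fst_add, Prod.snd_add, Prod.smul_fst, Prod.smul_snd]
    ring
  have hconv : ∀ σ, Convex ℝ {w | w ∈ ball z ε ∧ 0 < σ * L w} := by
    intro σ v hv w hw a b ha hb hab
    refine ⟨convex_ball z ε hv.1 hw.1 ha hb hab, ?_⟩
    rw [hLlin a b hab, mul_add]
    have h1 : σ * (a * L v) + σ * (b * L w) = a * (σ * L v) + b * (σ * L w) := by ring
    rw [h1]
    have hv2 : 0 < σ * L v := hv.2
    have hw2 : 0 < σ * L w := hw.2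
    rcases ha.eq_or_lt with rfl | ha'
    · have : b = 1 := by linarith
      simp [this, hw2]
    · exact add_pos_of_pos_of_nonneg (mul_pos ha' hv2) (mul_nonneg hb hw2.le)
  have hdisj : Disjoint (interior Φ) Φᶜ := disjoint_left.2 fun w hw hw' => hw' (interior_subset hw)
  have hn : 0 < dt * dt + dr * dr := by
    have hne : dr ≠ 0 ∨ dt ≠ 0 := by
      by_contra hc
      rw [not_or, not_not, not_not] at hc
      refine h.side_ne i (Prod.ext ?_ ?_)
      · linarith [hc.1]
      · linarith [hc.2]
    rcases hne with h1 | h1 <;> nlinarith [mul_self_pos.2 h1, mul_self_nonneg dt, mul_self_nonneg dr]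
  have hnear : ∀ᶠ s : ℝ in 𝓝[>] 0, z + s • ((-dt, dr) : ℝ × ℝ) ∈ ball z ε ∧
      z - s • ((-dt, dr) : ℝ × ℝ) ∈ ball z ε := by
    have c1 : Tendsto (fun s : ℝ => z + s • ((-dt, dr) : ℝ × ℝ)) (𝓝 0) (𝓝 (z + (0 : ℝ) • (-dt, dr))) :=
      Continuous.tendsto (by fun_prop) 0
    have c2 : Tendsto (fun s : ℝ => z - s • ((-dt, dr) : ℝ × ℝ)) (𝓝 0) (𝓝 (z - (0 : ℝ) • (-dt, dr))) :=
      Continuous.tendsto (by fun_prop) 0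
    rw [zero_smul, add_zero] at c1
    rw [zero_smul, sub_zero] at c2
    exact nhdsWithin_le_nhds ((c1.eventually (ball_mem_nhds z hε)).and
      (c2.eventually (ball_mem_nhds z hε)))
  obtain ⟨s, ⟨hs1, hs2⟩, ⟨hs3, hs4⟩, hs0⟩ :=
    ((h.left_inside i z hz).and (hnear.and self_mem_nhdsWithin)).exists
  have hs0' : 0 < s := hs0
  have hLp : L (z + s • ((-dt, dr) : ℝ × ℝ)) = s * (dt * dt + dr * dr) := by
    simp only [L, Prod.fst_add, Prod.snd_add, Prod.smul_fst, Prod.smul_snd]; ring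
  have hLm : L (z - s • ((-dt, dr) : ℝ × ℝ)) = -(s * (dt * dt + dr * dr)) := by
    simp only [L, Prod.fst_sub, Prod.snd_sub, Prod.smul_fst, Prod.smul_snd]; ring
  refine ⟨ε, hε, fun w hw => ⟨fun hL => ?_, fun hL => ?_⟩⟩
  · have hne : ({w | w ∈ ball z ε ∧ 0 < 1 * L w} ∩ interior Φ).Nonempty :=
      ⟨z + s • ((-dt, dr) : ℝ × ℝ), ⟨hs3, by rw [hLp, one_mul]; positivity⟩, hs1⟩
    have hsub := (hconv 1).isPreconnected.subset_left_of_subset_union isOpen_interior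
      h.isClosed.isOpen_compl hdisj (fun v hv => hfr v hv.1 (by
        have h1 : 0 < 1 * L v := hv.2
        linarith)) hne
    exact interior_subset (hsub ⟨hw, by rw [one_mul]; exact hL⟩)
  · have hne : ({w | w ∈ ball z ε ∧ 0 < -1 * L w} ∩ Φᶜ).Nonempty :=
      ⟨z - s • ((-dt, dr) : ℝ × ℝ), ⟨hs4, by rw [hLm]; linarith [mul_pos hs0' hn]⟩, hs2⟩
    have hsub := (hconv (-1)).isPreconnected.subset_right_of_subset_union isOpen_interior
      h.isClosed.isOpen_compl hdisj (fun v hv => hfr v hv.1 (by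
        have h1 : 0 < -1 * L v := hv.2
        linarith)) hne
    refine hsub ⟨hw, ?_⟩
    linarith

/-- The region lies to the left of its sides and in `r ≥ 0`, so a side on the axis is traversed
downwards. -/
lemma axis_side_lt {i : Fin (m + 1)} (h0 : (P i).1 = 0) (h1 : (P (i + 1)).1 = 0) :
    (P (i + 1)).2 < (P i).2 := by
  by_contra hc
  have hne := fun he => h.side_ne i (Prod.ext (by rw [h0, h1]) he)
  have hlt := lt_of_le_of_ne (not_lt.1 hc) hne
  have hz : (1 / 2 : ℝ) • P i + (1 / 2 : ℝ) • P (i + 1) ∈ openSegment ℝ (P i) (P (i + 1)) :=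
    ⟨1 / 2, 1 / 2, by norm_num, by norm_num, by norm_num, rfl⟩
  obtain ⟨s, ⟨hs1, -⟩, hs0⟩ := ((h.left_inside i _ hz).and self_mem_nhdsWithin).exists
  have hs0' : 0 < s := hs0
  have := h.radius_nonneg _ (interior_subset hs1)
  simp only [Prod.fst_add, Prod.smul_fst, smul_eq_mul] at this
  have h2 := mul_pos hs0' (sub_pos.2 hlt)
  linarith

end IsAdmissibleRegion

/-- The height at radius `r` of the line through `P` and `Q`. -/
def lineHeight (P Q : ℝ × ℝ) (r : ℝ) : ℝ := P.2 + (Q.2 - P.2) / (Q.1 - P.1) * (r - P.1)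

lemma exists_mem_openSegment {P Q : ℝ × ℝ} {r : ℝ} (hr : r ∈ uIcc P.1 Q.1) (hP : P.1 ≠ r)
    (hQ : Q.1 ≠ r) : (r, lineHeight P Q r) ∈ openSegment ℝ P Q := by
  have hne : Q.1 - P.1 ≠ 0 := by
    intro hc
    rw [sub_eq_zero.1 hc, uIcc_self] at hr
    exact hP hr.symm
  rw [openSegment_eq_image']
  refine ⟨(r - P.1) / (Q.1 - P.1), ?_, ?_⟩
  · rcases lt_or_gt_of_ne hne with hlt | hgt
    · rw [uIcc_of_ge (by linarith)] at hr
      have h1 : r < P.1 := lt_of_le_of_ne hr.2 (Ne.symm hP)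
      have h2 : Q.1 < r := lt_of_le_of_ne hr.1 hQ
      exact ⟨div_pos_of_neg_of_neg (by linarith) hlt, by rw [div_lt_one_of_neg hlt]; linarith⟩
    · rw [uIcc_of_le (by linarith)] at hr
      have h1 : P.1 < r := lt_of_le_of_ne hr.1 hP
      have h2 : r < Q.1 := lt_of_le_of_ne hr.2 (Ne.symm hQ)
      exact ⟨div_pos (by linarith) hgt, by rw [div_lt_one hgt]; linarith⟩
  · ext
    · simp only [Prod.fst_add, Prod.smul_fst, Prod.fst_sub, smul_eq_mul]
      field_simp
      ring
    · simp only [lineHeight, Prod.snd_add, Prod.smul_snd, Prod.snd_sub]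
      ring

lemma mem_uIcc_of_mem_segment {P Q z : ℝ × ℝ} (hz : z ∈ segment ℝ P Q) : z.1 ∈ uIcc P.1 Q.1 := by
  rw [← segment_eq_uIcc]
  obtain ⟨a, b, ha, hb, hab, rfl⟩ := hz
  exact ⟨a, b, ha, hb, hab, rfl⟩

lemma eq_lineHeight_of_mem_segment {P Q z : ℝ × ℝ} (hne : P.1 ≠ Q.1) (hz : z ∈ segment ℝ P Q) :
    z.2 = lineHeight P Q z.1 := by
  rw [segment_eq_image'] at hz
  obtain ⟨s, -, rfl⟩ := hz
  simp only [lineHeight, Prod.fst_add, Prod.snd_add, Prod.smul_fst, Prod.smul_snd, Prod.fst_sub,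
    Prod.snd_sub]
  field_simp
  ring

/-- The set of points near which `D` vanishes is open and closed in the line. Punctured
neighbourhoods allow the values at the crossing points to be ignored. -/
lemma eq_zero_of_punctured_locally_constant {D : ℝ → ℝ}
    (hD : ∀ t, ∃ c, ∀ᶠ s in 𝓝[≠] t, D s = c) (h0 : ∃ t, ∀ᶠ s in 𝓝[≠] t, D s = 0) :
    ∀ t, ∀ᶠ s in 𝓝[≠] t, D s = 0 := by
  let A : Set ℝ := {t | ∀ᶠ s in 𝓝[≠] t, D s = 0}
  have hopen : ∀ p : ℝ → Prop, IsOpen {t | ∀ᶠ s in 𝓝[≠] t, p (D s)} := by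
    intro p
    rw [isOpen_iff_mem_nhds]
    intro t ht
    have h1 := eventually_nhdsWithin_iff.1 ht
    filter_upwards [eventually_eventually_nhds.2 h1] with x hx
    by_cases hxt : x = t
    · rw [hxt]; exact ht
    · have h2 := isOpen_ne.mem_nhds hxt
      have h3 : ∀ᶠ y in 𝓝 x, p (D y) := by filter_upwards [hx, h2] with y hy hyt using hy hyt
      exact nhdsWithin_le_nhds h3
  have hAc : Aᶜ = {t | ∀ᶠ s in 𝓝[≠] t, D s ≠ 0} := by
    ext t
    obtain ⟨c, hc⟩ := hD t
    constructor
    · intro ht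
      have hc0 : c ≠ 0 := by
        rintro rfl
        exact ht hc
      exact hc.mono fun s hs => by rw [hs]; exact hc0
    · intro ht ht'
      have h1 : ∀ᶠ s in 𝓝[≠] t, D s ≠ 0 := ht
      have h2 := ht'
      obtain ⟨s, hs1, hs2⟩ := (h1.and h2).exists
      exact hs1 hs2
  have hA : IsClopen A := ⟨⟨by rw [hAc]; exact hopen (· ≠ 0)⟩, hopen (· = 0)⟩
  have hu : A = univ := hA.eq_univ h0
  intro t
  have : t ∈ A := hu ▸ mem_univ t
  exact this

end Polygon

/-! ### Green's formula for the polygon -/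

section PolygonIntegral

open Classical in
/-- The indicator function, on the vertical line at radius `r`, of the part below the segment
`[P, Q]`. -/
def belowSide (P Q : ℝ × ℝ) (r t : ℝ) : ℝ :=
  if r ∈ uIcc P.1 Q.1 ∧ t < lineHeight P Q r then 1 else 0

lemma eventually_belowSide {P Q : ℝ × ℝ} {r t : ℝ} (ht : r ∈ uIcc P.1 Q.1 → t ≠ lineHeight P Q r) :
    ∀ᶠ s in 𝓝 t, belowSide P Q r s = belowSide P Q r t := by
  by_cases hr : r ∈ uIcc P.1 Q.1
  · rcases lt_or_gt_of_ne (ht hr) with h1 | h1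
    · filter_upwards [gt_mem_nhds h1] with s hs
      have hs' := hs
      simp [belowSide, hr, hs', h1]
    · filter_upwards [lt_mem_nhds h1] with s hs
      have hs' := hs
      simp [belowSide, not_lt.2 hs'.le, not_lt.2 h1.le]
  · exact .of_forall fun s => by simp [belowSide, hr]

namespace IsAdmissibleRegion

variable {m : ℕ} {Φ : Set (ℝ × ℝ)} {P : Fin (m + 1) → ℝ × ℝ} (h : IsAdmissibleRegion Φ P)
include h

lemma eventually_ind_of_notMem {r t : ℝ} (hr : ∀ i, (P i).1 ≠ r)
    (ht : ∀ i, r ∈ uIcc (P i).1 (P (i + 1)).1 → t ≠ lineHeight (P i) (P (i + 1)) r) :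
    ∀ᶠ s in 𝓝 t, ind Φ (r, s) = ind Φ (r, t) := by
  have hf : (r, t) ∉ frontier Φ := by
    rw [h.frontier_eq, mem_iUnion, not_exists]
    intro i hi
    have h1 := mem_uIcc_of_mem_segment hi
    have hne : (P i).1 ≠ (P (i + 1)).1 := by
      intro he
      simp only [he, uIcc_self] at h1
      exact hr (i + 1) h1.symm
    exact ht i h1 (eq_lineHeight_of_mem_segment hne hi)
  have hc : Tendsto (fun s => (r, s)) (𝓝 t) (𝓝 (r, t)) := Continuous.tendsto (by fun_prop) t
  by_cases hmem : (r, t) ∈ Φ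
  · have hint : (r, t) ∈ interior Φ := by
      by_contra hni
      exact hf ⟨subset_closure hmem, hni⟩
    filter_upwards [hc.eventually (isOpen_interior.mem_nhds hint)] with s hs
    simp [hmem, interior_subset hs]
  · filter_upwards [hc.eventually (h.isClosed.isOpen_compl.mem_nhds hmem)] with s hs
    have hs' : (r, s) ∉ Φ := hs
    simp [hmem, hs']

/-- The discrete Green formula on a vertical line. -/
lemma sum_belowSide {r t : ℝ} (hr : ∀ i, (P i).1 ≠ r)
    (ht : ∀ i, r ∈ uIcc (P i).1 (P (i + 1)).1 → t ≠ lineHeight (P i) (P (i + 1)) r) :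
    ∑ i, Real.sign ((P (i + 1)).1 - (P i).1) * belowSide (P i) (P (i + 1)) r t = -ind Φ (r, t) := by
  -- `D` is locally constant off the sides, takes the same value just below and just above each
  -- crossing, and is zero far up. Hence it vanishes.
  let D : ℝ → ℝ := fun t =>
    ∑ i, Real.sign ((P (i + 1)).1 - (P i).1) * belowSide (P i) (P (i + 1)) r t + ind Φ (r, t)
  have hconst : ∀ t, (∀ i, r ∈ uIcc (P i).1 (P (i + 1)).1 →
      t ≠ lineHeight (P i) (P (i + 1)) r) → ∀ᶠ s in 𝓝 t, D s = D t := by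
    intro t ht
    have h1 : ∀ᶠ s in 𝓝 t, ∀ i, belowSide (P i) (P (i + 1)) r s =
        belowSide (P i) (P (i + 1)) r t := eventually_all.2 fun i => eventually_belowSide (ht i)
    filter_upwards [h1, h.eventually_ind_of_notMem hr ht] with s hs1 hs2
    simp only [D, hs1, hs2]
  have hcross : ∀ t, (∃ i, r ∈ uIcc (P i).1 (P (i + 1)).1 ∧
      t = lineHeight (P i) (P (i + 1)) r) → ∃ c, ∀ᶠ s in 𝓝[≠] t, D s = c := by
    rintro t ⟨i, hi, rfl⟩
    set t := lineHeight (P i) (P (i + 1)) r with htdef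
    have hz := exists_mem_openSegment hi (hr i) (hr (i + 1))
    have hj : ∀ j, j ≠ i → r ∈ uIcc (P j).1 (P (j + 1)).1 → t ≠ lineHeight (P j) (P (j + 1)) r := by
      intro j hji hj he
      have hz' := exists_mem_openSegment hj (hr j) (hr (j + 1))
      rw [← he] at hz'
      exact h.notMem_segment hji.symm hz (openSegment_subset_segment ℝ _ _ hz')
    have h1 : ∀ᶠ s in 𝓝 t, ∀ j, j ≠ i → belowSide (P j) (P (j + 1)) r s =
        belowSide (P j) (P (j + 1)) r t := eventually_all.2 fun j => by
      by_cases hji : j = i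
      · exact .of_forall fun s hs => absurd hji hs
      · exact (eventually_belowSide (hj j hji)).mono fun s hs _ => hs
    obtain ⟨ε, hε, hball⟩ := h.exists_half_ball i hz
    have hne : (P (i + 1)).1 - (P i).1 ≠ 0 := by
      intro hc
      rw [sub_eq_zero.1 hc, uIcc_self] at hi
      exact hr i hi.symm
    -- On a side that runs to the right the region lies above: the two terms contribute `1 + 0`
    -- below and `0 + 1` above. On a side that runs to the left they contribute `-1 + 1` below and
    -- `0 + 0` above.
    refine ⟨∑ j ∈ Finset.univ.erase i, Real.sign ((P (j + 1)).1 - (P j).1) *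
      belowSide (P j) (P (j + 1)) r t + (if 0 < (P (i + 1)).1 - (P i).1 then 1 else 0), ?_⟩
    filter_upwards [nhdsWithin_le_nhds h1, nhdsWithin_le_nhds (ball_mem_nhds t hε),
      self_mem_nhdsWithin] with s hs1 hs2 hs3
    have hw : (r, s) ∈ ball (r, t) ε := by simpa [hε] using hs2
    have hb := hball _ hw
    simp only [sub_self, mul_zero, zero_add] at hb
    have hst : s ≠ t := hs3
    simp only [D]
    rw [← Finset.sum_erase_add _ _ (Finset.mem_univ i), add_assoc]
    congr 1
    · refine Finset.sum_congr rfl fun j hj => ?_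
      rw [hs1 j (Finset.ne_of_mem_erase hj)]
    · rcases lt_or_gt_of_ne hne with hneg | hpos
      · rw [Real.sign_of_neg hneg, if_neg (not_lt.2 hneg.le)]
        rcases lt_or_gt_of_ne hst with hlt | hgt
        · have hm := hb.1 (mul_pos_of_neg_of_neg hneg (by linarith))
          simp [hm, belowSide, hi, ← htdef, hlt]
        · have hm := hb.2 (mul_neg_of_neg_of_pos hneg (by linarith))
          simp [hm, belowSide, ← htdef, not_lt.2 hgt.le]
      · rw [Real.sign_of_pos hpos, if_pos hpos]
        rcases lt_or_gt_of_ne hst with hlt | hgt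
        · have hm := hb.2 (mul_neg_of_pos_of_neg hpos (by linarith))
          simp [hm, belowSide, hi, ← htdef, hlt]
        · have hm := hb.1 (mul_pos hpos (by linarith))
          simp [hm, belowSide, ← htdef, not_lt.2 hgt.le]
  have hloc : ∀ t, ∃ c, ∀ᶠ s in 𝓝[≠] t, D s = c := by
    intro t
    by_cases hc : ∃ i, r ∈ uIcc (P i).1 (P (i + 1)).1 ∧ t = lineHeight (P i) (P (i + 1)) r
    · exact hcross t hc
    · refine ⟨D t, nhdsWithin_le_nhds (hconst t fun i hi he => hc ⟨i, hi, he⟩)⟩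
  have hfar : ∃ t, ∀ᶠ s in 𝓝[≠] t, D s = 0 := by
    have h1 : ∀ᶠ s : ℝ in atTop, ∀ i, belowSide (P i) (P (i + 1)) r s = 0 :=
      eventually_all.2 fun i => by
        filter_upwards [eventually_ge_atTop (lineHeight (P i) (P (i + 1)) r)] with s hs
        simp [belowSide, not_lt.2 hs]
    have h2 : ∀ᶠ s : ℝ in atTop, ind Φ (r, s) = 0 := by
      obtain ⟨B, hB⟩ := (h.isCompact.image continuous_snd).bddAbove
      filter_upwards [eventually_gt_atTop B] with s hs
      exact indicator_of_notMem (fun hm => (absurd (hB ⟨_, hm, rfl⟩) (not_le.2 hs))) _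
    obtain ⟨T, hT⟩ := eventually_atTop.1 (h1.and h2)
    refine ⟨T + 1, nhdsWithin_le_nhds ?_⟩
    filter_upwards [lt_mem_nhds (show T < T + 1 by linarith)] with s hs
    have hs' : T < s := hs
    obtain ⟨h3, h4⟩ := hT s hs'.le
    simp [D, h3, h4]
  have h1 := eq_zero_of_punctured_locally_constant hloc hfar t
  have h2 : ∀ᶠ s in 𝓝[≠] t, D s = D t := nhdsWithin_le_nhds (hconst t ht)
  obtain ⟨s, hs1, hs2⟩ := (h1.and h2).exists
  linarith

end IsAdmissibleRegion

/-- The part of space-time below the surface swept out by a side. -/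
def sideRegion (P Q : ℝ × ℝ) : Set Spacetime :=
  {z | ‖z.1‖ ∈ uIcc P.1 Q.1 ∧ z.2 < lineHeight P Q ‖z.1‖}

lemma measurable_lineHeight (P Q : ℝ × ℝ) : Measurable fun x : E3 => lineHeight P Q ‖x‖ := by
  unfold lineHeight
  exact Continuous.measurable (by fun_prop)

lemma measurableSet_sideRegion (P Q : ℝ × ℝ) : MeasurableSet (sideRegion P Q) :=
  (measurable_fst.norm measurableSet_uIcc).inter
    (measurableSet_lt measurable_snd ((measurable_lineHeight P Q).comp measurable_fst))

lemma ind_sideRegion (P Q : ℝ × ℝ) (z : Spacetime) :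
    ind (sideRegion P Q) z = belowSide P Q ‖z.1‖ z.2 := by
  by_cases hz : z ∈ sideRegion P Q
  · rw [ind, indicator_of_mem hz]
    exact (if_pos hz).symm
  · rw [ind, indicator_of_notMem hz]
    exact (if_neg hz).symm

lemma IsAdmissibleRegion.measurableSet_radialRegion {k : ℕ} {Φ : Set (ℝ × ℝ)}
    {P : Fin (k + 1) → ℝ × ℝ} (h : IsAdmissibleRegion Φ P) : MeasurableSet (radialRegion Φ) :=
  (h.isClosed.preimage (continuous_fst.norm.prodMk continuous_snd)).measurableSet

/-- Green's formula in the time variable. -/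
lemma IsAdmissibleRegion.sum_integral_sideRegion {k : ℕ} {Φ : Set (ℝ × ℝ)}
    {P : Fin (k + 1) → ℝ × ℝ} (h : IsAdmissibleRegion Φ P) {m : Spacetime → ℝ}
    (hm : Integrable m) :
    ∑ i, Real.sign ((P (i + 1)).1 - (P i).1) * ∫ z in sideRegion (P i) (P (i + 1)), m z =
      -∫ z in radialRegion Φ, m z := by
  have hi : ∀ i, Integrable fun z => ind (sideRegion (P i) (P (i + 1))) z * m z := fun i =>
    integrable_ind_mul (measurableSet_sideRegion _ _) hm
  simp_rw [setIntegral_eq_ind (measurableSet_sideRegion _ _), ← integral_const_mul]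
  rw [setIntegral_eq_ind h.measurableSet_radialRegion, ← integral_neg,
    ← integral_finsetSum _ fun i _ => (hi i).const_mul _]
  refine integral_congr_ae ?_
  have h1 : ∀ᵐ z : Spacetime, ∀ i, (P i).1 ≠ ‖z.1‖ :=
    ae_all_iff.2 fun i => (ae_norm_fst_ne (P i).1).mono fun z hz => Ne.symm hz
  have h2 : ∀ᵐ z : Spacetime, ∀ i, z.2 ≠ lineHeight (P i) (P (i + 1)) ‖z.1‖ :=
    ae_all_iff.2 fun i => ae_snd_ne (measurable_lineHeight (P i) (P (i + 1)))
  filter_upwards [h1, h2] with z hz1 hz2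
  have h3 := h.sum_belowSide hz1 fun i _ => hz2 i
  simp_rw [ind_sideRegion, ← mul_assoc]
  rw [← Finset.sum_mul, h3, neg_mul]
  rfl

end PolygonIntegral

/-! ### Fluxes through the sides and through the boundary -/

section SideFlux

lemma integral_congr_off_axis {f g : Spacetime → ℝ} (hfg : ∀ z, z.1 ≠ 0 → f z = g z)
    (S : Set Spacetime) : ∫ z in S, f z = ∫ z in S, g z :=
  integral_congr_ae (ae_restrict_of_ae (ae_fst_ne_zero.mono hfg))

lemma integrableOn_congr_off_axis {f g : Spacetime → ℝ}
    (hfg : ∀ z, z.1 ≠ 0 → f z = g z) {S : Set Spacetime} (hg : IntegrableOn g S) :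
    IntegrableOn f S :=
  hg.congr (ae_restrict_of_ae (ae_fst_ne_zero.mono fun z hz => (hfg z hz).symm))

namespace RadialCurrent

variable {w e m : Spacetime → ℝ} {σ K : ℝ} (h : RadialCurrent w e m σ K)
include h

/-- With this, an annulus obeys the same formula as a cone, with slope `0`, although its flux is an
ordinary integral and not a limit. -/
lemma integral_coneRegion_horizontal {r₁ r₂ : ℝ} (hr : r₁ ≤ r₂) (t : ℝ) :
    ∫ z in coneRegion r₁ r₂ t 0, m z = pastIntegral m r₁ t - pastIntegral m r₂ t := by
  rw [pastIntegral, pastIntegral, setIntegral_eq_ind (measurableSet_past _ _),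
    setIntegral_eq_ind (measurableSet_past _ _),
    setIntegral_eq_ind (measurableSet_coneRegion _ _ _ _),
    ← integral_sub (integrable_ind_mul (measurableSet_past _ _) h.integrable_m)
      (integrable_ind_mul (measurableSet_past _ _) h.integrable_m)]
  refine integral_congr_ae ?_
  filter_upwards [ae_norm_fst_ne r₁] with z h1
  by_cases ht : z.2 < t
  · rcases lt_or_gt_of_ne h1 with h3 | h3
    · simp [indicator, coneRegion, not_le.2 h3, not_lt.2 h3.le, not_lt.2 (h3.trans_le hr).le]
    · by_cases h2 : ‖z.1‖ ≤ r₂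
      · simp [indicator, coneRegion, h3, h3.le, not_lt.2 h2, ht]
      · simp [indicator, coneRegion, h3, not_le.1 h2]
  · simp [indicator, coneRegion, ht]

variable {V : Spacetime → Spacetime} {P Q : ℝ × ℝ}
  (hV : ∀ (ν : ℝ × ℝ) (z : Spacetime), z.1 ≠ 0 →
    normalComponent V ν z = σ * (ν.1 * w z + ν.2 * (σ * e z)))
include hV

/-- The field is `σ (w, σ e)`. Reversing the orientation changes the sign of the normal and
exchanges the endpoints, so both cases give `σ` times the increment of the potential from `P` to
`Q`. -/
lemma hasCylinderFlux (hP : 0 < P.1) (hPQ : P.1 = Q.1) (hne : P.2 ≠ Q.2) :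
    HasCylinderFlux V P Q (σ * (potential e m σ Q.1 Q.2 - potential e m σ P.1 P.2)) := by
  unfold HasCylinderFlux
  intro N layer
  rcases lt_or_gt_of_ne hne with hlt | hgt
  · have hN : N = (1, 0) := by
      simp only [N, abs_of_pos (sub_pos.2 hlt), div_self (sub_pos.2 hlt).ne']
    have hnc : ∀ z, z.1 ≠ 0 → normalComponent V N z = σ * w z := fun z hz => by
      rw [hV N z hz, hN]; ring
    obtain ⟨h1, h2⟩ := h.tendsto_cylinder_layer hP hlt
    have hl : layer = fun k => {z : Spacetime | |‖z.1‖ - P.1| < k ∧ z.2 ∈ Icc P.2 Q.2} := by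
      simp only [layer, uIcc_of_le hlt.le]
    rw [hl]
    refine ⟨h1.mono fun k hk => integrableOn_congr_off_axis hnc (hk.const_mul σ), ?_⟩
    rw [← hPQ]
    refine (h2.const_mul σ).congr fun k => ?_
    rw [integral_congr_off_axis hnc, integral_const_mul]
    ring
  · have hN : N = (-1, 0) := by
      simp only [N, abs_of_neg (sub_neg.2 hgt), div_neg, div_self (sub_neg.2 hgt).ne]
    have hnc : ∀ z, z.1 ≠ 0 → normalComponent V N z = -σ * w z := fun z hz => by
      rw [hV N z hz, hN]; ring
    obtain ⟨h1, h2⟩ := h.tendsto_cylinder_layer hP hgt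
    have hl : layer = fun k => {z : Spacetime | |‖z.1‖ - P.1| < k ∧ z.2 ∈ Icc Q.2 P.2} := by
      simp only [layer, uIcc_of_ge (le_of_lt hgt)]
    rw [hl]
    refine ⟨h1.mono fun k hk => integrableOn_congr_off_axis hnc (hk.const_mul (-σ)), ?_⟩
    rw [← hPQ]
    have h3 := h2.const_mul (-σ)
    rw [show -σ * (potential e m σ P.1 P.2 - potential e m σ P.1 Q.2) =
      σ * (potential e m σ P.1 Q.2 - potential e m σ P.1 P.2) by ring] at h3
    refine h3.congr fun k => ?_
    rw [integral_congr_off_axis hnc, integral_const_mul]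
    ring

lemma hasConeFlux (hP : 0 ≤ P.1) (hQ : 0 ≤ Q.1) (hne : P.1 ≠ Q.1) :
    HasConeFlux V P Q (σ * (potential e m σ Q.1 Q.2 - potential e m σ P.1 P.2 +
      Real.sign (Q.1 - P.1) * ∫ z in sideRegion P Q, m z)) := by
  unfold HasConeFlux
  intro N c layer
  have hd : Q.1 - P.1 ≠ 0 := sub_ne_zero.2 hne.symm
  have hcd : c * (Q.1 - P.1) = Q.2 - P.2 := div_mul_cancel₀ _ hd
  rcases lt_or_gt_of_ne hne with hlt | hgt
  · have hN : N = (c, -1) := by simp only [N, c, abs_of_pos (sub_pos.2 hlt), neg_div, div_self hd]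
    have hnc : ∀ z, z.1 ≠ 0 → normalComponent V N z = σ * (c * w z - σ * e z) :=
      fun z hz => by rw [hV N z hz, hN]; ring
    have hl : layer = coneLayer P.1 Q.1 P.2 c := by
      funext k
      simp only [layer, uIcc_of_le hlt.le, coneLayer]
    have hreg : sideRegion P Q = coneRegion P.1 Q.1 P.2 c := by
      simp only [sideRegion, coneRegion, lineHeight, uIcc_of_le hlt.le, c]
    have h2 := h.tendsto_coneLayer hP hlt c P.2
    rw [hcd, add_sub_cancel] at h2
    rw [hl, hreg, Real.sign_of_pos (sub_pos.2 hlt), one_mul]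
    refine ⟨.of_forall fun k => integrableOn_congr_off_axis hnc ?_, ?_⟩
    · obtain ⟨h3, h4⟩ := h.integrableOn_coneLayer P.1 Q.1 P.2 c k
      exact ((h3.const_mul c).sub (h4.const_mul σ)).const_mul σ
    · refine (h2.const_mul σ).congr fun k => ?_
      rw [integral_congr_off_axis hnc, integral_const_mul]
      ring
  · have hN : N = (-c, 1) := by
      simp only [N, c, abs_of_neg (sub_neg.2 hgt), div_neg, neg_div, neg_neg, div_self hd]
    have hnc : ∀ z, z.1 ≠ 0 → normalComponent V N z = -σ * (c * w z - σ * e z) :=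
      fun z hz => by rw [hV N z hz, hN]; ring
    have hline : ∀ r, P.2 + c * (r - P.1) = Q.2 + c * (r - Q.1) := fun r => by linarith
    have hl : layer = coneLayer Q.1 P.1 Q.2 c := by
      funext k
      simp only [layer, uIcc_of_ge (le_of_lt hgt), coneLayer, hline]
    have hreg : sideRegion P Q = coneRegion Q.1 P.1 Q.2 c := by
      have hlh : ∀ r, lineHeight P Q r = Q.2 + c * (r - Q.1) := hline
      simp only [sideRegion, coneRegion, hlh, uIcc_of_ge (le_of_lt hgt)]
    have h2 := h.tendsto_coneLayer hQ hgt c Q.2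
    rw [← hline, sub_self, mul_zero, add_zero] at h2
    rw [hl, hreg, Real.sign_of_neg (sub_neg.2 hgt)]
    refine ⟨.of_forall fun k => integrableOn_congr_off_axis hnc ?_, ?_⟩
    · obtain ⟨h3, h4⟩ := h.integrableOn_coneLayer Q.1 P.1 Q.2 c k
      exact ((h3.const_mul c).sub (h4.const_mul σ)).const_mul (-σ)
    · have h3 := h2.const_mul (-σ)
      rw [show -σ * (potential e m σ P.1 P.2 - potential e m σ Q.1 Q.2 +
          ∫ z in coneRegion Q.1 P.1 Q.2 c, m z) =
        σ * (potential e m σ Q.1 Q.2 - potential e m σ P.1 P.2 +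
          -1 * ∫ z in coneRegion Q.1 P.1 Q.2 c, m z) by ring] at h3
      refine h3.congr fun k => ?_
      rw [integral_congr_off_axis hnc, integral_const_mul]
      ring

lemma hasAnnulusFlux (hne : P.1 ≠ Q.1) (ht : P.2 = Q.2) :
    HasAnnulusFlux V P Q (σ * (potential e m σ Q.1 Q.2 - potential e m σ P.1 P.2 +
      Real.sign (Q.1 - P.1) * ∫ z in sideRegion P Q, m z)) := by
  unfold HasAnnulusFlux
  intro N A
  have hss : σ * σ = 1 := by rcases h.sign with hs | hs <;> rw [hs] <;> norm_num
  have hnc : ∀ᵐ x, normalComponent V N (x, P.2) = N.2 * e (x, P.2) := by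
    filter_upwards [ae_ne_zero] with x hx
    rw [hV N (x, P.2) hx]
    linear_combination (N.2 * e (x, P.2)) * hss
  have hsideq : ∀ r₁ r₂, uIcc P.1 Q.1 = Icc r₁ r₂ →
      sideRegion P Q = coneRegion r₁ r₂ P.2 0 := fun r₁ r₂ hr => by
    simp only [sideRegion, coneRegion, lineHeight, hr, ht, sub_self, zero_div, zero_mul]
  refine ⟨((h.integrable_e P.2).integrableOn.const_mul N.2).congr (ae_restrict_of_ae
    (hnc.mono fun x hx => hx.symm)), ?_⟩
  rw [integral_congr_ae (ae_restrict_of_ae hnc), integral_const_mul]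
  rcases lt_or_gt_of_ne hne with hlt | hgt
  · have hN : N.2 = -1 := by
      simp only [N, abs_of_pos (sub_pos.2 hlt), neg_div, div_self (sub_pos.2 hlt).ne']
    have hu := uIcc_of_le hlt.le
    have hA : A = {x : E3 | ‖x‖ ∈ Icc P.1 Q.1} := by simp only [A, hu]
    rw [hN, hA, h.integral_annulus hlt.le, hsideq _ _ hu, h.integral_coneRegion_horizontal hlt.le,
      Real.sign_of_pos (sub_pos.2 hlt), ← ht]
    unfold potential
    linear_combination (exteriorIntegral e Q.1 P.2 - exteriorIntegral e P.1 P.2) * hss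
  · have hN : N.2 = 1 := by
      simp only [N, abs_of_neg (sub_neg.2 hgt), div_neg, neg_div, neg_neg,
        div_self (sub_neg.2 hgt).ne]
    have hu := uIcc_of_ge (le_of_lt hgt)
    have hA : A = {x : E3 | ‖x‖ ∈ Icc Q.1 P.1} := by simp only [A, hu]
    rw [hN, hA, h.integral_annulus (le_of_lt hgt), hsideq _ _ hu,
      h.integral_coneRegion_horizontal (le_of_lt hgt), Real.sign_of_neg (sub_neg.2 hgt), ← ht]
    unfold potential
    linear_combination (exteriorIntegral e Q.1 P.2 - exteriorIntegral e P.1 P.2) * hss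

-- One formula for all kinds of sides. On vertical sides the sign is zero and the integral of `m`
-- drops out. A side on the axis has flux `0` by convention, so the increment of the potential has
-- to be taken away again.
open Classical in
lemma hasSideFlux (hP : 0 ≤ P.1) (hQ : 0 ≤ Q.1) (hne : P ≠ Q) :
    HasSideFlux V P Q (σ * (potential e m σ Q.1 Q.2 - potential e m σ P.1 P.2 +
      Real.sign (Q.1 - P.1) * (∫ z in sideRegion P Q, m z) -
      if P.1 = 0 ∧ Q.1 = 0 then potential e m σ 0 Q.2 - potential e m σ 0 P.2 else 0)) := by
  unfold HasSideFlux
  by_cases h1 : P.1 = Q.1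
  · rw [if_pos h1]
    have hs : Real.sign (Q.1 - P.1) = 0 := by rw [h1, sub_self, Real.sign_zero]
    rw [hs, zero_mul, add_zero]
    by_cases h2 : P.1 = 0
    · rw [if_pos h2, if_pos ⟨h2, h1 ▸ h2⟩, ← h1, h2]
      ring
    · rw [if_neg h2, if_neg fun hc => h2 hc.1, sub_zero]
      exact h.hasCylinderFlux hV (lt_of_le_of_ne hP (Ne.symm h2)) h1 fun h3 => hne (Prod.ext h1 h3)
  · rw [if_neg h1, if_neg fun hc : P.1 = 0 ∧ Q.1 = 0 => h1 (hc.1.trans hc.2.symm), sub_zero]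
    by_cases h2 : P.2 = Q.2
    · rw [if_pos h2]
      exact h.hasAnnulusFlux hV h1 h2
    · rw [if_neg h2]
      exact h.hasConeFlux hV hP hQ h1

-- Around the closed polygon the increments of the potential telescope, and by Green's formula the
-- signed integrals below the sides add up to `-∫ m` over the region. The increments taken away on
-- the axis are all that is left.
open Classical in
lemma hasBoundaryFlux {k : ℕ} {Φ : Set (ℝ × ℝ)} {P : Fin (k + 1) → ℝ × ℝ}
    (hΦ : IsAdmissibleRegion Φ P) :
    HasBoundaryFlux V P (σ * (-(∫ z in radialRegion Φ, m z) +
      ∑ i, if (P i).1 = 0 ∧ (P (i + 1)).1 = 0 then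
        potential e m σ 0 (P i).2 - potential e m σ 0 (P (i + 1)).2 else 0)) := by
  refine ⟨_, fun i => h.hasSideFlux hV (hΦ.vertex_nonneg i) (hΦ.vertex_nonneg (i + 1))
    (hΦ.side_ne i), ?_⟩
  have hshift : ∑ i, potential e m σ (P (i + 1)).1 (P (i + 1)).2 =
      ∑ i, potential e m σ (P i).1 (P i).2 :=
    Fintype.sum_equiv (Equiv.addRight (1 : Fin (k + 1))) _ _ fun _ => rfl
  rw [← Finset.mul_sum, Finset.sum_sub_distrib, Finset.sum_add_distrib,
    hΦ.sum_integral_sideRegion h.integrable_m, Finset.sum_sub_distrib, hshift]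
  rw [sub_self, zero_add, sub_eq_add_neg, ← Finset.sum_neg_distrib]
  congr 2
  refine Finset.sum_congr rfl fun i _ => ?_
  split_ifs <;> ring

end RadialCurrent

end SideFlux

/-! ### The part of the boundary on the axis -/

section AxisMeasure

namespace IsAdmissibleRegion

variable {m : ℕ} {Φ : Set (ℝ × ℝ)} {P : Fin (m + 1) → ℝ × ℝ} (h : IsAdmissibleRegion Φ P)
include h

-- Sides on the axis run downwards, so the half-open sides correspond to the intervals `Ioc`, which
-- are disjoint. They exhaust the axis part of the frontier up to the finitely many vertices, which
-- are null as there are no atoms.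
open Classical in
lemma measureReal_axis (μ : Measure ℝ) [IsFiniteMeasure μ] [NullSingletonClass μ] :
    μ.real {t : ℝ | (0, t) ∈ frontier Φ} = ∑ i, if (P i).1 = 0 ∧ (P (i + 1)).1 = 0 then
        μ.real (Ioc (P (i + 1)).2 (P i).2) else 0 := by
  let T : Fin (m + 1) → Set ℝ := fun i =>
    if (P i).1 = 0 ∧ (P (i + 1)).1 = 0 then Ioc (P (i + 1)).2 (P i).2 else ∅
  have hTmem : ∀ i, ∀ t ∈ T i, (0, t) ∈ halfOpenSegment (P i) (P (i + 1)) := by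
    intro i t ht
    by_cases hi : (P i).1 = 0 ∧ (P (i + 1)).1 = 0
    · simp only [T, if_pos hi] at ht
      have hlt := h.axis_side_lt hi.1 hi.2
      have hpos : 0 < (P i).2 - (P (i + 1)).2 := by linarith
      refine ⟨((P i).2 - t) / ((P i).2 - (P (i + 1)).2), div_nonneg (by linarith [ht.2]) hpos.le,
        (div_lt_one hpos).2 (by linarith [ht.1]), ?_⟩
      ext
      · simp [hi.1, hi.2]
      · simp only [Prod.snd_add, Prod.smul_snd, Prod.snd_sub, smul_eq_mul]
        field_simp
        ring
    · simp only [T, if_neg hi] at ht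
      exact ht.elim
  have hTmeas : ∀ i, MeasurableSet (T i) := fun i => by
    by_cases hi : (P i).1 = 0 ∧ (P (i + 1)).1 = 0
    · simp only [T, if_pos hi]; exact measurableSet_Ioc
    · simp only [T, if_neg hi]; exact MeasurableSet.empty
  have hdisj := fun i j hij => disjoint_left.2 fun t hti htj =>
      disjoint_left.1 (h.simple i j hij) (hTmem i t hti) (hTmem j t htj)
  have hfin : (range fun i => (P i).2).Finite := finite_range _
  have hset : {t : ℝ | (0, t) ∈ frontier Φ} =ᵐ[μ] ⋃ i, T i := by
    have hnot : ∀ᵐ t ∂μ, t ∉ range fun i => (P i).2 :=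
      measure_eq_zero_iff_ae_notMem.1 (hfin.measure_zero μ)
    filter_upwards [hnot] with t ht
    refine propext ⟨fun hf => ?_, fun hT => ?_⟩
    · have hf' : (0, t) ∈ frontier Φ := hf
      rw [h.frontier_eq, mem_iUnion] at hf'
      obtain ⟨i, a, b, ha, hb, hab, he⟩ := hf'
      have h1 : a * (P i).1 + b * (P (i + 1)).1 = 0 := congrArg Prod.fst he
      have h2 : a * (P i).2 + b * (P (i + 1)).2 = t := congrArg Prod.snd he
      have n1 := mul_nonneg ha (h.vertex_nonneg i)
      have n2 := mul_nonneg hb (h.vertex_nonneg (i + 1))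
      have hane : a ≠ 0 := by
        rintro rfl
        refine ht ⟨i + 1, ?_⟩
        have hb1 : b = 1 := by linarith
        simpa [hb1] using h2
      have hbne : b ≠ 0 := by
        rintro rfl
        refine ht ⟨i, ?_⟩
        have ha1 : a = 1 := by linarith
        simpa [ha1] using h2
      have hi : (P i).1 = 0 ∧ (P (i + 1)).1 = 0 := by
        constructor
        · exact (mul_eq_zero.1 (show a * (P i).1 = 0 by linarith)).resolve_left hane
        · exact (mul_eq_zero.1 (show b * (P (i + 1)).1 = 0 by linarith)).resolve_left hbne
      have hlt := h.axis_side_lt hi.1 hi.2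
      have hT : t ∈ T i := by
        simp only [T, if_pos hi]
        have ha0 : 0 < a := lt_of_le_of_ne ha hane.symm
        have hp : 0 < (P i).2 - (P (i + 1)).2 := by linarith
        have e1 : t - (P (i + 1)).2 = a * ((P i).2 - (P (i + 1)).2) := by
          rw [← h2, show b = 1 - a by linarith]; ring
        have e2 : (P i).2 - t = b * ((P i).2 - (P (i + 1)).2) := by
          rw [← h2, show a = 1 - b by linarith]; ring
        exact ⟨by linarith [mul_pos ha0 hp], by linarith [mul_nonneg hb hp.le]⟩
      exact mem_iUnion.2 ⟨i, hT⟩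
    · obtain ⟨i, hi⟩ := mem_iUnion.1 (show t ∈ ⋃ i, T i from hT)
      have hseg : (0, t) ∈ segment ℝ (P i) (P (i + 1)) := by
        obtain ⟨s, hs0, hs1, hs⟩ := hTmem i t hi
        rw [segment_eq_image']
        exact ⟨s, ⟨hs0, hs1.le⟩, hs.symm⟩
      have hf : (0, t) ∈ frontier Φ := by rw [h.frontier_eq]; exact mem_iUnion.2 ⟨i, hseg⟩
      exact hf
  rw [measureReal_congr hset, measureReal_iUnion_fintype hdisj hTmeas]
  refine Finset.sum_congr rfl fun i _ => ?_
  by_cases hi : (P i).1 = 0 ∧ (P (i + 1)).1 = 0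
  · simp only [T, if_pos hi]
  · simp only [T, if_neg hi, measureReal_empty]

end IsAdmissibleRegion

lemma HasSideFlux.unique {V : Spacetime → Spacetime} {P Q : ℝ × ℝ} {F F' : ℝ}
    (h : HasSideFlux V P Q F) (h' : HasSideFlux V P Q F') : F = F' := by
  unfold HasSideFlux at h h'
  split_ifs at h h'
  · rw [h, h']
  · exact tendsto_nhds_unique h.2 h'.2
  · exact h.2.trans h'.2.symm
  · exact tendsto_nhds_unique h.2 h'.2

lemma HasBoundaryFlux.unique {V : Spacetime → Spacetime} {m : ℕ} {P : Fin (m + 1) → ℝ × ℝ}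
    {F F' : ℝ} (h : HasBoundaryFlux V P F) (h' : HasBoundaryFlux V P F') : F = F' := by
  obtain ⟨f, hf, rfl⟩ := h
  obtain ⟨f', hf', rfl⟩ := h'
  exact Finset.sum_congr rfl fun i _ => (hf i).unique (hf' i)

/-- The vertices of a rectangle with a side on the axis. -/
def rectangleVertices (t₁ t₂ : ℝ) : Fin (3 + 1) → ℝ × ℝ := ![(0, t₁), (1, t₁), (1, t₂), (0, t₂)]

lemma frontier_rectangle {t₁ t₂ : ℝ} (ht : t₁ < t₂) : frontier (Icc (0 : ℝ) 1 ×ˢ Icc t₁ t₂) =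
      Icc 0 1 ×ˢ {t₁, t₂} ∪ {0, 1} ×ˢ Icc t₁ t₂ := by
  rw [frontier_prod_eq, closure_Icc, closure_Icc, frontier_Icc ht.le, frontier_Icc zero_le_one]

lemma axis_rectangle {t₁ t₂ : ℝ} (ht : t₁ < t₂) :
    {t : ℝ | (0, t) ∈ frontier (Icc (0 : ℝ) 1 ×ˢ Icc t₁ t₂)} = Icc t₁ t₂ := by
  ext t
  rw [frontier_rectangle ht, mem_ofPred_eq]
  constructor
  · rintro (⟨-, rfl | rfl⟩ | ⟨-, h⟩)
    · exact ⟨le_rfl, ht.le⟩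
    · exact ⟨ht.le, le_rfl⟩
    · exact h
  · exact fun h => Or.inr ⟨by simp, h⟩

lemma segment_horizontal {a b t : ℝ} : segment ℝ (a, t) (b, t) = uIcc a b ×ˢ {t} := by
  ext ⟨x, y⟩
  rw [mem_prod, mem_singleton_iff, ← segment_eq_uIcc]
  constructor
  · rintro ⟨c, d, hc, hd, hcd, he⟩
    have h1 := congrArg Prod.fst he
    have h2 : c * t + d * t = y := congrArg Prod.snd he
    refine ⟨⟨c, d, hc, hd, hcd, h1⟩, ?_⟩
    rw [← add_mul, hcd, one_mul] at h2
    exact h2.symm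
  · rintro ⟨⟨c, d, hc, hd, hcd, h1⟩, h2⟩
    refine ⟨c, d, hc, hd, hcd, Prod.ext h1 ?_⟩
    have h2' : y = t := h2
    simp only [Prod.snd_add, Prod.smul_snd, smul_eq_mul]
    rw [← add_mul, hcd, one_mul, h2']

lemma segment_vertical {a s t : ℝ} : segment ℝ (a, s) (a, t) = {a} ×ˢ uIcc s t := by
  ext ⟨x, y⟩
  rw [mem_prod, mem_singleton_iff, ← segment_eq_uIcc]
  constructor
  · rintro ⟨c, d, hc, hd, hcd, he⟩
    have h1 : c * a + d * a = x := congrArg Prod.fst he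
    have h2 := congrArg Prod.snd he
    refine ⟨?_, ⟨c, d, hc, hd, hcd, h2⟩⟩
    rw [← add_mul, hcd, one_mul] at h1
    exact h1.symm
  · rintro ⟨h2, ⟨c, d, hc, hd, hcd, h1⟩⟩
    refine ⟨c, d, hc, hd, hcd, Prod.ext ?_ h1⟩
    have h2' : x = a := h2
    simp only [Prod.fst_add, Prod.smul_fst, smul_eq_mul]
    rw [← add_mul, hcd, one_mul, h2']

/-- For uniqueness: rectangles resting on the axis isolate the mass of an arbitrary compact
interval. -/
lemma isAdmissibleRegion_rectangle {t₁ t₂ : ℝ} (ht : t₁ < t₂) :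
    IsAdmissibleRegion (Icc 0 1 ×ˢ Icc t₁ t₂) (rectangleVertices t₁ t₂) where
  isCompact := isCompact_Icc.prod isCompact_Icc
  radius_nonneg z hz := hz.1.1
  side_ne i := by fin_cases i <;> simp [rectangleVertices, ht.ne, ht.ne']
  direction i := by fin_cases i <;> simp [rectangleVertices]
  simple i j hij := by
    rw [disjoint_left]
    rintro z ⟨s, hs0, hs1, hs⟩ ⟨s', hs0', hs1', hs'⟩
    have h1 := congrArg Prod.fst (hs.symm.trans hs')
    have h2 := congrArg Prod.snd (hs.symm.trans hs')
    fin_cases i <;> fin_cases j <;> simp [rectangleVertices] at h1 h2 hij <;>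
      exact absurd h2 (by nlinarith)
  frontier_eq := by
    rw [frontier_rectangle ht]
    have e0 : segment ℝ (rectangleVertices t₁ t₂ 0) (rectangleVertices t₁ t₂ (0 + 1)) =
        uIcc 0 1 ×ˢ {t₁} := segment_horizontal
    have e1 : segment ℝ (rectangleVertices t₁ t₂ 1) (rectangleVertices t₁ t₂ (1 + 1)) =
        {1} ×ˢ uIcc t₁ t₂ := segment_vertical
    have e2 : segment ℝ (rectangleVertices t₁ t₂ 2) (rectangleVertices t₁ t₂ (2 + 1)) =
        uIcc 1 0 ×ˢ {t₂} := segment_horizontal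
    have e3 : segment ℝ (rectangleVertices t₁ t₂ 3) (rectangleVertices t₁ t₂ (3 + 1)) =
        {0} ×ˢ uIcc t₂ t₁ := segment_vertical
    rw [uIcc_of_le zero_le_one] at e0
    rw [uIcc_of_le ht.le] at e1
    rw [uIcc_of_ge zero_le_one] at e2
    rw [uIcc_of_ge ht.le] at e3
    ext ⟨x, y⟩
    simp only [mem_iUnion]
    constructor
    · rintro (⟨hx, rfl | rfl⟩ | ⟨rfl | rfl, hy⟩)
      · exact ⟨0, by rw [e0]; exact ⟨hx, rfl⟩⟩
      · exact ⟨2, by rw [e2]; exact ⟨hx, rfl⟩⟩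
      · exact ⟨3, by rw [e3]; exact ⟨rfl, hy⟩⟩
      · exact ⟨1, by rw [e1]; exact ⟨rfl, hy⟩⟩
    · rintro ⟨i, hi⟩
      fin_cases i
      · have h1 := e0.subset hi
        exact Or.inl ⟨h1.1, Or.inl h1.2⟩
      · have h1 := e1.subset hi
        exact Or.inr ⟨Or.inr h1.1, h1.2⟩
      · have h1 := e2.subset hi
        exact Or.inl ⟨h1.1, Or.inr h1.2⟩
      · have h1 := e3.subset hi
        exact Or.inr ⟨Or.inl h1.1, h1.2⟩
  left_inside i z hz := by
    have hd : 0 < t₂ - t₁ := sub_pos.2 ht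
    rw [interior_prod_eq, interior_Icc, interior_Icc]
    rw [openSegment_eq_image'] at hz
    obtain ⟨s, ⟨hs0, hs1⟩, rfl⟩ := hz
    filter_upwards [self_mem_nhdsWithin, mem_nhdsWithin_of_mem_nhds (gt_mem_nhds hd),
      mem_nhdsWithin_of_mem_nhds (gt_mem_nhds (one_div_pos.2 hd))] with ε h0 h1 h2
    have h0' : 0 < ε := h0
    have h2' := (lt_div_iff₀ hd).1 h2
    have h3 := mul_pos h0' hd
    fin_cases i <;> simp [rectangleVertices] <;> refine ⟨⟨⟨?_, ?_⟩, ?_, ?_⟩, ?_⟩ <;> first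
      | linarith
      | nlinarith
      | (intros; linarith)

end AxisMeasure

/-! ### The measure on the axis -/

section Axis

variable {w e m : Spacetime → ℝ} {σ K : ℝ}

namespace RadialCurrent

variable (h : RadialCurrent w e m σ K)
include h

lemma monotone_pastIntegral (r : ℝ) : Monotone (pastIntegral m r) := by
  intro s t hst
  exact setIntegral_mono_set h.integrable_m.integrableOn (.of_forall fun z => h.m_nonneg z)
    (.of_forall fun z (hz : r < ‖z.1‖ ∧ z.2 < s) => ⟨hz.1, hz.2.trans_le hst⟩)

lemma pastIntegral_nonneg (r t : ℝ) : 0 ≤ pastIntegral m r t :=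
  integral_nonneg fun z => h.m_nonneg z

lemma pastIntegral_le (r t : ℝ) : pastIntegral m r t ≤ ∫ z, m z :=
  setIntegral_le_integral h.integrable_m (.of_forall fun z => h.m_nonneg z)

lemma continuous_pastIntegral (r : ℝ) : Continuous (pastIntegral m r) := by
  have heq : pastIntegral m r = fun t => ∫ z, ind {z : Spacetime | r < ‖z.1‖ ∧ z.2 < t} z * m z :=
    funext fun t => setIntegral_eq_ind (measurableSet_past r t) m
  rw [heq, continuous_iff_continuousAt]
  intro t
  refine tendsto_integral_bounded_mul h.integrable_m (C := 1) (.of_forall fun s =>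
    (measurable_const.indicator (measurableSet_past r s)).aestronglyMeasurable)
    (.of_forall fun s z => ?_) ?_
  · rw [abs_of_nonneg (ind_nonneg _ _)]; exact ind_le_one _ _
  · filter_upwards [ae_snd_ne measurable_const] with z hz
    refine tendsto_const_nhds.congr' ?_
    rcases lt_or_gt_of_ne hz with h1 | h1
    · filter_upwards [lt_mem_nhds h1] with s hs
      have hs' : z.2 < s := hs
      simp [indicator, h1, hs']
    · filter_upwards [gt_mem_nhds h1] with s hs
      have hs' : s < z.2 := hs
      simp [indicator, not_lt.2 h1.le, not_lt.2 hs'.le]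

lemma continuous_potential (r : ℝ) : Continuous (potential e m σ r) :=
  (continuous_const.mul (h.continuous_exteriorIntegral r)).add (h.continuous_pastIntegral r)

lemma abs_potential_le (r t : ℝ) : |potential e m σ r t| ≤ K + ∫ z, m z := by
  refine (abs_add_le _ _).trans (add_le_add ?_ ?_)
  · rw [abs_mul, h.abs_sign, one_mul, abs_of_nonneg (h.exteriorIntegral_nonneg r t)]
    exact h.exteriorIntegral_le r t
  · rw [abs_of_nonneg (h.pastIntegral_nonneg r t)]
    exact h.pastIntegral_le r t

lemma exteriorIntegral_zero (t : ℝ) : exteriorIntegral e 0 t = ∫ x, e (x, t) := by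
  rw [exteriorIntegral, setIntegral_eq_ind (measurableSet_exterior 0)]
  refine integral_congr_ae ?_
  filter_upwards [ae_ne_zero] with x hx
  have hx' : x ∈ {x : E3 | 0 < ‖x‖} := norm_pos_iff.2 hx
  simp only [indicator_of_mem hx', one_mul]

end RadialCurrent

/-- The Stieltjes function, up to a constant, of the measure on the axis. -/
def axisStieltjes (h : RadialCurrent w e m σ K) : StieltjesFunction ℝ where
  toFun t := -potential e m σ 0 t / Real.pi
  mono' s t hst :=
    div_le_div_of_nonneg_right (neg_le_neg (h.potential_axis_antitone hst)) Real.pi_pos.le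
  right_continuous' t :=
    ((h.continuous_potential 0).neg.div_const Real.pi).continuousAt.continuousWithinAt

/-- The measure on the axis. -/
def axisMeasure (h : RadialCurrent w e m σ K) : Measure ℝ := (axisStieltjes h).measure

namespace RadialCurrent

variable (h : RadialCurrent w e m σ K)

lemma axisStieltjes_apply (t : ℝ) : axisStieltjes h t = -potential e m σ 0 t / Real.pi := rfl

lemma continuous_axisStieltjes : Continuous (axisStieltjes h) :=
  (h.continuous_potential 0).neg.div_const Real.pi

lemma abs_axisStieltjes_le (t : ℝ) : |axisStieltjes h t| ≤ (K + ∫ z, m z) / Real.pi := by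
  rw [axisStieltjes_apply, abs_div, abs_neg, abs_of_pos Real.pi_pos]
  have := h.abs_potential_le 0 t
  gcongr

instance isFiniteMeasure_axisMeasure : IsFiniteMeasure (axisMeasure h) :=
  StieltjesFunction.isFiniteMeasure_of_forall_abs_le _ h.abs_axisStieltjes_le

instance nullSingleton_axisMeasure : NullSingletonClass (axisMeasure h) := ⟨fun t => by
  rw [axisMeasure, StieltjesFunction.measure_singleton,
    (h.continuous_axisStieltjes.continuousAt.continuousWithinAt).leftLim_eq]
  simp⟩

lemma exists_tendsto_axisStieltjes : ∃ l u, Tendsto (axisStieltjes h) atBot (𝓝 l) ∧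
    Tendsto (axisStieltjes h) atTop (𝓝 u) := by
  have hb := h.abs_axisStieltjes_le
  refine ⟨_, _, tendsto_atBot_ciInf (axisStieltjes h).mono
    ⟨-((K + ∫ z, m z) / Real.pi), ?_⟩, tendsto_atTop_ciSup (axisStieltjes h).mono
    ⟨(K + ∫ z, m z) / Real.pi, ?_⟩⟩
  · rintro _ ⟨t, rfl⟩; exact (abs_le.1 (hb t)).1
  · rintro _ ⟨t, rfl⟩; exact (abs_le.1 (hb t)).2

lemma continuous_axisMeasure_Iic : Continuous fun t => axisMeasure h (Iic t) := by
  obtain ⟨l, u, hl, -⟩ := h.exists_tendsto_axisStieltjes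
  simp_rw [axisMeasure, StieltjesFunction.measure_Iic _ hl]
  exact continuous_ofReal.comp (h.continuous_axisStieltjes.sub continuous_const)

lemma axisMeasure_Ioc {s t : ℝ} (hst : s ≤ t) : Real.pi * (axisMeasure h).real (Ioc s t) =
    potential e m σ 0 s - potential e m σ 0 t := by
  rw [measureReal_def, axisMeasure, StieltjesFunction.measure_Ioc, toReal_ofReal
    (sub_nonneg.2 ((axisStieltjes h).mono hst)), axisStieltjes_apply, axisStieltjes_apply]
  field_simp
  ring

/-- For `σ = 1` the potential drops over `[-t, t]` by at most `∫ e(·, -t) ≤ K`, because the past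
integral increases and `e ≥ 0`. The argument gives `K/π`; the factor is discarded as `π ≥ 1`. -/
lemma axisMeasure_univ_le (hσ : σ = 1) : (axisMeasure h).real univ ≤ K := by
  obtain ⟨l, u, hl, hu⟩ := h.exists_tendsto_axisStieltjes
  have hle : ∀ t, 0 ≤ t → axisStieltjes h t - axisStieltjes h (-t) ≤ K := by
    intro t ht
    have h1 := h.monotone_pastIntegral 0 (show -t ≤ t by linarith)
    have h2 := h.exteriorIntegral_nonneg 0 t
    have h3 := h.exteriorIntegral_le 0 (-t)
    have h4 := (axisStieltjes h).mono (show -t ≤ t by linarith)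
    have h5 : Real.pi * (axisStieltjes h t - axisStieltjes h (-t)) ≤ K := by
      rw [axisStieltjes_apply, axisStieltjes_apply]
      have : Real.pi * (-potential e m σ 0 t / Real.pi - -potential e m σ 0 (-t) / Real.pi) =
          potential e m σ 0 (-t) - potential e m σ 0 t := by
        field_simp
        ring
      rw [this]
      unfold potential
      rw [hσ]
      linarith
    have h6 : 1 ≤ Real.pi := by linarith [Real.pi_gt_three]
    have h7 := mul_le_mul_of_nonneg_right h6 (sub_nonneg.2 h4)
    linarith
  have hlim : u - l ≤ K := by
    refine le_of_tendsto (hu.sub (hl.comp tendsto_neg_atTop_atBot)) ?_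
    filter_upwards [eventually_ge_atTop 0] with t ht using hle t ht
  rw [measureReal_def, axisMeasure, StieltjesFunction.measure_univ _ hl hu]
  exact toReal_le_of_le_ofReal h.nonneg (ofReal_le_ofReal hlim)

open Classical in
lemma sum_axis_potential {k : ℕ} {Φ : Set (ℝ × ℝ)} {P : Fin (k + 1) → ℝ × ℝ}
    (hΦ : IsAdmissibleRegion Φ P) :
    ∑ i, (if (P i).1 = 0 ∧ (P (i + 1)).1 = 0 then
      potential e m σ 0 (P i).2 - potential e m σ 0 (P (i + 1)).2 else 0) =
      -(Real.pi * (axisMeasure h).real {t : ℝ | (0, t) ∈ frontier Φ}) := by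
  rw [hΦ.measureReal_axis, Finset.mul_sum, ← Finset.sum_neg_distrib]
  refine Finset.sum_congr rfl fun i _ => ?_
  by_cases hi : (P i).1 = 0 ∧ (P (i + 1)).1 = 0
  · rw [if_pos hi, if_pos hi, h.axisMeasure_Ioc (hΦ.axis_side_lt hi.1 hi.2).le]
    ring
  · rw [if_neg hi, if_neg hi, mul_zero, neg_zero]

end RadialCurrent

end Axis

/-! ### The flux formula for solutions, and uniqueness -/

section EnergyFlux

variable {p : ℝ} {u : Spacetime → ℝ} {Du : Spacetime → E3} {ut : Spacetime → ℝ}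

namespace IsFiniteEnergySolution

variable (h : IsFiniteEnergySolution p u Du ut) (hp3 : 3 ≤ p) (hp5 : p ≤ 5)
include h hp3 hp5

lemma radialCurrent {σ : ℝ} (hσ : σ = 1 ∨ σ = -1) :
    RadialCurrent (fluxRadial p u Du ut σ) (fluxTime p u Du ut σ) (morawetzDensity p u Du) σ
      (energy p u Du ut) where
  aesm_w := h.aesm_fluxRadial σ
  aesm_e := h.aesm_fluxTime σ
  aesm_m := h.aesm_morawetzDensity
  sign := hσ
  e_nonneg := fluxTime_nonneg hp3 u Du ut σ
  m_nonneg := morawetzDensity_nonneg hp3 u Du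
  abs_w_le := abs_fluxRadial_le hp3 u Du ut σ
  w_le _ hz := fluxRadial_le hp3 u Du ut σ hz
  norm_mul_m_le z _ := norm_mul_morawetzDensity_le hp3 hp5 u Du ut σ z
  integrable_e := (h.continuous_integral_fluxTime hp3 hp5 σ).1
  integral_e_le := h.integral_fluxTime_le hp3 hp5 hσ
  continuous_ball := h.continuous_integral_fluxTime_ball hp3 hp5 σ
  continuous_e := (h.continuous_integral_fluxTime hp3 hp5 σ).2
  identity hψ := h.integral_radial_identity σ hp3 hp5 (by rcases hσ with rfl | rfl <;> norm_num) hψ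

/-- On the axis the exterior integrals extend over all of space and add up to the energy, so the two
potentials differ by a constant. Hence one measure serves both fields. -/
lemma potential_axis_sub (s t : ℝ) :
    potential (fluxTime p u Du ut (-1)) (morawetzDensity p u Du) (-1) 0 s -
      potential (fluxTime p u Du ut (-1)) (morawetzDensity p u Du) (-1) 0 t =
    potential (fluxTime p u Du ut 1) (morawetzDensity p u Du) 1 0 s -
      potential (fluxTime p u Du ut 1) (morawetzDensity p u Du) 1 0 t := by
  have h1 := h.integral_fluxTime_add hp3 hp5 s
  have h2 := h.integral_fluxTime_add hp3 hp5 t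
  unfold potential
  rw [(h.radialCurrent hp3 hp5 (Or.inl rfl)).exteriorIntegral_zero,
    (h.radialCurrent hp3 hp5 (Or.inl rfl)).exteriorIntegral_zero,
    (h.radialCurrent hp3 hp5 (Or.inr rfl)).exteriorIntegral_zero,
    (h.radialCurrent hp3 hp5 (Or.inr rfl)).exteriorIntegral_zero]
  linarith

end IsFiniteEnergySolution

lemma inner_smul_radialDir (a : ℝ) {x : E3} (hx : x ≠ 0) :
    inner ℝ (a • radialDir x) (radialDir x) = a := by
  have hn : ‖radialDir x‖ = 1 := by
    rw [radialDir, norm_smul, norm_inv, norm_norm, inv_mul_cancel₀ (norm_ne_zero_iff.2 hx)]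
  rw [real_inner_smul_left, real_inner_self_eq_norm_sq, hn, one_pow, mul_one]

lemma normalComponent_Vminus (ν : ℝ × ℝ) (z : Spacetime) (hz : z.1 ≠ 0) :
    normalComponent (Vminus p u Du ut) ν z =
      1 * (ν.1 * fluxRadial p u Du ut 1 z + ν.2 * (1 * fluxTime p u Du ut 1 z)) := by
  unfold normalComponent Vminus
  rw [inner_smul_radialDir _ hz]
  unfold fluxRadial fluxTime sideDensity nullDeriv Lplus
  ring

lemma normalComponent_Vplus (ν : ℝ × ℝ) (z : Spacetime) (hz : z.1 ≠ 0) :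
    normalComponent (Vplus p u Du ut) ν z =
      (-1) * (ν.1 * fluxRadial p u Du ut (-1) z + ν.2 * (-1 * fluxTime p u Du ut (-1) z)) := by
  unfold normalComponent Vplus
  rw [inner_smul_radialDir _ hz]
  unfold fluxRadial fluxTime sideDensity nullDeriv Lminus
  ring

theorem IsFiniteEnergySolution.energy_flux (h : IsFiniteEnergySolution p u Du ut) (hp3 : 3 ≤ p)
    (hp5 : p ≤ 5) {k : ℕ} {Φ : Set (ℝ × ℝ)} {P : Fin (k + 1) → ℝ × ℝ}
    (hΦ : IsAdmissibleRegion Φ P) :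
    HasBoundaryFlux (Vminus p u Du ut) P (-(∫ z in radialRegion Φ, morawetzDensity p u Du z) -
        Real.pi * (axisMeasure (h.radialCurrent hp3 hp5 (Or.inl rfl))).real
          {t : ℝ | (0, t) ∈ frontier Φ}) ∧
    HasBoundaryFlux (Vplus p u Du ut) P ((∫ z in radialRegion Φ, morawetzDensity p u Du z) +
        Real.pi * (axisMeasure (h.radialCurrent hp3 hp5 (Or.inl rfl))).real
          {t : ℝ | (0, t) ∈ frontier Φ}) := by
  have h1 := (h.radialCurrent hp3 hp5 (Or.inl rfl)).hasBoundaryFlux normalComponent_Vminus hΦ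
  have h2 := (h.radialCurrent hp3 hp5 (Or.inr rfl)).hasBoundaryFlux normalComponent_Vplus hΦ
  simp_rw [h.potential_axis_sub hp3 hp5] at h2
  rw [(h.radialCurrent hp3 hp5 (Or.inl rfl)).sum_axis_potential hΦ] at h1 h2
  constructor
  · convert h1 using 1
    ring
  · convert h2 using 1
    ring

lemma measure_eq_of_real_Icc {μ ν : Measure ℝ} [IsFiniteMeasure μ] [IsFiniteMeasure ν]
    [NullSingletonClass μ] [NullSingletonClass ν]
    (h : ∀ s t, s < t → μ.real (Icc s t) = ν.real (Icc s t)) : μ = ν := by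
  refine Measure.ext_of_Ioc μ ν fun s t hst => ?_
  rw [measure_congr Ioc_ae_eq_Icc, measure_congr Ioc_ae_eq_Icc]
  exact (measureReal_eq_measureReal_iff).1 (h s t hst)

/-- `{t}` lies in `(s, t]`, whose mass tends to zero as `s ↑ t`. It gives the absence of atoms for a
competing measure, of which only the continuity of `t ↦ ν (Iic t)` is known. -/
lemma nullSingletonClass_of_continuous_Iic {ν : Measure ℝ} [IsFiniteMeasure ν]
    (hc : Continuous fun t => ν (Iic t)) : NullSingletonClass ν := by
  refine ⟨fun t => ?_⟩
  have hsub : ∀ s < t, ν {t} ≤ ν (Iic t) - ν (Iic s) := by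
    intro s hs
    rw [← measure_sdiff (Iic_subset_Iic.2 hs.le) measurableSet_Iic.nullMeasurableSet
      (measure_ne_top _ _)]
    refine measure_mono ?_
    rintro x rfl
    exact ⟨mem_Iic.2 le_rfl, fun hx => not_le.2 hs (mem_Iic.1 hx)⟩
  have hlim : Tendsto (fun s => ν (Iic t) - ν (Iic s)) (𝓝[<] t) (𝓝 0) := by
    have h1 : Tendsto (fun s => ν (Iic s)) (𝓝[<] t) (𝓝 (ν (Iic t))) :=
      (hc.tendsto t).mono_left nhdsWithin_le_nhds
    have h2 := Tendsto.sub (tendsto_const_nhds (x := ν (Iic t))) h1 (Or.inl (measure_ne_top _ _))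
    rwa [tsub_self] at h2
  refine le_antisymm (ge_of_tendsto hlim ?_) bot_le
  filter_upwards [self_mem_nhdsWithin] with s hs using hsub s hs

end EnergyFlux

end InOutEnergy

end

theorem mainTheorem4 (p : ℝ) (hp3 : 3 ≤ p) (hp5 : p ≤ 5) :
    ∃ C : ℝ, 0 < C ∧
      ∀ (u : InOutEnergy.Spacetime → ℝ) (Du : InOutEnergy.Spacetime → InOutEnergy.E3)
        (ut : InOutEnergy.Spacetime → ℝ), InOutEnergy.IsFiniteEnergySolution p u Du ut →
        -- regions away from the `t`-axis
        (∀ (m : ℕ) (Φ : Set (ℝ × ℝ)) (P : Fin (m + 1) → ℝ × ℝ),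
          InOutEnergy.IsAdmissibleRegion Φ P → (∀ z ∈ Φ, 0 < z.1) →
            IntegrableOn (InOutEnergy.morawetzDensity p u Du) (InOutEnergy.radialRegion Φ) ∧
            InOutEnergy.HasBoundaryFlux (InOutEnergy.Vminus p u Du ut) P
              (-∫ z in InOutEnergy.radialRegion Φ, InOutEnergy.morawetzDensity p u Du z) ∧
            InOutEnergy.HasBoundaryFlux (InOutEnergy.Vplus p u Du ut) P
              (∫ z in InOutEnergy.radialRegion Φ, InOutEnergy.morawetzDensity p u Du z)) ∧
        -- regions that may touch the `t`-axis
        ∃! μ : Measure ℝ,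
          IsFiniteMeasure μ ∧
          Continuous (fun t : ℝ => μ (Set.Iic t)) ∧
          μ.real Set.univ ≤ C * InOutEnergy.energy p u Du ut ∧
          ∀ (m : ℕ) (Φ : Set (ℝ × ℝ)) (P : Fin (m + 1) → ℝ × ℝ),
            InOutEnergy.IsAdmissibleRegion Φ P →
              IntegrableOn (InOutEnergy.morawetzDensity p u Du) (InOutEnergy.radialRegion Φ) ∧
              ∃ Fminus Fplus : ℝ,
                InOutEnergy.HasBoundaryFlux (InOutEnergy.Vminus p u Du ut) P Fminus ∧
                InOutEnergy.HasBoundaryFlux (InOutEnergy.Vplus p u Du ut) P Fplus ∧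
                Fminus + Real.pi * μ.real {t : ℝ | ((0 : ℝ), t) ∈ frontier Φ} =
                  -∫ z in InOutEnergy.radialRegion Φ, InOutEnergy.morawetzDensity p u Du z ∧
                Fplus - Real.pi * μ.real {t : ℝ | ((0 : ℝ), t) ∈ frontier Φ} =
                  ∫ z in InOutEnergy.radialRegion Φ, InOutEnergy.morawetzDensity p u Du z := by
  refine ⟨1, one_pos, fun u Du ut h => ?_⟩
  have hR := h.radialCurrent hp3 hp5 (Or.inl rfl)
  refine ⟨fun m Φ P hΦ hpos => ?_, InOutEnergy.axisMeasure hR, ⟨inferInstance,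
    hR.continuous_axisMeasure_Iic, ?_, fun m Φ P hΦ => ?_⟩, ?_⟩
  -- Away from the axis the extra term is the mass of the empty set, so the first assertion is a
  -- case of the general formula.
  · have hempty : {t : ℝ | ((0 : ℝ), t) ∈ frontier Φ} = ∅ :=
      Set.eq_empty_iff_forall_notMem.2 fun t ht =>
        lt_irrefl _ (hpos _ (hΦ.isClosed.frontier_subset ht))
    have hF := h.energy_flux hp3 hp5 hΦ
    rw [hempty, measureReal_empty, mul_zero, sub_zero, add_zero] at hF
    exact ⟨hR.integrable_m.integrableOn, hF⟩
  · rw [one_mul]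
    exact hR.axisMeasure_univ_le rfl
  · obtain ⟨h1, h2⟩ := h.energy_flux hp3 hp5 hΦ
    exact ⟨hR.integrable_m.integrableOn, _, _, h1, h2, sub_add_cancel _ _, add_sub_cancel_right _ _⟩
  · rintro ν ⟨hfin, hcont, -, hν⟩
    have := InOutEnergy.nullSingletonClass_of_continuous_Iic hcont
    refine InOutEnergy.measure_eq_of_real_Icc fun s t hst => ?_
    have hΦ := InOutEnergy.isAdmissibleRegion_rectangle hst
    obtain ⟨-, F, -, hF, -, hFν, -⟩ := hν _ _ _ hΦ
    -- Fluxes are unique as limits or as integrals, so the formula for the inward field over the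
    -- rectangle on `[s, t]` forces the two masses of `[s, t]` to agree.
    rw [hF.unique (h.energy_flux hp3 hp5 hΦ).1, InOutEnergy.axis_rectangle hst] at hFν
    have h1 : Real.pi * ν.real (Set.Icc s t) =
        Real.pi * (InOutEnergy.axisMeasure hR).real (Set.Icc s t) := by linarith
    exact mul_left_cancel₀ Real.pi_ne_zero h1
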